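/- **Setting.** Let $d\in\{2,3\}$, $k\ge 1$, $T>0$, $I=[0,T]$. Let $\Omega\subset\mathbb R^d$ be a bounded domain with piecewise linear boundary and, for $t\in I$, let $\Gamma(t)\subset\Omega$ be a compact connected $C^{2+k}$ hypersurface bounding a domain $\Omega_1(t)\subset\Omega$, $\partial\Omega_1(t)=\Gamma(t)$; put $\Omega_2(t)=\Omega\setminus\overline{\Omega_1(t)}$. Let $\mathbf w\in C(I\times\overline\Omega;\mathbb R^d)$ be a velocity field with $\mathbf w|_{\Omega_i}\in C^1(\overline{\mathcal Q}_i)$, $\overline{\mathcal Q}_i=\bigcup_{t\in I}\{t\}\times\overline{\Omega_i(t)}$, and $\mathbf w(t,\cdot)\in C^{2+k}(\overline{\Omega_i(t)})$, whose flow $\Phi_i$ ($\partial_t\Phi_i=\mathbf w(t,\Phi_i)$, $\Phi_i(0,x)=x$) maps $\overline{\Omega_i(0)},\Omega_i(0),\Gamma(0)$ onto $\overline{\Omega_i(t)},\Omega_i(t),\Gamma(t)$. Let $\mathcal A_i\in C(\overline{\mathcal Q}_i)$ with $\mathcal A_i\ge\gamma>0$, $\mathcal B\in C(I\times\overline\Omega;\mathbb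 R^d)$, $\mathcal C\in C(I\times\overline\Omega)$. **Mesh.** Let an admissible simplicial partition of $\overline\Omega$, split into two submeshes $i=1,2$, be given, such that interface facets (facets common to an element of each submesh) have their vertices on $\Gamma(0)$ and every facet with all vertices on $\Gamma(0)$ is an interface facet. An element is an interface element if at least two of its vertices lie on $\Gamma(0)$. For an element parametrised by $F$ over the reference simplex $\hat K$, let $\tilde\mu$ be the sum of the barycentric coordinates of its vertices on $\Gamma(0)$, $\tilde y$ the point with these coordinates divided by $\tilde\mu$ and the others $0$, and let $\Pi_t$ be the nearest point projection onto $\Gamma(t)$. Write $$P_t[F](\hat x)=F(\hat x)+\tilde\mu(\hat x)^{k+2}\bigl(\Pi_t(F(\tilde y(\hat x)))-F(\tilde y(\hat x))\bigr)$$ on interface elements where $\tilde\mu\ne0$, and $P_t[F]=F$ otherwise. The nodes of an element $\tilde K$ of the $i$-th submesh at time $t$ are $\alpha(t)=\Phi_i(t;P_0[F_{\tilde K}](\hat\alpha))$, where $F_{\tilde K}$ is the affine reference map and $\hat\alpha$ runs through the Lagrange nodes of degree $k$; $F_{K(t)}$ is the polynomial map of degree $k$ on $\hat K$ with $F_{K(t)}(\hat\alpha)=\alpha(t)$;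 $K(t)=F_{K(t)}(\hat K)$; $\Omega_i^h(t)$ is the union of the elements $K(t)$ of the $i$-th submesh and $\Gamma^h(t)=\Omega^h_1(t)\cap\Omega^h_2(t)$. The lift is $\Lambda^h_i(t;x)=P_t[F_{K(t)}](F_{K(t)}^{-1}(x))$ on $K(t)$. The mesh of size $h>0$ is called *$\kappa$-regular* if, for all $t\in I$: $F_{\tilde K}$ and $F_{K(t)}$ satisfy $\kappa^{-1}h|\hat x-\hat y|\le|F(\hat x)-F(\hat y)|\le\kappa h|\hat x-\hat y|$ on $\hat K$ for all elements (uniform quasi-uniformity in time, $|\cdot|$ on $\hat K$ being the maximum norm of barycentric coordinates), and the mesh is fine enough for the construction to be meaningful, namely: the nodes of the $i$-th submesh at time $0$ lie in $\overline{\Omega_i(0)}$; the $K(t)$ form a conforming subdivision; the points at which $\Pi_t$ (and, for the initial mesh, $\Pi_0$) is evaluated have a unique nearest point; and $\Lambda_i^h(t;\cdot)$ is a bijection of $\Omega_i^h(t)$ onto $\overline{\Omega_i(t)}$ with $\kappa^{-1}|x-y|\le|\Lambda_i^h(t;x)-\Lambda_i^h(t;y)|\le\kappa|x-y|$ on each $K(t)$.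 **Spaces.** $\|v\|_{H^h(t)}^2=\sum_{K(t)}\|v\|^2_{L^2(K(t))}$, $\|v\|_{V^h(t)}^2=\sum_{K(t)}\|v\|^2_{H^1(K(t))}$, sums over all elements of both submeshes. $\mathcal S^h(t)$ is the space of pairs $(v_1,v_2)$ of elementwise functions with $v|_{K(t)}\circ F_{K(t)}$ a polynomial of degree at most $k$, single-valued at the nodes of each submesh, with $v_1=v_2$ at the nodes on $\Gamma^h(t)$ and $v_2=0$ at the nodes on $\partial\Omega$. The discrete flow is $\phi^h_tv=v\circ F_{K(0)}\circ F_{K(t)}^{-1}$ on $K(t)$, $\partial_t^hU=\phi^h_t\frac{d}{dt}\phi^h_{-t}U$, and $v^l$ is the lift of $v$, $v^l(\Lambda^h(t;x))=v(x)$. Further $\|f\|^2_{L^2_H}=\int_0^T\sum_i\|f_i(t)\|^2_{L^2(\Omega_i(t))}dt$, and $\|G\|_{L^2_{\mathcal V_\Gamma^*}}^2=\int_0^T\|G(t)\|^2_{H^{1/2}(\Gamma(t))^*}dt$, where $\|v\|_{H^{1/2}(\Gamma)}^2=\int_\Gamma|v|^2+\int_\Gamma\int_\Gamma\frac{|v(x)-v(y)|^2}{|x-y|^d}$.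 Let $\mathbf w^h$ be the nodal interpolant of $\mathbf w(t,\cdot)$ on each $K(t)$, and $$m^h(t;v,\zeta)=\sum_i\int_{\Omega_i^h(t)}v_i\zeta_i,\qquad \lambda^h(t;v,\zeta)=\sum_i\int_{\Omega_i^h(t)}(\nabla\cdot\mathbf w^h)v_i\zeta_i,$$ $$a^h(t;v,\zeta)=\sum_i\int_{\Omega_i^h(t)}\mathcal A_i(t;\Lambda_i^h)\nabla v_i\cdot\nabla\zeta_i+[\mathcal B(t;\Lambda_i^h)-\mathbf w^h]\cdot\nabla v_i\,\zeta_i+[\mathcal C(t;\Lambda_i^h)-\nabla\cdot\mathbf w^h]v_i\zeta_i,$$ $$l^h(t;\zeta)=\sum_i\int_{\Omega_i^h(t)}f_i(t;\Lambda_i^h)\,|\det D\Lambda_i^h|\,\zeta_i+\langle G(t),\zeta_1^l|_{\Gamma(t)}\rangle .$$ **Theorem.** For every $\kappa$ there is a constant $C$, depending only on $T$, $k$, $\kappa$, the evolving domain with its velocity, and the coefficients (not on $h$ or the mesh, nor on $U_0^h$, $f$, $G$), such that for every $\kappa$-regular mesh, every $U^h_0\in\mathcal S^h(0)$, $f\in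 L^2_H$ and $G\in L^2_{\mathcal V_\Gamma^*}$ there is exactly one $U^h$ with $U^h(t)\in\mathcal S^h(t)$ for $t\in I$, $t\mapsto\phi^h_{-t}U^h(t)$ absolutely continuous, $U^h(0)=U^h_0$, and, for almost every $t\in I$, $$m^h(t;\partial_t^hU^h,\zeta)+a^h(t;U^h,\zeta)+\lambda^h(t;U^h,\zeta)=l^h(t;\zeta)\qquad\text{for all }\zeta\in\mathcal S^h(t);$$ moreover $$\sup_{t\in I}\|U^h(t)\|^2_{H^h(t)}+\int_0^T\|U^h(t)\|^2_{V^h(t)}\,dt\le C\Bigl(\|U^h_0\|^2_{H^h(0)}+\|f\|^2_{L^2_H}+\|G\|^2_{L^2_{\mathcal V_\Gamma^*}}\Bigr).$$ -/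

import Mathlib

open MeasureTheory Set
open scoped NNReal ENNReal

noncomputable section

namespace InterfaceFEM

/-- Euclidean space `ℝ^d`. -/
abbrev Space (d : ℕ) := EuclideanSpace ℝ (Fin d)

/-! ### The evolving domain -/

/-- The data of a moving interface problem: the fixed domain `Ω`, the two evolving subdomains
(`Om 0 t` is the inner one `Ω₁(t)`, `Om 1 t` the outer one `Ω₂(t)`), the interface `Γ(t)`, the
velocity field `w` and the flow maps `Φ i t : closure Ωᵢ(0) → closure Ωᵢ(t)`. -/
structure Geometry (d : ℕ) where
  Ω : Set (Space d)
  Om : Fin 2 → ℝ → Set (Space d)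
  Γ : ℝ → Set (Space d)
  w : ℝ → Space d → Space d
  Φ : Fin 2 → ℝ → Space d → Space d

/-- `Γ` is a hypersurface of class `C^n` and the open set `D` lies locally on one side of it. -/
def IsCnBoundary {d : ℕ} (n : ℕ) (Γ D : Set (Space d)) : Prop :=
  ∀ x ∈ Γ, ∃ (U : Set (Space d)) (ρ : Space d → ℝ), IsOpen U ∧ x ∈ U ∧
    ContDiffOn ℝ n ρ U ∧ (∀ y ∈ U, fderiv ℝ ρ y ≠ 0) ∧
    Γ ∩ U = {y ∈ U | ρ y = 0} ∧ D ∩ U = {y ∈ U | ρ y < 0}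

/-- The closed space-time cylinder `⋃ₜ {t} × closure Ωᵢ(t)`. -/
def Geometry.cyl {d : ℕ} (D : Geometry d) (T : ℝ) (i : Fin 2) : Set (ℝ × Space d) :=
  {q | q.1 ∈ Icc 0 T ∧ q.2 ∈ closure (D.Om i q.1)}

/-- The standing assumptions on the evolving domain on `[0,T]`.  A function belongs to `C^n` of a
closed set if it is the restriction of a `C^n` function on the whole space. -/
structure Geometry.IsAdmissible {d : ℕ} (D : Geometry d) (k : ℕ) (T : ℝ) : Prop where
  isOpen : IsOpen D.Ω
  connected : IsConnected D.Ω
  bounded : Bornology.IsBounded D.Ω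
  /-- piecewise linear boundary -/
  polyhedral : ∃ P : Finset (Finset (Space d)),
    closure D.Ω = ⋃ s ∈ P, convexHull ℝ (s : Set (Space d))
  regular : interior (closure D.Ω) = D.Ω
  inner_isOpen : ∀ t ∈ Icc 0 T, IsOpen (D.Om 0 t)
  inner_connected : ∀ t ∈ Icc 0 T, IsConnected (D.Om 0 t)
  inner_subset : ∀ t ∈ Icc 0 T, D.Om 0 t ⊆ D.Ω
  inner_frontier : ∀ t ∈ Icc 0 T, frontier (D.Om 0 t) = D.Γ t
  interface_compact : ∀ t ∈ Icc 0 T, IsCompact (D.Γ t)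
  interface_connected : ∀ t ∈ Icc 0 T, IsConnected (D.Γ t)
  interface_subset : ∀ t ∈ Icc 0 T, D.Γ t ⊆ D.Ω
  interface_smooth : ∀ t ∈ Icc 0 T, IsCnBoundary (2 + k) (D.Γ t) (D.Om 0 t)
  outer_eq : ∀ t ∈ Icc 0 T, D.Om 1 t = D.Ω \ closure (D.Om 0 t)
  /-- `w ∈ C(I × closure Ω)` -/
  velocity_continuous : ContinuousOn (fun q : ℝ × Space d => D.w q.1 q.2)
    (Icc 0 T ×ˢ closure D.Ω)
  /-- `w|_{Ωᵢ} ∈ C¹` of the closed space-time cylinder -/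
  velocity_C1 : ∀ i, ∃ g : ℝ × Space d → Space d, ContDiff ℝ 1 g ∧
    ∀ q ∈ D.cyl T i, D.w q.1 q.2 = g q
  /-- `w(t,·)|_{Ωᵢ(t)} ∈ C^{2+k}(closure Ωᵢ(t))` -/
  velocity_smooth : ∀ i, ∀ t ∈ Icc 0 T, ∃ g : Space d → Space d, ContDiff ℝ (2 + k : ℕ) g ∧
    EqOn (D.w t) g (closure (D.Om i t))
  /-- `Φ i` is the flow of `w`, and `w` transports the subdomains -/
  flow_zero : ∀ i, ∀ x ∈ closure (D.Om i 0), D.Φ i 0 x = x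
  flow_deriv : ∀ i, ∀ x ∈ closure (D.Om i 0), ∀ t ∈ Icc 0 T,
    HasDerivWithinAt (fun s => D.Φ i s x) (D.w t (D.Φ i t x)) (Icc 0 T) t
  flow_closure : ∀ i, ∀ t ∈ Icc 0 T, D.Φ i t '' closure (D.Om i 0) = closure (D.Om i t)
  flow_interior : ∀ i, ∀ t ∈ Icc 0 T, D.Φ i t '' D.Om i 0 = D.Om i t
  flow_interface : ∀ i, ∀ t ∈ Icc 0 T, D.Φ i t '' D.Γ 0 = D.Γ t

/-- The coefficients `𝒜ᵢ`, `ℬ`, `𝒞`. -/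
structure Coeffs (d : ℕ) where
  A : Fin 2 → ℝ → Space d → ℝ
  B : ℝ → Space d → Space d
  C : ℝ → Space d → ℝ

structure Coeffs.IsAdmissible {d : ℕ} (c : Coeffs d) (D : Geometry d) (T γ : ℝ) : Prop where
  A_continuous : ∀ i, ContinuousOn (fun q : ℝ × Space d => c.A i q.1 q.2) (D.cyl T i)
  B_continuous : ContinuousOn (fun q : ℝ × Space d => c.B q.1 q.2) (Icc 0 T ×ˢ closure D.Ω)
  C_continuous : ContinuousOn (fun q : ℝ × Space d => c.C q.1 q.2) (Icc 0 T ×ˢ closure D.Ω)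
  γ_pos : 0 < γ
  A_lower : ∀ i, ∀ t ∈ Icc 0 T, ∀ x ∈ D.Om i t, γ ≤ c.A i t x

/-! ### The function spaces for the data -/

/-- `f ∈ L²_H`, i.e. `t ↦ f(t) ∘ Φ(t)` belongs to `L²(I; L²(Ω₁(0)) × L²(Ω₂(0)))`. -/
def MemL2H {d : ℕ} (D : Geometry d) (T : ℝ) (f : ℝ → Fin 2 → Space d → ℝ) : Prop :=
  ∀ i, MemLp (fun q : ℝ × Space d => f q.1 i (D.Φ i q.1 q.2)) 2
    (volume.restrict (Icc 0 T ×ˢ D.Om i 0))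

/-- `‖f‖²_{L²_H} = ∫₀ᵀ ∑ᵢ ‖fᵢ(t)‖²_{L²(Ωᵢ(t))} dt`. -/
def normSqL2H {d : ℕ} (D : Geometry d) (T : ℝ) (f : ℝ → Fin 2 → Space d → ℝ) : ℝ≥0∞ :=
  ∫⁻ t in Icc 0 T, ∑ i, ∫⁻ x in D.Om i t, ‖f t i x‖ₑ ^ 2

/-- Surface measure on a subset `Γ` of `ℝ^d`. -/
def surf {d : ℕ} (Γ : Set (Space d)) : Measure (Space d) :=
  Measure.restrict (Measure.euclideanHausdorffMeasure (d - 1)) Γ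

/-- The quotient `(v(x) - v(y)) / |x - y|^{d/2}`, whose squared `L²` norm over `Γ × Γ` is the square
of the Gagliardo seminorm of `H^{1/2}(Γ)`. -/
def gagliardo {d : ℕ} (v : Space d → ℝ) (q : Space d × Space d) : ℝ :=
  (v q.1 - v q.2) / ‖q.1 - q.2‖ ^ ((d : ℝ) / 2)

/-- `H^{1/2}(Γ)`, as a space of functions (taken up to null sets of the surface measure: everything
below depends on classes only). -/
def HHalf {d : ℕ} (Γ : Set (Space d)) : Submodule ℝ (Space d → ℝ) where
  carrier := {v | MemLp v 2 (surf Γ) ∧ MemLp (gagliardo v) 2 ((surf Γ).prod (surf Γ))}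
  add_mem' := by
    rintro a b ⟨ha, ha'⟩ ⟨hb, hb'⟩
    refine ⟨ha.add hb, ?_⟩
    have : gagliardo (a + b) = gagliardo a + gagliardo b := by
      funext q
      simp only [gagliardo, Pi.add_apply]
      ring
    rw [this]
    exact ha'.add hb'
  zero_mem' := by
    refine ⟨MemLp.zero, ?_⟩
    have : gagliardo (0 : Space d → ℝ) = 0 := by
      funext q
      simp [gagliardo]
    rw [this]
    exact MemLp.zero
  smul_mem' := by
    rintro r a ⟨ha, ha'⟩
    refine ⟨ha.const_smul r, ?_⟩
    have : gagliardo (r • a) = r • gagliardo a := by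
      funext q
      simp only [gagliardo, Pi.smul_apply, smul_eq_mul]
      ring
    rw [this]
    exact ha'.const_smul r

/-- `‖v‖²_{H^{1/2}(Γ)} = ∫_Γ |v|² + ∫_Γ ∫_Γ |v(x) - v(y)|² / |x - y|^d`. -/
def normSqHHalf {d : ℕ} (Γ : Set (Space d)) (v : Space d → ℝ) : ℝ≥0∞ :=
  eLpNorm v 2 (surf Γ) ^ 2 + eLpNorm (gagliardo v) 2 ((surf Γ).prod (surf Γ)) ^ 2

/-- The dual norm of a linear functional on `H^{1/2}(Γ)`. -/
def dualNorm {d : ℕ} (Γ : Set (Space d)) (g : HHalf Γ →ₗ[ℝ] ℝ) : ℝ≥0∞ :=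
  ⨆ (v : HHalf Γ) (_ : normSqHHalf Γ v ≤ 1), ‖g v‖ₑ

open Classical in
/-- The duality pairing `⟨g, v⟩` for a function `v ∈ H^{1/2}(Γ)`. -/
def dualPair {d : ℕ} {Γ : Set (Space d)} (g : HHalf Γ →ₗ[ℝ] ℝ) (v : Space d → ℝ) : ℝ :=
  if h : v ∈ HHalf Γ then g ⟨v, h⟩ else 0

/-- The flow `φ_t v = v ∘ Φ₁(t)⁻¹` on functions on the interface. -/
def interfacePush {d : ℕ} (D : Geometry d) (t : ℝ) (v : Space d → ℝ) : Space d → ℝ :=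
  fun x => v (Function.invFunOn (D.Φ 0 t) (D.Γ 0) x)

/-- `G ∈ L²_{𝒱_Γ^*}`: each `G(t)` is a bounded functional on `H^{1/2}(Γ(t))`, the pull-back
`t ↦ ⟨G(t), φ_t ·⟩ ∈ H^{1/2}(Γ(0))^*` is measurable (weak and strong measurability agree, the space
being separable), and `∫₀ᵀ ‖G(t)‖² dt < ∞`. -/
structure MemL2VΓdual {d : ℕ} (D : Geometry d) (T : ℝ)
    (G : (t : ℝ) → HHalf (D.Γ t) →ₗ[ℝ] ℝ) : Prop where
  bounded : ∀ t ∈ Icc 0 T, dualNorm (D.Γ t) (G t) < ⊤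
  measurable : ∀ v ∈ HHalf (D.Γ 0),
    AEMeasurable (fun t => dualPair (G t) (interfacePush D t v)) (volume.restrict (Icc 0 T))
  integrable : ∫⁻ t in Icc 0 T, dualNorm (D.Γ t) (G t) ^ 2 < ⊤

/-- `‖G‖²_{L²_{𝒱_Γ^*}}`. -/
def normSqL2VΓdual {d : ℕ} (D : Geometry d) (T : ℝ)
    (G : (t : ℝ) → HHalf (D.Γ t) →ₗ[ℝ] ℝ) : ℝ≥0∞ :=
  ∫⁻ t in Icc 0 T, dualNorm (D.Γ t) (G t) ^ 2

/-! ### The reference element -/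

/-- The reference simplex, in barycentric coordinates. -/
def refSimplex (d : ℕ) : Set (Fin (d + 1) → ℝ) := stdSimplex ℝ (Fin (d + 1))

/-- Indices of the Lagrange nodes of degree `k`: multi-indices `β` with `|β| = k`. -/
def nodeIdx (d k : ℕ) : Finset (Fin (d + 1) → ℕ) := Finset.piAntidiag Finset.univ k

/-- The Lagrange node `β / k` of the reference simplex. -/
def refNode {d : ℕ} (k : ℕ) (β : Fin (d + 1) → ℕ) : Fin (d + 1) → ℝ := fun a => (β a : ℝ) / k

/-- The Lagrange basis polynomial of degree `k` which is `1` at the node `β / k` and `0` at all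
other nodes. -/
def lagr {d : ℕ} (k : ℕ) (β : Fin (d + 1) → ℕ) (l : Fin (d + 1) → ℝ) : ℝ :=
  ∏ a, ∏ j ∈ Finset.range (β a), ((k : ℝ) * l a - j) / (j + 1)

/-- Sum of the barycentric coordinates belonging to the vertices in `S`. -/
def muTilde {d : ℕ} (S : Finset (Fin (d + 1))) (l : Fin (d + 1) → ℝ) : ℝ := ∑ a ∈ S, l a

/-- Projection (in barycentric coordinates) onto the face spanned by the vertices in `S`. -/
def yTilde {d : ℕ} (S : Finset (Fin (d + 1))) (l : Fin (d + 1) → ℝ) : Fin (d + 1) → ℝ :=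
  fun a => if a ∈ S then l a / muTilde S l else 0

/-- `y` is a point of `Γ` at minimal distance from `x`. -/
def IsNearest {d : ℕ} (Γ : Set (Space d)) (x y : Space d) : Prop :=
  y ∈ Γ ∧ dist x y = Metric.infDist x Γ

open Classical in
/-- The nearest point projection onto `Γ`. -/
def nearest {d : ℕ} (Γ : Set (Space d)) (x : Space d) : Space d :=
  if h : ∃ y, IsNearest Γ x y then h.choose else x

open Classical in
/-- Let an element be given by a parametrisation `F` over the reference simplex, with the vertices
in `S` on `Γ`.  If it is an interface element, i.e. has at least two vertices on `Γ`, this is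
`l ↦ x + μ̃^{k+2} (Π(y) - y)` with `x = F(l)` and `y = F(ỹ(l))` (and `l ↦ x` where `μ̃ = 0`);
otherwise it is `l ↦ x`. -/
def projCorrect {d : ℕ} (Γ : Set (Space d)) (k : ℕ) (S : Finset (Fin (d + 1)))
    (F : (Fin (d + 1) → ℝ) → Space d) (l : Fin (d + 1) → ℝ) : Space d :=
  if 2 ≤ S.card ∧ muTilde S l ≠ 0 then
    F l + muTilde S l ^ (k + 2) • (nearest Γ (F (yTilde S l)) - F (yTilde S l))
  else F l

/-! ### The evolving isoparametric mesh -/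

/-- An initial mesh: `n i` simplices in the partition of the `i`-th subdomain, each with its
`d + 1` vertices. -/
structure Mesh (d : ℕ) where
  n : Fin 2 → ℕ
  vert : (Σ i : Fin 2, Fin (n i)) → Fin (d + 1) → Space d

/-- The elements of the mesh; `K.1` is the subdomain to which `K` belongs. -/
abbrev Mesh.Elt {d : ℕ} (M : Mesh d) := Σ i : Fin 2, Fin (M.n i)

/-- The affine reference map of the straight element. -/
def Mesh.straight {d : ℕ} (M : Mesh d) (K : M.Elt) (l : Fin (d + 1) → ℝ) : Space d :=
  ∑ a, l a • M.vert K a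

open Classical in
/-- The (local numbers of the) vertices of `K` on the initial interface. -/
def Mesh.ifaceVerts {d : ℕ} (M : Mesh d) (D : Geometry d) (K : M.Elt) : Finset (Fin (d + 1)) :=
  Finset.univ.filter fun a => M.vert K a ∈ D.Γ 0

/-- The map `Ψ^h`, composed with the reference map of the straight element. -/
def Mesh.psi {d : ℕ} (M : Mesh d) (D : Geometry d) (k : ℕ) (K : M.Elt) :
    (Fin (d + 1) → ℝ) → Space d :=
  projCorrect (D.Γ 0) k (M.ifaceVerts D K) (M.straight K)

/-- The Lagrange node with index `β` of `K(t)`: the nodes of the initial mesh, mapped by `Ψ^h`, move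
with the flow `Φᵢ`. -/
def Mesh.node {d : ℕ} (M : Mesh d) (D : Geometry d) (k : ℕ) (t : ℝ) (K : M.Elt)
    (β : Fin (d + 1) → ℕ) : Space d :=
  D.Φ K.1 t (M.psi D k K (refNode k β))

/-- The reference map `F_{K(t)}` of the isoparametric element `K(t)`: the degree `k` polynomial
that takes the reference nodes to the nodes at time `t`. -/
def Mesh.refMap {d : ℕ} (M : Mesh d) (D : Geometry d) (k : ℕ) (t : ℝ) (K : M.Elt)
    (l : Fin (d + 1) → ℝ) : Space d :=
  ∑ β ∈ nodeIdx d k, lagr k β l • M.node D k t K β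

/-- The element `K(t)`. -/
def Mesh.elt {d : ℕ} (M : Mesh d) (D : Geometry d) (k : ℕ) (t : ℝ) (K : M.Elt) :
    Set (Space d) :=
  M.refMap D k t K '' refSimplex d

/-- The inverse of the reference map on `K(t)`. -/
def Mesh.refInv {d : ℕ} (M : Mesh d) (D : Geometry d) (k : ℕ) (t : ℝ) (K : M.Elt) :
    Space d → (Fin (d + 1) → ℝ) :=
  Function.invFunOn (M.refMap D k t K) (refSimplex d)

/-- The lift `Λ^h(t; ·)` on the element `K(t)`. -/
def Mesh.lift {d : ℕ} (M : Mesh d) (D : Geometry d) (k : ℕ) (t : ℝ) (K : M.Elt)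
    (x : Space d) : Space d :=
  projCorrect (D.Γ t) k (M.ifaceVerts D K) (M.refMap D k t K) (M.refInv D k t K x)

/-- The discrete velocity `w^h(t; ·)` on `K(t)`: the interpolant of `w` at the moving nodes. -/
def Mesh.velocity {d : ℕ} (M : Mesh d) (D : Geometry d) (k : ℕ) (t : ℝ) (K : M.Elt)
    (x : Space d) : Space d :=
  ∑ β ∈ nodeIdx d k, lagr k β (M.refInv D k t K x) • D.w t (M.node D k t K β)

/-- The divergence `∇ · w^h` on `K(t)`. -/
def Mesh.divVelocity {d : ℕ} (M : Mesh d) (D : Geometry d) (k : ℕ) (t : ℝ) (K : M.Elt)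
    (x : Space d) : ℝ :=
  LinearMap.trace ℝ (Space d) (fderiv ℝ (M.velocity D k t K) x : Space d →ₗ[ℝ] Space d)

/-- The initial mesh is an admissible simplicial partition of `closure Ω`, fitted to the interface.
A facet of `K` is the set of its vertices other than vertex `a`. -/
structure Mesh.IsFitted {d : ℕ} (M : Mesh d) (D : Geometry d) : Prop where
  affineIndependent : ∀ K : M.Elt, AffineIndependent ℝ (M.vert K)
  distinct : ∀ K K' : M.Elt, range (M.vert K) = range (M.vert K') → K = K'
  admissible : ∀ K K' : M.Elt,
    convexHull ℝ (range (M.vert K)) ∩ convexHull ℝ (range (M.vert K')) =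
      convexHull ℝ (range (M.vert K) ∩ range (M.vert K'))
  cover : ⋃ K : M.Elt, convexHull ℝ (range (M.vert K)) = closure D.Ω
  /-- interface facets have their vertices on the interface -/
  iface_vert : ∀ K K' : M.Elt, K.1 = 0 → K'.1 = 1 → ∀ a a',
    M.vert K '' {a}ᶜ = M.vert K' '' {a'}ᶜ → M.vert K '' {a}ᶜ ⊆ D.Γ 0
  /-- a facet with all its vertices on the interface is an interface facet -/
  vert_iface : ∀ (K : M.Elt) (a : Fin (d + 1)), M.vert K '' {a}ᶜ ⊆ D.Γ 0 →
    ∃ (K' : M.Elt) (a' : Fin (d + 1)), K'.1 ≠ K.1 ∧ M.vert K' '' {a'}ᶜ = M.vert K '' {a}ᶜ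

/-- The mesh, of mesh size `h`, is uniformly quasi-uniform, at the start and under the evolution,
with regularity constant `κ`, and it is fine enough for the construction of the evolving elements
and of the lift to be meaningful: the nodes of the `i`-th submesh lie in `closure Ωᵢ(0)`, the
elements at time `t` form a conforming subdivision, the nearest point projection is used only where
nearest points are unique, and the lift is a bijection from the discrete subdomain onto the
closed subdomain which distorts lengths on each element by at most the factor `κ`. -/
structure Mesh.IsRegular {d : ℕ} (M : Mesh d) (D : Geometry d) (k : ℕ) (T κ h : ℝ) : Prop where
  straight_upper : ∀ K : M.Elt, ∀ l ∈ refSimplex d, ∀ l' ∈ refSimplex d,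
    dist (M.straight K l) (M.straight K l') ≤ κ * h * dist l l'
  straight_lower : ∀ K : M.Elt, ∀ l ∈ refSimplex d, ∀ l' ∈ refSimplex d,
    h * dist l l' ≤ κ * dist (M.straight K l) (M.straight K l')
  upper : ∀ t ∈ Icc 0 T, ∀ K : M.Elt, ∀ l ∈ refSimplex d, ∀ l' ∈ refSimplex d,
    dist (M.refMap D k t K l) (M.refMap D k t K l') ≤ κ * h * dist l l'
  lower : ∀ t ∈ Icc 0 T, ∀ K : M.Elt, ∀ l ∈ refSimplex d, ∀ l' ∈ refSimplex d,
    h * dist l l' ≤ κ * dist (M.refMap D k t K l) (M.refMap D k t K l')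
  node_mem : ∀ K : M.Elt, ∀ β ∈ nodeIdx d k,
    M.psi D k K (refNode k β) ∈ closure (D.Om K.1 0)
  /-- a common point has the same barycentric coordinates with respect to the common vertices, and
  vanishing coordinates with respect to all others -/
  conforming : ∀ t ∈ Icc 0 T, ∀ K K' : M.Elt, ∀ l ∈ refSimplex d, ∀ l' ∈ refSimplex d,
    M.refMap D k t K l = M.refMap D k t K' l' →
    ∀ z : Space d, ∑ a, (M.vert K ⁻¹' {z}).indicator l a = ∑ a, (M.vert K' ⁻¹' {z}).indicator l' a
  nearest_initial : ∀ K : M.Elt, 2 ≤ (M.ifaceVerts D K).card → ∀ l ∈ refSimplex d,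
    muTilde (M.ifaceVerts D K) l ≠ 0 →
    ∃! y, IsNearest (D.Γ 0) (M.straight K (yTilde (M.ifaceVerts D K) l)) y
  nearest_evolving : ∀ t ∈ Icc 0 T, ∀ K : M.Elt, 2 ≤ (M.ifaceVerts D K).card →
    ∀ l ∈ refSimplex d, muTilde (M.ifaceVerts D K) l ≠ 0 →
    ∃! y, IsNearest (D.Γ t) (M.refMap D k t K (yTilde (M.ifaceVerts D K) l)) y
  lift_onto : ∀ t ∈ Icc 0 T, ∀ i,
    ⋃ j : Fin (M.n i), M.lift D k t ⟨i, j⟩ '' M.elt D k t ⟨i, j⟩ = closure (D.Om i t)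
  lift_injective : ∀ t ∈ Icc 0 T, ∀ i, ∀ j j' : Fin (M.n i),
    ∀ x ∈ M.elt D k t ⟨i, j⟩, ∀ x' ∈ M.elt D k t ⟨i, j'⟩,
    M.lift D k t ⟨i, j⟩ x = M.lift D k t ⟨i, j'⟩ x' → x = x'
  lift_upper : ∀ t ∈ Icc 0 T, ∀ K : M.Elt, ∀ x ∈ M.elt D k t K, ∀ y ∈ M.elt D k t K,
    dist (M.lift D k t K x) (M.lift D k t K y) ≤ κ * dist x y
  lift_lower : ∀ t ∈ Icc 0 T, ∀ K : M.Elt, ∀ x ∈ M.elt D k t K, ∀ y ∈ M.elt D k t K,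
    dist x y ≤ κ * dist (M.lift D k t K x) (M.lift D k t K y)

/-! ### Discrete functions -/

/-- Elementwise defined functions: `v K` is the function on `K(t)`, extended by zero. -/
abbrev Mesh.Fun {d : ℕ} (M : Mesh d) := M.Elt → Space d → ℝ

/-- `‖v‖²_{H^h(t)}`. -/
def Mesh.normSqH {d : ℕ} (M : Mesh d) (D : Geometry d) (k : ℕ) (t : ℝ) (v : M.Fun) : ℝ≥0∞ :=
  ∑ K : M.Elt, ∫⁻ x in M.elt D k t K, ‖v K x‖ₑ ^ 2

/-- `‖v‖²_{V^h(t)}`, the square of the broken `H¹` norm. -/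
def Mesh.normSqV {d : ℕ} (M : Mesh d) (D : Geometry d) (k : ℕ) (t : ℝ) (v : M.Fun) : ℝ≥0∞ :=
  ∑ K : M.Elt, ∫⁻ x in M.elt D k t K, (‖v K x‖ₑ ^ 2 + ‖gradient (v K) x‖ₑ ^ 2)

/-- The finite element space `𝒮^h(t)`: on each element a polynomial of degree at most `k` in
reference coordinates; single-valued at the nodes within each subdomain and on the discrete
interface; zero at the nodes on `∂Ω`. -/
structure Mesh.MemS {d : ℕ} (M : Mesh d) (D : Geometry d) (k : ℕ) (t : ℝ) (v : M.Fun) :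
    Prop where
  polynomial : ∀ K : M.Elt, ∃ p : MvPolynomial (Fin (d + 1)) ℝ, p.totalDegree ≤ k ∧
    v K = (M.elt D k t K).indicator fun x => MvPolynomial.eval (M.refInv D k t K x) p
  nodal : ∀ i, ∀ j j' : Fin (M.n i), ∀ β ∈ nodeIdx d k,
    M.node D k t ⟨i, j⟩ β ∈ M.elt D k t ⟨i, j'⟩ →
    v ⟨i, j⟩ (M.node D k t ⟨i, j⟩ β) = v ⟨i, j'⟩ (M.node D k t ⟨i, j⟩ β)
  interface : ∀ (j : Fin (M.n 0)) (j' : Fin (M.n 1)), ∀ β ∈ nodeIdx d k,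
    M.node D k t ⟨0, j⟩ β ∈ M.elt D k t ⟨1, j'⟩ →
    v ⟨0, j⟩ (M.node D k t ⟨0, j⟩ β) = v ⟨1, j'⟩ (M.node D k t ⟨0, j⟩ β)
  boundary : ∀ j : Fin (M.n 1), ∀ β ∈ nodeIdx d k,
    M.node D k t ⟨1, j⟩ β ∈ frontier D.Ω → v ⟨1, j⟩ (M.node D k t ⟨1, j⟩ β) = 0

/-- The push-forward `φ^h_t v = v ∘ Φ^h(t)⁻¹`, where `Φ^h(t) = F_{K(t)} ∘ F_{K(0)}⁻¹` on `K(0)`. -/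
def Mesh.push {d : ℕ} (M : Mesh d) (D : Geometry d) (k : ℕ) (t : ℝ) (v : M.Fun) : M.Fun :=
  fun K => (M.elt D k t K).indicator fun x => v K (M.refMap D k 0 K (M.refInv D k t K x))

/-- The pull-back `φ^h_{-t} v = v ∘ Φ^h(t)`. -/
def Mesh.pull {d : ℕ} (M : Mesh d) (D : Geometry d) (k : ℕ) (t : ℝ) (v : M.Fun) : M.Fun :=
  fun K => (M.elt D k 0 K).indicator fun x => v K (M.refMap D k t K (M.refInv D k 0 K x))

/-- The discrete material derivative `∂^h_t U = φ^h_t (d/dt) φ^h_{-t} U`. -/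
def Mesh.matDeriv {d : ℕ} (M : Mesh d) (D : Geometry d) (k : ℕ) (U : ℝ → M.Fun) (t : ℝ) :
    M.Fun :=
  M.push D k t fun K x => deriv (fun s => M.pull D k s (U s) K x) t

open Classical in
/-- The lift `v^l` of the `i`-th component of `v` to `closure Ωᵢ(t)`: `v^l(Λ(t; x)) = v(x)`. -/
def Mesh.liftFun {d : ℕ} (M : Mesh d) (D : Geometry d) (k : ℕ) (t : ℝ) (i : Fin 2)
    (v : M.Fun) (z : Space d) : ℝ :=
  if h : ∃ q : Fin (M.n i) × Space d,
      q.2 ∈ M.elt D k t ⟨i, q.1⟩ ∧ M.lift D k t ⟨i, q.1⟩ q.2 = z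
  then v ⟨i, h.choose.1⟩ h.choose.2 else 0

/-! ### The scheme -/

/-- `m^h(t; v, ζ)`. -/
def Mesh.mForm {d : ℕ} (M : Mesh d) (D : Geometry d) (k : ℕ) (t : ℝ) (v ζ : M.Fun) : ℝ :=
  ∑ K : M.Elt, ∫ x in M.elt D k t K, v K x * ζ K x

/-- `a^h(t; v, ζ)`. -/
def Mesh.aForm {d : ℕ} (M : Mesh d) (D : Geometry d) (c : Coeffs d) (k : ℕ) (t : ℝ)
    (v ζ : M.Fun) : ℝ :=
  ∑ K : M.Elt, ∫ x in M.elt D k t K,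
    (c.A K.1 t (M.lift D k t K x) * inner ℝ (gradient (v K) x) (gradient (ζ K) x)
      + inner ℝ (c.B t (M.lift D k t K x) - M.velocity D k t K x) (gradient (v K) x) * ζ K x
      + (c.C t (M.lift D k t K x) - M.divVelocity D k t K x) * v K x * ζ K x)

/-- `λ^h(t; v, ζ)`. -/
def Mesh.lamForm {d : ℕ} (M : Mesh d) (D : Geometry d) (k : ℕ) (t : ℝ) (v ζ : M.Fun) : ℝ :=
  ∑ K : M.Elt, ∫ x in M.elt D k t K, M.divVelocity D k t K x * v K x * ζ K x

/-- `l^h(t; ζ)`.  The volume term is `(f^{-l} J^h, ζ)_{H^h(t)}` with `J^h = |det DΛ^h|`.  The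
interface term `(G^{-l} μ^h, ζ)_{L²(Γ^h(t))}` is `∫_{Γ(t)} G ζ^l` when `G(t)` is a function, `μ^h`
being the Jacobian of the lift `Γ^h(t) → Γ(t)`; for a functional it is `⟨G(t), ζ^l⟩`. -/
def Mesh.load {d : ℕ} (M : Mesh d) (D : Geometry d) (k : ℕ)
    (f : ℝ → Fin 2 → Space d → ℝ) (G : (t : ℝ) → HHalf (D.Γ t) →ₗ[ℝ] ℝ) (t : ℝ) (ζ : M.Fun) : ℝ :=
  (∑ K : M.Elt, ∫ x in M.elt D k t K,
    f t K.1 (M.lift D k t K x) * |(fderiv ℝ (M.lift D k t K) x).det| * ζ K x)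
  + dualPair (G t) (M.liftFun D k t 0 ζ)

/-- `U` is a solution of the scheme on `[0,T]` with initial value `U₀`: `U(t) ∈ 𝒮^h(t)`, the
pull-back `φ^h_{-t} U(t) ∈ 𝒮^h(0)` is absolutely continuous in time, the initial condition
holds, and the equation holds for almost every `t` and all test functions in `𝒮^h(t)`. -/
structure Mesh.IsSolution {d : ℕ} (M : Mesh d) (D : Geometry d) (c : Coeffs d) (k : ℕ) (T : ℝ)
    (f : ℝ → Fin 2 → Space d → ℝ) (G : (t : ℝ) → HHalf (D.Γ t) →ₗ[ℝ] ℝ) (U₀ : M.Fun)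
    (U : ℝ → M.Fun) : Prop where
  mem : ∀ t ∈ Icc 0 T, M.MemS D k t (U t)
  absCont : ∀ K x, AbsolutelyContinuousOnInterval (fun t => M.pull D k t (U t) K x) 0 T
  initial : U 0 = U₀
  equation : ∀ᵐ t ∂(volume.restrict (Icc 0 T)), ∀ ζ : M.Fun, M.MemS D k t ζ →
    M.mForm D k t (M.matDeriv D k U t) ζ + M.aForm D c k t (U t) ζ + M.lamForm D k t (U t) ζ
      = M.load D k f G t ζ

end InterfaceFEM

end

/-!
# Well-posedness and stability of an evolving interface finite element scheme

Two facts make the semi-discrete problem a linear system of ordinary differential equations. First,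
the nodes of a mesh are moved by the flow, and adjacent elements, across the interface too, see the
same motion of their common nodes; so the set of admissible nodal values does not depend on time
(`Mesh.Standing.memS_iff`). Second, the discrete flow transports the nodal basis, so the material
derivative differentiates coefficients only (`Mesh.Standing.matDeriv_vec`). In a basis of the
admissible nodal values the scheme reads `M x' + S x = l` (`Mesh.Standing.equation_iff`), with the
matrices of `m^h` and `a^h + λ^h`. The mass matrix is definite and continuous in time, hence
invertible, and the system is solvable for integrable `l` (`exists_matrix_evolution`).

On the reference simplex the Jacobian of an element changes at the rate of the divergence of the
discrete velocity, so that `M' = Λ` with the matrix `Λ` of `λ^h` (`Mesh.Standing.hasDerivAt_mass`),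
and `(xᵀ M x)' = 2 xᵀ (l - S x) + xᵀ Λ x`. A Gårding inequality (`Mesh.Standing.garding`), whose
constants do not depend on the mesh because the discrete velocity and its divergence are bounded
uniformly (`Geometry.IsAdmissible.exists_uniform_bound`), and Gronwall's lemma
(`matrix_energy_estimate`) give the estimate, and with zero data uniqueness. The stability estimate
is taken with the quotient of `l²` and the squared `H¹` norm in place of the norm of the data, since
the dual norm of `G` need not be measurable in time.

The substance lies in the load. On `Γ(t)` it is bounded by the `H^{1/2}` norm of the lifted test
function, which has to be estimated by its broken `H¹` norm uniformly over all meshes. The lift is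
only Lipschitz on each element, so instead of weak derivatives the proof uses upper gradients along
Lipschitz curves (`IsUpperGradientOn`), which behave well under bi-Lipschitz maps: a continuous
function that is pieced together from finitely many elements has an upper gradient bounded by the
elementwise derivatives (`exists_upperGradient_of_pieces`), because a curve meets each closed
element in a closed set of times. The trace theorem is proved for such functions, first over a piece
of a half space, where the Gagliardo integral is estimated along segments into the interior by a
weighted Cauchy–Schwarz inequality of Hardy type (`gagliardo_halfBox_le`), then for compact
boundaries by charts (`IsCnBoundary.exists_trace`), and with a constant independent of time by
transport with the bi-Lipschitz flow (`Geometry.IsAdmissible.exists_trace`).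

Finally `t ↦ ⟨G(t), ζ^l⟩` has to be measurable, although only pairings of `G` with functions
transported from the initial interface are known to be. On a fixed mesh the lifted functions, pulled
back to the initial interface, are uniformly Lipschitz and depend continuously on time; their
`H^{1/2}` distance is dominated by an integrable kernel, so they are approximated by step functions
in time (`Geometry.IsAdmissible.aemeasurable_dualPair`). Continuity in time of the lift rests on
continuity of the nearest point projection in space and time
(`Geometry.IsAdmissible.continuousOn_nearest`).
-/

open Filter Topology

noncomputable section

namespace InterfaceFEM

/-! ### Integration tools -/

/-- A Lipschitz map increases the `n`-dimensional measure at most by the `n`-th power of its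
Lipschitz constant. Neither injectivity of the map nor measurability of the integrand is needed. -/
theorem setLIntegral_image_le_hausdorffMeasure {X Y : Type*} [EMetricSpace X] [MeasurableSpace X]
    [BorelSpace X] [EMetricSpace Y] [MeasurableSpace Y] [BorelSpace Y] {f : X → Y} {A : Set X}
    (hA : MeasurableSet A) {K : ℝ≥0} (hf : LipschitzOnWith K f A) (n : ℕ) (φ : Y → ℝ≥0∞) :
    ∫⁻ y in f '' A, φ y ∂μH[n] ≤ (K : ℝ≥0∞) ^ n * ∫⁻ x in A, φ (f x) ∂μH[n] := by
  have hfm : AEMeasurable f ((μH[n] : Measure X).restrict A) := hf.continuousOn.aemeasurable hA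
  have key : (μH[n] : Measure Y).restrict (f '' A) ≤
      ((K : ℝ≥0∞) ^ n) • Measure.map f ((μH[n] : Measure X).restrict A) := by
    refine Measure.le_iff.2 fun B hB => ?_
    rw [Measure.restrict_apply hB, Measure.smul_apply, Measure.map_apply_of_aemeasurable hfm hB,
      Measure.restrict_apply' hA]
    have : B ∩ f '' A = f '' (f ⁻¹' B ∩ A) := by
      rw [inter_comm (f ⁻¹' B), image_inter_preimage, inter_comm]
    rw [this]
    have h1 := (hf.mono (inter_subset_right (s := f ⁻¹' B))).hausdorffMeasure_image_le
      (Nat.cast_nonneg n)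
    simpa using h1
  calc ∫⁻ y in f '' A, φ y ∂μH[n]
      ≤ ∫⁻ y, φ y ∂(((K : ℝ≥0∞) ^ n) • Measure.map f ((μH[n] : Measure X).restrict A)) :=
        lintegral_mono' key le_rfl
    _ = (K : ℝ≥0∞) ^ n * ∫⁻ y, φ y ∂(Measure.map f ((μH[n] : Measure X).restrict A)) := by
        rw [lintegral_smul_measure, smul_eq_mul]
    _ ≤ _ := by
        gcongr
        exact lintegral_map_le _ _

theorem setLIntegral_image_le_of_lipschitzOnWith {X Y : Type*} [EMetricSpace X] [MeasurableSpace X]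
    [BorelSpace X] [EMetricSpace Y] [MeasurableSpace Y] [BorelSpace Y] {f : X → Y} {A : Set X}
    (hA : MeasurableSet A) {K : ℝ≥0} (hf : LipschitzOnWith K f A) (n : ℕ) (φ : Y → ℝ≥0∞) :
    ∫⁻ y in f '' A, φ y ∂μHE[n] ≤ (K : ℝ≥0∞) ^ n * ∫⁻ x in A, φ (f x) ∂μHE[n] := by
  simp only [Measure.euclideanHausdorffMeasure_def, Measure.restrict_smul,
    lintegral_smul_measure, ENNReal.smul_def, smul_eq_mul]
  rw [mul_left_comm]
  gcongr
  exact setLIntegral_image_le_hausdorffMeasure hA hf n φ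

theorem volume_setLIntegral_image_le {d : ℕ} {f : Space d → Space d} {A : Set (Space d)}
    (hA : MeasurableSet A) {K : ℝ≥0} (hf : LipschitzOnWith K f A) (φ : Space d → ℝ≥0∞) :
    ∫⁻ y in f '' A, φ y ≤ (K : ℝ≥0∞) ^ d * ∫⁻ x in A, φ (f x) := by
  have := setLIntegral_image_le_of_lipschitzOnWith hA hf d φ
  simpa only [EuclideanSpace.euclideanHausdorffMeasure_eq_volume] using this

/-- The Cauchy–Schwarz inequality for the Lebesgue integral, in squared form. -/
theorem lintegral_mul_sq_le {α : Type*} [MeasurableSpace α] {μ : Measure α} {f g : α → ℝ≥0∞}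
    (hf : AEMeasurable f μ) (hg : AEMeasurable g μ) :
    (∫⁻ a, f a * g a ∂μ) ^ 2 ≤ (∫⁻ a, f a ^ 2 ∂μ) * ∫⁻ a, g a ^ 2 ∂μ := by
  have h := ENNReal.lintegral_mul_le_Lp_mul_Lq μ (Real.HolderConjugate.two_two) hf hg
  simp only [Pi.mul_apply, ENNReal.rpow_two] at h
  calc _ ≤ ((∫⁻ a, f a ^ 2 ∂μ) ^ (1 / (2 : ℝ)) * (∫⁻ a, g a ^ 2 ∂μ) ^ (1 / (2 : ℝ))) ^ 2 := by
        gcongr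
    _ = _ := by
        rw [mul_pow, ← ENNReal.rpow_natCast, ← ENNReal.rpow_natCast, ← ENNReal.rpow_mul,
          ← ENNReal.rpow_mul]
        norm_num

theorem add_sq_le_two_mul (a b : ℝ≥0∞) : (a + b) ^ 2 ≤ 2 * (a ^ 2 + b ^ 2) := by
  have := ENNReal.rpow_add_le_mul_rpow_add_rpow a b (p := 2) (by norm_num)
  simp only [ENNReal.rpow_two] at this
  norm_num at this
  exact this

theorem lintegral_Ioc_rpow_neg_half :
    ∫⁻ s in Ioc (0 : ℝ) 1, ENNReal.ofReal (s ^ (-(1 / 2) : ℝ)) = 2 := by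
  have hi : IntervalIntegrable (fun s : ℝ => s ^ (-(1 / 2) : ℝ)) volume 0 1 :=
    intervalIntegral.intervalIntegrable_rpow' (by norm_num)
  rw [← ofReal_integral_eq_lintegral_ofReal hi.1]
  · rw [← intervalIntegral.integral_of_le zero_le_one, integral_rpow (by left; norm_num)]
    norm_num
  · filter_upwards [ae_restrict_mem measurableSet_Ioc] with s hs
    exact Real.rpow_nonneg hs.1.le _

/-- A Hardy-type form of the Cauchy–Schwarz inequality on the unit interval. The weight `s^{1/2}`
compensates the factor `1/s` produced later by scaling in `s`. -/
theorem sq_lintegral_Ioc_le {f : ℝ → ℝ≥0∞} (hf : AEMeasurable f (volume.restrict (Ioc 0 1))) :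
    (∫⁻ s in Ioc (0 : ℝ) 1, f s) ^ 2 ≤
      2 * ∫⁻ s in Ioc (0 : ℝ) 1, ENNReal.ofReal (s ^ (1 / 2 : ℝ)) * f s ^ 2 := by
  have h := lintegral_mul_sq_le (μ := volume.restrict (Ioc (0 : ℝ) 1))
    (f := fun s => ENNReal.ofReal (s ^ (-(1 / 4) : ℝ)))
    (g := fun s => ENNReal.ofReal (s ^ (1 / 4 : ℝ)) * f s)
    (by fun_prop) ((by fun_prop : AEMeasurable (fun s : ℝ => ENNReal.ofReal (s ^ (1 / 4 : ℝ)))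
      (volume.restrict (Ioc 0 1))).mul hf)
  have e1 : ∫⁻ s in Ioc (0 : ℝ) 1, ENNReal.ofReal (s ^ (-(1 / 4) : ℝ)) *
      (ENNReal.ofReal (s ^ (1 / 4 : ℝ)) * f s) = ∫⁻ s in Ioc (0 : ℝ) 1, f s := by
    refine setLIntegral_congr_fun measurableSet_Ioc fun s hs => ?_
    rw [← mul_assoc, ← ENNReal.ofReal_mul (Real.rpow_nonneg hs.1.le _), ← Real.rpow_add hs.1]
    norm_num
  have e2 : ∫⁻ s in Ioc (0 : ℝ) 1, ENNReal.ofReal (s ^ (-(1 / 4) : ℝ)) ^ 2 = 2 := by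
    rw [← lintegral_Ioc_rpow_neg_half]
    refine setLIntegral_congr_fun measurableSet_Ioc fun s hs => ?_
    rw [← ENNReal.ofReal_pow (Real.rpow_nonneg hs.1.le _), ← Real.rpow_natCast,
      ← Real.rpow_mul hs.1.le]
    norm_num
  have e3 : ∫⁻ s in Ioc (0 : ℝ) 1, (ENNReal.ofReal (s ^ (1 / 4 : ℝ)) * f s) ^ 2 =
      ∫⁻ s in Ioc (0 : ℝ) 1, ENNReal.ofReal (s ^ (1 / 2 : ℝ)) * f s ^ 2 := by
    refine setLIntegral_congr_fun measurableSet_Ioc fun s hs => ?_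
    rw [mul_pow, ← ENNReal.ofReal_pow (Real.rpow_nonneg hs.1.le _), ← Real.rpow_natCast,
      ← Real.rpow_mul hs.1.le]
    norm_num
  rw [e1, e2, e3] at h
  exact h

/-- Scaling the variable in a one-dimensional Lebesgue integral. -/
theorem lintegral_comp_mul_left_eq {a : ℝ} (ha : 0 < a) (f : ℝ → ℝ≥0∞) (hf : Measurable f) :
    ∫⁻ x in Ioi (0 : ℝ), f (a * x) = ENNReal.ofReal a⁻¹ * ∫⁻ x in Ioi (0 : ℝ), f x := by
  have h : ∫⁻ x, (Ioi (0 : ℝ)).indicator f x ∂(Measure.map (a * ·) volume) =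
      ENNReal.ofReal a⁻¹ * ∫⁻ x in Ioi (0 : ℝ), f x := by
    rw [Real.map_volume_mul_left ha.ne', lintegral_smul_measure, abs_of_pos (inv_pos.2 ha),
      smul_eq_mul, lintegral_indicator measurableSet_Ioi]
  rw [← h, lintegral_map (hf.indicator measurableSet_Ioi) (measurable_const_mul a),
    ← lintegral_indicator measurableSet_Ioi]
  congr 1 with x
  by_cases hx : 0 < x
  · have : 0 < a * x := by positivity
    simp [indicator, hx, this]
  · have : ¬ 0 < a * x := by
      push Not at hx ⊢
      exact mul_nonpos_of_nonneg_of_nonpos ha.le hx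
    simp [indicator, hx, this]

/-- Polar coordinates for the Lebesgue integral of a radial function. -/
theorem lintegral_fun_norm {m : ℕ} (hm : 1 ≤ m) {f : ℝ → ℝ≥0∞} (hf : Measurable f) :
    ∫⁻ x : Space m, f ‖x‖ = (m : ℝ≥0∞) * volume (Metric.ball (0 : Space m) 1) *
      ∫⁻ r in Ioi (0 : ℝ), ENNReal.ofReal (r ^ (m - 1)) * f r := by
  have : Nonempty (Fin m) := ⟨⟨0, hm⟩⟩
  have hE : Nontrivial (Space m) := inferInstance
  let μ : Measure (Space m) := volume
  calc ∫⁻ x : Space m, f ‖x‖ = ∫⁻ x : ({(0)}ᶜ : Set (Space m)), f (‖x.1‖) ∂(μ.comap (↑)) := by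
        rw [lintegral_subtype_comap (measurableSet_singleton _).compl (fun x : Space m => f ‖x‖),
          restrict_compl_singleton]
    _ = ∫⁻ x, f x.2 ∂μ.toSphere.prod (.volumeIoiPow (Module.finrank ℝ (Space m) - 1)) := by
        simpa using μ.measurePreserving_homeomorphUnitSphereProd.lintegral_comp_emb
          (Homeomorph.measurableEmbedding _) (f ∘ Subtype.val ∘ Prod.snd)
    _ = μ.toSphere univ * ∫⁻ x : Ioi (0 : ℝ), f x
          ∂(Measure.volumeIoiPow (Module.finrank ℝ (Space m) - 1)) := by
        rw [lintegral_prod _ (by fun_prop)]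
        simp [mul_comm]
    _ = _ := by
        simp only [Measure.volumeIoiPow]
        rw [lintegral_withDensity_eq_lintegral_mul _ (by fun_prop) (by fun_prop),
          μ.toSphere_apply_univ, finrank_euclideanSpace_fin]
        congr 1
        exact lintegral_subtype_comap measurableSet_Ioi
          (fun r : ℝ => ENNReal.ofReal (r ^ (m - 1)) * f r)

/-! ### Upper gradients and the trace inequality in a half space -/

/-- `g` is an upper gradient of `u` on `S`: along every Lipschitz path in `S` the increment of `u`
is at most the integral of `g`. Paths are parametrised over `[0,1]` with a Lipschitz constant `L`,
which stands for the arc length. -/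
def IsUpperGradientOn {E : Type*} [PseudoEMetricSpace E] (u : E → ℝ) (g : E → ℝ≥0∞) (S : Set E) :
    Prop :=
  ∀ (c : ℝ → E) (L : ℝ≥0), LipschitzOnWith L c (Icc 0 1) → MapsTo c (Icc 0 1) S →
    ‖u (c 1) - u (c 0)‖ₑ ≤ L * ∫⁻ s in Ioc (0 : ℝ) 1, g (c s)

/-- Upper gradients pull back under Lipschitz maps. -/
theorem IsUpperGradientOn.comp {E F : Type*} [PseudoEMetricSpace E] [PseudoEMetricSpace F]
    {u : F → ℝ} {g : F → ℝ≥0∞} {S : Set F} (h : IsUpperGradientOn u g S) {A : Set E} {f : E → F}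
    {K : ℝ≥0} (hf : LipschitzOnWith K f A) (hA : MapsTo f A S) :
    IsUpperGradientOn (fun x => u (f x)) (fun x => K * g (f x)) A := by
  intro c L hc hcA
  refine (h (fun s => f (c s)) (K * L) (hf.comp hc hcA) (hA.comp hcA)).trans ?_
  rw [lintegral_const_mul' _ _ ENNReal.coe_ne_top, ENNReal.coe_mul]
  exact le_of_eq (by ring)

/-- The increment of `u` along a segment, squared, in the weighted form suited to scaling. -/
theorem IsUpperGradientOn.sq_sub_segment_le {E : Type*} [NormedAddCommGroup E] [NormedSpace ℝ E]
    [MeasurableSpace E] [BorelSpace E] {u : E → ℝ} {g : E → ℝ≥0∞} {S : Set E}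
    (h : IsUpperGradientOn u g S) (hg : Measurable g) (a v : E)
    (hS : ∀ s ∈ Icc (0 : ℝ) 1, a + s • v ∈ S) :
    ‖u (a + v) - u a‖ₑ ^ 2 ≤
      2 * (‖v‖ₑ ^ 2 * ∫⁻ s in Ioc (0 : ℝ) 1, ENNReal.ofReal (s ^ (1 / 2 : ℝ)) *
        S.indicator (fun p => g p ^ 2) (a + s • v)) := by
  have hl : LipschitzOnWith ‖v‖₊ (fun s : ℝ => a + s • v) (Icc 0 1) := by
    refine LipschitzWith.lipschitzOnWith (LipschitzWith.of_dist_le_mul fun s s' => ?_)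
    rw [dist_add_left, dist_eq_norm, ← sub_smul, norm_smul, mul_comm, Real.dist_eq]
    rfl
  have h1 := h _ _ hl hS
  simp only [one_smul, zero_smul, add_zero] at h1
  have hm : Measurable fun s : ℝ => g (a + s • v) := hg.comp (by fun_prop)
  calc ‖u (a + v) - u a‖ₑ ^ 2
      ≤ ((‖v‖₊ : ℝ≥0∞) * ∫⁻ s in Ioc (0 : ℝ) 1, g (a + s • v)) ^ 2 := by gcongr
    _ ≤ (‖v‖₊ : ℝ≥0∞) ^ 2 * (2 * ∫⁻ s in Ioc (0 : ℝ) 1, ENNReal.ofReal (s ^ (1 / 2 : ℝ)) *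
          g (a + s • v) ^ 2) := by
        rw [mul_pow]
        gcongr
        exact sq_lintegral_Ioc_le hm.aemeasurable
    _ = 2 * (‖v‖ₑ ^ 2 * ∫⁻ s in Ioc (0 : ℝ) 1, ENNReal.ofReal (s ^ (1 / 2 : ℝ)) *
          g (a + s • v) ^ 2) := by
        rw [mul_left_comm]; rfl
    _ = _ := by
        congr 2
        refine setLIntegral_congr_fun measurableSet_Ioc fun s hs => ?_
        simp only [indicator_of_mem (hS s ⟨hs.1.le, hs.2⟩)]

/-- The weight `s^{1/2}` makes the factor `1/s`, which comes from rescaling `r`, integrable. -/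
theorem lintegral_weighted_scaling {f : ℝ → ℝ≥0∞} (hf : Measurable f) :
    ∫⁻ s in Ioc (0 : ℝ) 1, ENNReal.ofReal (s ^ (1 / 2 : ℝ)) * ∫⁻ r in Ioi (0 : ℝ), f (s * r) =
      2 * ∫⁻ r in Ioi (0 : ℝ), f r := by
  rw [← lintegral_Ioc_rpow_neg_half, ← lintegral_mul_const _ (by fun_prop)]
  refine setLIntegral_congr_fun measurableSet_Ioc fun s hs => ?_
  rw [lintegral_comp_mul_left_eq hs.1 f hf, ← mul_assoc,
    ← ENNReal.ofReal_mul (Real.rpow_nonneg hs.1.le _), ← Real.rpow_neg_one s, ← Real.rpow_add hs.1]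
  norm_num

/-- The part of the half space `ℝ^m × [0,∞)` on which local charts are defined. -/
def halfBox (m : ℕ) (r : ℝ) : Set (Space m × ℝ) := Metric.ball 0 r ×ˢ Icc 0 (2 * r)

theorem measurableSet_halfBox (m : ℕ) (r : ℝ) : MeasurableSet (halfBox m r) :=
  Metric.isOpen_ball.measurableSet.prod measurableSet_Icc

theorem enorm_sq_mul_inv_pow_le {m : ℕ} (hm : 1 ≤ m) (a : ℝ≥0∞) (ha : a ≠ ⊤) :
    a ^ 2 * (a ^ (m + 1))⁻¹ ≤ (a ^ (m - 1))⁻¹ := by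
  rcases eq_or_ne a 0 with rfl | h0
  · simp
  · obtain ⟨n, rfl⟩ : ∃ n, m = n + 1 := ⟨m - 1, by omega⟩
    have : a ^ (n + 1 + 1) = a ^ 2 * a ^ n := by ring
    rw [this, ENNReal.mul_inv (by left; positivity) (by left; exact ENNReal.pow_ne_top ha),
      ← mul_assoc, ENNReal.mul_inv_cancel (by positivity) (ENNReal.pow_ne_top ha), one_mul]
    simp

theorem sq_mul_le_of_le_add {D a b q₁ q₂ N J k : ℝ≥0∞} (hD : D ≤ a + b)
    (ha : a ^ 2 ≤ 2 * (N ^ 2 * q₁)) (hb : b ^ 2 ≤ 2 * (N ^ 2 * q₂)) (hk : N ^ 2 * J ≤ k) :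
    D ^ 2 * J ≤ 4 * (k * q₁) + 4 * (k * q₂) := by
  calc D ^ 2 * J ≤ (2 * (2 * (N ^ 2 * q₁) + 2 * (N ^ 2 * q₂))) * J := by
        gcongr
        calc D ^ 2 ≤ (a + b) ^ 2 := by gcongr
          _ ≤ _ := (add_sq_le_two_mul _ _).trans (by gcongr)
    _ = 4 * (N ^ 2 * J * q₁) + 4 * (N ^ 2 * J * q₂) := by ring
    _ ≤ _ := by gcongr

/-- The trace inequality for the Gagliardo seminorm in a half space. Two boundary points `x`, `y`
are joined through the point above their midpoint at height `‖x - y‖`. -/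
theorem gagliardo_halfBox_le {m : ℕ} (hm : 1 ≤ m) {r : ℝ} {u : Space m × ℝ → ℝ}
    {g : Space m × ℝ → ℝ≥0∞} (hg : Measurable g) (hu : IsUpperGradientOn u g (halfBox m r)) :
    ∫⁻ x in Metric.ball (0 : Space m) r, ∫⁻ y in Metric.ball (0 : Space m) r,
        ‖u (x, 0) - u (y, 0)‖ₑ ^ 2 * (‖x - y‖ₑ ^ (m + 1))⁻¹ ≤
      16 * (m * volume (Metric.ball (0 : Space m) 1)) * ∫⁻ p in halfBox m r, g p ^ 2 := by
  set G : Space m × ℝ → ℝ≥0∞ := (halfBox m r).indicator fun p => g p ^ 2 with hG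
  have hGm : Measurable G := (hg.pow_const 2).indicator (measurableSet_halfBox m r)
  -- `Q x z` bounds the increment of `u` along the segment from `(x, 0)` to `(x + z/2, ‖z‖)`.
  set Q : Space m → Space m → ℝ≥0∞ := fun x z => ∫⁻ s in Ioc (0 : ℝ) 1,
    ENNReal.ofReal (s ^ (1 / 2 : ℝ)) * G (x + s • ((1 / 2 : ℝ) • z), s * ‖z‖) with hQ
  set k : Space m → ℝ≥0∞ := fun z => (‖z‖ₑ ^ (m - 1))⁻¹ with hk
  have hkm : Measurable k := by fun_prop
  have hQm : Measurable fun p : Space m × Space m => Q p.1 p.2 := by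
    refine Measurable.lintegral_prod_right' (f := fun q : (Space m × Space m) × ℝ =>
      ENNReal.ofReal (q.2 ^ (1 / 2 : ℝ)) *
        G (q.1.1 + q.2 • ((1 / 2 : ℝ) • q.1.2), q.2 * ‖q.1.2‖)) ?_
    refine Measurable.mul (by fun_prop) (hGm.comp (by fun_prop))
  -- The height `‖z‖ < 2 r` of the end point is the reason for the height `2 r` of the half box.
  have hP : ∀ x ∈ Metric.ball (0 : Space m) r, ∀ z, x + z ∈ Metric.ball (0 : Space m) r →
      ‖u (x + (1 / 2 : ℝ) • z, ‖z‖) - u (x, 0)‖ₑ ^ 2 ≤ 2 * (‖z‖ₑ ^ 2 * Q x z) := by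
    intro x hx z hz
    have hz2 : ‖z‖ ≤ 2 * r := by
      have h1 := mem_ball_zero_iff.1 hx
      have h2 := mem_ball_zero_iff.1 hz
      have h3 : z = (x + z) - x := by abel
      calc ‖z‖ = ‖(x + z) - x‖ := by rw [← h3]
        _ ≤ ‖x + z‖ + ‖x‖ := norm_sub_le _ _
        _ ≤ 2 * r := by linarith
    have h1 := hu.sq_sub_segment_le hg (x, 0) ((1 / 2 : ℝ) • z, ‖z‖) (by
      intro s hs
      refine ⟨?_, ?_⟩
      · have := (convex_ball (0 : Space m) r).add_smul_mem hx hz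
          (t := s * (1 / 2)) ⟨by nlinarith [hs.1], by nlinarith [hs.2]⟩
        simpa [smul_smul] using this
      · simp only [Prod.snd_add, Prod.smul_snd, smul_eq_mul, zero_add]
        exact ⟨mul_nonneg hs.1 (norm_nonneg _),
          (mul_le_of_le_one_left (norm_nonneg _) hs.2).trans hz2⟩)
    have hn : ‖(((1 / 2 : ℝ) • z, ‖z‖) : Space m × ℝ)‖ₑ = ‖z‖ₑ := by
      have : ‖(((1 / 2 : ℝ) • z, ‖z‖) : Space m × ℝ)‖ = ‖z‖ := by
        rw [Prod.norm_def]
        simp only [norm_smul, norm_norm]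
        refine max_eq_right ?_
        norm_num
        linarith [norm_nonneg z]
      rw [← ofReal_norm, this, ofReal_norm]
    rw [hn] at h1
    simpa only [Prod.mk_add_mk, Prod.smul_mk, smul_eq_mul, zero_add, hQ, hG] using h1
  -- The segments from `x` and from `y` meet above the midpoint; of the kernel `|z|^{-(m+1)}` the
  -- power `|z|^{-(m-1)} = k z` is left.
  have hD : ∀ x ∈ Metric.ball (0 : Space m) r, ∀ y ∈ Metric.ball (0 : Space m) r,
      ‖u (x, 0) - u (y, 0)‖ₑ ^ 2 * (‖x - y‖ₑ ^ (m + 1))⁻¹ ≤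
        4 * (k (y - x) * Q x (y - x)) + 4 * (k (x - y) * Q y (x - y)) := by
    intro x hx y hy
    have h1 := hP x hx (y - x) (by simpa using hy)
    have h2 := hP y hy (x - y) (by simpa using hx)
    have hmid : y + (1 / 2 : ℝ) • (x - y) = x + (1 / 2 : ℝ) • (y - x) := by module
    rw [hmid, norm_sub_rev x y] at h2
    set M : Space m × ℝ := (x + (1 / 2 : ℝ) • (y - x), ‖y - x‖)
    have hne : ‖y - x‖ₑ = ‖x - y‖ₑ := by rw [← enorm_neg]; congr 1; abel
    rw [hne] at h1
    have h3 : ‖u (x, 0) - u (y, 0)‖ₑ ≤ ‖u M - u (x, 0)‖ₑ + ‖u M - u (y, 0)‖ₑ := by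
      have : u (x, 0) - u (y, 0) = (u M - u (y, 0)) - (u M - u (x, 0)) := by ring
      rw [this, add_comm]
      exact enorm_sub_le
    have hkk : ‖x - y‖ₑ ^ 2 * (‖x - y‖ₑ ^ (m + 1))⁻¹ ≤ k (x - y) :=
      enorm_sq_mul_inv_pow_le hm _ enorm_ne_top
    have hkk' : k (y - x) = k (x - y) := by simp only [hk, hne]
    rw [hkk']
    exact sq_mul_le_of_le_add h3 h1 h2 hkk
  clear_value Q k
  have hkQm : Measurable fun p : Space m × Space m => k (p.2 - p.1) * Q p.1 (p.2 - p.1) :=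
    (hkm.comp (by fun_prop)).mul
      (hQm.comp (f := fun p : Space m × Space m => (p.1, p.2 - p.1)) (by fun_prop))
  have hkQm' : Measurable fun p : Space m × Space m => k (p.1 - p.2) * Q p.2 (p.1 - p.2) :=
    hkQm.comp measurable_swap
  -- Both terms contribute equally, by symmetry in `x` and `y`.
  have hsum : ∫⁻ x in Metric.ball (0 : Space m) r, ∫⁻ y in Metric.ball (0 : Space m) r,
        ‖u (x, 0) - u (y, 0)‖ₑ ^ 2 * (‖x - y‖ₑ ^ (m + 1))⁻¹ ≤
      8 * ∫⁻ x, ∫⁻ y, k (y - x) * Q x (y - x) := by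
    calc _ ≤ ∫⁻ x in Metric.ball (0 : Space m) r, ∫⁻ y in Metric.ball (0 : Space m) r,
          (4 * (k (y - x) * Q x (y - x)) + 4 * (k (x - y) * Q y (x - y))) := by
          refine setLIntegral_mono' Metric.isOpen_ball.measurableSet fun x hx => ?_
          exact setLIntegral_mono' Metric.isOpen_ball.measurableSet fun y hy => hD x hx y hy
      _ ≤ ∫⁻ x, ∫⁻ y, (4 * (k (y - x) * Q x (y - x)) + 4 * (k (x - y) * Q y (x - y))) :=
          (setLIntegral_le_lintegral _ _).trans
            (lintegral_mono fun x => setLIntegral_le_lintegral _ _)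
      _ = 4 * (∫⁻ x, ∫⁻ y, k (y - x) * Q x (y - x)) +
            4 * ∫⁻ x, ∫⁻ y, k (x - y) * Q y (x - y) := by
          rw [← lintegral_const_mul _ hkQm.lintegral_prod_right',
            ← lintegral_const_mul _ hkQm'.lintegral_prod_right',
            ← lintegral_add_left (hkQm.lintegral_prod_right'.const_mul 4)]
          congr 1 with x
          have hx1 : Measurable fun y => k (y - x) * Q x (y - x) :=
            hkQm.comp (measurable_prodMk_left (x := x))
          have hx2 : Measurable fun y => k (x - y) * Q y (x - y) :=
            hkQm'.comp (measurable_prodMk_left (x := x))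
          rw [lintegral_add_left (hx1.const_mul 4), lintegral_const_mul _ hx1,
            lintegral_const_mul _ hx2]
      _ = _ := by
          rw [lintegral_lintegral_swap (f := fun x y => k (x - y) * Q y (x - y))
            hkQm'.aemeasurable, ← add_mul]
          norm_num
  set K : ℝ → ℝ≥0∞ := fun τ => ∫⁻ x : Space m, G (x, τ) with hK
  have hKm : Measurable K := hGm.lintegral_prod_left'
  -- Integration over `x` removes the horizontal shift of the segment.
  have hQint : ∀ z, ∫⁻ x, Q x z = ∫⁻ s in Ioc (0 : ℝ) 1,
      ENNReal.ofReal (s ^ (1 / 2 : ℝ)) * K (s * ‖z‖) := by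
    intro z
    simp only [hQ]
    have hmz : Measurable fun p : Space m × ℝ => ENNReal.ofReal (p.2 ^ (1 / 2 : ℝ)) *
        G (p.1 + p.2 • ((1 / 2 : ℝ) • z), p.2 * ‖z‖) :=
      Measurable.mul (by fun_prop) (hGm.comp (by fun_prop))
    rw [lintegral_lintegral_swap hmz.aemeasurable]
    congr 1 with s
    have hGz : Measurable fun x : Space m => G (x + s • (1 / 2 : ℝ) • z, s * ‖z‖) :=
      hGm.comp (by fun_prop)
    rw [lintegral_const_mul _ hGz]
    congr 1
    exact lintegral_add_right_eq_self (fun x => G (x, s * ‖z‖)) _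
  -- In polar coordinates the kernel `k` cancels the Jacobian `r^{m-1}`.
  have hradial : ∀ s : ℝ, ∫⁻ z : Space m, k z * K (s * ‖z‖) =
      m * volume (Metric.ball (0 : Space m) 1) * ∫⁻ r in Ioi (0 : ℝ), K (s * r) := by
    intro s
    have h1 := lintegral_fun_norm hm (f := fun r => (ENNReal.ofReal r ^ (m - 1))⁻¹ * K (s * r))
      (Measurable.mul (by fun_prop) (hKm.comp (by fun_prop)))
    simp only [ofReal_norm] at h1
    rw [hk, h1]
    congr 1
    refine setLIntegral_congr_fun measurableSet_Ioi fun r hr => ?_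
    rw [ENNReal.ofReal_pow (le_of_lt hr), ← mul_assoc, ENNReal.mul_inv_cancel, one_mul]
    · exact pow_ne_zero _ (by simpa using hr)
    · exact ENNReal.pow_ne_top ENNReal.ofReal_ne_top
  have hmain : ∫⁻ x, ∫⁻ y, k (y - x) * Q x (y - x) =
      (m * volume (Metric.ball (0 : Space m) 1)) * (2 * ∫⁻ τ in Ioi (0 : ℝ), K τ) := by
    have h1 : ∀ x : Space m, ∫⁻ y, k (y - x) * Q x (y - x) = ∫⁻ z, k z * Q x z := fun x =>
      lintegral_sub_right_eq_self (fun z => k z * Q x z) x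
    simp_rw [h1]
    have hm2 : Measurable fun p : Space m × Space m => k p.2 * Q p.1 p.2 :=
      (hkm.comp measurable_snd).mul hQm
    rw [lintegral_lintegral_swap hm2.aemeasurable]
    have h2 : ∀ z : Space m, ∫⁻ x, k z * Q x z = ∫⁻ s in Ioc (0 : ℝ) 1,
        ENNReal.ofReal (s ^ (1 / 2 : ℝ)) * (k z * K (s * ‖z‖)) := by
      intro z
      have hQz : Measurable fun x => Q x z := hQm.comp measurable_prodMk_right
      have hKz : Measurable fun s : ℝ => ENNReal.ofReal (s ^ (1 / 2 : ℝ)) * K (s * ‖z‖) :=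
        Measurable.mul (by fun_prop) (hKm.comp (by fun_prop))
      rw [lintegral_const_mul _ hQz, hQint z, ← lintegral_const_mul _ hKz]
      congr 1 with s
      ring
    simp_rw [h2]
    have hm3 : Measurable fun p : Space m × ℝ => ENNReal.ofReal (p.2 ^ (1 / 2 : ℝ)) *
        (k p.1 * K (p.2 * ‖p.1‖)) :=
      Measurable.mul (by fun_prop) ((hkm.comp measurable_fst).mul (hKm.comp (by fun_prop)))
    rw [lintegral_lintegral_swap hm3.aemeasurable, ← lintegral_weighted_scaling hKm,
      ← lintegral_const_mul]
    · congr 1 with s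
      have hkK : Measurable fun x : Space m => k x * K (s * ‖x‖) :=
        hkm.mul (hKm.comp (by fun_prop))
      rw [lintegral_const_mul _ hkK, hradial s]
      ring
    · refine Measurable.mul (by fun_prop) ?_
      exact Measurable.lintegral_prod_right' (f := fun p : ℝ × ℝ => K (p.1 * p.2))
        (hKm.comp (by fun_prop))
  have hKG : ∫⁻ τ in Ioi (0 : ℝ), K τ ≤ ∫⁻ p in halfBox m r, g p ^ 2 := by
    calc _ ≤ ∫⁻ τ, K τ := setLIntegral_le_lintegral _ _
      _ = ∫⁻ p, G p := by
          rw [Measure.volume_eq_prod, lintegral_prod_symm _ hGm.aemeasurable]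
      _ = _ := lintegral_indicator (measurableSet_halfBox m r) _
  calc _ ≤ 8 * ∫⁻ x, ∫⁻ y, k (y - x) * Q x (y - x) := hsum
    _ = 16 * (m * volume (Metric.ball (0 : Space m) 1)) * ∫⁻ τ in Ioi (0 : ℝ), K τ := by
        rw [hmain]
        have : (16 : ℝ≥0∞) = 8 * 2 := by norm_num
        rw [this]; ring
    _ ≤ _ := by gcongr

/-- The `L²` trace inequality in a half space. -/
theorem sq_trace_halfBox_le {m : ℕ} {r : ℝ} (hr : 0 < r) {u : Space m × ℝ → ℝ}
    {g : Space m × ℝ → ℝ≥0∞} (hg : Measurable g) (hu : IsUpperGradientOn u g (halfBox m r))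
    (hum : Measurable ((halfBox m r).indicator fun p => ‖u p‖ₑ ^ 2)) :
    ∫⁻ x in Metric.ball (0 : Space m) r, ‖u (x, 0)‖ₑ ^ 2 ≤
      (2 * (ENNReal.ofReal r)⁻¹ + 8 * ENNReal.ofReal r) *
        ∫⁻ p in halfBox m r, (‖u p‖ₑ ^ 2 + g p ^ 2) := by
  set G : Space m × ℝ → ℝ≥0∞ := (halfBox m r).indicator fun p => g p ^ 2 with hG
  set V : Space m × ℝ → ℝ≥0∞ := (halfBox m r).indicator fun p => ‖u p‖ₑ ^ 2 with hV
  have hGm : Measurable G := (hg.pow_const 2).indicator (measurableSet_halfBox m r)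
  set ρ : ℝ≥0∞ := ENNReal.ofReal r with hρ
  have hρ0 : ρ ≠ 0 := by simpa [hρ] using hr
  have hρt : ρ ≠ ⊤ := ENNReal.ofReal_ne_top
  -- Compare the boundary value with the value at height `s`, and average over `s ∈ (0, r]`.
  have hpt : ∀ x ∈ Metric.ball (0 : Space m) r, ∀ s ∈ Ioc (0 : ℝ) r,
      ‖u (x, 0)‖ₑ ^ 2 ≤ 2 * V (x, s) + 4 * ρ ^ 2 * ∫⁻ σ in Ioc (0 : ℝ) 1,
        ENNReal.ofReal (σ ^ (1 / 2 : ℝ)) * G (x, σ * s) := by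
    intro x hx s hs
    have hmem : ∀ σ ∈ Icc (0 : ℝ) 1, (x, (0 : ℝ)) + σ • ((0 : Space m), s) ∈ halfBox m r := by
      intro σ hσ
      refine ⟨by simpa using hx, ?_⟩
      simp only [Prod.snd_add, Prod.smul_snd, smul_eq_mul, zero_add]
      exact ⟨mul_nonneg hσ.1 hs.1.le,
        (mul_le_of_le_one_left hs.1.le hσ.2).trans (hs.2.trans (by linarith))⟩
    have h1 := hu.sq_sub_segment_le hg (x, 0) (0, s) hmem
    have h1s := hmem 1 ⟨zero_le_one, le_rfl⟩
    simp only [Prod.mk_add_mk, Prod.smul_mk, smul_eq_mul, zero_add, smul_zero, add_zero,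
      one_mul] at h1 h1s
    have hn : ‖(((0 : Space m), s) : Space m × ℝ)‖ₑ ≤ ρ := by
      rw [← ofReal_norm, Prod.norm_def]
      refine ENNReal.ofReal_le_ofReal ?_
      simp [abs_of_pos hs.1, hs.2, hr.le]
    have h3 : ‖u (x, 0)‖ₑ ≤ ‖u (x, s)‖ₑ + ‖u (x, s) - u (x, 0)‖ₑ := by
      have : u (x, 0) = u (x, s) - (u (x, s) - u (x, 0)) := by ring
      conv_lhs => rw [this]
      exact enorm_sub_le
    have hVx : V (x, s) = ‖u (x, s)‖ₑ ^ 2 := by simp only [hV, indicator_of_mem h1s]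
    calc ‖u (x, 0)‖ₑ ^ 2 ≤ (‖u (x, s)‖ₑ + ‖u (x, s) - u (x, 0)‖ₑ) ^ 2 := by gcongr
      _ ≤ 2 * (‖u (x, s)‖ₑ ^ 2 + ‖u (x, s) - u (x, 0)‖ₑ ^ 2) := add_sq_le_two_mul _ _
      _ ≤ 2 * (V (x, s) + 2 * (ρ ^ 2 * ∫⁻ σ in Ioc (0 : ℝ) 1,
        ENNReal.ofReal (σ ^ (1 / 2 : ℝ)) * G (x, σ * s))) := by
          rw [hVx]
          gcongr
          refine h1.trans ?_
          gcongr
      _ = _ := by ring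
  have hint : ∀ x ∈ Metric.ball (0 : Space m) r,
      ρ * ‖u (x, 0)‖ₑ ^ 2 ≤ 2 * (∫⁻ s, V (x, s)) + 8 * ρ ^ 2 * ∫⁻ s, G (x, s) := by
    intro x hx
    have hGx : Measurable fun s => G (x, s) := hGm.comp measurable_prodMk_left
    have hVx : Measurable fun s => V (x, s) := hum.comp measurable_prodMk_left
    have hσ : Measurable fun s : ℝ => ∫⁻ σ in Ioc (0 : ℝ) 1,
        ENNReal.ofReal (σ ^ (1 / 2 : ℝ)) * G (x, σ * s) := by
      refine Measurable.lintegral_prod_right' (f := fun p : ℝ × ℝ =>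
        ENNReal.ofReal (p.2 ^ (1 / 2 : ℝ)) * G (x, p.2 * p.1)) ?_
      exact Measurable.mul (by fun_prop) (hGm.comp (by fun_prop))
    calc ρ * ‖u (x, 0)‖ₑ ^ 2 = ∫⁻ s in Ioc (0 : ℝ) r, ‖u (x, 0)‖ₑ ^ 2 := by
          simp [hρ, mul_comm]
      _ ≤ ∫⁻ s in Ioc (0 : ℝ) r, (2 * V (x, s) + 4 * ρ ^ 2 * ∫⁻ σ in Ioc (0 : ℝ) 1,
            ENNReal.ofReal (σ ^ (1 / 2 : ℝ)) * G (x, σ * s)) :=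
          setLIntegral_mono' measurableSet_Ioc fun s hs => hpt x hx s hs
      _ ≤ ∫⁻ s in Ioi (0 : ℝ), (2 * V (x, s) + 4 * ρ ^ 2 * ∫⁻ σ in Ioc (0 : ℝ) 1,
            ENNReal.ofReal (σ ^ (1 / 2 : ℝ)) * G (x, σ * s)) :=
          lintegral_mono_set Ioc_subset_Ioi_self
      _ = 2 * (∫⁻ s in Ioi (0 : ℝ), V (x, s)) + 4 * ρ ^ 2 * ∫⁻ s in Ioi (0 : ℝ),
            ∫⁻ σ in Ioc (0 : ℝ) 1, ENNReal.ofReal (σ ^ (1 / 2 : ℝ)) * G (x, σ * s) := by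
          rw [lintegral_add_left (hVx.const_mul 2), lintegral_const_mul _ hVx,
            lintegral_const_mul _ hσ]
      _ = 2 * (∫⁻ s in Ioi (0 : ℝ), V (x, s)) + 4 * ρ ^ 2 *
            (2 * ∫⁻ s in Ioi (0 : ℝ), G (x, s)) := by
          rw [← lintegral_weighted_scaling hGx, lintegral_lintegral_swap]
          · congr 2
            refine lintegral_congr fun s => ?_
            exact lintegral_const_mul _ (hGx.comp (measurable_const_mul s))
          · refine Measurable.aemeasurable ?_
            exact Measurable.mul (by fun_prop) (hGm.comp (by fun_prop))
      _ ≤ 2 * (∫⁻ s, V (x, s)) + 4 * ρ ^ 2 * (2 * ∫⁻ s, G (x, s)) := by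
          gcongr <;> exact Measure.restrict_le_self
      _ = _ := by ring
  have hVG : ∀ {F : Space m × ℝ → ℝ≥0∞}, Measurable ((halfBox m r).indicator F) →
      ∫⁻ x : Space m, ∫⁻ s, (halfBox m r).indicator F (x, s) = ∫⁻ p in halfBox m r, F p := by
    intro F hF
    rw [← lintegral_indicator (measurableSet_halfBox m r), Measure.volume_eq_prod,
      lintegral_prod _ hF.aemeasurable]
  have htot : ρ * ∫⁻ x in Metric.ball (0 : Space m) r, ‖u (x, 0)‖ₑ ^ 2 ≤
      2 * (∫⁻ p in halfBox m r, ‖u p‖ₑ ^ 2) + 8 * ρ ^ 2 * ∫⁻ p in halfBox m r, g p ^ 2 := by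
    rw [← lintegral_const_mul' _ _ hρt]
    calc _ ≤ ∫⁻ x in Metric.ball (0 : Space m) r,
          (2 * (∫⁻ s, V (x, s)) + 8 * ρ ^ 2 * ∫⁻ s, G (x, s)) :=
          setLIntegral_mono' Metric.isOpen_ball.measurableSet fun x hx => hint x hx
      _ ≤ ∫⁻ x, (2 * (∫⁻ s, V (x, s)) + 8 * ρ ^ 2 * ∫⁻ s, G (x, s)) :=
          setLIntegral_le_lintegral _ _
      _ = _ := by
          rw [lintegral_add_left (hum.lintegral_prod_right'.const_mul 2),
            lintegral_const_mul _ hum.lintegral_prod_right',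
            lintegral_const_mul _ hGm.lintegral_prod_right', hVG hum, hVG hGm]
  set A := ∫⁻ p in halfBox m r, ‖u p‖ₑ ^ 2
  set B := ∫⁻ p in halfBox m r, g p ^ 2
  have hAB : ∫⁻ p in halfBox m r, (‖u p‖ₑ ^ 2 + g p ^ 2) = A + B :=
    lintegral_add_right _ (hg.pow_const 2)
  rw [hAB]
  calc ∫⁻ x in Metric.ball (0 : Space m) r, ‖u (x, 0)‖ₑ ^ 2
      = ρ⁻¹ * (ρ * ∫⁻ x in Metric.ball (0 : Space m) r, ‖u (x, 0)‖ₑ ^ 2) := by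
        rw [← mul_assoc, ENNReal.inv_mul_cancel hρ0 hρt, one_mul]
    _ ≤ ρ⁻¹ * (2 * A + 8 * ρ ^ 2 * B) := by gcongr
    _ = 2 * ρ⁻¹ * A + 8 * (ρ⁻¹ * ρ) * ρ * B := by ring
    _ = 2 * ρ⁻¹ * A + 8 * ρ * B := by rw [ENNReal.inv_mul_cancel hρ0 hρt, mul_one]
    _ ≤ _ := by
        rw [mul_add]
        gcongr
        · exact le_self_add
        · exact le_add_self

/-! ### The trace inequality on a domain with `C¹` boundary -/

/-- Lebesgue measure on a normed space of dimension `n` is a multiple of the Hausdorff measure. -/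
theorem exists_volume_eq_smul_hausdorffMeasure {E : Type*} [NormedAddCommGroup E] [NormedSpace ℝ E]
    [FiniteDimensional ℝ E] [MeasureSpace E] [BorelSpace E]
    [(volume : Measure E).IsAddHaarMeasure] {n : ℕ} (hn : Module.finrank ℝ E = n) :
    ∃ c : ℝ≥0, c ≠ 0 ∧ (volume : Measure E) = c • μH[n] := by
  subst hn
  exact ⟨_, (Measure.addHaarScalarFactor_pos_of_isAddHaarMeasure _ _).ne',
    Measure.isAddLeftInvariant_eq_smul _ _⟩

/-- A bi-Lipschitz map between spaces of equal dimension pulls integrals back with bounds. -/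
theorem exists_setLIntegral_comp_le {m : ℕ} {Θ : Space m × ℝ → Space (m + 1)}
    {Ψ : Space (m + 1) → Space m × ℝ} {H : Set (Space m × ℝ)} (hH : MeasurableSet H)
    (hΘ : ContinuousOn Θ H) (hinv : ∀ p ∈ H, Ψ (Θ p) = p) {K : ℝ≥0}
    (hΨ : LipschitzOnWith K Ψ (Θ '' H)) :
    ∃ C : ℝ≥0, ∀ φ : Space (m + 1) → ℝ≥0∞, ∫⁻ p in H, φ (Θ p) ≤ C * ∫⁻ x in Θ '' H, φ x := by
  have : (volume : Measure (Space m × ℝ)).IsAddHaarMeasure := by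
    rw [Measure.volume_eq_prod]
    infer_instance
  obtain ⟨c₁, -, h₁⟩ := exists_volume_eq_smul_hausdorffMeasure (E := Space m × ℝ) (n := m + 1)
    (by simp)
  obtain ⟨c₂, hc₂, h₂⟩ := exists_volume_eq_smul_hausdorffMeasure (E := Space (m + 1)) (n := m + 1)
    (by simp)
  have hinj : InjOn Θ H := fun p hp q hq hpq => by rw [← hinv p hp, hpq, hinv q hq]
  have hA : MeasurableSet (Θ '' H) := hH.image_of_continuousOn_injOn hΘ hinj
  have himg : Ψ '' (Θ '' H) = H := by
    rw [image_image]
    exact (image_congr hinv).trans (image_id' H)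
  refine ⟨c₁ * K ^ (m + 1) * c₂⁻¹, fun φ => ?_⟩
  have h := setLIntegral_image_le_hausdorffMeasure hA hΨ (m + 1) (fun p => φ (Θ p))
  rw [himg] at h
  have e : ∫⁻ x in Θ '' H, φ (Θ (Ψ x)) ∂μH[((m + 1 : ℕ) : ℝ)] =
      ∫⁻ x in Θ '' H, φ x ∂μH[((m + 1 : ℕ) : ℝ)] := by
    refine setLIntegral_congr_fun hA ?_
    rintro _ ⟨p, hp, rfl⟩
    simp only [hinv p hp]
  rw [e] at h
  rw [h₁, h₂, Measure.restrict_smul, Measure.restrict_smul, lintegral_smul_measure,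
    lintegral_smul_measure]
  simp only [ENNReal.smul_def, smul_eq_mul]
  calc _ ≤ (c₁ : ℝ≥0∞) * ((K : ℝ≥0∞) ^ (m + 1) * ∫⁻ x in Θ '' H, φ x ∂μH[((m + 1 : ℕ) : ℝ)]) := by
        gcongr
    _ = _ := by
        rw [ENNReal.coe_mul, ENNReal.coe_mul, ENNReal.coe_pow, mul_assoc (_ * _), 
          ← mul_assoc ((c₂⁻¹ : ℝ≥0) : ℝ≥0∞),
          ← ENNReal.coe_mul c₂⁻¹, inv_mul_cancel₀ hc₂, ENNReal.coe_one, one_mul, mul_assoc]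

/-- A boundary chart: a bi-Lipschitz image of a half box near a boundary point. The last property
bounds the pull-back of integrals. -/
theorem IsCnBoundary.exists_chart {m n : ℕ} (hn : 1 ≤ n) {Γ D : Set (Space (m + 1))}
    (hΓ : IsCnBoundary n Γ D) {x₀ : Space (m + 1)} (hx₀ : x₀ ∈ Γ) :
    ∃ r > 0, ∃ (Θ : Space m × ℝ → Space (m + 1)) (K C : ℝ≥0) (N : Set (Space (m + 1))),
      0 < K ∧ IsOpen N ∧ x₀ ∈ N ∧ LipschitzOnWith K Θ (halfBox m r) ∧
      MapsTo Θ (halfBox m r) (D ∪ Γ) ∧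
      (∀ p ∈ halfBox m r, ∀ q ∈ halfBox m r, edist p q ≤ K * edist (Θ p) (Θ q)) ∧
      Γ ∩ N ⊆ (fun x => Θ (x, 0)) '' Metric.ball 0 r ∧
      ∀ φ : Space (m + 1) → ℝ≥0∞, ∫⁻ p in halfBox m r, φ (Θ p) ≤ C * ∫⁻ x in D ∪ Γ, φ x := by
  obtain ⟨U, ρ, hU, hxU, hρ, hρ', hΓU, hDU⟩ := hΓ x₀ hx₀
  have hρx : ContDiffAt ℝ n ρ x₀ := hρ.contDiffAt (hU.mem_nhds hxU)
  have hst : HasStrictFDerivAt ρ (fderiv ℝ ρ x₀) x₀ :=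
    hρx.hasStrictFDerivAt (by exact_mod_cast (by omega : n ≠ 0))
  set ℓ : Space (m + 1) →L[ℝ] ℝ := fderiv ℝ ρ x₀ with hℓ
  have hℓ0 : ℓ ≠ 0 := hρ' x₀ hxU
  -- the kernel of the differential plays the role of the tangent space
  set S : Submodule ℝ (Space (m + 1)) := LinearMap.ker (ℓ : Space (m + 1) →ₗ[ℝ] ℝ) with hS
  have hSdim : Module.finrank ℝ S = Module.finrank ℝ (Space m) := by
    have h1 := LinearMap.finrank_range_add_finrank_ker (ℓ : Space (m + 1) →ₗ[ℝ] ℝ)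
    have h2 : LinearMap.range (ℓ : Space (m + 1) →ₗ[ℝ] ℝ) = ⊤ := by
      refine LinearMap.range_eq_top.2 (LinearMap.surjective ?_)
      intro h0
      exact hℓ0 (ContinuousLinearMap.coe_injective h0)
    rw [h2, ← hS] at h1
    simp only [finrank_top, Module.finrank_self, finrank_euclideanSpace, Fintype.card_fin] at h1 ⊢
    omega
  let e : S ≃ₗ[ℝ] Space m := LinearEquiv.ofFinrankEq _ _ hSdim
  obtain ⟨Q, hQ⟩ := S.exists_isCompl
  let P : Space (m + 1) →ₗ[ℝ] S := S.projectionOnto Q hQ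
  let A₁ : Space (m + 1) →ₗ[ℝ] Space m := e.toLinearMap.comp P
  -- `Ψ` consists of tangential coordinates and `-ρ`; its differential at `x₀` is the isomorphism
  -- `A`, and `Θ` is the local inverse.
  let Aₗ : Space (m + 1) →ₗ[ℝ] Space m × ℝ := A₁.prod (-(ℓ : Space (m + 1) →ₗ[ℝ] ℝ))
  have hinj : Function.Injective Aₗ := by
    rw [← LinearMap.ker_eq_bot, LinearMap.ker_eq_bot']
    intro v hv
    have h1 : A₁ v = 0 := congrArg Prod.fst hv
    have h2 : -ℓ v = 0 := congrArg Prod.snd hv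
    have h3 : v ∈ S := by
      rw [hS, LinearMap.mem_ker]
      simpa using h2
    have h4 : P v = ⟨v, h3⟩ := Submodule.projectionOnto_apply_left hQ ⟨v, h3⟩
    have h5 : e ⟨v, h3⟩ = 0 := by rw [← h4]; exact h1
    have h6 : (⟨v, h3⟩ : S) = 0 := by simpa using h5
    exact congrArg Subtype.val h6
  let A : Space (m + 1) ≃L[ℝ] Space m × ℝ :=
    (LinearMap.linearEquivOfInjective Aₗ hinj (by simp)).toContinuousLinearEquiv
  have hA : ∀ v, A v = (A₁ v, -ℓ v) := fun v => rfl
  let A₁c : Space (m + 1) →L[ℝ] Space m := LinearMap.toContinuousLinearMap A₁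
  let Ψ : Space (m + 1) → Space m × ℝ := fun x => (A₁c (x - x₀), -ρ x)
  have hΨ : HasStrictFDerivAt Ψ (A : Space (m + 1) →L[ℝ] Space m × ℝ) x₀ := by
    have h1 : HasStrictFDerivAt (fun x => A₁c (x - x₀)) A₁c x₀ :=
      (A₁c.hasStrictFDerivAt (x := x₀ - x₀)).comp (f := fun x => x - x₀) x₀
        ((hasStrictFDerivAt_id x₀).sub_const x₀)
    have h2 := h1.prodMk hst.neg
    convert! h2 using 1
  have hρ0 : ρ x₀ = 0 := by
    have : x₀ ∈ {y ∈ U | ρ y = 0} := hΓU ▸ ⟨hx₀, hxU⟩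
    exact this.2
  have hΨ0 : Ψ x₀ = (0, 0) := by simp [Ψ, hρ0]
  let Θ := hΨ.localInverse
  have hΘ0 : Θ (0, 0) = x₀ := by rw [← hΨ0]; exact hΨ.localInverse_apply_image
  have hΘd : HasStrictFDerivAt Θ (A.symm : Space m × ℝ →L[ℝ] Space (m + 1)) (0, 0) := by
    rw [← hΨ0]; exact hΨ.to_localInverse
  obtain ⟨K₁, s₁, hs₁, hL₁⟩ := hΘd.exists_lipschitzOnWith
  obtain ⟨K₂, s₂, hs₂, hL₂⟩ := hΨ.exists_lipschitzOnWith
  have hev : ∀ᶠ p in 𝓝 ((0 : Space m), (0 : ℝ)),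
      p ∈ s₁ ∧ Θ p ∈ s₂ ∧ Θ p ∈ U ∧ Ψ (Θ p) = p := by
    have hc : Tendsto Θ (𝓝 (0, 0)) (𝓝 x₀) := by
      have := hΘd.continuousAt.tendsto
      rwa [hΘ0] at this
    have h4 : ∀ᶠ p in 𝓝 ((0 : Space m), (0 : ℝ)), Ψ (Θ p) = p := by
      rw [← hΨ0]; exact hΨ.eventually_right_inverse
    filter_upwards [hs₁, hc hs₂, hc (hU.mem_nhds hxU), h4] with p h1 h2 h3 h4
    exact ⟨h1, h2, h3, h4⟩
  obtain ⟨ε, hε, hball⟩ := Metric.eventually_nhds_iff_ball.1 hev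
  -- The half box of radius `r` and height `2 r` lies in the ball of radius `ε`.
  set r : ℝ := ε / 3 with hr
  have hr0 : 0 < r := by positivity
  have hbox : ∀ p ∈ halfBox m r, p ∈ Metric.ball ((0 : Space m), (0 : ℝ)) ε := by
    rintro ⟨x, s⟩ ⟨hx, hs⟩
    have hx' : ‖x‖ < r := mem_ball_zero_iff.1 hx
    have hs' : 0 ≤ s ∧ s ≤ 2 * r := hs
    have : ((0 : Space m), (0 : ℝ)) = 0 := rfl
    rw [this, mem_ball_zero_iff, Prod.norm_def, max_lt_iff]
    refine ⟨by simp only; linarith, ?_⟩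
    simp only [Real.norm_eq_abs, abs_of_nonneg hs'.1]
    linarith [hs'.2]
  have hL₁' : LipschitzOnWith (K₁ + K₂ + 1) Θ (halfBox m r) := by
    refine (hL₁.mono fun p hp => (hball p (hbox p hp)).1).weaken ?_
    rw [add_assoc]; exact le_self_add
  have hL₂' : LipschitzOnWith (K₁ + K₂ + 1) Ψ (Θ '' halfBox m r) := by
    refine (hL₂.mono ?_).weaken ?_
    · rintro _ ⟨p, hp, rfl⟩
      exact (hball p (hbox p hp)).2.1
    · rw [add_right_comm]; exact le_add_self
  have hinv : ∀ p ∈ halfBox m r, Ψ (Θ p) = p := fun p hp => (hball p (hbox p hp)).2.2.2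
  have hmaps : MapsTo Θ (halfBox m r) (D ∪ Γ) := by
    rintro p hp
    have hpU := (hball p (hbox p hp)).2.2.1
    have h2 : -ρ (Θ p) = p.2 := congrArg Prod.snd (hinv p hp)
    have hp2 : 0 ≤ p.2 := hp.2.1
    rcases hp2.eq_or_lt with h0 | h0
    · right
      have : Θ p ∈ Γ ∩ U := by rw [hΓU]; exact ⟨hpU, by linarith⟩
      exact this.1
    · left
      have : Θ p ∈ D ∩ U := by rw [hDU]; exact ⟨hpU, by linarith⟩
      exact this.1
  obtain ⟨C, hC⟩ := exists_setLIntegral_comp_le (measurableSet_halfBox m r) hL₁'.continuousOn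
    hinv hL₂'
  refine ⟨r, hr0, Θ, K₁ + K₂ + 1, C,
    interior {x | x ∈ U ∧ Θ (Ψ x) = x ∧ Ψ x ∈ Metric.ball ((0 : Space m), (0 : ℝ)) r},
    by positivity, isOpen_interior, ?_, hL₁', hmaps, ?_, ?_, fun φ => (hC φ).trans ?_⟩
  · rw [mem_interior_iff_mem_nhds]
    have hc : Tendsto Ψ (𝓝 x₀) (𝓝 (0, 0)) := by
      have := hΨ.continuousAt.tendsto
      rwa [hΨ0] at this
    filter_upwards [hU.mem_nhds hxU, hΨ.eventually_left_inverse,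
      hc (Metric.ball_mem_nhds _ hr0)] with x h1 h2 h3
    exact ⟨h1, h2, h3⟩
  · intro p hp q hq
    have := hL₂' (mem_image_of_mem Θ hp) (mem_image_of_mem Θ hq)
    rwa [hinv p hp, hinv q hq] at this
  · rintro x ⟨hxΓ, hxN⟩
    obtain ⟨h1, h2, h3⟩ := interior_subset hxN
    have h4 : x ∈ {y ∈ U | ρ y = 0} := hΓU ▸ ⟨hxΓ, h1⟩
    refine ⟨A₁c (x - x₀), ?_, ?_⟩
    · rw [mem_ball_zero_iff]
      have : ((0 : Space m), (0 : ℝ)) = 0 := rfl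
      rw [this, mem_ball_zero_iff, Prod.norm_def] at h3
      exact (le_max_left _ _).trans_lt h3
    · have : Ψ x = (A₁c (x - x₀), 0) := by simp only [Ψ, h4.2, neg_zero]
      simp only
      rw [← this, h2]
  · gcongr
    exact hmaps.image_subset

theorem IsUpperGradientOn.congr {E : Type*} [PseudoEMetricSpace E] {u v : E → ℝ}
    {g g' : E → ℝ≥0∞} {S : Set E} (h : IsUpperGradientOn u g S) (huv : EqOn u v S)
    (hg : EqOn g g' S) : IsUpperGradientOn v g' S := by
  intro c L hc hcS
  have h1 := h c L hc hcS
  rw [huv (hcS ⟨zero_le_one, le_rfl⟩), huv (hcS ⟨le_rfl, zero_le_one⟩)] at h1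
  refine h1.trans (le_of_eq ?_)
  congr 1
  exact setLIntegral_congr_fun measurableSet_Ioc fun s hs => hg (hcS ⟨hs.1.le, hs.2⟩)

theorem inv_pow_le_mul_inv_pow {a b K : ℝ≥0∞} (hK : K ≠ 0) (hKt : K ≠ ⊤) (h : a ≤ K * b) (n : ℕ) :
    (b ^ n)⁻¹ ≤ K ^ n * (a ^ n)⁻¹ := by
  calc (b ^ n)⁻¹ = K ^ n * (K ^ n * b ^ n)⁻¹ := by
        rw [ENNReal.mul_inv (by left; positivity) (by left; exact ENNReal.pow_ne_top hKt),
          ← mul_assoc, ENNReal.mul_inv_cancel (by positivity) (ENNReal.pow_ne_top hKt), one_mul]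
    _ ≤ _ := by
        gcongr
        rw [← mul_pow]
        gcongr

/-- Both trace inequalities near a boundary point. -/
theorem IsCnBoundary.exists_local_trace {m n : ℕ} (hm : 1 ≤ m) (hn : 1 ≤ n)
    {Γ D : Set (Space (m + 1))} (hΓ : IsCnBoundary n Γ D) {x₀ : Space (m + 1)} (hx₀ : x₀ ∈ Γ) :
    ∃ (C : ℝ≥0) (N : Set (Space (m + 1))), IsOpen N ∧ x₀ ∈ N ∧ μHE[m] (Γ ∩ N) < ⊤ ∧
      ∀ (u : Space (m + 1) → ℝ) (g : Space (m + 1) → ℝ≥0∞), Measurable u → Measurable g →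
        IsUpperGradientOn u g (D ∪ Γ) →
        ∫⁻ x in Γ ∩ N, ‖u x‖ₑ ^ 2 ∂μHE[m] ≤ C * ∫⁻ x in D ∪ Γ, (‖u x‖ₑ ^ 2 + g x ^ 2) ∧
        ∫⁻ x in Γ ∩ N, ∫⁻ y in Γ ∩ N, ‖u x - u y‖ₑ ^ 2 * (‖x - y‖ₑ ^ (m + 1))⁻¹ ∂μHE[m] ∂μHE[m] ≤
          C * ∫⁻ x in D ∪ Γ, (‖u x‖ₑ ^ 2 + g x ^ 2) := by
  obtain ⟨r, hr, Θ, K, C, N, hK, hN, hxN, hΘ, hmaps, hanti, hcov, hC⟩ := hΓ.exists_chart hn hx₀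
  set B : Set (Space m) := Metric.ball 0 r with hB
  have hBm : MeasurableSet B := Metric.isOpen_ball.measurableSet
  have hbox0 : ∀ x ∈ B, (x, (0 : ℝ)) ∈ halfBox m r := fun x hx => ⟨hx, le_rfl, by positivity⟩
  set θ : Space m → Space (m + 1) := fun x => Θ (x, 0) with hθ
  have hθL : LipschitzOnWith K θ B := by
    intro x hx y hy
    refine (hΘ (hbox0 x hx) (hbox0 y hy)).trans (le_of_eq ?_)
    rw [Prod.edist_eq]
    simp
  have hK0 : (K : ℝ≥0∞) ≠ 0 := by simpa using hK.ne'
  -- integrals over the boundary patch are integrals over a ball of `ℝ^m`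
  have hsurf : ∀ F : Space (m + 1) → ℝ≥0∞,
      ∫⁻ x in Γ ∩ N, F x ∂μHE[m] ≤ (K : ℝ≥0∞) ^ m * ∫⁻ x in B, F (θ x) := by
    intro F
    have h := setLIntegral_image_le_of_lipschitzOnWith hBm hθL m F
    rw [EuclideanSpace.euclideanHausdorffMeasure_eq_volume] at h
    exact (lintegral_mono_set hcov).trans h
  have hVB : volume B < ⊤ := measure_ball_lt_top
  set c₁ : ℝ≥0∞ := 2 * (ENNReal.ofReal r)⁻¹ + 8 * ENNReal.ofReal r with hc₁
  have hc₁t : c₁ ≠ ⊤ := by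
    have : (ENNReal.ofReal r)⁻¹ ≠ ⊤ := by simp [hr]
    finiteness
  set c₂ : ℝ≥0∞ := 16 * (m * volume (Metric.ball (0 : Space m) 1)) with hc₂
  have hc₂t : c₂ ≠ ⊤ := by
    have : volume (Metric.ball (0 : Space m) 1) ≠ ⊤ := measure_ball_lt_top.ne
    finiteness
  set Cf : ℝ≥0∞ := (K : ℝ≥0∞) ^ m * (K ^ m * (K ^ (m + 1) * c₂) + c₁) * ((1 + K ^ 2) * C) with hCf
  have hCft : Cf ≠ ⊤ := by finiteness
  refine ⟨Cf.toNNReal, N, hN, hxN, ?_, ?_⟩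
  · have h := hsurf fun _ => 1
    simp only [lintegral_const, one_mul, Measure.restrict_apply MeasurableSet.univ,
      univ_inter] at h
    exact h.trans_lt (by finiteness)
  intro u g hu hg hug
  rw [ENNReal.coe_toNNReal hCft]
  -- the pull-back of `u` and of its upper gradient to the half box
  classical
  set Θ' : Space m × ℝ → Space (m + 1) := (halfBox m r).piecewise Θ fun _ => 0 with hΘ'
  have hHm := measurableSet_halfBox m r
  have hΘ'm : Measurable Θ' :=
    hΘ.continuousOn.measurable_piecewise continuous_const.continuousOn hHm
  have hΘ'e : ∀ p ∈ halfBox m r, Θ' p = Θ p := fun p hp => piecewise_eq_of_mem _ _ _ hp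
  set ut : Space m × ℝ → ℝ := fun p => u (Θ' p) with hut
  set gt : Space m × ℝ → ℝ≥0∞ := fun p => K * g (Θ' p) with hgt
  have hutm : Measurable ut := hu.comp hΘ'm
  have hgtm : Measurable gt := (hg.comp hΘ'm).const_mul _
  have hug' : IsUpperGradientOn ut gt (halfBox m r) :=
    (hug.comp hΘ hmaps).congr (fun p hp => by simp only [hut, hΘ'e p hp])
      (fun p hp => by simp only [hgt, hΘ'e p hp])
  set E : ℝ≥0∞ := ∫⁻ x in D ∪ Γ, (‖u x‖ₑ ^ 2 + g x ^ 2) with hE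
  have hEn : ∫⁻ p in halfBox m r, (‖ut p‖ₑ ^ 2 + gt p ^ 2) ≤ (1 + (K : ℝ≥0∞) ^ 2) * C * E := by
    calc ∫⁻ p in halfBox m r, (‖ut p‖ₑ ^ 2 + gt p ^ 2)
        ≤ ∫⁻ p in halfBox m r, (1 + (K : ℝ≥0∞) ^ 2) * (‖u (Θ p)‖ₑ ^ 2 + g (Θ p) ^ 2) := by
          refine setLIntegral_mono' hHm fun p hp => ?_
          simp only [hut, hgt, hΘ'e p hp, mul_pow]
          calc _ ≤ 1 * (‖u (Θ p)‖ₑ ^ 2) + (K : ℝ≥0∞) ^ 2 * g (Θ p) ^ 2 +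
                ((K : ℝ≥0∞) ^ 2 * (‖u (Θ p)‖ₑ ^ 2) + 1 * g (Θ p) ^ 2) := by
                rw [one_mul]; exact le_self_add
            _ = _ := by ring
      _ = (1 + (K : ℝ≥0∞) ^ 2) * ∫⁻ p in halfBox m r, (‖u (Θ p)‖ₑ ^ 2 + g (Θ p) ^ 2) :=
          lintegral_const_mul' _ _ (by finiteness)
      _ ≤ (1 + (K : ℝ≥0∞) ^ 2) * (C * E) := by
          gcongr
          exact hC fun x => ‖u x‖ₑ ^ 2 + g x ^ 2
      _ = _ := by ring
  have hbd : ∀ x ∈ B, ut (x, 0) = u (θ x) := fun x hx => by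
    simp only [hut, hθ, hΘ'e _ (hbox0 x hx)]
  constructor
  · have h1 := sq_trace_halfBox_le hr hgtm hug'
      (((hutm.enorm).pow_const 2).indicator hHm)
    calc ∫⁻ x in Γ ∩ N, ‖u x‖ₑ ^ 2 ∂μHE[m] ≤ (K : ℝ≥0∞) ^ m * ∫⁻ x in B, ‖u (θ x)‖ₑ ^ 2 := hsurf _
      _ = (K : ℝ≥0∞) ^ m * ∫⁻ x in B, ‖ut (x, 0)‖ₑ ^ 2 := by
          congr 1
          exact setLIntegral_congr_fun hBm fun x hx => by simp only [hbd x hx]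
      _ ≤ (K : ℝ≥0∞) ^ m * (c₁ * ((1 + (K : ℝ≥0∞) ^ 2) * C * E)) := by
          gcongr
          exact h1.trans (by gcongr)
      _ ≤ Cf * E := by
          have : Cf * E = (K : ℝ≥0∞) ^ m * (c₁ * ((1 + (K : ℝ≥0∞) ^ 2) * C * E)) +
            (K : ℝ≥0∞) ^ m * (K ^ m * (K ^ (m + 1) * c₂)) * ((1 + K ^ 2) * C) * E := by
            rw [hCf]; ring
          rw [this]
          exact le_self_add
  · have h1 := gagliardo_halfBox_le hm hgtm hug'
    have h2 : ∫⁻ p in halfBox m r, gt p ^ 2 ≤ (1 + (K : ℝ≥0∞) ^ 2) * C * E :=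
      (lintegral_mono fun p => le_add_self).trans hEn
    calc ∫⁻ x in Γ ∩ N, ∫⁻ y in Γ ∩ N,
          ‖u x - u y‖ₑ ^ 2 * (‖x - y‖ₑ ^ (m + 1))⁻¹ ∂μHE[m] ∂μHE[m]
        ≤ ∫⁻ x in Γ ∩ N, ((K : ℝ≥0∞) ^ m * ∫⁻ y in B,
          ‖u x - u (θ y)‖ₑ ^ 2 * (‖x - θ y‖ₑ ^ (m + 1))⁻¹) ∂μHE[m] :=
          lintegral_mono fun x => hsurf _
      _ ≤ (K : ℝ≥0∞) ^ m * ∫⁻ x in B, ((K : ℝ≥0∞) ^ m * ∫⁻ y in B,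
          ‖u (θ x) - u (θ y)‖ₑ ^ 2 * (‖θ x - θ y‖ₑ ^ (m + 1))⁻¹) := hsurf _
      _ ≤ (K : ℝ≥0∞) ^ m * ∫⁻ x in B, ((K : ℝ≥0∞) ^ m * ∫⁻ y in B, (K : ℝ≥0∞) ^ (m + 1) *
          (‖ut (x, 0) - ut (y, 0)‖ₑ ^ 2 * (‖x - y‖ₑ ^ (m + 1))⁻¹)) := by
          refine mul_le_mul' le_rfl ?_
          refine setLIntegral_mono' hBm fun x hx => ?_
          refine mul_le_mul' le_rfl ?_
          refine setLIntegral_mono' hBm fun y hy => ?_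
          rw [hbd x hx, hbd y hy, mul_left_comm]
          gcongr
          refine inv_pow_le_mul_inv_pow hK0 ENNReal.coe_ne_top ?_ _
          have := hanti _ (hbox0 x hx) _ (hbox0 y hy)
          rw [Prod.edist_eq] at this
          simpa [hθ, edist_eq_enorm_sub] using this
      _ = (K : ℝ≥0∞) ^ m * (K ^ m * (K ^ (m + 1) * ∫⁻ x in B, ∫⁻ y in B,
          ‖ut (x, 0) - ut (y, 0)‖ₑ ^ 2 * (‖x - y‖ₑ ^ (m + 1))⁻¹)) := by
          rw [lintegral_const_mul' _ _ (by finiteness)]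
          congr 2
          rw [← lintegral_const_mul' _ _ (by finiteness)]
          congr 1 with x
          rw [lintegral_const_mul' _ _ (by finiteness)]
      _ ≤ (K : ℝ≥0∞) ^ m * (K ^ m * (K ^ (m + 1) * (c₂ * ((1 + (K : ℝ≥0∞) ^ 2) * C * E)))) := by
          gcongr
          exact h1.trans (by gcongr)
      _ ≤ Cf * E := by
          have : Cf * E = (K : ℝ≥0∞) ^ m * (c₁ * ((1 + (K : ℝ≥0∞) ^ 2) * C * E)) +
            (K : ℝ≥0∞) ^ m * (K ^ m * (K ^ (m + 1) * (c₂ * ((1 + (K : ℝ≥0∞) ^ 2) * C * E)))) := by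
            rw [hCf]; ring
          rw [this]
          exact le_add_self

theorem eLpNorm_two_sq {α : Type*} [MeasurableSpace α] {μ : Measure α} (f : α → ℝ) :
    eLpNorm f 2 μ ^ 2 = ∫⁻ x, ‖f x‖ₑ ^ 2 ∂μ := by
  have := eLpNorm_nnreal_pow_eq_lintegral (f := f) (μ := μ) (p := 2) (by norm_num)
  simpa using this

theorem enorm_gagliardo_sq {d : ℕ} (v : Space d → ℝ) (x y : Space d) :
    ‖gagliardo v (x, y)‖ₑ ^ 2 = ‖v x - v y‖ₑ ^ 2 * (‖x - y‖ₑ ^ d)⁻¹ := by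
  rcases eq_or_ne x y with rfl | hxy
  · simp [gagliardo]
  · have h0 : 0 < ‖x - y‖ := norm_pos_iff.2 (sub_ne_zero.2 hxy)
    have hq : 0 < ‖x - y‖ ^ ((d : ℝ) / 2) := Real.rpow_pos_of_pos h0 _
    have e : ‖gagliardo v (x, y)‖ ^ 2 = ‖v x - v y‖ ^ 2 * (‖x - y‖ ^ d)⁻¹ := by
      simp only [gagliardo]
      rw [norm_div, div_pow, Real.norm_of_nonneg hq.le, ← Real.rpow_natCast (_ ^ _),
        ← Real.rpow_mul h0.le, div_eq_mul_inv]
      norm_num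
    rw [← ofReal_norm, ← ENNReal.ofReal_pow (norm_nonneg _), e,
      ENNReal.ofReal_mul (by positivity), ENNReal.ofReal_inv_of_pos (by positivity),
      ENNReal.ofReal_pow h0.le, ENNReal.ofReal_pow (norm_nonneg _), ofReal_norm, ofReal_norm]

/-- `‖v‖²_{H^{1/2}(Γ)}` as iterated integrals. -/
theorem normSqHHalf_eq {d : ℕ} {Γ : Set (Space d)} [SFinite (surf Γ)] {v : Space d → ℝ}
    (hv : AEStronglyMeasurable v (surf Γ)) :
    normSqHHalf Γ v = ∫⁻ x, ‖v x‖ₑ ^ 2 ∂surf Γ +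
      ∫⁻ x, ∫⁻ y, ‖v x - v y‖ₑ ^ 2 * (‖x - y‖ₑ ^ d)⁻¹ ∂surf Γ ∂surf Γ := by
  rw [normSqHHalf, eLpNorm_two_sq, eLpNorm_two_sq, lintegral_prod]
  · simp only [enorm_gagliardo_sq]
  · have h1 : AEMeasurable v (surf Γ) := hv.aemeasurable
    have h2 : AEMeasurable (gagliardo v) ((surf Γ).prod (surf Γ)) := by
      refine AEMeasurable.div ?_ (by fun_prop)
      exact (h1.comp_fst).sub (h1.comp_snd)
    exact h2.enorm.pow_const 2

theorem mem_HHalf_iff {d : ℕ} {Γ : Set (Space d)} [SFinite (surf Γ)] {v : Space d → ℝ}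
    (hv : AEStronglyMeasurable v (surf Γ)) : v ∈ HHalf Γ ↔ normSqHHalf Γ v < ⊤ := by
  have h2 : AEStronglyMeasurable (gagliardo v) ((surf Γ).prod (surf Γ)) := by
    have h1 : AEMeasurable v (surf Γ) := hv.aemeasurable
    refine AEMeasurable.aestronglyMeasurable ?_
    refine AEMeasurable.div ?_ (by fun_prop)
    exact (h1.comp_fst).sub (h1.comp_snd)
  change (MemLp v 2 (surf Γ) ∧ MemLp (gagliardo v) 2 ((surf Γ).prod (surf Γ))) ↔ _
  rw [normSqHHalf, ENNReal.add_lt_top, ENNReal.pow_lt_top_iff, ENNReal.pow_lt_top_iff]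
  simp [MemLp, hv, h2]

/-- The trace theorem: the `H^{1/2}(Γ)` norm of a continuous function is bounded by its `L²` norm
and that of an upper gradient over the domain bounded by `Γ`. -/
theorem IsCnBoundary.exists_trace {m n : ℕ} (hm : 1 ≤ m) (hn : 1 ≤ n)
    {Γ D : Set (Space (m + 1))} (hΓ : IsCnBoundary n Γ D) (hΓc : IsCompact Γ)
    (hDc : IsClosed (D ∪ Γ)) :
    IsFiniteMeasure (surf Γ) ∧ ∃ C : ℝ≥0, ∀ (u : Space (m + 1) → ℝ) (g : Space (m + 1) → ℝ≥0∞),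
      ContinuousOn u (D ∪ Γ) → Measurable g → IsUpperGradientOn u g (D ∪ Γ) →
      normSqHHalf Γ u ≤ C * ∫⁻ x in D ∪ Γ, (‖u x‖ₑ ^ 2 + g x ^ 2) := by
  have hloc := fun x : Γ => hΓ.exists_local_trace hm hn x.2
  choose C N hN hxN hfin htr using hloc
  obtain ⟨t, ht⟩ := hΓc.elim_finite_subcover N hN
    (fun x hx => mem_iUnion.2 ⟨⟨x, hx⟩, hxN ⟨x, hx⟩⟩)
  have ht' : Γ ⊆ ⋃ i : t, N i := by
    intro x hx
    obtain ⟨i, hi, hxi⟩ := mem_iUnion₂.1 (ht hx)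
    exact mem_iUnion.2 ⟨⟨i, hi⟩, hxi⟩
  -- Points of `Γ` at distance less than the Lebesgue number `δ` lie in a common patch.
  obtain ⟨δ, hδ, hleb⟩ := lebesgue_number_lemma_of_metric hΓc (fun i : t => hN i) ht'
  have hsurf : surf Γ = Measure.restrict μHE[m] Γ := rfl
  have hΓm : MeasurableSet Γ := hΓc.isClosed.measurableSet
  have hfinite : IsFiniteMeasure (surf Γ) := by
    refine ⟨?_⟩
    rw [hsurf, Measure.restrict_apply MeasurableSet.univ, univ_inter]
    have : Γ ⊆ ⋃ i : t, Γ ∩ N i := by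
      rw [← inter_iUnion]
      exact subset_inter subset_rfl ht'
    refine (measure_mono this).trans_lt ((measure_iUnion_le _).trans_lt ?_)
    rw [tsum_fintype]
    exact ENNReal.sum_lt_top.2 fun i _ => hfin i
  refine ⟨hfinite, ?_⟩
  set ε : ℝ≥0∞ := (ENNReal.ofReal δ ^ (m + 1))⁻¹ with hε
  have hεt : ε ≠ ⊤ := by
    have : ENNReal.ofReal δ ≠ 0 := by simpa using hδ
    simp [hε, this]
  set A : ℝ≥0∞ := surf Γ univ with hA
  have hAt : A ≠ ⊤ := measure_ne_top _ _
  set S : ℝ≥0∞ := ∑ i : t, (C i : ℝ≥0∞) with hS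
  have hSt : S ≠ ⊤ := by rw [hS]; exact ENNReal.sum_ne_top.2 fun i _ => ENNReal.coe_ne_top
  set Cf : ℝ≥0∞ := S + (S + 4 * ε * A * S) with hCf
  have hCft : Cf ≠ ⊤ := by finiteness
  refine ⟨Cf.toNNReal, fun u₀ g hu₀ hg hug₀ => ?_⟩
  rw [ENNReal.coe_toNNReal hCft]
  have hDm : MeasurableSet (D ∪ Γ) := hDc.measurableSet
  -- Extension by zero makes the function measurable and leaves its trace unchanged.
  set u : Space (m + 1) → ℝ := (D ∪ Γ).indicator u₀ with hu
  have hum : Measurable u := by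
    classical
    have := hu₀.measurable_piecewise (continuous_const (y := (0 : ℝ))).continuousOn hDm
    rw [hu, ← piecewise_eq_indicator]
    exact this
  have huu : ∀ x ∈ D ∪ Γ, u x = u₀ x := fun x hx => indicator_of_mem hx _
  have hug : IsUpperGradientOn u g (D ∪ Γ) :=
    hug₀.congr (fun x hx => (huu x hx).symm) fun x _ => rfl
  set E : ℝ≥0∞ := ∫⁻ x in D ∪ Γ, (‖u₀ x‖ₑ ^ 2 + g x ^ 2) with hE
  have hEu : ∫⁻ x in D ∪ Γ, (‖u x‖ₑ ^ 2 + g x ^ 2) = E :=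
    setLIntegral_congr_fun hDm fun x hx => by simp only [huu x hx]
  have hae : u =ᵐ[surf Γ] u₀ := by
    rw [hsurf]
    filter_upwards [ae_restrict_mem hΓm] with x hx
    exact huu x (Or.inr hx)
  have hu₀m : AEStronglyMeasurable u₀ (surf Γ) := hum.aestronglyMeasurable.congr hae
  have hnorm : normSqHHalf Γ u₀ = ∫⁻ x, ‖u x‖ₑ ^ 2 ∂surf Γ +
      ∫⁻ x, ∫⁻ y, ‖u x - u y‖ₑ ^ 2 * (‖x - y‖ₑ ^ (m + 1))⁻¹ ∂surf Γ ∂surf Γ := by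
    rw [normSqHHalf_eq hu₀m]
    congr 1
    · refine lintegral_congr_ae ?_
      filter_upwards [hae] with x hx
      rw [hx]
    · refine lintegral_congr_ae ?_
      filter_upwards [hae] with x hx
      refine lintegral_congr_ae ?_
      filter_upwards [hae] with y hy
      rw [hx, hy]
  rw [hnorm]
  have hL2 : ∫⁻ x, ‖u x‖ₑ ^ 2 ∂surf Γ ≤ S * E := by
    have h1 : Γ ⊆ ⋃ i : t, Γ ∩ N i := by
      rw [← inter_iUnion]
      exact subset_inter subset_rfl ht'
    calc ∫⁻ x, ‖u x‖ₑ ^ 2 ∂surf Γ ≤ ∫⁻ x in ⋃ i : t, Γ ∩ N i, ‖u x‖ₑ ^ 2 ∂μHE[m] :=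
          lintegral_mono_set h1
      _ ≤ ∑' i : t, ∫⁻ x in Γ ∩ N i, ‖u x‖ₑ ^ 2 ∂μHE[m] := lintegral_iUnion_le _ _
      _ = ∑ i : t, ∫⁻ x in Γ ∩ N i, ‖u x‖ₑ ^ 2 ∂μHE[m] := tsum_fintype _
      _ ≤ ∑ i : t, (C i : ℝ≥0∞) * E := by
          refine Finset.sum_le_sum fun i _ => ?_
          rw [← hEu]
          exact (htr i u g hum hg hug).1
      _ = S * E := by rw [hS, Finset.sum_mul]
  set F : Space (m + 1) → Space (m + 1) → ℝ≥0∞ := fun x y =>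
    ‖u x - u y‖ₑ ^ 2 * (‖x - y‖ₑ ^ (m + 1))⁻¹ with hF
  have hFm : Measurable fun p : Space (m + 1) × Space (m + 1) => F p.1 p.2 := by
    simp only [hF]
    fun_prop
  -- close pairs lie in a common patch, distant pairs are controlled by the `L²` norm
  have hsplit : ∀ x ∈ Γ, ∀ y ∈ Γ, F x y ≤
      ∑ i : t, (N i).indicator (fun x => (N i).indicator (F x) y) x +
        2 * ε * (‖u x‖ₑ ^ 2 + ‖u y‖ₑ ^ 2) := by
    intro x hx y hy
    by_cases hxy : dist y x < δ
    · obtain ⟨i, hi⟩ := hleb x hx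
      have hyi : y ∈ N i := hi hxy
      have hxi : x ∈ N i := hi (Metric.mem_ball_self hδ)
      refine le_trans ?_ (le_self_add (α := ℝ≥0∞))
      refine le_trans ?_ (Finset.single_le_sum (f := fun i : t =>
        (N i).indicator (fun x => (N i).indicator (F x) y) x) (fun _ _ => zero_le)
        (Finset.mem_univ i))
      simp only [indicator_of_mem hxi, indicator_of_mem hyi, le_refl]
    · refine le_trans ?_ (le_add_self (α := ℝ≥0∞))
      have h1 : ‖u x - u y‖ₑ ^ 2 ≤ 2 * (‖u x‖ₑ ^ 2 + ‖u y‖ₑ ^ 2) := by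
        refine le_trans ?_ (add_sq_le_two_mul _ _)
        gcongr
        exact enorm_sub_le
      have h2 : (‖x - y‖ₑ ^ (m + 1))⁻¹ ≤ ε := by
        rw [hε]
        gcongr
        rw [← ofReal_norm]
        refine ENNReal.ofReal_le_ofReal ?_
        rw [← dist_eq_norm, dist_comm]
        exact not_lt.1 hxy
      calc F x y ≤ (2 * (‖u x‖ₑ ^ 2 + ‖u y‖ₑ ^ 2)) * ε := by
            simp only [hF]; gcongr
        _ = _ := by ring
  have hsum : ∀ᵐ x ∂surf Γ, ∀ᵐ y ∂surf Γ, F x y ≤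
      ∑ i : t, (N i).indicator (fun x => (N i).indicator (F x) y) x +
        2 * ε * (‖u x‖ₑ ^ 2 + ‖u y‖ₑ ^ 2) := by
    rw [hsurf]
    filter_upwards [ae_restrict_mem hΓm] with x hx
    filter_upwards [ae_restrict_mem hΓm] with y hy
    exact hsplit x hx y hy
  have hind : ∀ i : t, Measurable fun p : Space (m + 1) × Space (m + 1) =>
      (N i).indicator (fun x => (N i).indicator (F x) p.2) p.1 := by
    intro i
    have : (fun p : Space (m + 1) × Space (m + 1) =>
        (N i).indicator (fun x => (N i).indicator (F x) p.2) p.1) =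
        (N i ×ˢ N i).indicator fun p => F p.1 p.2 := by
      ext ⟨x, y⟩
      by_cases hx : x ∈ N i <;> by_cases hy : y ∈ N i <;> simp [hx, hy]
    rw [this]
    exact hFm.indicator ((hN i).measurableSet.prod (hN i).measurableSet)
  have husq : Measurable fun x => ‖u x‖ₑ ^ 2 := hum.enorm.pow_const 2
  have hpatch : ∀ i : t, ∫⁻ x, ∫⁻ y, (N i).indicator (fun x => (N i).indicator (F x) y) x
      ∂surf Γ ∂surf Γ ≤ C i * E := by
    intro i
    have h1 := (htr i u g hum hg hug).2
    rw [hEu] at h1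
    refine le_trans (le_of_eq ?_) h1
    have hNm := (hN i).measurableSet
    have e1 : ∀ x, ∫⁻ y, (N i).indicator (fun x => (N i).indicator (F x) y) x ∂surf Γ =
        (N i).indicator (fun x => ∫⁻ y in Γ ∩ N i, F x y ∂μHE[m]) x := by
      intro x
      by_cases hx : x ∈ N i
      · simp only [indicator_of_mem hx]
        rw [lintegral_indicator hNm, hsurf, Measure.restrict_restrict hNm, inter_comm]
      · simp only [indicator_of_notMem hx, lintegral_zero]
    simp_rw [e1]
    rw [lintegral_indicator hNm, hsurf, Measure.restrict_restrict hNm, inter_comm]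
  have hG : ∫⁻ x, ∫⁻ y, F x y ∂surf Γ ∂surf Γ ≤ S * E + 4 * ε * A * (S * E) := by
    calc ∫⁻ x, ∫⁻ y, F x y ∂surf Γ ∂surf Γ
        ≤ ∫⁻ x, ∫⁻ y, (∑ i : t, (N i).indicator (fun x => (N i).indicator (F x) y) x +
            2 * ε * (‖u x‖ₑ ^ 2 + ‖u y‖ₑ ^ 2)) ∂surf Γ ∂surf Γ := by
          refine lintegral_mono_ae ?_
          filter_upwards [hsum] with x hx
          exact lintegral_mono_ae hx
      _ = ∫⁻ x, (∑ i : t, ∫⁻ y, (N i).indicator (fun x => (N i).indicator (F x) y) x ∂surf Γ +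
            2 * ε * (‖u x‖ₑ ^ 2 * A + ∫⁻ y, ‖u y‖ₑ ^ 2 ∂surf Γ)) ∂surf Γ := by
          congr 1 with x
          have hix : ∀ i ∈ (Finset.univ : Finset t), Measurable fun y =>
              (N i).indicator (fun x => (N i).indicator (F x) y) x :=
            fun i _ => (hind i).comp measurable_prodMk_left
          rw [lintegral_add_left (Finset.measurable_fun_sum _ hix),
            lintegral_finsetSum _ hix,
            lintegral_const_mul _ (husq.const_add _), lintegral_add_left measurable_const,
            lintegral_const]
      _ = ∑ i : t, ∫⁻ x, ∫⁻ y, (N i).indicator (fun x => (N i).indicator (F x) y) x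
            ∂surf Γ ∂surf Γ + 2 * ε * ((∫⁻ y, ‖u y‖ₑ ^ 2 ∂surf Γ) * A +
              (∫⁻ y, ‖u y‖ₑ ^ 2 ∂surf Γ) * A) := by
          have hix : ∀ i ∈ (Finset.univ : Finset t), Measurable fun x => ∫⁻ y,
              (N i).indicator (fun x => (N i).indicator (F x) y) x ∂surf Γ :=
            fun i _ => (hind i).lintegral_prod_right'
          rw [lintegral_add_left (Finset.measurable_fun_sum _ hix),
            lintegral_finsetSum _ hix, lintegral_const_mul _ ((husq.mul_const _).add_const _),
            lintegral_add_left (husq.mul_const _), lintegral_const, lintegral_mul_const _ husq]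
      _ ≤ ∑ i : t, C i * E + 2 * ε * ((S * E) * A + (S * E) * A) := by
          gcongr with i
          exact hpatch i
      _ = _ := by
          rw [hS, Finset.sum_mul]
          ring
  calc _ ≤ S * E + (S * E + 4 * ε * A * (S * E)) := add_le_add hL2 hG
    _ = Cf * E := by rw [hCf]; ring

/-! ### Upper gradients of piecewise Lipschitz functions -/

/-- A function on an interval that is `M`-Lipschitz on each member of a finite closed cover is
`M`-Lipschitz: each member is left at its last point and never needed again. -/
theorem dist_le_of_finite_closed_cover {ι : Type*} {f : ℝ → ℝ} {M : ℝ} {C : ι → Set ℝ}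
    (hC : ∀ i, IsClosed (C i)) (hf : ∀ i, ∀ x ∈ C i, ∀ y ∈ C i, |f x - f y| ≤ M * |x - y|)
    (t : Finset ι) : ∀ a b : ℝ, a ≤ b → Icc a b ⊆ ⋃ i ∈ t, C i → |f b - f a| ≤ M * (b - a) := by
  classical
  induction t using Finset.strongInduction with
  | H t ih =>
    intro a b hab hcov
    obtain ⟨i, hi, hai⟩ := mem_iUnion₂.1 (hcov ⟨le_rfl, hab⟩)
    have hcomp : IsCompact (C i ∩ Icc a b) := isCompact_Icc.inter_left (hC i)
    -- the last point of the interval that lies in the member containing `a`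
    set s := sSup (C i ∩ Icc a b) with hs
    have hsm : s ∈ C i ∩ Icc a b := hcomp.sSup_mem ⟨a, hai, le_rfl, hab⟩
    have h1 : |f s - f a| ≤ M * (s - a) := by
      have := hf i s hsm.1 a hai
      rwa [abs_of_nonneg (sub_nonneg.2 hsm.2.1)] at this
    rcases hsm.2.2.eq_or_lt with hsb | hsb
    · rwa [hsb] at h1
    · have hsub : Ioc s b ⊆ ⋃ j ∈ t.erase i, C j := by
        intro x hx
        have hxab : x ∈ Icc a b := ⟨hsm.2.1.trans hx.1.le, hx.2⟩
        obtain ⟨j, hj, hxj⟩ := mem_iUnion₂.1 (hcov hxab)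
        refine mem_iUnion₂.2 ⟨j, Finset.mem_erase.2 ⟨?_, hj⟩, hxj⟩
        rintro rfl
        exact absurd (le_csSup hcomp.bddAbove ⟨hxj, hxab⟩) (not_le.2 hx.1)
      have hclosed : IsClosed (⋃ j ∈ t.erase i, C j) :=
        isClosed_biUnion_finset fun j _ => hC j
      have hsub' : Icc s b ⊆ ⋃ j ∈ t.erase i, C j := by
        rw [← closure_Ioc hsb.ne]
        exact closure_minimal hsub hclosed
      have h2 := ih _ (Finset.erase_ssubset hi) s b hsb.le hsub'
      calc |f b - f a| ≤ |f b - f s| + |f s - f a| := abs_sub_le _ _ _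
        _ ≤ M * (b - s) + M * (s - a) := add_le_add h2 h1
        _ = _ := by ring

/-- The increment of a Lipschitz function is bounded by the integral of its derivative. -/
theorem enorm_sub_le_lintegral_deriv {f : ℝ → ℝ} {M : ℝ≥0} (hf : LipschitzOnWith M f (Icc 0 1)) :
    ‖f 1 - f 0‖ₑ ≤ ∫⁻ s in Ioc (0 : ℝ) 1, ‖deriv f s‖ₑ := by
  have hac : AbsolutelyContinuousOnInterval f 0 1 :=
    LipschitzOnWith.absolutelyContinuousOnInterval (K := M) (by rwa [uIcc_of_le zero_le_one])
  rw [← hac.integral_deriv_eq_sub, intervalIntegral.integral_of_le zero_le_one]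
  exact enorm_integral_le_lintegral_enorm _

/-- The chain rule inequality: the derivative of a function that coincides near `s` with `ζ ∘ x`,
`x` being Lipschitz at `s`. -/
theorem norm_deriv_le_of_comp {E : Type*} [NormedAddCommGroup E] [NormedSpace ℝ E] {f : ℝ → ℝ}
    {ζ : E → ℝ} {x : ℝ → E} {s : ℝ} {K : ℝ≥0} (hζ : DifferentiableAt ℝ ζ (x s))
    (hx : ∀ᶠ r in 𝓝 s, ‖x r - x s‖ ≤ K * ‖r - s‖) (hf : ∀ᶠ r in 𝓝 s, f r = ζ (x r)) :
    ‖deriv f s‖ ≤ ‖fderiv ℝ ζ (x s)‖ * K := by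
  -- `deriv` is `0` where `f` is not differentiable, and there is nothing to prove
  by_cases hd : DifferentiableAt ℝ f s
  swap
  · rw [deriv_zero_of_not_differentiableAt hd, norm_zero]; positivity
  refine le_of_forall_pos_le_add fun ε hε => ?_
  have hcont : Tendsto x (𝓝 s) (𝓝 (x s)) := by
    rw [tendsto_iff_norm_sub_tendsto_zero]
    refine squeeze_zero' (Eventually.of_forall fun _ => norm_nonneg _) hx ?_
    have : Continuous fun r : ℝ => (K : ℝ) * ‖r - s‖ := by fun_prop
    simpa using this.tendsto s
  have ho := hζ.hasFDerivAt.isLittleO.def (c := ε / (K + 1)) (by positivity)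
  have hK1 : ε / (K + 1) * K ≤ ε := by
    rw [div_mul_eq_mul_div, div_le_iff₀ (by positivity)]
    nlinarith [K.coe_nonneg]
  have hev : ∀ᶠ r in 𝓝 s, ‖f r - f s‖ ≤ (‖fderiv ℝ ζ (x s)‖ * K + ε) * ‖r - s‖ := by
    filter_upwards [hcont.eventually ho, hx, hf] with r h1 h2 h3
    rw [h3, hf.self_of_nhds]
    calc ‖ζ (x r) - ζ (x s)‖
        ≤ ‖ζ (x r) - ζ (x s) - fderiv ℝ ζ (x s) (x r - x s)‖ + ‖fderiv ℝ ζ (x s) (x r - x s)‖ := by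
          have := norm_add_le (ζ (x r) - ζ (x s) - fderiv ℝ ζ (x s) (x r - x s))
            (fderiv ℝ ζ (x s) (x r - x s))
          rwa [sub_add_cancel] at this
      _ ≤ ε / (K + 1) * ‖x r - x s‖ + ‖fderiv ℝ ζ (x s)‖ * ‖x r - x s‖ :=
          add_le_add h1 (ContinuousLinearMap.le_opNorm _ _)
      _ = (ε / (K + 1) + ‖fderiv ℝ ζ (x s)‖) * ‖x r - x s‖ := by ring
      _ ≤ (ε / (K + 1) + ‖fderiv ℝ ζ (x s)‖) * (K * ‖r - s‖) := by gcongr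
      _ = (ε / (K + 1) * K + ‖fderiv ℝ ζ (x s)‖ * K) * ‖r - s‖ := by ring
      _ ≤ (‖fderiv ℝ ζ (x s)‖ * K + ε) * ‖r - s‖ := by
          gcongr ?_ * _
          linarith
  have := HasFDerivAt.le_of_lip' hd.hasDerivAt.hasFDerivAt (by positivity) hev
  simpa using this

/-- Let a set `X` be the union of finitely many bi-Lipschitz images `φ i '' P i`, overlapping only
outside the images of the open sets `O i ⊆ P i` of full measure, and let `u` be given on these
pieces by Lipschitz functions `ζ i`. Then `u` is continuous and has an upper gradient whose `L²`
norm is controlled by the derivatives of the `ζ i`. -/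
theorem exists_upperGradient_of_pieces {d : ℕ} {ι : Type*} [Fintype ι] {X : Set (Space d)}
    {P O : ι → Set (Space d)} {φ : ι → Space d → Space d} {ζ : ι → Space d → ℝ} {u : Space d → ℝ}
    {L : ℝ≥0} (hP : ∀ i, IsCompact (P i)) (hOP : ∀ i, O i ⊆ P i) (hO : ∀ i, IsOpen (O i))
    (hnull : ∀ i, volume (P i \ O i) = 0) (hφ : ∀ i, LipschitzOnWith L (φ i) (P i))
    (hφ' : ∀ i, ∀ x ∈ P i, ∀ y ∈ P i, edist x y ≤ L * edist (φ i x) (φ i y))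
    (hcov : ⋃ i, φ i '' P i = X)
    (hdisj : ∀ i, ∀ x ∈ O i, ∀ j, ∀ y ∈ P j, φ j y = φ i x → j = i)
    (hζ : ∀ i, ∃ M : ℝ≥0, LipschitzOnWith M (ζ i) (P i))
    (hζ' : ∀ i, ∀ x ∈ O i, DifferentiableAt ℝ (ζ i) x)
    (hu : ∀ i, ∀ x ∈ P i, u (φ i x) = ζ i x) :
    ContinuousOn u X ∧ (∫⁻ z in X, ‖u z‖ₑ ^ 2 ≤ L ^ d * ∑ i, ∫⁻ x in P i, ‖ζ i x‖ₑ ^ 2) ∧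
    ∃ g : Space d → ℝ≥0∞, Measurable g ∧ IsUpperGradientOn u g X ∧
      ∫⁻ z in X, g z ^ 2 ≤ L ^ d * (L ^ 2 * ∑ i, ∫⁻ x in P i, ‖fderiv ℝ (ζ i) x‖ₑ ^ 2) := by
  classical
  have hinj : ∀ i, InjOn (φ i) (P i) := by
    intro i x hx y hy hxy
    have := hφ' i x hx y hy
    rw [hxy, edist_self, mul_zero] at this
    exact edist_eq_zero.1 (le_antisymm this zero_le)
  let inv : ι → Space d → Space d := fun i => Function.invFunOn (φ i) (P i)
  have hinv : ∀ i, ∀ x ∈ P i, inv i (φ i x) = x := fun i x hx => (hinj i).leftInvOn_invFunOn hx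
  have hinvL : ∀ i, LipschitzOnWith L (inv i) (φ i '' P i) := by
    rintro i _ ⟨x, hx, rfl⟩ _ ⟨y, hy, rfl⟩
    rw [hinv i x hx, hinv i y hy]
    exact hφ' i x hx y hy
  have hPc : ∀ i, IsCompact (φ i '' P i) := fun i =>
    (hP i).image_of_continuousOn (hφ i).continuousOn
  have hu' : ∀ i, EqOn u (fun z => ζ i (inv i z)) (φ i '' P i) := by
    rintro i _ ⟨x, hx, rfl⟩
    simp only [hinv i x hx, hu i x hx]
  choose M hM using hζ
  have huL : ∀ i, LipschitzOnWith (M i * L) u (φ i '' P i) := by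
    intro i x hx y hy
    rw [hu' i hx, hu' i hy]
    refine (hM i).comp (hinvL i) ?_ hx hy
    rintro _ ⟨x, hx, rfl⟩
    rw [hinv i x hx]
    exact hx
  have hφO : ∀ i, MeasurableSet (φ i '' O i) := fun i =>
    (hO i).measurableSet.image_of_continuousOn_injOn ((hφ i).continuousOn.mono (hOP i))
      ((hinj i).mono (hOP i))
  have hPm : ∀ i, MeasurableSet (P i) := fun i => (hP i).measurableSet
  refine ⟨?_, ?_, ?_⟩
  · rw [← hcov]
    exact (locallyFinite_of_finite _).continuousOn_iUnion (fun i => (hPc i).isClosed)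
      fun i => (huL i).continuousOn
  · rw [← hcov, Finset.mul_sum]
    refine (lintegral_iUnion_le _ _).trans ?_
    rw [tsum_fintype]
    refine Finset.sum_le_sum fun i _ => ?_
    refine (volume_setLIntegral_image_le (hPm i) (hφ i) _).trans (le_of_eq ?_)
    congr 1
    exact setLIntegral_congr_fun (hPm i) fun x hx => by simp only [hu i x hx]
  -- On the open part of the piece `i` the upper gradient is that of `ζ i ∘ (φ i)⁻¹`; on the
  -- remaining null set it is `⊤`, so that nothing has to be known about a path while it stays
  -- there.
  let gi : ι → Space d → ℝ≥0∞ := fun i =>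
    (φ i '' O i).indicator fun z => L * ‖fderiv ℝ (ζ i) (inv i z)‖ₑ
  set W : Set (Space d) := ⋃ i, φ i '' O i with hW
  have hWm : MeasurableSet W := MeasurableSet.iUnion hφO
  let g : Space d → ℝ≥0∞ := fun z => ∑ i, gi i z + Wᶜ.indicator (fun _ => ⊤) z
  have hgim : ∀ i, Measurable (gi i) := by
    intro i
    have h1 : Measurable ((φ i '' O i).piecewise (inv i) fun _ => 0) :=
      ((hinvL i).continuousOn.mono (image_mono (hOP i))).measurable_piecewise
        continuous_const.continuousOn (hφO i)
    have h2 : Measurable fun z => (L : ℝ≥0∞) * ‖fderiv ℝ (ζ i)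
        ((φ i '' O i).piecewise (inv i) (fun _ => 0) z)‖ₑ :=
      (((measurable_fderiv ℝ (ζ i)).comp h1).enorm).const_mul _
    have h3 : gi i = (φ i '' O i).indicator fun z => (L : ℝ≥0∞) * ‖fderiv ℝ (ζ i)
        ((φ i '' O i).piecewise (inv i) (fun _ => 0) z)‖ₑ := by
      ext z
      by_cases hz : z ∈ φ i '' O i
      · simp only [gi, indicator_of_mem hz, piecewise_eq_of_mem _ _ _ hz]
      · simp only [gi, indicator_of_notMem hz]
    rw [h3]
    exact h2.indicator (hφO i)
  have hgO : ∀ i, ∀ x ∈ O i, g (φ i x) = L * ‖fderiv ℝ (ζ i) x‖ₑ := by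
    intro i x hx
    have hxm := mem_image_of_mem (φ i) hx
    have h1 : φ i x ∉ Wᶜ := fun h => h (mem_iUnion.2 ⟨i, hxm⟩)
    simp only [g, indicator_of_notMem h1, add_zero]
    rw [Finset.sum_eq_single i]
    · simp only [gi, indicator_of_mem hxm, hinv i x (hOP i hx)]
    · intro j _ hji
      refine indicator_of_notMem ?_ _
      rintro ⟨y, hy, hyx⟩
      exact hji (hdisj i x hx j y (hOP j hy) hyx)
    · simp
  refine ⟨g, ?_, ?_, ?_⟩
  · exact (Finset.measurable_fun_sum _ fun i _ => hgim i).add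
      (measurable_const.indicator hWm.compl)
  · intro c L' hc hcX
    -- a constant path is treated apart, since `0 * ⊤ = 0`
    rcases eq_or_ne L' 0 with rfl | hL'
    · have := hc (⟨zero_le_one, le_rfl⟩ : (1 : ℝ) ∈ Icc (0 : ℝ) 1)
        (⟨le_rfl, zero_le_one⟩ : (0 : ℝ) ∈ Icc (0 : ℝ) 1)
      rw [ENNReal.coe_zero, zero_mul] at this
      have h0 : c 1 = c 0 := edist_eq_zero.1 (le_antisymm this zero_le)
      simp [h0]
    -- `u ∘ c` is Lipschitz on each of the finitely many closed sets of times at which the path is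
    -- in a given piece, hence on the whole interval
    let C : ι → Set ℝ := fun i => Icc 0 1 ∩ c ⁻¹' (φ i '' P i)
    have hC : ∀ i, IsClosed (C i) := fun i =>
      hc.continuousOn.preimage_isClosed_of_isClosed isClosed_Icc (hPc i).isClosed
    set Mf : ℝ≥0 := ∑ i, M i * L * L' with hMf
    have hfC : ∀ i, ∀ x ∈ C i, ∀ y ∈ C i, |u (c x) - u (c y)| ≤ (Mf : ℝ) * |x - y| := by
      intro i x hx y hy
      have h1 : LipschitzOnWith (M i * L * L') (fun s => u (c s)) (C i) :=
        (huL i).comp (hc.mono inter_subset_left) fun s hs => hs.2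
      have h2 := (h1.weaken (Finset.single_le_sum (f := fun i => M i * L * L')
        (fun _ _ => zero_le) (Finset.mem_univ i))).dist_le_mul x hx y hy
      simpa only [Real.dist_eq] using h2
    have hcovC : ∀ a b : ℝ, 0 ≤ a → b ≤ 1 → Icc a b ⊆ ⋃ i ∈ (Finset.univ : Finset ι), C i := by
      intro a b ha hb s hs
      have hs' : s ∈ Icc (0 : ℝ) 1 := ⟨ha.trans hs.1, hs.2.trans hb⟩
      have := hcX hs'
      rw [← hcov] at this
      obtain ⟨i, hi⟩ := mem_iUnion.1 this
      exact mem_iUnion₂.2 ⟨i, Finset.mem_univ _, hs', hi⟩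
    have hfL : LipschitzOnWith Mf (fun s => u (c s)) (Icc 0 1) := by
      refine LipschitzOnWith.of_dist_le_mul fun x hx y hy => ?_
      rcases le_total x y with hxy | hxy
      · have := dist_le_of_finite_closed_cover hC hfC Finset.univ x y hxy (hcovC x y hx.1 hy.2)
        rw [dist_comm, dist_comm x y, Real.dist_eq, Real.dist_eq, abs_of_nonneg (sub_nonneg.2 hxy)]
        exact this
      · have := dist_le_of_finite_closed_cover hC hfC Finset.univ y x hxy (hcovC y x hy.1 hx.2)
        rw [Real.dist_eq, Real.dist_eq, abs_of_nonneg (sub_nonneg.2 hxy)]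
        exact this
    refine (enorm_sub_le_lintegral_deriv hfL).trans ?_
    rw [← lintegral_const_mul' _ _ ENNReal.coe_ne_top, ← restrict_Ioo_eq_restrict_Ioc]
    refine setLIntegral_mono' measurableSet_Ioo fun s hs => ?_
    have hsI : Icc (0 : ℝ) 1 ∈ 𝓝 s := Icc_mem_nhds hs.1 hs.2
    have hs01 : s ∈ Icc (0 : ℝ) 1 := Ioo_subset_Icc_self hs
    by_cases hW' : c s ∈ W
    swap
    · have : g (c s) = ⊤ := by
        have : c s ∈ Wᶜ := hW'
        simp only [g, indicator_of_mem this, add_top]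
      rw [this, ENNReal.mul_top (by simpa using hL')]
      exact le_top
    obtain ⟨i, x₀, hx₀, hcx⟩ := mem_iUnion.1 hW'
    -- near `s` the path stays in the piece with index `i`
    have hnear : ∀ᶠ r in 𝓝 s, c r ∈ φ i '' P i := by
      have h1 : ∀ j, ∀ᶠ r in 𝓝 s, j ≠ i → c r ∉ φ j '' P j := by
        intro j
        by_cases hji : j = i
        · exact Eventually.of_forall fun r h => absurd hji h
        · have h2 : c s ∈ (φ j '' P j)ᶜ := by
            rintro ⟨y, hy, hyx⟩
            exact hji (hdisj i x₀ hx₀ j y hy (hyx.trans hcx.symm))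
          have h3 := (hc.continuousOn.continuousAt hsI).eventually
            ((hPc j).isClosed.isOpen_compl.mem_nhds h2)
          filter_upwards [h3] with r hr _ using hr
      filter_upwards [eventually_all.2 h1, hsI] with r hr hrI
      have := hcX hrI
      rw [← hcov] at this
      obtain ⟨j, hj⟩ := mem_iUnion.1 this
      by_cases hji : j = i
      · rwa [← hji]
      · exact absurd hj (hr j hji)
    have hxs : inv i (c s) = x₀ := by rw [← hcx, hinv i x₀ (hOP i hx₀)]
    have hder := norm_deriv_le_of_comp (f := fun s => u (c s)) (ζ := ζ i)
      (x := fun r => inv i (c r)) (s := s) (K := L * L') (by rw [hxs]; exact hζ' i x₀ hx₀) (by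
        filter_upwards [hnear, hsI] with r hr hrI
        have h1 := (hinvL i).dist_le_mul _ hr _ hnear.self_of_nhds
        have h2 := hc.dist_le_mul r hrI s hs01
        rw [dist_eq_norm] at h1 h2
        refine h1.trans ?_
        rw [NNReal.coe_mul, mul_assoc]
        gcongr
        rwa [dist_eq_norm] at h2 ⊢) (by
        filter_upwards [hnear] with r hr using hu' i hr)
    rw [hxs] at hder
    rw [← hcx, hgO i x₀ hx₀, ← ofReal_norm]
    refine (ENNReal.ofReal_le_ofReal hder).trans (le_of_eq ?_)
    rw [ENNReal.ofReal_mul (norm_nonneg _), ofReal_norm, ENNReal.ofReal_coe_nnreal,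
      ENNReal.coe_mul]
    ring
  -- the images of the `P i \ O i`, where `g` may be `⊤`, are null sets
  · have hsplit : X ⊆ (⋃ i, φ i '' O i) ∪ ⋃ i, φ i '' (P i \ O i) := by
      rw [← hcov]
      rintro z hz
      obtain ⟨i, x, hx, rfl⟩ := mem_iUnion.1 hz
      by_cases hxO : x ∈ O i
      · exact Or.inl (mem_iUnion.2 ⟨i, x, hxO, rfl⟩)
      · exact Or.inr (mem_iUnion.2 ⟨i, x, ⟨hx, hxO⟩, rfl⟩)
    have h0 : ∫⁻ z in ⋃ i, φ i '' (P i \ O i), g z ^ 2 = 0 := by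
      refine le_antisymm ((lintegral_iUnion_le _ _).trans ?_) zero_le
      rw [tsum_fintype]
      refine (Finset.sum_eq_zero fun i _ => ?_).le
      refine le_antisymm ((volume_setLIntegral_image_le ((hPm i).diff (hO i).measurableSet)
        ((hφ i).mono sdiff_subset) _).trans ?_) zero_le
      rw [setLIntegral_measure_zero _ _ (hnull i), mul_zero]
    refine (lintegral_mono_set hsplit).trans ((lintegral_union_le _ _ _).trans ?_)
    rw [h0, add_zero, ← mul_assoc, Finset.mul_sum]
    refine (lintegral_iUnion_le _ _).trans ?_
    rw [tsum_fintype]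
    refine Finset.sum_le_sum fun i _ => ?_
    refine (volume_setLIntegral_image_le (hO i).measurableSet ((hφ i).mono (hOP i)) _).trans ?_
    rw [mul_assoc]
    gcongr
    calc ∫⁻ x in O i, g (φ i x) ^ 2 = ∫⁻ x in O i, (L : ℝ≥0∞) ^ 2 * ‖fderiv ℝ (ζ i) x‖ₑ ^ 2 :=
          setLIntegral_congr_fun (hO i).measurableSet fun x hx => by
            simp only [hgO i x hx, mul_pow]
      _ = (L : ℝ≥0∞) ^ 2 * ∫⁻ x in O i, ‖fderiv ℝ (ζ i) x‖ₑ ^ 2 :=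
          lintegral_const_mul' _ _ (by finiteness)
      _ ≤ _ := by
          gcongr
          exact hOP i

/-! ### The flow of the velocity field -/

namespace Geometry.IsAdmissible

variable {d k : ℕ} {D : Geometry d} {T : ℝ}

theorem closure_inner (hD : D.IsAdmissible k T) {t : ℝ} (ht : t ∈ Icc 0 T) :
    closure (D.Om 0 t) = D.Om 0 t ∪ D.Γ t := by
  rw [closure_eq_self_union_frontier, hD.inner_frontier t ht]

theorem om_subset (hD : D.IsAdmissible k T) {t : ℝ} (ht : t ∈ Icc 0 T) (i : Fin 2) :
    D.Om i t ⊆ D.Ω := by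
  fin_cases i
  · exact hD.inner_subset t ht
  · change D.Om 1 t ⊆ D.Ω
    rw [hD.outer_eq t ht]
    exact sdiff_subset

theorem closure_om_subset (hD : D.IsAdmissible k T) {t : ℝ} (ht : t ∈ Icc 0 T) (i : Fin 2) :
    closure (D.Om i t) ⊆ closure D.Ω := closure_mono (hD.om_subset ht i)

theorem isCompact_closure (hD : D.IsAdmissible k T) : IsCompact (closure D.Ω) :=
  hD.bounded.isCompact_closure

theorem isCompact_closure_om (hD : D.IsAdmissible k T) {t : ℝ} (ht : t ∈ Icc 0 T) (i : Fin 2) :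
    IsCompact (closure (D.Om i t)) :=
  hD.isCompact_closure.of_isClosed_subset isClosed_closure (hD.closure_om_subset ht i)

theorem om_isOpen (hD : D.IsAdmissible k T) {t : ℝ} (ht : t ∈ Icc 0 T) (i : Fin 2) :
    IsOpen (D.Om i t) := by
  fin_cases i
  · exact hD.inner_isOpen t ht
  · change IsOpen (D.Om 1 t)
    rw [hD.outer_eq t ht]
    exact hD.isOpen.sdiff isClosed_closure

theorem closure_outer_disjoint (hD : D.IsAdmissible k T) {t : ℝ} (ht : t ∈ Icc 0 T) :
    Disjoint (D.Om 0 t) (closure (D.Om 1 t)) := by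
  refine Disjoint.closure_right ?_ (hD.inner_isOpen t ht)
  rw [hD.outer_eq t ht]
  exact disjoint_sdiff_right.mono_left subset_closure

theorem mem_interface_of_mem_closure (hD : D.IsAdmissible k T) {t : ℝ} (ht : t ∈ Icc 0 T)
    {x : Space d} (h0 : x ∈ closure (D.Om 0 t)) (h1 : x ∈ closure (D.Om 1 t)) : x ∈ D.Γ t := by
  rw [hD.closure_inner ht] at h0
  rcases h0 with h0 | h0
  · exact absurd h1 (disjoint_left.1 (hD.closure_outer_disjoint ht) h0)
  · exact h0

theorem interface_subset_inner (hD : D.IsAdmissible k T) {t : ℝ} (ht : t ∈ Icc 0 T) :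
    D.Γ t ⊆ closure (D.Om 0 t) := by
  rw [hD.closure_inner ht]
  exact subset_union_right

/-- The interface lies in the closure of the outer subdomain as well: a boundary point is not a
local maximum of the defining function. -/
theorem interface_subset_outer (hD : D.IsAdmissible k T) {t : ℝ} (ht : t ∈ Icc 0 T) :
    D.Γ t ⊆ closure (D.Om 1 t) := by
  intro x hx
  by_contra hcon
  obtain ⟨U, ρ, hU, hxU, -, hρ', hΓU, hDU⟩ := hD.interface_smooth t ht x hx
  have hx0 : x ∈ {y ∈ U | ρ y = 0} := hΓU ▸ ⟨hx, hxU⟩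
  refine hρ' x hxU (IsLocalMax.fderiv_eq_zero ?_)
  filter_upwards [isClosed_closure.isOpen_compl.mem_nhds hcon, hU.mem_nhds hxU,
    hD.isOpen.mem_nhds (hD.interface_subset t ht hx)] with y hy1 hyU hyΩ
  rw [hx0.2]
  have hy2 : y ∉ D.Om 1 t := fun h => hy1 (subset_closure h)
  rw [hD.outer_eq t ht] at hy2
  have hy3 : y ∈ closure (D.Om 0 t) := by
    by_contra h
    exact hy2 ⟨hyΩ, h⟩
  rw [hD.closure_inner ht] at hy3
  rcases hy3 with h | h
  · have : y ∈ {y ∈ U | ρ y < 0} := hDU ▸ ⟨h, hyU⟩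
    exact this.2.le
  · have : y ∈ {y ∈ U | ρ y = 0} := hΓU ▸ ⟨h, hyU⟩
    exact this.2.le

theorem interface_subset_closure (hD : D.IsAdmissible k T) {t : ℝ} (ht : t ∈ Icc 0 T) (i : Fin 2) :
    D.Γ t ⊆ closure (D.Om i t) := by
  fin_cases i
  · exact hD.interface_subset_inner ht
  · exact hD.interface_subset_outer ht

theorem flow_mem (hD : D.IsAdmissible k T) {t : ℝ} (ht : t ∈ Icc 0 T) (i : Fin 2) {x : Space d}
    (hx : x ∈ closure (D.Om i 0)) : D.Φ i t x ∈ closure (D.Om i t) := by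
  rw [← hD.flow_closure i t ht]
  exact mem_image_of_mem _ hx

/-- The velocity is Lipschitz in space on each subdomain, uniformly in time. -/
theorem exists_velocity_lipschitz (hD : D.IsAdmissible k T) :
    ∃ L : ℝ≥0, ∀ i, ∀ t ∈ Icc 0 T, LipschitzOnWith L (D.w t) (closure (D.Om i t)) := by
  obtain ⟨R, hR⟩ := hD.isCompact_closure.isBounded.subset_closedBall (0 : Space d)
  have h : ∀ i, ∃ L : ℝ≥0, ∀ t ∈ Icc 0 T, LipschitzOnWith L (D.w t) (closure (D.Om i t)) := by
    intro i
    obtain ⟨g, hg, hw⟩ := hD.velocity_C1 i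
    obtain ⟨L, hL⟩ := hg.contDiffOn.exists_lipschitzOnWith (s := Icc 0 T ×ˢ Metric.closedBall 0 R)
      (by norm_num) ((convex_Icc 0 T).prod (convex_closedBall _ _))
      (isCompact_Icc.prod (isCompact_closedBall _ _))
    refine ⟨L, fun t ht x hx y hy => ?_⟩
    have h1 := hw (t, x) ⟨ht, hx⟩
    have h2 := hw (t, y) ⟨ht, hy⟩
    simp only at h1 h2
    rw [h1, h2]
    refine (hL ⟨ht, hR (hD.closure_om_subset ht i hx)⟩
      ⟨ht, hR (hD.closure_om_subset ht i hy)⟩).trans (le_of_eq ?_)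
    simp [Prod.edist_eq]
  choose L hL using h
  exact ⟨∑ i, L i, fun i t ht => (hL i t ht).weaken
    (Finset.single_le_sum (fun _ _ => zero_le) (Finset.mem_univ i))⟩

theorem flow_continuousOn_time (hD : D.IsAdmissible k T) (i : Fin 2) {x : Space d}
    (hx : x ∈ closure (D.Om i 0)) : ContinuousOn (fun s => D.Φ i s x) (Icc 0 T) :=
  fun t ht => (hD.flow_deriv i x hx t ht).continuousWithinAt

/-- The flow is bi-Lipschitz, uniformly in time, by Grönwall's inequality forwards and backwards in
time. -/
theorem exists_flow_biLipschitz (hD : D.IsAdmissible k T) :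
    ∃ K : ℝ≥0, 1 ≤ K ∧ ∀ i, ∀ t ∈ Icc 0 T, ∀ x ∈ closure (D.Om i 0), ∀ y ∈ closure (D.Om i 0),
      dist (D.Φ i t x) (D.Φ i t y) ≤ K * dist x y ∧
        dist x y ≤ K * dist (D.Φ i t x) (D.Φ i t y) := by
  obtain ⟨L, hL⟩ := hD.exists_velocity_lipschitz
  refine ⟨max 1 (Real.toNNReal (Real.exp (L * T))), le_max_left _ _, fun i t ht x hx y hy => ?_⟩
  have hK : Real.exp (L * T) ≤ (max 1 (Real.toNNReal (Real.exp (L * T))) : ℝ≥0) := by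
    rw [NNReal.coe_max]
    exact (Real.le_coe_toNNReal _).trans (le_max_right _ _)
  have hexp : Real.exp (L * (t - 0)) ≤ (max 1 (Real.toNNReal (Real.exp (L * T))) : ℝ≥0) := by
    refine le_trans ?_ hK
    rw [Real.exp_le_exp, sub_zero]
    exact mul_le_mul_of_nonneg_left ht.2 L.coe_nonneg
  have hsub : Icc 0 t ⊆ Icc 0 T := Icc_subset_Icc_right ht.2
  have hder : ∀ z ∈ closure (D.Om i 0), ∀ s ∈ Ico 0 T,
      HasDerivWithinAt (fun s => D.Φ i s z) (D.w s (D.Φ i s z)) (Ici s) s := by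
    intro z hz s hs
    refine (hD.flow_deriv i z hz s (Ico_subset_Icc_self hs)).mono_of_mem_nhdsWithin ?_
    exact mem_of_superset (Ico_mem_nhdsGE hs.2)
      fun r hr => ⟨hs.1.trans hr.1, hr.2.le⟩
  constructor
  · have h := dist_le_of_trajectories_ODE_of_mem (v := D.w) (s := fun s => closure (D.Om i s))
      (K := L) (a := 0) (b := t) (δ := dist x y) (f := fun s => D.Φ i s x)
      (g := fun s => D.Φ i s y)
      (fun s hs => hL i s (hsub (Ico_subset_Icc_self hs)))
      ((hD.flow_continuousOn_time i hx).mono hsub)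
      (fun s hs => hder x hx s ⟨hs.1, hs.2.trans_le ht.2⟩)
      (fun s hs => hD.flow_mem (hsub (Ico_subset_Icc_self hs)) i hx)
      ((hD.flow_continuousOn_time i hy).mono hsub)
      (fun s hs => hder y hy s ⟨hs.1, hs.2.trans_le ht.2⟩)
      (fun s hs => hD.flow_mem (hsub (Ico_subset_Icc_self hs)) i hy)
      (by simp only [hD.flow_zero i x hx, hD.flow_zero i y hy, le_refl]) t ⟨ht.1, le_rfl⟩
    refine h.trans ?_
    rw [mul_comm]
    gcongr
  · -- the same inequality for the reversed trajectories
    have hrev : ∀ s ∈ Icc 0 t, t - s ∈ Icc 0 T := fun s hs =>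
      ⟨sub_nonneg.2 hs.2, (sub_le_self t hs.1).trans ht.2⟩
    have hcont : ∀ z ∈ closure (D.Om i 0), ContinuousOn (fun s => D.Φ i (t - s) z) (Icc 0 t) :=
      fun z hz => (hD.flow_continuousOn_time i hz).comp
        (continuousOn_const.sub continuousOn_id) hrev
    have hder' : ∀ z ∈ closure (D.Om i 0), ∀ s ∈ Ico 0 t,
        HasDerivWithinAt (fun s => D.Φ i (t - s) z) (-D.w (t - s) (D.Φ i (t - s) z)) (Ici s) s := by
      intro z hz s hs
      have h1 := hD.flow_deriv i z hz (t - s) (hrev s (Ico_subset_Icc_self hs))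
      have h2 : HasDerivWithinAt (fun s => t - s) (-1) (Icc s t) s := by
        simpa using (hasDerivWithinAt_id s (Icc s t)).const_sub t
      have h3 := h1.scomp s h2 (fun r hr => hrev r ⟨hs.1.trans hr.1, hr.2⟩)
      have h4 : HasDerivWithinAt (fun s => D.Φ i (t - s) z)
          (-D.w (t - s) (D.Φ i (t - s) z)) (Icc s t) s := by
        simpa [Function.comp_def] using h3
      exact h4.mono_of_mem_nhdsWithin (Icc_mem_nhdsGE hs.2)
    have h := dist_le_of_trajectories_ODE_of_mem (v := fun s z => -D.w (t - s) z)
      (s := fun s => closure (D.Om i (t - s)))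
      (K := L) (a := 0) (b := t) (δ := dist (D.Φ i t x) (D.Φ i t y))
      (f := fun s => D.Φ i (t - s) x) (g := fun s => D.Φ i (t - s) y)
      (fun s hs => by
        have := hL i (t - s) (hrev s (Ico_subset_Icc_self hs))
        intro a ha b hb
        simpa [edist_neg_neg] using this ha hb)
      (hcont x hx) (hder' x hx)
      (fun s hs => hD.flow_mem (hrev s (Ico_subset_Icc_self hs)) i hx)
      (hcont y hy) (hder' y hy)
      (fun s hs => hD.flow_mem (hrev s (Ico_subset_Icc_self hs)) i hy)
      (by simp only [sub_zero, le_refl]) t ⟨ht.1, le_rfl⟩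
    simp only [sub_self, hD.flow_zero i x hx, hD.flow_zero i y hy] at h
    refine h.trans ?_
    rw [mul_comm]
    gcongr

/-- The flows of the two subdomains agree on the interface. -/
theorem flow_eq_of_mem_interface (hD : D.IsAdmissible k T) {t : ℝ} (ht : t ∈ Icc 0 T)
    {x : Space d} (hx : x ∈ D.Γ 0) : D.Φ 0 t x = D.Φ 1 t x := by
  have h0 : (0 : ℝ) ∈ Icc 0 T := ⟨le_rfl, ht.1.trans ht.2⟩
  obtain ⟨L, hL⟩ := hD.exists_velocity_lipschitz
  have hsub : Icc 0 t ⊆ Icc 0 T := Icc_subset_Icc_right ht.2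
  have hxc : ∀ i, x ∈ closure (D.Om i 0) := fun i => hD.interface_subset_closure h0 i hx
  have hder : ∀ i, ∀ s ∈ Ico 0 T,
      HasDerivWithinAt (fun s => D.Φ i s x) (D.w s (D.Φ i s x)) (Ici s) s := by
    intro i s hs
    refine (hD.flow_deriv i x (hxc i) s (Ico_subset_Icc_self hs)).mono_of_mem_nhdsWithin ?_
    exact mem_of_superset (Ico_mem_nhdsGE hs.2)
      fun r hr => ⟨hs.1.trans hr.1, hr.2.le⟩
  have hmem : ∀ i, ∀ s ∈ Icc 0 T, D.Φ i s x ∈ closure (D.Om 0 s) := fun i s hs => by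
    refine hD.interface_subset_inner hs ?_
    rw [← hD.flow_interface i s hs]
    exact mem_image_of_mem _ hx
  have h := dist_le_of_trajectories_ODE_of_mem (v := D.w) (s := fun s => closure (D.Om 0 s))
    (K := L) (a := 0) (b := t) (δ := 0) (f := fun s => D.Φ 0 s x)
    (g := fun s => D.Φ 1 s x)
    (fun s hs => hL 0 s (hsub (Ico_subset_Icc_self hs)))
    ((hD.flow_continuousOn_time 0 (hxc 0)).mono hsub)
    (fun s hs => hder 0 s ⟨hs.1, hs.2.trans_le ht.2⟩)
    (fun s hs => hmem 0 s (hsub (Ico_subset_Icc_self hs)))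
    ((hD.flow_continuousOn_time 1 (hxc 1)).mono hsub)
    (fun s hs => hder 1 s ⟨hs.1, hs.2.trans_le ht.2⟩)
    (fun s hs => hmem 1 s (hsub (Ico_subset_Icc_self hs)))
    (by simp only [hD.flow_zero 0 x (hxc 0), hD.flow_zero 1 x (hxc 1), dist_self, le_refl])
    t ⟨ht.1, le_rfl⟩
  rw [zero_mul] at h
  exact dist_le_zero.1 h

theorem flow_injOn (hD : D.IsAdmissible k T) {t : ℝ} (ht : t ∈ Icc 0 T) (i : Fin 2) :
    InjOn (D.Φ i t) (closure (D.Om i 0)) := by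
  obtain ⟨K, -, hK⟩ := hD.exists_flow_biLipschitz
  intro x hx y hy hxy
  have := (hK i t ht x hx y hy).2
  rw [hxy, dist_self, mul_zero] at this
  exact dist_le_zero.1 this

/-- The flow of the outer subdomain preserves the outer boundary. -/
theorem flow_mem_frontier_iff (hD : D.IsAdmissible k T) {t : ℝ} (ht : t ∈ Icc 0 T) {x : Space d}
    (hx : x ∈ closure (D.Om 1 0)) : D.Φ 1 t x ∈ frontier D.Ω ↔ x ∈ frontier D.Ω := by
  have h0 : (0 : ℝ) ∈ Icc 0 T := ⟨le_rfl, ht.1.trans ht.2⟩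
  have key : ∀ s ∈ Icc 0 T, ∀ y ∈ closure (D.Om 1 s),
      (y ∈ frontier D.Ω ↔ y ∉ D.Om 1 s ∧ y ∉ D.Γ s) := by
    intro s hs y hy
    have hyΩ := hD.closure_om_subset hs 1 hy
    rw [hD.isOpen.frontier_eq]
    constructor
    · rintro ⟨-, h⟩
      exact ⟨fun h' => h (hD.om_subset hs 1 h'), fun h' => h (hD.interface_subset s hs h')⟩
    · rintro ⟨h1, h2⟩
      refine ⟨hyΩ, fun h3 => ?_⟩
      rw [hD.outer_eq s hs] at h1
      have h4 : y ∈ closure (D.Om 0 s) := by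
        by_contra h
        exact h1 ⟨h3, h⟩
      exact h2 (hD.mem_interface_of_mem_closure hs h4 hy)
  have hinj := hD.flow_injOn ht 1
  have e1 : D.Φ 1 t x ∈ D.Om 1 t ↔ x ∈ D.Om 1 0 := by
    rw [← hD.flow_interior 1 t ht]
    exact hinj.mem_image_iff subset_closure hx
  have e2 : D.Φ 1 t x ∈ D.Γ t ↔ x ∈ D.Γ 0 := by
    rw [← hD.flow_interface 1 t ht]
    exact hinj.mem_image_iff (hD.interface_subset_outer h0) hx
  rw [key t ht _ (hD.flow_mem ht 1 hx), key 0 h0 x hx, e1, e2]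

theorem flow_continuousOn (hD : D.IsAdmissible k T) (i : Fin 2) :
    ContinuousOn (fun q : ℝ × Space d => D.Φ i q.1 q.2) (Icc 0 T ×ˢ closure (D.Om i 0)) := by
  obtain ⟨K, -, hK⟩ := hD.exists_flow_biLipschitz
  refine continuousOn_prod_of_continuousOn_lipschitzOnWith' _ K (fun t ht => ?_) fun x hx => ?_
  · exact LipschitzOnWith.of_dist_le_mul fun x hx y hy => (hK i t ht x hx y hy).1
  · exact hD.flow_continuousOn_time i hx

end Geometry.IsAdmissible

/-- The inverse `closure Ωᵢ(t) → closure Ωᵢ(0)` of the flow map. -/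
def Geometry.flowInv {d : ℕ} (D : Geometry d) (i : Fin 2) (t : ℝ) : Space d → Space d :=
  Function.invFunOn (D.Φ i t) (closure (D.Om i 0))

namespace Geometry.IsAdmissible

variable {d k : ℕ} {D : Geometry d} {T : ℝ}

theorem flowInv_flow (hD : D.IsAdmissible k T) {t : ℝ} (ht : t ∈ Icc 0 T) (i : Fin 2)
    {x : Space d} (hx : x ∈ closure (D.Om i 0)) : D.flowInv i t (D.Φ i t x) = x :=
  (hD.flow_injOn ht i).leftInvOn_invFunOn hx

theorem flowInv_mem (hD : D.IsAdmissible k T) {t : ℝ} (ht : t ∈ Icc 0 T) (i : Fin 2)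
    {z : Space d} (hz : z ∈ closure (D.Om i t)) : D.flowInv i t z ∈ closure (D.Om i 0) := by
  rw [← hD.flow_closure i t ht] at hz
  exact Function.invFunOn_mem hz

theorem flow_flowInv (hD : D.IsAdmissible k T) {t : ℝ} (ht : t ∈ Icc 0 T) (i : Fin 2)
    {z : Space d} (hz : z ∈ closure (D.Om i t)) : D.Φ i t (D.flowInv i t z) = z := by
  rw [← hD.flow_closure i t ht] at hz
  exact Function.invFunOn_eq hz

end Geometry.IsAdmissible

/-! ### Traces on the moving interface -/

theorem exists_measurable_eqOn {X Y : Type*} [TopologicalSpace X] [MeasurableSpace X]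
    [OpensMeasurableSpace X] [TopologicalSpace Y] [MeasurableSpace Y] [BorelSpace Y] [Zero Y]
    {f : X → Y} {s : Set X} (hf : ContinuousOn f s) (hs : MeasurableSet s) :
    ∃ g : X → Y, Measurable g ∧ EqOn g f s := by
  classical
  exact ⟨s.piecewise f fun _ => 0, hf.measurable_piecewise continuous_const.continuousOn hs,
    fun x hx => piecewise_eq_of_mem _ _ _ hx⟩

theorem lintegral_surf_image_le {d : ℕ} {f : Space d → Space d} {Γ : Set (Space d)}
    (hΓ : MeasurableSet Γ) {K : ℝ≥0} (hf : LipschitzOnWith K f Γ) (φ : Space d → ℝ≥0∞) :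
    ∫⁻ y, φ y ∂surf (f '' Γ) ≤ (K : ℝ≥0∞) ^ (d - 1) * ∫⁻ x, φ (f x) ∂surf Γ :=
  setLIntegral_image_le_of_lipschitzOnWith hΓ hf _ φ

/-- The `H^{1/2}` norm is stable under bi-Lipschitz changes of variables. -/
theorem normSqHHalf_image_le {d : ℕ} {f : Space d → Space d} {Γ : Set (Space d)}
    (hΓ : IsCompact Γ) [IsFiniteMeasure (surf Γ)] [IsFiniteMeasure (surf (f '' Γ))] {K : ℝ≥0}
    (hK : 1 ≤ K) (hf : LipschitzOnWith K f Γ)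
    (hf' : ∀ x ∈ Γ, ∀ y ∈ Γ, edist x y ≤ K * edist (f x) (f y)) {v : Space d → ℝ}
    (hv : ContinuousOn v (f '' Γ)) :
    normSqHHalf (f '' Γ) v ≤ (K : ℝ≥0∞) ^ (3 * d) * normSqHHalf Γ (fun x => v (f x)) := by
  have hK0 : (K : ℝ≥0∞) ≠ 0 := by
    simpa using (zero_lt_one.trans_le hK).ne'
  have hK1 : (1 : ℝ≥0∞) ≤ K := by exact_mod_cast hK
  have hfΓ : IsCompact (f '' Γ) := hΓ.image_of_continuousOn hf.continuousOn
  have hm1 : AEStronglyMeasurable v (surf (f '' Γ)) :=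
    hv.aestronglyMeasurable hfΓ.isClosed.measurableSet
  have hm2 : AEStronglyMeasurable (fun x => v (f x)) (surf Γ) :=
    (hv.comp hf.continuousOn (mapsTo_image f Γ)).aestronglyMeasurable hΓ.isClosed.measurableSet
  have hΓm := hΓ.isClosed.measurableSet
  rw [normSqHHalf_eq hm1, normSqHHalf_eq hm2, mul_add]
  refine add_le_add ?_ ?_
  · refine (lintegral_surf_image_le hΓm hf _).trans ?_
    gcongr
    omega
  · set I := ∫⁻ x, ∫⁻ y, ‖v (f x) - v (f y)‖ₑ ^ 2 * (‖x - y‖ₑ ^ d)⁻¹ ∂surf Γ ∂surf Γ with hI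
    calc ∫⁻ x, ∫⁻ y, ‖v x - v y‖ₑ ^ 2 * (‖x - y‖ₑ ^ d)⁻¹ ∂surf (f '' Γ) ∂surf (f '' Γ)
        ≤ (K : ℝ≥0∞) ^ (d - 1) * ∫⁻ x, ∫⁻ y, ‖v (f x) - v y‖ₑ ^ 2 * (‖f x - y‖ₑ ^ d)⁻¹
            ∂surf (f '' Γ) ∂surf Γ := lintegral_surf_image_le hΓm hf _
      _ ≤ (K : ℝ≥0∞) ^ (d - 1) * ∫⁻ x, (K : ℝ≥0∞) ^ (d - 1) * (K ^ d *
            ∫⁻ y, ‖v (f x) - v (f y)‖ₑ ^ 2 * (‖x - y‖ₑ ^ d)⁻¹ ∂surf Γ) ∂surf Γ := by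
          gcongr 1
          refine lintegral_mono_ae ?_
          have : ∀ᵐ x ∂surf Γ, x ∈ Γ := ae_restrict_mem hΓm
          filter_upwards [this] with x hx
          refine (lintegral_surf_image_le hΓm hf _).trans ?_
          gcongr 1
          rw [← lintegral_const_mul' _ _ (by finiteness)]
          refine lintegral_mono_ae ?_
          filter_upwards [this] with y hy
          have h1 := inv_pow_le_mul_inv_pow hK0 ENNReal.coe_ne_top (hf' x hx y hy) d
          rw [edist_eq_enorm_sub, edist_eq_enorm_sub] at h1
          calc _ ≤ ‖v (f x) - v (f y)‖ₑ ^ 2 * ((K : ℝ≥0∞) ^ d * (‖x - y‖ₑ ^ d)⁻¹) := by gcongr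
            _ = _ := by ring
      _ = (K : ℝ≥0∞) ^ (d - 1 + (d - 1) + d) * I := by
          rw [lintegral_const_mul' _ _ (by finiteness), lintegral_const_mul' _ _ (by finiteness),
            pow_add, pow_add, hI]
          ring
      _ ≤ _ := by
          gcongr
          omega

/-- A function with bounded slope along the curves in the closed domain is Lipschitz on the
boundary. -/
theorem IsCnBoundary.exists_lipschitz {m n : ℕ} (hn : 1 ≤ n)
    {Γ D : Set (Space (m + 1))} (hΓ : IsCnBoundary n Γ D) (hΓc : IsCompact Γ) :
    ∃ C : ℝ≥0, ∀ (u : Space (m + 1) → ℝ) (L : ℝ≥0), (∀ x ∈ Γ, |u x| ≤ L) →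
      IsUpperGradientOn u (fun _ => L) (D ∪ Γ) → LipschitzOnWith (C * L) u Γ := by
  have hloc : ∀ x : Γ, ∃ (C : ℝ≥0) (N : Set (Space (m + 1))), IsOpen N ∧ x.1 ∈ N ∧
      ∀ (u : Space (m + 1) → ℝ) (L : ℝ≥0), IsUpperGradientOn u (fun _ => L) (D ∪ Γ) →
        ∀ y ∈ Γ ∩ N, ∀ z ∈ Γ ∩ N, edist (u y) (u z) ≤ (C * L : ℝ≥0) * edist y z := by
    intro x
    obtain ⟨r, hr, Θ, K, C, N, hK, hN, hxN, hΘ, hmaps, hanti, hcov, -⟩ := hΓ.exists_chart hn x.2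
    refine ⟨K * K, N, hN, hxN, fun u L hu y hy z hz => ?_⟩
    obtain ⟨a, ha, rfl⟩ := hcov hy
    obtain ⟨b, hb, rfl⟩ := hcov hz
    have hbox : ∀ s ∈ Icc (0 : ℝ) 1, (b + s • (a - b), (0 : ℝ)) ∈ halfBox m r := fun s hs =>
      ⟨(convex_ball (0 : Space m) r).add_smul_sub_mem hb ha hs, le_rfl, by positivity⟩
    -- the image of the segment from `b` to `a` in the chart is a curve of length at most `K * ‖a
    -- - b‖`
    have hline : LipschitzOnWith ‖a - b‖₊ (fun s : ℝ => (b + s • (a - b), (0 : ℝ))) (Icc 0 1) := by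
      refine LipschitzWith.lipschitzOnWith (LipschitzWith.of_dist_le_mul fun s s' => ?_)
      rw [Prod.dist_eq, dist_self, dist_add_left, dist_eq_norm, ← sub_smul, norm_smul, mul_comm,
        Real.dist_eq, max_eq_left (by positivity)]
      rfl
    have h := hu (fun s : ℝ => Θ (b + s • (a - b), 0)) _ (hΘ.comp hline hbox)
      (hmaps.comp hbox)
    simp only [one_smul, zero_smul, add_zero, add_sub_cancel, lintegral_const,
      Measure.restrict_apply MeasurableSet.univ, univ_inter, Real.volume_Ioc, sub_zero,
      ENNReal.ofReal_one, mul_one] at h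
    rw [edist_eq_enorm_sub]
    refine h.trans ?_
    have h2 := hanti (a, 0) ⟨ha, le_rfl, by positivity⟩ (b, 0) ⟨hb, le_rfl, by positivity⟩
    rw [Prod.edist_eq, edist_self, max_eq_left zero_le, edist_eq_enorm_sub] at h2
    push_cast
    calc (K : ℝ≥0∞) * ‖a - b‖₊ * L ≤ K * (K * edist (Θ (a, 0)) (Θ (b, 0))) * L := by
          gcongr
          exact h2
      _ = _ := by ring
  choose C N hN hxN hC using hloc
  -- Points closer than a Lebesgue number `δ` of a finite cover by charts lie in a common chart;
  -- for all others the bound on `u` suffices.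
  obtain ⟨t, ht⟩ := hΓc.elim_finite_subcover N hN
    (fun x hx => mem_iUnion.2 ⟨⟨x, hx⟩, hxN ⟨x, hx⟩⟩)
  have ht' : Γ ⊆ ⋃ i : t, N i := by
    intro x hx
    obtain ⟨i, hi, hxi⟩ := mem_iUnion₂.1 (ht hx)
    exact mem_iUnion.2 ⟨⟨i, hi⟩, hxi⟩
  obtain ⟨δ, hδ, hleb⟩ := lebesgue_number_lemma_of_metric hΓc (fun i : t => hN i) ht'
  refine ⟨∑ i : t, C i + Real.toNNReal (2 / δ), fun u L hL hu x hx y hy => ?_⟩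
  by_cases hxy : dist y x < δ
  · obtain ⟨i, hi⟩ := hleb x hx
    refine (hC i u L hu x ⟨hx, hi (Metric.mem_ball_self hδ)⟩ y ⟨hy, hi hxy⟩).trans ?_
    gcongr
    exact (Finset.single_le_sum (f := fun i : t => C i) (fun _ _ => zero_le)
      (Finset.mem_univ i)).trans le_self_add
  · rw [edist_dist, edist_dist, ← ENNReal.ofReal_coe_nnreal,
      ← ENNReal.ofReal_mul (NNReal.coe_nonneg _)]
    refine ENNReal.ofReal_le_ofReal ?_
    have h1 : dist (u x) (u y) ≤ 2 * L := by
      rw [Real.dist_eq]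
      have := abs_sub (u x) (u y)
      linarith [hL x hx, hL y hy]
    have h2 : (1 : ℝ) ≤ dist x y / δ := by
      rw [le_div_iff₀ hδ, one_mul, dist_comm]
      exact not_lt.1 hxy
    push_cast
    rw [Real.coe_toNNReal _ (by positivity)]
    have h3 : (0 : ℝ) ≤ ∑ i : t, (C i : ℝ) * L * dist x y := by positivity
    have h4 : (2 : ℝ) * L * 1 ≤ 2 * L * (dist x y / δ) := by gcongr
    calc dist (u x) (u y) ≤ 2 * L * (dist x y / δ) := by linarith
      _ = 2 / δ * L * dist x y := by ring
      _ ≤ _ := by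
        gcongr
        exact le_add_of_nonneg_left (by positivity)

theorem isUpperGradientOn_coord {d : ℕ} (a : Fin d) (S : Set (Space d)) :
    IsUpperGradientOn (fun x : Space d => x a) (fun _ => 1) S := by
  intro c L hc _
  have h1 := hc (show (1 : ℝ) ∈ Icc 0 1 from ⟨zero_le_one, le_rfl⟩)
    (show (0 : ℝ) ∈ Icc 0 1 from ⟨le_rfl, zero_le_one⟩)
  simp only [lintegral_const, Measure.restrict_apply MeasurableSet.univ, univ_inter,
    Real.volume_Ioc, sub_zero, ENNReal.ofReal_one, mul_one]
  rw [edist_dist (1 : ℝ), Real.dist_eq, sub_zero, abs_one, ENNReal.ofReal_one, mul_one] at h1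
  refine le_trans ?_ h1
  rw [edist_eq_enorm_sub, ← ofReal_norm, ← ofReal_norm]
  exact ENNReal.ofReal_le_ofReal (PiLp.norm_apply_le (p := 2) (c 1 - c 0) a)

/-- The kernel which dominates the Gagliardo integrand of Lipschitz functions is integrable: it is
the sum of the Gagliardo integrands of the coordinate functions, whose upper gradient is `1`, so
that the trace theorem applies to them. -/
theorem IsCnBoundary.lintegral_kernel_lt_top {m n : ℕ} (hm : 1 ≤ m) (hn : 1 ≤ n)
    {Γ D : Set (Space (m + 1))} (hΓ : IsCnBoundary n Γ D) (hΓc : IsCompact Γ)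
    (hDc : IsCompact (D ∪ Γ)) :
    ∫⁻ x, ∫⁻ y, ‖x - y‖ₑ ^ 2 * (‖x - y‖ₑ ^ (m + 1))⁻¹ ∂surf Γ ∂surf Γ < ⊤ := by
  obtain ⟨hfin, C, hC⟩ := hΓ.exists_trace hm hn hΓc hDc.isClosed
  have hcoord : ∀ a : Fin (m + 1),
      ∫⁻ x, ∫⁻ y, ‖x a - y a‖ₑ ^ 2 * (‖x - y‖ₑ ^ (m + 1))⁻¹ ∂surf Γ ∂surf Γ < ⊤ := by
    intro a
    have hca : Continuous fun x : Space (m + 1) => x a := by fun_prop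
    have h1 := hC (fun x => x a) (fun _ => 1) hca.continuousOn measurable_const
      (isUpperGradientOn_coord a _)
    have h2 : ∫⁻ x, ∫⁻ y, ‖x a - y a‖ₑ ^ 2 * (‖x - y‖ₑ ^ (m + 1))⁻¹ ∂surf Γ ∂surf Γ ≤
        normSqHHalf Γ (fun x => x a) := by
      rw [normSqHHalf_eq hca.aestronglyMeasurable]
      exact le_add_self
    refine (h2.trans h1).trans_lt (ENNReal.mul_lt_top ENNReal.coe_lt_top ?_)
    obtain ⟨R, hR⟩ := hDc.isBounded.exists_norm_le
    have h3 : ∀ x ∈ D ∪ Γ, ‖x a‖ₑ ^ 2 + 1 ^ 2 ≤ ENNReal.ofReal R ^ 2 + 1 ^ 2 := by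
      intro x hx
      gcongr
      rw [← ofReal_norm]
      exact ENNReal.ofReal_le_ofReal ((PiLp.norm_apply_le (p := 2) x a).trans (hR x hx))
    refine (setLIntegral_mono' hDc.isClosed.measurableSet h3).trans_lt ?_
    rw [lintegral_const, Measure.restrict_apply MeasurableSet.univ, univ_inter]
    exact ENNReal.mul_lt_top (by finiteness) hDc.measure_lt_top
  have hsum : ∀ x y : Space (m + 1), ‖x - y‖ₑ ^ 2 * (‖x - y‖ₑ ^ (m + 1))⁻¹ =
      ∑ a, ‖x a - y a‖ₑ ^ 2 * (‖x - y‖ₑ ^ (m + 1))⁻¹ := by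
    intro x y
    rw [← Finset.sum_mul]
    congr 1
    rw [← ofReal_norm, ← ENNReal.ofReal_pow (norm_nonneg _), EuclideanSpace.norm_sq_eq,
      ENNReal.ofReal_sum_of_nonneg fun _ _ => by positivity]
    refine Finset.sum_congr rfl fun a _ => ?_
    rw [ENNReal.ofReal_pow (norm_nonneg _), ofReal_norm, PiLp.sub_apply]
  set F : Fin (m + 1) → Space (m + 1) → Space (m + 1) → ℝ≥0∞ := fun a x y =>
    ‖x a - y a‖ₑ ^ 2 * (‖x - y‖ₑ ^ (m + 1))⁻¹ with hF
  have hmeas : ∀ a, Measurable fun p : Space (m + 1) × Space (m + 1) => F a p.1 p.2 :=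
    fun a => by
      simp only [hF]
      fun_prop
  have hcoord' : ∀ a, ∫⁻ x, ∫⁻ y, F a x y ∂surf Γ ∂surf Γ < ⊤ := hcoord
  have hsum' : ∀ x y, ‖x - y‖ₑ ^ 2 * (‖x - y‖ₑ ^ (m + 1))⁻¹ = ∑ a, F a x y := hsum
  clear_value F
  have h2 : ∀ x, ∫⁻ y, ‖x - y‖ₑ ^ 2 * (‖x - y‖ₑ ^ (m + 1))⁻¹ ∂surf Γ =
      ∑ a, ∫⁻ y, F a x y ∂surf Γ := fun x => by
    have h3 : ∀ a ∈ Finset.univ, Measurable fun y => F a x y :=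
      fun a _ => (hmeas a).comp measurable_prodMk_left
    rw [← lintegral_finsetSum _ h3]
    exact lintegral_congr fun y => hsum' x y
  rw [lintegral_congr h2, lintegral_finsetSum _ fun a _ => (hmeas a).lintegral_prod_right']
  exact ENNReal.sum_lt_top.2 fun a _ => hcoord' a

/-! ### Functionals on `H^{1/2}` -/

theorem normSqHHalf_smul {d : ℕ} {Γ : Set (Space d)} (r : ℝ) (v : Space d → ℝ) :
    normSqHHalf Γ (r • v) = ‖r‖ₑ ^ 2 * normSqHHalf Γ v := by
  have : gagliardo (r • v) = r • gagliardo v := by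
    funext q
    simp only [gagliardo, Pi.smul_apply, smul_eq_mul]
    ring
  rw [normSqHHalf, normSqHHalf, this, eLpNorm_const_smul, eLpNorm_const_smul]
  ring

theorem normSqHHalf_lt_top_of_mem {d : ℕ} {Γ : Set (Space d)} {v : Space d → ℝ}
    (hv : v ∈ HHalf Γ) : normSqHHalf Γ v < ⊤ := by
  rw [normSqHHalf, ENNReal.add_lt_top]
  exact ⟨ENNReal.pow_lt_top hv.1.2, ENNReal.pow_lt_top hv.2.2⟩

/-- The defining inequality of the dual norm, for functions of any norm. -/
theorem enorm_dualPair_sq_le {d : ℕ} {Γ : Set (Space d)} {g : HHalf Γ →ₗ[ℝ] ℝ}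
    (hg : dualNorm Γ g < ⊤) {v : Space d → ℝ} (hv : v ∈ HHalf Γ) :
    ‖dualPair g v‖ₑ ^ 2 ≤ dualNorm Γ g ^ 2 * normSqHHalf Γ v := by
  have hN := normSqHHalf_lt_top_of_mem hv
  have hpair : dualPair g v = g ⟨v, hv⟩ := by rw [dualPair, dif_pos hv]
  rw [hpair]
  have key : ∀ r : ℝ, ‖r‖ₑ ^ 2 * normSqHHalf Γ v ≤ 1 → ‖r‖ₑ * ‖g ⟨v, hv⟩‖ₑ ≤ dualNorm Γ g := by
    intro r hr
    have h1 : ‖g (r • ⟨v, hv⟩)‖ₑ ≤ dualNorm Γ g :=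
      le_iSup₂_of_le (f := fun (v : HHalf Γ) (_ : normSqHHalf Γ v ≤ 1) => ‖g v‖ₑ)
        (r • ⟨v, hv⟩) (by
          change normSqHHalf Γ (r • v) ≤ 1
          rwa [normSqHHalf_smul]) le_rfl
    rwa [map_smul, smul_eq_mul, enorm_mul] at h1
  -- on the elements of norm zero a bounded functional vanishes, by homogeneity
  rcases eq_or_ne (normSqHHalf Γ v) 0 with h0 | h0
  · have hgv : g ⟨v, hv⟩ = 0 := by
      by_contra hne
      have h1 := key (((dualNorm Γ g).toReal + 1) / g ⟨v, hv⟩) (by simp [h0])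
      rw [← enorm_mul, div_mul_cancel₀ _ hne, ← ofReal_norm, Real.norm_of_nonneg (by positivity),
        ENNReal.ofReal_le_iff_le_toReal hg.ne] at h1
      linarith
    simp [hgv, h0]
  · set N := (normSqHHalf Γ v).toReal with hNd
    have hNpos : 0 < N := ENNReal.toReal_pos h0 hN.ne
    have hNe : normSqHHalf Γ v = ENNReal.ofReal N := (ENNReal.ofReal_toReal hN.ne).symm
    have hr : ‖(√N)⁻¹‖ₑ ^ 2 * normSqHHalf Γ v = 1 := by
      rw [hNe, ← ofReal_norm, ← ENNReal.ofReal_pow (norm_nonneg _),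
        ← ENNReal.ofReal_mul (by positivity), Real.norm_of_nonneg (by positivity), inv_pow,
        Real.sq_sqrt hNpos.le, inv_mul_cancel₀ hNpos.ne', ENNReal.ofReal_one]
    calc ‖g ⟨v, hv⟩‖ₑ ^ 2 = (‖(√N)⁻¹‖ₑ * ‖g ⟨v, hv⟩‖ₑ) ^ 2 * normSqHHalf Γ v := by
          rw [mul_pow, mul_right_comm, hr, one_mul]
      _ ≤ _ := by
          gcongr
          exact key _ hr.le

namespace Geometry.IsAdmissible

variable {d k : ℕ} {D : Geometry d} {T : ℝ}

theorem isFiniteMeasure_surf (hd : 2 ≤ d) (hD : D.IsAdmissible k T) {t : ℝ} (ht : t ∈ Icc 0 T) :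
    IsFiniteMeasure (surf (D.Γ t)) := by
  obtain ⟨m, rfl⟩ : ∃ m, d = m + 1 := ⟨d - 1, by omega⟩
  refine ((hD.interface_smooth t ht).exists_trace (by omega) (by omega)
    (hD.interface_compact t ht) ?_).1
  rw [← hD.closure_inner ht]
  exact isClosed_closure

theorem lintegral_interface_kernel_lt_top (hd : 2 ≤ d) (hD : D.IsAdmissible k T) {t : ℝ}
    (ht : t ∈ Icc 0 T) :
    ∫⁻ x, ∫⁻ y, ‖x - y‖ₑ ^ 2 * (‖x - y‖ₑ ^ d)⁻¹ ∂surf (D.Γ t) ∂surf (D.Γ t) < ⊤ := by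
  obtain ⟨m, rfl⟩ : ∃ m, d = m + 1 := ⟨d - 1, by omega⟩
  refine (hD.interface_smooth t ht).lintegral_kernel_lt_top (by omega) (by omega)
    (hD.interface_compact t ht) ?_
  rw [← hD.closure_inner ht]
  exact hD.isCompact_closure_om ht 0

theorem exists_interface_lipschitz (hd : 2 ≤ d) (hD : D.IsAdmissible k T) {t : ℝ}
    (ht : t ∈ Icc 0 T) :
    ∃ C : ℝ≥0, ∀ (u : Space d → ℝ) (L : ℝ≥0), (∀ x ∈ D.Γ t, |u x| ≤ L) →
      IsUpperGradientOn u (fun _ => L) (closure (D.Om 0 t)) →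
      LipschitzOnWith (C * L) u (D.Γ t) := by
  obtain ⟨m, rfl⟩ : ∃ m, d = m + 1 := ⟨d - 1, by omega⟩
  rw [hD.closure_inner ht]
  exact (hD.interface_smooth t ht).exists_lipschitz (by omega) (hD.interface_compact t ht)

theorem flow_lipschitzOnWith (hD : D.IsAdmissible k T) :
    ∃ K : ℝ≥0, 1 ≤ K ∧ ∀ i, ∀ t ∈ Icc 0 T, LipschitzOnWith K (D.Φ i t) (closure (D.Om i 0)) ∧
      LipschitzOnWith K (D.flowInv i t) (closure (D.Om i t)) := by
  obtain ⟨K, hK1, hK⟩ := hD.exists_flow_biLipschitz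
  refine ⟨K, hK1, fun i t ht => ⟨LipschitzOnWith.of_dist_le_mul fun x hx y hy =>
    (hK i t ht x hx y hy).1, LipschitzOnWith.of_dist_le_mul fun x hx y hy => ?_⟩⟩
  have := (hK i t ht _ (hD.flowInv_mem ht i hx) _ (hD.flowInv_mem ht i hy)).2
  rwa [hD.flow_flowInv ht i hx, hD.flow_flowInv ht i hy] at this

/-- The `H^{1/2}` norms on the moving interface, transported by the flow. -/
theorem exists_normSqHHalf_flow_le (hd : 2 ≤ d) (hD : D.IsAdmissible k T) :
    ∃ C : ℝ≥0, ∀ t ∈ Icc 0 T, ∀ v : Space d → ℝ, ContinuousOn v (D.Γ t) →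
      normSqHHalf (D.Γ t) v ≤ C * normSqHHalf (D.Γ 0) (fun x => v (D.Φ 0 t x)) := by
  obtain ⟨K, hK1, hK⟩ := hD.exists_flow_biLipschitz
  refine ⟨K ^ (3 * d), fun t ht v hv => ?_⟩
  have h0 : (0 : ℝ) ∈ Icc 0 T := ⟨le_rfl, ht.1.trans ht.2⟩
  have hsub := hD.interface_subset_inner h0
  have := hD.isFiniteMeasure_surf hd ht
  have := hD.isFiniteMeasure_surf hd h0
  have himg := hD.flow_interface 0 t ht
  have : IsFiniteMeasure (surf (D.Φ 0 t '' D.Γ 0)) := by rwa [himg]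
  have h := normSqHHalf_image_le (f := D.Φ 0 t) (Γ := D.Γ 0) (hD.interface_compact 0 h0) hK1
    (LipschitzOnWith.of_dist_le_mul fun x hx y hy =>
      (hK 0 t ht x (hsub hx) y (hsub hy)).1)
    (fun x hx y hy => by
      rw [edist_dist, edist_dist, ← ENNReal.ofReal_coe_nnreal,
        ← ENNReal.ofReal_mul (NNReal.coe_nonneg _)]
      exact ENNReal.ofReal_le_ofReal (hK 0 t ht x (hsub hx) y (hsub hy)).2)
    (v := v) (by rwa [himg])
  rw [himg] at h
  push_cast
  exact h

/-- The trace theorem on the moving interface, with a constant which does not depend on time: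
the flow is bi-Lipschitz uniformly in time and reduces it to the initial interface. -/
theorem exists_trace (hd : 2 ≤ d) (hD : D.IsAdmissible k T) :
    ∃ C : ℝ≥0, ∀ t ∈ Icc 0 T, ∀ (u : Space d → ℝ) (g : Space d → ℝ≥0∞),
      ContinuousOn u (closure (D.Om 0 t)) → Measurable g →
      IsUpperGradientOn u g (closure (D.Om 0 t)) →
      normSqHHalf (D.Γ t) u ≤ C * ∫⁻ x in closure (D.Om 0 t), (‖u x‖ₑ ^ 2 + g x ^ 2) := by
  rcases lt_or_ge T 0 with hT | hT
  · exact ⟨0, fun t ht => absurd (ht.1.trans ht.2) (not_le.2 hT)⟩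
  have h0 : (0 : ℝ) ∈ Icc 0 T := ⟨le_rfl, hT⟩
  -- the trace theorem at time `0`, for the function pulled back by the flow
  obtain ⟨C₀, hC₀⟩ : ∃ C : ℝ≥0, ∀ (u : Space d → ℝ) (g : Space d → ℝ≥0∞),
      ContinuousOn u (closure (D.Om 0 0)) → Measurable g →
      IsUpperGradientOn u g (closure (D.Om 0 0)) →
      normSqHHalf (D.Γ 0) u ≤ C * ∫⁻ x in closure (D.Om 0 0), (‖u x‖ₑ ^ 2 + g x ^ 2) := by
    obtain ⟨m, rfl⟩ : ∃ m, d = m + 1 := ⟨d - 1, by omega⟩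
    rw [hD.closure_inner h0]
    refine ((hD.interface_smooth 0 h0).exists_trace (by omega) (by omega)
      (hD.interface_compact 0 h0) ?_).2
    rw [← hD.closure_inner h0]
    exact isClosed_closure
  obtain ⟨C₁, hC₁⟩ := hD.exists_normSqHHalf_flow_le hd
  obtain ⟨K, hK1, hK⟩ := hD.flow_lipschitzOnWith
  refine ⟨C₁ * (C₀ * (K ^ d * K ^ 2)), fun t ht u g hu hg hug => ?_⟩
  obtain ⟨hΦ, hΦ'⟩ := hK 0 t ht
  have hK1' : (1 : ℝ≥0∞) ≤ (K : ℝ≥0∞) ^ 2 := by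
    have : 1 ≤ K ^ 2 := one_le_pow₀ hK1
    exact_mod_cast this
  have hm0 : MeasurableSet (closure (D.Om 0 0)) := isClosed_closure.measurableSet
  have hmt : MeasurableSet (closure (D.Om 0 t)) := isClosed_closure.measurableSet
  have hmaps : MapsTo (D.Φ 0 t) (closure (D.Om 0 0)) (closure (D.Om 0 t)) :=
    fun x hx => hD.flow_mem ht 0 hx
  -- a measurable function is needed for the upper gradient; the flow is controlled only on the
  -- closed domain
  obtain ⟨Φ', hΦ'm, hΦ'e⟩ := exists_measurable_eqOn hΦ.continuousOn hm0
  have h1 := hC₀ (fun x => u (D.Φ 0 t x)) (fun x => K * g (Φ' x))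
    (hu.comp hΦ.continuousOn hmaps) ((hg.comp hΦ'm).const_mul _)
    ((hug.comp hΦ hmaps).congr (fun _ _ => rfl) fun x hx => by simp only [hΦ'e hx])
  have h2 : ∫⁻ x in closure (D.Om 0 0), (‖u (D.Φ 0 t x)‖ₑ ^ 2 + (K * g (Φ' x)) ^ 2) ≤
      (K : ℝ≥0∞) ^ d * ((K : ℝ≥0∞) ^ 2 * ∫⁻ z in closure (D.Om 0 t), (‖u z‖ₑ ^ 2 + g z ^ 2)) := by
    have himg : D.flowInv 0 t '' closure (D.Om 0 t) = closure (D.Om 0 0) := by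
      ext x
      constructor
      · rintro ⟨z, hz, rfl⟩
        exact hD.flowInv_mem ht 0 hz
      · exact fun hx => ⟨_, hD.flow_mem ht 0 hx, hD.flowInv_flow ht 0 hx⟩
    have h3 := volume_setLIntegral_image_le hmt hΦ'
      (fun x => ‖u (D.Φ 0 t x)‖ₑ ^ 2 + (K * g (Φ' x)) ^ 2)
    rw [himg] at h3
    refine h3.trans ?_
    gcongr 1
    rw [← lintegral_const_mul' _ _ (by finiteness)]
    refine setLIntegral_mono' hmt fun z hz => ?_
    rw [hΦ'e (hD.flowInv_mem ht 0 hz), hD.flow_flowInv ht 0 hz, mul_pow, mul_add]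
    gcongr
    exact le_mul_of_one_le_left zero_le hK1'
  have hcont : ContinuousOn u (D.Γ t) := hu.mono (hD.interface_subset_inner ht)
  calc normSqHHalf (D.Γ t) u ≤ C₁ * (C₀ * ((K : ℝ≥0∞) ^ d * ((K : ℝ≥0∞) ^ 2 *
        ∫⁻ z in closure (D.Om 0 t), (‖u z‖ₑ ^ 2 + g z ^ 2)))) := by
        refine (hC₁ t ht u hcont).trans ?_
        gcongr
        exact h1.trans (by gcongr)
    _ = _ := by
        push_cast
        ring

end Geometry.IsAdmissible

/-! ### Lagrange interpolation on the simplex -/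

theorem mem_nodeIdx {d k : ℕ} {β : Fin (d + 1) → ℕ} : β ∈ nodeIdx d k ↔ ∑ a, β a = k := by
  simp [nodeIdx]

theorem refNode_mem {d k : ℕ} (hk : 1 ≤ k) {β : Fin (d + 1) → ℕ} (hβ : β ∈ nodeIdx d k) :
    refNode k β ∈ refSimplex d := by
  refine ⟨fun a => by simp only [refNode]; positivity, ?_⟩
  simp only [refNode]
  rw [← Finset.sum_div, ← Nat.cast_sum, mem_nodeIdx.1 hβ]
  exact div_self (by positivity)

theorem lagr_refNode {d k : ℕ} (hk : 1 ≤ k) {β γ : Fin (d + 1) → ℕ} (hβ : β ∈ nodeIdx d k)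
    (hγ : γ ∈ nodeIdx d k) : lagr k β (refNode k γ) = if γ = β then 1 else 0 := by
  have hk0 : (k : ℝ) ≠ 0 := by positivity
  have hterm : ∀ a j, ((k : ℝ) * refNode k γ a - j) / (j + 1) = ((γ a : ℝ) - j) / (j + 1) := by
    intro a j
    simp only [refNode]
    rw [mul_div_cancel₀ _ hk0]
  split_ifs with h
  · subst h
    refine Finset.prod_eq_one fun a _ => ?_
    have h1 : ∏ j ∈ Finset.range (γ a), ((j : ℝ) + 1) ≠ 0 :=
      Finset.prod_ne_zero_iff.2 fun j _ => by positivity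
    simp only [hterm]
    rw [Finset.prod_div_distrib, div_eq_one_iff_eq h1, ← Finset.prod_range_reflect]
    refine Finset.prod_congr rfl fun j hj => ?_
    have : j < γ a := Finset.mem_range.1 hj
    rw [Nat.cast_sub (by omega), Nat.cast_sub (by omega)]
    push_cast
    ring
  -- distinct multi-indices of the same length: in some coordinate `γ` is smaller, and the factor
  -- with `j = γ a` vanishes
  · obtain ⟨a, ha⟩ : ∃ a, γ a < β a := by
      by_contra hcon
      push Not at hcon
      refine h (funext fun a => ?_)
      have hs : ∑ a, β a = ∑ a, γ a := by rw [mem_nodeIdx.1 hβ, mem_nodeIdx.1 hγ]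
      exact ((Finset.sum_eq_sum_iff_of_le fun a _ => hcon a).1 hs a (Finset.mem_univ a)).symm
    refine Finset.prod_eq_zero (Finset.mem_univ a) ?_
    refine Finset.prod_eq_zero (Finset.mem_range.2 ha) ?_
    rw [hterm, sub_self, zero_div]

/-- The Lagrange basis function as a polynomial. -/
def lagrPoly {d : ℕ} (k : ℕ) (β : Fin (d + 1) → ℕ) : MvPolynomial (Fin (d + 1)) ℝ :=
  ∏ a, ∏ j ∈ Finset.range (β a), (MvPolynomial.C (k / (j + 1) : ℝ) * MvPolynomial.X a -
    MvPolynomial.C (j / (j + 1) : ℝ))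

theorem eval_lagrPoly {d : ℕ} (k : ℕ) (β : Fin (d + 1) → ℕ) (l : Fin (d + 1) → ℝ) :
    MvPolynomial.eval l (lagrPoly k β) = lagr k β l := by
  simp only [lagrPoly, lagr, map_prod, map_sub, map_mul, MvPolynomial.eval_C, MvPolynomial.eval_X]
  refine Finset.prod_congr rfl fun a _ => Finset.prod_congr rfl fun j _ => ?_
  ring

theorem totalDegree_lagrPoly_le {d k : ℕ} {β : Fin (d + 1) → ℕ} (hβ : β ∈ nodeIdx d k) :
    (lagrPoly k β).totalDegree ≤ k := by
  refine (MvPolynomial.totalDegree_finsetProd _ _).trans ?_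
  rw [← mem_nodeIdx.1 hβ]
  refine Finset.sum_le_sum fun a _ => ?_
  refine (MvPolynomial.totalDegree_finsetProd _ _).trans ?_
  refine (Finset.sum_le_card_nsmul _ _ 1 fun j _ => ?_).trans (by simp)
  refine (MvPolynomial.totalDegree_sub _ _).trans (max_le ?_ (by simp))
  refine (MvPolynomial.totalDegree_mul _ _).trans ?_
  rw [MvPolynomial.totalDegree_C, zero_add]
  exact (MvPolynomial.totalDegree_X a).le

/-- In a space of functions of dimension at most `n`, interpolation at `n` points with a nodal
basis is exact. -/
theorem eq_sum_of_nodal {H ι : Type*} [Fintype ι] [DecidableEq ι] {W : Submodule ℝ (H → ℝ)}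
    [Module.Finite ℝ W] (hrank : Module.finrank ℝ W ≤ Fintype.card ι) {L : ι → H → ℝ}
    (hLW : ∀ β, L β ∈ W) {node : ι → H} (hL : ∀ β γ, L β (node γ) = if γ = β then 1 else 0)
    {f : H → ℝ} (hf : f ∈ W) (x : H) : f x = ∑ β, f (node β) * L β x := by
  let L' : ι → W := fun β => ⟨L β, hLW β⟩
  have hind : LinearIndependent ℝ L' := by
    rw [Fintype.linearIndependent_iff]
    intro c hc γ
    have := congrFun (congrArg Subtype.val hc) (node γ)
    simpa [L', hL] using this
  have htop : Submodule.span ℝ (range L') = ⊤ :=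
    hind.span_eq_top_of_card_eq_finrank' (le_antisymm hind.fintype_card_le_finrank hrank)
  have hpW : (⟨f, hf⟩ : W) ∈ Submodule.span ℝ (range L') := by rw [htop]; trivial
  obtain ⟨c, hc⟩ := (Submodule.mem_span_range_iff_exists_fun ℝ).1 hpW
  have hc' : ∀ l, ∑ β, c β * L β l = f l := by
    intro l
    have := congrFun (congrArg Subtype.val hc) l
    simpa [L'] using this
  rw [← hc' x]
  refine Finset.sum_congr rfl fun β _ => ?_
  rw [← hc' (node β)]
  simp [hL]

/-- On the hyperplane of barycentric coordinates, a polynomial of degree at most `k` is determined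
by its values at the Lagrange nodes. Homogenizing with the sum of the coordinates, such polynomials
are spanned by the monomials of degree exactly `k`, which are as many as the nodes. -/
theorem eval_eq_sum_lagr {d k : ℕ} (hk : 1 ≤ k) {p : MvPolynomial (Fin (d + 1)) ℝ}
    (hp : p.totalDegree ≤ k) {l : Fin (d + 1) → ℝ} (hl : ∑ a, l a = 1) :
    MvPolynomial.eval l p =
      ∑ β ∈ nodeIdx d k, MvPolynomial.eval (refNode k β) p * lagr k β l := by
  classical
  -- functions on the hyperplane; there a monomial of lower degree is multiplied by a power of the
  -- sum of the coordinates, which is `1`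
  let H := {l : Fin (d + 1) → ℝ // ∑ a, l a = 1}
  let mon : nodeIdx d k → H → ℝ := fun β l => ∏ a, l.1 a ^ β.1 a
  let W : Submodule ℝ (H → ℝ) := Submodule.span ℝ (range mon)
  have hfin : Module.Finite ℝ W := Module.Finite.span_of_finite ℝ (finite_range mon)
  have hrank : Module.finrank ℝ W ≤ Fintype.card (nodeIdx d k) := finrank_range_le_card mon
  have hW : ∀ q : MvPolynomial (Fin (d + 1)) ℝ, q.totalDegree ≤ k →
      (fun l : H => MvPolynomial.eval l.1 q) ∈ W := by
    intro q hq
    have h1 : (fun l : H => MvPolynomial.eval l.1 q) =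
        ∑ s ∈ q.support, q.coeff s • fun l : H => ∏ a, l.1 a ^ s a := by
      funext l
      rw [MvPolynomial.eval_eq']
      simp
    rw [h1]
    refine Submodule.sum_mem _ fun s hs => Submodule.smul_mem _ _ ?_
    have hsk : ∑ a, s a ≤ k := by
      refine le_trans ?_ ((MvPolynomial.le_totalDegree hs).trans hq)
      rw [Finsupp.sum_fintype _ _ fun _ => rfl]
    have h2 : (fun l : H => ∏ a, l.1 a ^ s a) =
        ∑ r ∈ Finset.piAntidiag (Finset.univ : Finset (Fin (d + 1))) (k - ∑ a, s a),
          (Nat.multinomial Finset.univ r : ℝ) • fun l : H => ∏ a, l.1 a ^ (s a + r a) := by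
      funext l
      have h3 : (∑ a, l.1 a) ^ (k - ∑ a, s a) = 1 := by rw [l.2, one_pow]
      rw [Finset.sum_pow_eq_sum_piAntidiag] at h3
      refine ((mul_one (∏ a, l.1 a ^ s a)).symm.trans (congrArg _ h3.symm)).trans ?_
      rw [Finset.mul_sum, Finset.sum_apply]
      simp only [Pi.smul_apply, smul_eq_mul]
      refine Finset.sum_congr rfl fun r _ => ?_
      simp only [pow_add, Finset.prod_mul_distrib]
      ring
    rw [h2]
    refine Submodule.sum_mem _ fun r hr => Submodule.smul_mem _ _ (Submodule.subset_span ?_)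
    have hr' : ∑ a, r a = k - ∑ a, s a := by simpa using hr
    exact ⟨⟨fun a => s a + r a, mem_nodeIdx.2 (by rw [Finset.sum_add_distrib, hr']; omega)⟩, rfl⟩
  have h := eq_sum_of_nodal (W := W) (f := fun l : H => MvPolynomial.eval l.1 p)
    (L := fun (β : nodeIdx d k) (l : H) => lagr k β.1 l.1)
    (node := fun β => ⟨refNode k β.1, (refNode_mem hk β.2).2⟩) hrank
    (fun β => by
      simp only [← eval_lagrPoly]
      exact hW _ (totalDegree_lagrPoly_le β.2))
    (fun β γ => by
      simp only [lagr_refNode hk β.2 γ.2, Subtype.ext_iff])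
    (hW p hp) ⟨l, hl⟩
  rw [← Finset.sum_coe_sort]
  exact h

theorem sum_lagr_eq_one {d k : ℕ} (hk : 1 ≤ k) {l : Fin (d + 1) → ℝ} (hl : ∑ a, l a = 1) :
    ∑ β ∈ nodeIdx d k, lagr k β l = 1 := by
  have := eval_eq_sum_lagr hk (p := (1 : MvPolynomial (Fin (d + 1)) ℝ)) (by simp) hl
  simpa using this.symm

theorem contDiff_lagr {d : ℕ} (k : ℕ) (β : Fin (d + 1) → ℕ) : ContDiff ℝ ⊤ (lagr (d := d) k β) := by
  unfold lagr
  fun_prop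

/-! ### Combinatorics of the mesh -/

@[to_additive]
theorem prod_comp_eq_finprod {ι α N : Type*} [Fintype ι] [CommMonoid N] {e : ι → α}
    (he : Function.Injective e) (F : α → N) (h : ∀ z ∉ range e, F z = 1) :
    ∏ a, F (e a) = ∏ᶠ z, F z := by
  classical
  rw [← finprod_eq_prod_of_fintype, ← finprod_mem_range he]
  refine finprod_congr fun z => ?_
  by_cases hz : z ∈ range e
  · rw [finprod_eq_if, if_pos hz]
  · rw [finprod_eq_if, if_neg hz, h z hz]

@[to_additive]
theorem prod_comp_eq_of_injective {ι ι' α N : Type*} [Fintype ι] [Fintype ι'] [CommMonoid N]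
    {e : ι → α} {e' : ι' → α} (he : Function.Injective e) (he' : Function.Injective e') (F : α → N)
    (h : ∀ z ∉ range e, F z = 1) (h' : ∀ z ∉ range e', F z = 1) :
    ∏ a, F (e a) = ∏ a, F (e' a) := by
  rw [prod_comp_eq_finprod he F h, prod_comp_eq_finprod he' F h']

/-- Coordinates with respect to the vertices `e` of an element, as a function of the vertex. -/
def label {d : ℕ} {R : Type*} [AddCommMonoid R] (e : Fin (d + 1) → Space d) (β : Fin (d + 1) → R)
    (z : Space d) : R := ∑ a, (e ⁻¹' {z}).indicator β a

section Label

variable {d : ℕ} {e e' : Fin (d + 1) → Space d}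

theorem label_apply {R : Type*} [AddCommMonoid R] (he : Function.Injective e)
    (β : Fin (d + 1) → R) (a : Fin (d + 1)) : label e β (e a) = β a := by
  rw [label, Finset.sum_eq_single a]
  · exact indicator_of_mem (mem_preimage.2 rfl) β
  · intro b _ hb
    exact indicator_of_notMem (s := e ⁻¹' {e a}) (fun h => hb (he h)) β
  · simp

theorem label_of_notMem {R : Type*} [AddCommMonoid R] (β : Fin (d + 1) → R) {z : Space d}
    (hz : z ∉ range e) : label e β z = 0 :=
  Finset.sum_eq_zero fun a _ => indicator_of_notMem (s := e ⁻¹' {z}) (fun h => hz ⟨a, h⟩) β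

theorem label_refNode (he : Function.Injective e) (k : ℕ) (β : Fin (d + 1) → ℕ) (z : Space d) :
    label e (refNode k β) z = ((label e β z : ℕ) : ℝ) / k := by
  by_cases hz : z ∈ range e
  · obtain ⟨a, rfl⟩ := hz
    rw [label_apply he, label_apply he, refNode]
  · rw [label_of_notMem _ hz, label_of_notMem _ hz]
    simp

theorem eq_of_label_eq {R : Type*} [AddCommMonoid R] (he : Function.Injective e)
    {β β' : Fin (d + 1) → R} (h : label e β = label e β') : β = β' := by
  funext a
  rw [← label_apply he β a, h, label_apply he]

/-- The multi-index with respect to the vertices `e'` of a multi-index with respect to `e`. -/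
theorem exists_label_eq {R : Type*} [AddCommMonoid R] (he' : Function.Injective e')
    {β : Fin (d + 1) → R} (h : ∀ z ∉ range e', label e β z = 0) :
    label e' (fun a => label e β (e' a)) = label e β := by
  funext z
  by_cases hz : z ∈ range e'
  · obtain ⟨a, rfl⟩ := hz
    rw [label_apply he']
  · rw [label_of_notMem _ hz, h z hz]

theorem sum_eq_of_label_eq {R : Type*} [AddCommMonoid R] (he : Function.Injective e)
    (he' : Function.Injective e') {β β' : Fin (d + 1) → R} (h : label e β = label e' β') :
    ∑ a, β a = ∑ a, β' a := by
  have := sum_comp_eq_of_injective he he' (label e β) (fun z hz => label_of_notMem _ hz)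
    (fun z hz => by rw [h, label_of_notMem _ hz])
  simp only [label_apply he] at this
  rw [this, h]
  simp only [label_apply he']

theorem lagr_eq_of_label_eq (he : Function.Injective e) (he' : Function.Injective e') {k : ℕ}
    {β β' : Fin (d + 1) → ℕ} {l l' : Fin (d + 1) → ℝ} (hβ : label e β = label e' β')
    (hl : label e l = label e' l') : lagr k β l = lagr k β' l' := by
  have := prod_comp_eq_of_injective he he'
    (fun z => ∏ j ∈ Finset.range (label e β z), ((k : ℝ) * label e l z - j) / (j + 1))
    (fun z hz => by simp [label_of_notMem _ hz])
    (fun z hz => by simp [hβ, label_of_notMem _ hz])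
  simp only [label_apply he] at this
  rw [lagr, this, hβ, hl]
  simp only [label_apply he', lagr]

theorem eq_zero_of_lagr_ne_zero {k : ℕ} {β : Fin (d + 1) → ℕ} {l : Fin (d + 1) → ℝ}
    (h : lagr k β l ≠ 0) {a : Fin (d + 1)} (hl : l a = 0) : β a = 0 := by
  by_contra hβ
  refine h (Finset.prod_eq_zero (Finset.mem_univ a) ?_)
  refine Finset.prod_eq_zero (Finset.mem_range.2 (Nat.pos_of_ne_zero hβ)) ?_
  simp [hl]

/-- Finite element functions with matching nodal values take the same value at a point with
matching coordinates: only the nodes on the common face contribute. -/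
theorem sum_lagr_eq_of_label_eq (he : Function.Injective e) (he' : Function.Injective e') {k : ℕ}
    {l l' : Fin (d + 1) → ℝ} (hl : label e l = label e' l') {c c' : nodeIdx d k → ℝ}
    (hc : ∀ β β' : nodeIdx d k, label e β.1 = label e' β'.1 → c β = c' β') :
    ∑ β, c β * lagr k β.1 l = ∑ β, c' β * lagr k β.1 l' := by
  have transfer : ∀ {e e' : Fin (d + 1) → Space d}, Function.Injective e → Function.Injective e' →
      ∀ {l l' : Fin (d + 1) → ℝ}, label e l = label e' l' → ∀ β : nodeIdx d k,
      lagr k β.1 l ≠ 0 → ∃ β' : nodeIdx d k, label e β.1 = label e' β'.1 := by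
    intro e e' he he' l l' hl β hβ
    have h1 : ∀ z ∉ range e', label e β.1 z = 0 := by
      intro z hz
      by_cases hze : z ∈ range e
      · obtain ⟨a, rfl⟩ := hze
        rw [label_apply he]
        refine eq_zero_of_lagr_ne_zero hβ ?_
        rw [← label_apply he l, hl, label_of_notMem _ hz]
      · exact label_of_notMem _ hze
    have h2 := exists_label_eq he' h1
    exact ⟨⟨_, mem_nodeIdx.2 ((sum_eq_of_label_eq he he' h2.symm).symm.trans
      (mem_nodeIdx.1 β.2))⟩, h2.symm⟩
  -- `τ` matches the nodes whose basis functions do not vanish at the point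
  choose τ hτ using fun (β : nodeIdx d k) (hβ : lagr k β.1 l ≠ 0) => transfer he he' hl β hβ
  refine Finset.sum_bij_ne_zero (fun β _ hβ => τ β (right_ne_zero_of_mul hβ)) (fun _ _ _ =>
    Finset.mem_univ _) ?_ ?_ ?_
  · intro β _ hβ γ _ hγ h
    have h1 := hτ β (right_ne_zero_of_mul hβ)
    rw [h, ← hτ γ (right_ne_zero_of_mul hγ)] at h1
    exact Subtype.ext (eq_of_label_eq he h1)
  · intro β' _ hβ'
    obtain ⟨β, hβ⟩ := transfer he' he hl.symm β' (right_ne_zero_of_mul hβ')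
    have h1 : c β * lagr k β.1 l = c' β' * lagr k β'.1 l' := by
      rw [hc β β' hβ.symm, lagr_eq_of_label_eq he he' hβ.symm hl]
    have h2 : c β * lagr k β.1 l ≠ 0 := h1 ▸ hβ'
    refine ⟨β, Finset.mem_univ _, h2, Subtype.ext (eq_of_label_eq he' ?_)⟩
    rw [← hτ β (right_ne_zero_of_mul h2), hβ]
  · intro β _ hβ
    have h1 := hτ β (right_ne_zero_of_mul hβ)
    exact congrArg₂ (· * ·) (hc β _ h1) (lagr_eq_of_label_eq he he' h1 hl)

end Label

theorem nearest_of_mem {d : ℕ} {Γ : Set (Space d)} {x : Space d} (hx : x ∈ Γ) :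
    nearest Γ x = x := by
  have h : ∃ y, IsNearest Γ x y := ⟨x, hx, by rw [Metric.infDist_zero_of_mem hx, dist_self]⟩
  rw [nearest, dif_pos h]
  have h1 := h.choose_spec.2
  rw [Metric.infDist_zero_of_mem hx] at h1
  exact (dist_eq_zero.1 h1).symm

/-- For an element with a single vertex on the interface the correction vanishes, so that the
distinction by the number of vertices is immaterial. -/
theorem projCorrect_eq {d : ℕ} {Γ : Set (Space d)} {k : ℕ} {S : Finset (Fin (d + 1))}
    {F : (Fin (d + 1) → ℝ) → Space d} (hF : ∀ a ∈ S, F (Pi.single a 1) ∈ Γ) {l : Fin (d + 1) → ℝ} :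
    projCorrect Γ k S F l = if muTilde S l ≠ 0 then
      F l + muTilde S l ^ (k + 2) • (nearest Γ (F (yTilde S l)) - F (yTilde S l)) else F l := by
  rw [projCorrect]
  by_cases hμ : muTilde S l = 0
  · simp [hμ]
  by_cases hS : 2 ≤ S.card
  · simp [hS]
  · rw [if_neg fun h => hS h.1, if_pos hμ]
    have hS0 : S.card ≠ 0 := by
      intro h0
      rw [Finset.card_eq_zero] at h0
      exact hμ (by simp [muTilde, h0])
    obtain ⟨a, rfl⟩ := Finset.card_eq_one.1 (by omega : S.card = 1)
    have hy : yTilde {a} l = Pi.single a 1 := by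
      funext b
      by_cases hb : b = a
      · subst hb
        have : l b ≠ 0 := by simpa [muTilde] using hμ
        simp [yTilde, muTilde, this]
      · simp [yTilde, hb]
    rw [hy, nearest_of_mem (hF a (Finset.mem_singleton_self a)), sub_self, smul_zero, add_zero]

namespace Mesh

/-- The standing assumptions: an admissible evolving domain and a regular fitted mesh. -/
structure Standing {d : ℕ} (M : Mesh d) (D : Geometry d) (k : ℕ) (T κ h : ℝ) : Prop where
  two_le : 2 ≤ d
  one_le : 1 ≤ k
  T_pos : 0 < T
  h_pos : 0 < h
  one_le_κ : 1 ≤ κ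
  adm : D.IsAdmissible k T
  fitted : M.IsFitted D
  regular : M.IsRegular D k T κ h

/-- Coefficient vectors with respect to the local Lagrange bases. -/
abbrev Coef {d : ℕ} (M : Mesh d) (k : ℕ) := M.Elt → nodeIdx d k → ℝ

/-- The elementwise function at time `t` with given nodal coefficients. -/
def fn {d : ℕ} (M : Mesh d) (D : Geometry d) (k : ℕ) (t : ℝ) (c : M.Coef k) : M.Fun :=
  fun K => (M.elt D k t K).indicator fun x => ∑ β, c K β * lagr k β.1 (M.refInv D k t K x)

/-- Nodal coefficients which are single-valued and vanish on the outer boundary. -/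
def nodal {d : ℕ} (M : Mesh d) (D : Geometry d) (k : ℕ) : Submodule ℝ (M.Coef k) where
  carrier := {c | (∀ K K' β β', label (M.vert K) β.1 = label (M.vert K') β'.1 → c K β = c K' β') ∧
    ∀ K β, K.1 = 1 → M.psi D k K (refNode k β.1) ∈ frontier D.Ω → c K β = 0}
  add_mem' := by
    rintro a b ⟨ha, ha'⟩ ⟨hb, hb'⟩
    refine ⟨fun K K' β β' h => ?_, fun K β h h' => ?_⟩
    · rw [Pi.add_apply, Pi.add_apply, Pi.add_apply, Pi.add_apply, ha K K' β β' h, hb K K' β β' h]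
    · rw [Pi.add_apply, Pi.add_apply, ha' K β h h', hb' K β h h', add_zero]
  zero_mem' := ⟨fun _ _ _ _ _ => rfl, fun _ _ _ _ => rfl⟩
  smul_mem' := by
    rintro r a ⟨ha, ha'⟩
    refine ⟨fun K K' β β' h => ?_, fun K β h h' => ?_⟩
    · rw [Pi.smul_apply, Pi.smul_apply, Pi.smul_apply, Pi.smul_apply, ha K K' β β' h]
    · rw [Pi.smul_apply, Pi.smul_apply, ha' K β h h', smul_zero]

namespace Standing

variable {d k : ℕ} {M : Mesh d} {D : Geometry d} {T κ h : ℝ}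

theorem κ_pos (hM : M.Standing D k T κ h) : 0 < κ := zero_lt_one.trans_le hM.one_le_κ

theorem zero_mem (hM : M.Standing D k T κ h) : (0 : ℝ) ∈ Icc 0 T := ⟨le_rfl, hM.T_pos.le⟩

theorem vert_injective (hM : M.Standing D k T κ h) (K : M.Elt) : Function.Injective (M.vert K) :=
  (hM.fitted.affineIndependent K).injective

theorem refMap_injOn (hM : M.Standing D k T κ h) {t : ℝ} (ht : t ∈ Icc 0 T) (K : M.Elt) :
    InjOn (M.refMap D k t K) (refSimplex d) := by
  intro l hl l' hl' hll
  have h1 := hM.regular.lower t ht K l hl l' hl'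
  rw [hll, dist_self, mul_zero] at h1
  have h2 : dist l l' ≤ 0 := by
    by_contra hcon
    have := mul_pos hM.h_pos (not_le.1 hcon)
    linarith
  exact dist_le_zero.1 h2

theorem refInv_refMap (hM : M.Standing D k T κ h) {t : ℝ} (ht : t ∈ Icc 0 T) (K : M.Elt)
    {l : Fin (d + 1) → ℝ} (hl : l ∈ refSimplex d) :
    M.refInv D k t K (M.refMap D k t K l) = l :=
  (hM.refMap_injOn ht K).leftInvOn_invFunOn hl

theorem refInv_mem {t : ℝ} {K : M.Elt} {x : Space d} (hx : x ∈ M.elt D k t K) :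
    M.refInv D k t K x ∈ refSimplex d := Function.invFunOn_mem hx

theorem refMap_mem_elt {t : ℝ} {K : M.Elt} {l : Fin (d + 1) → ℝ} (hl : l ∈ refSimplex d) :
    M.refMap D k t K l ∈ M.elt D k t K := mem_image_of_mem _ hl

theorem refMap_refNode (hM : M.Standing D k T κ h) (t : ℝ) (K : M.Elt) {β : Fin (d + 1) → ℕ}
    (hβ : β ∈ nodeIdx d k) : M.refMap D k t K (refNode k β) = M.node D k t K β := by
  rw [Mesh.refMap, Finset.sum_eq_single β]
  · rw [lagr_refNode hM.one_le hβ hβ, if_pos rfl, one_smul]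
  · intro γ hγ hne
    rw [lagr_refNode hM.one_le hγ hβ, if_neg hne.symm, zero_smul]
  · exact fun h => absurd hβ h

theorem straight_single (K : M.Elt) (a : Fin (d + 1)) :
    M.straight K (Pi.single a 1) = M.vert K a := by
  rw [Mesh.straight, Finset.sum_eq_single a]
  · simp
  · intro b _ hb
    simp [hb]
  · simp

/-- The curved initial parametrisations of two elements agree on their common face. -/
theorem psi_eq_of_label_eq (hM : M.Standing D k T κ h) {K K' : M.Elt} {l l' : Fin (d + 1) → ℝ}
    (hl : label (M.vert K) l = label (M.vert K') l') : M.psi D k K l = M.psi D k K' l' := by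
  classical
  have he := hM.vert_injective K
  have he' := hM.vert_injective K'
  have hvert : ∀ K : M.Elt, ∀ a ∈ M.ifaceVerts D K, M.straight K (Pi.single a 1) ∈ D.Γ 0 := by
    intro K a ha
    rw [straight_single]
    exact (Finset.mem_filter.1 ha).2
  -- a sum over the vertices only depends on the coordinates as a function of the vertex
  have hsum : ∀ {V : Type} [AddCommMonoid V] (F : ℝ → Space d → V), (∀ z, F 0 z = 0) →
      ∑ a, F (l a) (M.vert K a) = ∑ a, F (l' a) (M.vert K' a) := by
    intro V _ F hF
    have := sum_comp_eq_of_injective he he' (fun z => F (label (M.vert K) l z) z)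
      (fun z hz => by rw [label_of_notMem _ hz, hF])
      (fun z hz => by rw [hl, label_of_notMem _ hz, hF])
    simp only [label_apply he] at this
    rw [this, hl]
    simp only [label_apply he']
  have h1 : M.straight K l = M.straight K' l' := hsum (fun r z => r • z) fun z => zero_smul _ z
  have hμ' : ∀ (K : M.Elt) l, muTilde (M.ifaceVerts D K) l =
      ∑ a, if M.vert K a ∈ D.Γ 0 then l a else 0 := by
    intro K l
    rw [muTilde, Mesh.ifaceVerts, Finset.sum_filter]
  have h2 : muTilde (M.ifaceVerts D K) l = muTilde (M.ifaceVerts D K') l' := by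
    rw [hμ', hμ']
    exact hsum (fun r z => if z ∈ D.Γ 0 then r else 0) fun z => by simp
  have hy' : ∀ (K : M.Elt) l, M.straight K (yTilde (M.ifaceVerts D K) l) =
      ∑ a, (if M.vert K a ∈ D.Γ 0 then l a / muTilde (M.ifaceVerts D K) l else 0) • M.vert K a := by
    intro K l
    simp [Mesh.straight, yTilde, Mesh.ifaceVerts]
  have h3 : M.straight K (yTilde (M.ifaceVerts D K) l) =
      M.straight K' (yTilde (M.ifaceVerts D K') l') := by
    rw [hy', hy', h2]
    exact hsum (fun r z => (if z ∈ D.Γ 0 then r / muTilde (M.ifaceVerts D K') l' else 0) • z)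
      fun z => by simp
  rw [Mesh.psi, Mesh.psi, projCorrect_eq (hvert K), projCorrect_eq (hvert K'), h1, h2, h3]

theorem label_refNode_eq (hM : M.Standing D k T κ h) {K K' : M.Elt} {β β' : Fin (d + 1) → ℕ}
    (hβ : label (M.vert K) β = label (M.vert K') β') :
    label (M.vert K) (refNode k β) = label (M.vert K') (refNode k β') := by
  funext z
  rw [label_refNode (hM.vert_injective K), label_refNode (hM.vert_injective K'), hβ]

/-- Common nodes of two elements move together, across the interface too, where the two flows
agree. -/
theorem node_eq_of_label_eq (hM : M.Standing D k T κ h) {t : ℝ} (ht : t ∈ Icc 0 T) {K K' : M.Elt}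
    {β β' : Fin (d + 1) → ℕ} (hβm : β ∈ nodeIdx d k) (hβm' : β' ∈ nodeIdx d k)
    (hβ : label (M.vert K) β = label (M.vert K') β') :
    M.node D k t K β = M.node D k t K' β' := by
  have hψ : M.psi D k K (refNode k β) = M.psi D k K' (refNode k β') :=
    hM.psi_eq_of_label_eq (hM.label_refNode_eq hβ)
  have h1 := hM.regular.node_mem K β hβm
  have h2 := hM.regular.node_mem K' β' hβm'
  rw [Mesh.node, Mesh.node, ← hψ]
  rw [← hψ] at h2
  generalize M.psi D k K (refNode k β) = p at h1 h2
  obtain ⟨i, j⟩ := K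
  obtain ⟨i', j'⟩ := K'
  simp only at h1 h2 ⊢
  have key : ∀ p ∈ closure (D.Om 0 0), p ∈ closure (D.Om 1 0) → D.Φ 0 t p = D.Φ 1 t p :=
    fun p hp hp' => hM.adm.flow_eq_of_mem_interface ht
      (hM.adm.mem_interface_of_mem_closure hM.zero_mem hp hp')
  fin_cases i <;> fin_cases i'
  · rfl
  · exact key p h1 h2
  · exact (key p h2 h1).symm
  · rfl

theorem node_mem_elt_iff (hM : M.Standing D k T κ h) {t : ℝ} (ht : t ∈ Icc 0 T) {K K' : M.Elt}
    (β : nodeIdx d k) : M.node D k t K β.1 ∈ M.elt D k t K' ↔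
      ∃ β' : nodeIdx d k, label (M.vert K) β.1 = label (M.vert K') β'.1 := by
  have hk0 : (k : ℝ) ≠ 0 := by
    have := hM.one_le
    positivity
  have he := hM.vert_injective K
  have he' := hM.vert_injective K'
  constructor
  · rintro ⟨l', hl', hx⟩
    rw [← hM.refMap_refNode t K β.2] at hx
    have hlab : label (M.vert K) (refNode k β.1) = label (M.vert K') l' :=
      funext (hM.regular.conforming t ht K K' _ (refNode_mem hM.one_le β.2) l' hl' hx.symm)
    have h1 : ∀ z ∉ range (M.vert K'), label (M.vert K) β.1 z = 0 := by
      intro z hz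
      have h2 := congrFun hlab z
      rw [label_of_notMem _ hz, label_refNode he, div_eq_zero_iff] at h2
      exact_mod_cast h2.resolve_right hk0
    have h2 := exists_label_eq he' h1
    exact ⟨⟨_, mem_nodeIdx.2 ((sum_eq_of_label_eq he he' h2.symm).symm.trans
      (mem_nodeIdx.1 β.2))⟩, h2.symm⟩
  · rintro ⟨β', hβ'⟩
    rw [hM.node_eq_of_label_eq ht β.2 β'.2 hβ', ← hM.refMap_refNode t K' β'.2]
    exact refMap_mem_elt (refNode_mem hM.one_le β'.2)

theorem fn_refMap (hM : M.Standing D k T κ h) {t : ℝ} (ht : t ∈ Icc 0 T) (c : M.Coef k) (K : M.Elt)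
    {l : Fin (d + 1) → ℝ} (hl : l ∈ refSimplex d) :
    M.fn D k t c K (M.refMap D k t K l) = ∑ β, c K β * lagr k β.1 l := by
  rw [Mesh.fn, indicator_of_mem (refMap_mem_elt hl), hM.refInv_refMap ht K hl]

theorem fn_node (hM : M.Standing D k T κ h) {t : ℝ} (ht : t ∈ Icc 0 T) (c : M.Coef k) (K : M.Elt)
    (β : nodeIdx d k) : M.fn D k t c K (M.node D k t K β.1) = c K β := by
  rw [← hM.refMap_refNode t K β.2, hM.fn_refMap ht c K (refNode_mem hM.one_le β.2),
    Finset.sum_eq_single β]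
  · rw [lagr_refNode hM.one_le β.2 β.2, if_pos rfl, mul_one]
  · intro γ _ hne
    rw [lagr_refNode hM.one_le γ.2 β.2, if_neg fun h => hne (Subtype.ext h.symm), mul_zero]
  · simp

theorem node_mem_frontier_iff (hM : M.Standing D k T κ h) {t : ℝ} (ht : t ∈ Icc 0 T)
    {K : M.Elt} (hK : K.1 = 1) (β : nodeIdx d k) :
    M.node D k t K β.1 ∈ frontier D.Ω ↔ M.psi D k K (refNode k β.1) ∈ frontier D.Ω := by
  have h1 := hM.regular.node_mem K β.1 β.2
  rw [Mesh.node]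
  rw [hK] at h1 ⊢
  exact hM.adm.flow_mem_frontier_iff ht h1

/-- The finite element functions at time `t` are those with admissible nodal coefficients, and the
space of admissible coefficients does not depend on time. -/
theorem memS_iff (hM : M.Standing D k T κ h) {t : ℝ} (ht : t ∈ Icc 0 T) (v : M.Fun) :
    M.MemS D k t v ↔ ∃ c ∈ M.nodal D k, v = M.fn D k t c := by
  constructor
  · intro hv
    refine ⟨fun K β => v K (M.node D k t K β.1), ⟨fun K K' β β' hβ => ?_, fun K β hK hβ => ?_⟩, ?_⟩
    · have hn := hM.node_eq_of_label_eq ht β.2 β'.2 hβ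
      have h1 : M.node D k t K β.1 ∈ M.elt D k t K' := (hM.node_mem_elt_iff ht β).2 ⟨β', hβ⟩
      have h2 : M.node D k t K' β'.1 ∈ M.elt D k t K := (hM.node_mem_elt_iff ht β').2 ⟨β, hβ.symm⟩
      obtain ⟨i, j⟩ := K
      obtain ⟨i', j'⟩ := K'
      simp only
      fin_cases i <;> fin_cases i'
      · rw [← hn]; exact hv.nodal 0 j j' β.1 β.2 h1
      · rw [← hn]; exact hv.interface j j' β.1 β.2 h1
      · rw [hn]; exact (hv.interface j' j β'.1 β'.2 h2).symm
      · rw [← hn]; exact hv.nodal 1 j j' β.1 β.2 h1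
    · have h1 := (hM.node_mem_frontier_iff ht hK β).2 hβ
      obtain ⟨i, j⟩ := K
      simp only at hK
      subst hK
      exact hv.boundary j β.1 β.2 h1
    · funext K x
      obtain ⟨p, hp, hvp⟩ := hv.polynomial K
      have hnode : ∀ β : nodeIdx d k, v K (M.node D k t K β.1) =
          MvPolynomial.eval (refNode k β.1) p := by
        intro β
        have hm := refNode_mem hM.one_le β.2
        rw [hvp, ← hM.refMap_refNode t K β.2, indicator_of_mem (refMap_mem_elt hm),
          hM.refInv_refMap ht K hm]
      simp only [Mesh.fn, hnode]
      rw [hvp]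
      by_cases hx : x ∈ M.elt D k t K
      · rw [indicator_of_mem hx, indicator_of_mem hx, eval_eq_sum_lagr hM.one_le hp
          (refInv_mem hx).2, ← Finset.sum_coe_sort]
      · rw [indicator_of_notMem hx, indicator_of_notMem hx]
  · rintro ⟨c, ⟨hc, hc'⟩, rfl⟩
    have key : ∀ K K' : M.Elt, ∀ β ∈ nodeIdx d k, M.node D k t K β ∈ M.elt D k t K' →
        M.fn D k t c K (M.node D k t K β) = M.fn D k t c K' (M.node D k t K β) := by
      intro K K' β hβ hm
      obtain ⟨β', hβ'⟩ := (hM.node_mem_elt_iff ht ⟨β, hβ⟩).1 hm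
      rw [hM.fn_node ht c K ⟨β, hβ⟩, hM.node_eq_of_label_eq ht hβ β'.2 hβ', hM.fn_node ht c K' β']
      exact hc K K' ⟨β, hβ⟩ β' hβ'
    refine ⟨fun K => ?_, fun i j j' β hβ hm => key _ _ β hβ hm,
      fun j j' β hβ hm => key _ _ β hβ hm, fun j β hβ hm => ?_⟩
    · refine ⟨∑ β : nodeIdx d k, MvPolynomial.C (c K β) * lagrPoly k β.1, ?_, ?_⟩
      · refine (MvPolynomial.totalDegree_finsetSum _ _).trans (Finset.sup_le fun β _ => ?_)
        refine (MvPolynomial.totalDegree_mul _ _).trans ?_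
        rw [MvPolynomial.totalDegree_C, zero_add]
        exact totalDegree_lagrPoly_le β.2
      · simp only [Mesh.fn, map_sum, map_mul, MvPolynomial.eval_C, eval_lagrPoly]
    · rw [hM.fn_node ht c ⟨1, j⟩ ⟨β, hβ⟩]
      exact hc' ⟨1, j⟩ ⟨β, hβ⟩ rfl ((hM.node_mem_frontier_iff ht rfl ⟨β, hβ⟩).1 hm)

theorem fn_eq_of_mem (hM : M.Standing D k T κ h) {t : ℝ} (ht : t ∈ Icc 0 T) {c : M.Coef k}
    (hc : c ∈ M.nodal D k) {K K' : M.Elt} {x : Space d} (hx : x ∈ M.elt D k t K)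
    (hx' : x ∈ M.elt D k t K') : M.fn D k t c K x = M.fn D k t c K' x := by
  obtain ⟨l, hl, rfl⟩ := hx
  obtain ⟨l', hl', hll⟩ := hx'
  rw [hM.fn_refMap ht c K hl, ← hll, hM.fn_refMap ht c K' hl']
  exact sum_lagr_eq_of_label_eq (hM.vert_injective K) (hM.vert_injective K')
    (funext (hM.regular.conforming t ht K K' l hl l' hl' hll.symm)) (hc.1 K K')

end Standing

end Mesh

/-! ### The reference simplex in Cartesian coordinates -/

/-- The reference simplex in `ℝ^d`, parametrising `refSimplex d` by all barycentric coordinates but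
the first. -/
def refTri (d : ℕ) : Set (Space d) := {y | (∀ a, 0 ≤ y a) ∧ ∑ a, y a ≤ 1}

/-- The barycentric coordinates of a point of `ℝ^d` with respect to the reference simplex. -/
def bary {d : ℕ} (y : Space d) : Fin (d + 1) → ℝ := Fin.cons (1 - ∑ a, y a) fun a => y a

theorem sum_bary {d : ℕ} (y : Space d) : ∑ a, bary y a = 1 := by
  simp [bary, Fin.sum_univ_succ]

theorem bary_mem {d : ℕ} {y : Space d} (hy : y ∈ refTri d) : bary y ∈ refSimplex d := by
  refine ⟨fun a => ?_, sum_bary y⟩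
  refine Fin.cases ?_ (fun a => ?_) a
  · simpa [bary] using hy.2
  · simpa [bary] using hy.1 a

theorem bary_image (d : ℕ) : bary '' refTri d = refSimplex d := by
  refine Subset.antisymm (image_subset_iff.2 fun y hy => bary_mem hy) fun l hl => ?_
  have hs : l 0 + ∑ a : Fin d, l a.succ = 1 := by rw [← Fin.sum_univ_succ]; exact hl.2
  refine ⟨WithLp.toLp 2 fun a => l a.succ, ⟨fun a => hl.1 _, ?_⟩, ?_⟩
  · have := hl.1 0
    simp only
    linarith
  · funext a
    refine Fin.cases ?_ (fun a => ?_) a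
    · simp only [bary, Fin.cons_zero]
      linarith
    · simp [bary]

theorem dist_le_dist_bary {d : ℕ} (hd : 1 ≤ d) (y y' : Space d) :
    dist y y' ≤ d * dist (bary y) (bary y') := by
  have hd' : (1 : ℝ) ≤ d := by exact_mod_cast hd
  have hcomp : ∀ a, dist (y a) (y' a) ≤ dist (bary y) (bary y') := by
    intro a
    have := dist_le_pi_dist (bary y) (bary y') a.succ
    simpa [bary] using this
  rw [EuclideanSpace.dist_eq]
  refine Real.sqrt_le_iff.2 ⟨by positivity, ?_⟩
  calc ∑ a, dist (y a) (y' a) ^ 2 ≤ ∑ _a : Fin d, dist (bary y) (bary y') ^ 2 := by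
        refine Finset.sum_le_sum fun a _ => ?_
        gcongr
        exact hcomp a
    _ = d * dist (bary y) (bary y') ^ 2 := by simp
    _ ≤ (d * dist (bary y) (bary y')) ^ 2 := by
        rw [mul_pow]
        gcongr
        nlinarith

theorem convex_refTri (d : ℕ) : Convex ℝ (refTri d) := by
  rintro x ⟨hx, hx'⟩ y ⟨hy, hy'⟩ a b ha hb hab
  refine ⟨fun i => ?_, ?_⟩
  · simp only [PiLp.add_apply, PiLp.smul_apply, smul_eq_mul]
    exact add_nonneg (mul_nonneg ha (hx i)) (mul_nonneg hb (hy i))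
  · simp only [PiLp.add_apply, PiLp.smul_apply, smul_eq_mul, Finset.sum_add_distrib,
      ← Finset.mul_sum]
    nlinarith

theorem isClosed_refTri (d : ℕ) : IsClosed (refTri d) := by
  refine IsClosed.and ?_ ?_
  · have : {y : Space d | ∀ a, 0 ≤ y a} = ⋂ a, {y | 0 ≤ y a} := by ext; simp
    rw [this]
    exact isClosed_iInter fun a => isClosed_le continuous_const (by fun_prop)
  · exact isClosed_le (by fun_prop) continuous_const

theorem isCompact_refTri (d : ℕ) : IsCompact (refTri d) := by
  rcases Nat.eq_zero_or_pos d with rfl | hd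
  · exact (subsingleton_of_subsingleton (s := refTri 0)).isCompact
  refine Metric.isCompact_of_isClosed_isBounded (isClosed_refTri d) ?_
  refine Metric.isBounded_iff.2 ⟨d * 2, fun y hy y' hy' => ?_⟩
  refine (dist_le_dist_bary hd y y').trans ?_
  gcongr
  refine (dist_pi_le_iff (by norm_num)).2 fun a => ?_
  have h1 := bary_mem hy
  have h2 := bary_mem hy'
  have hle : ∀ l ∈ refSimplex d, l a ≤ 1 := fun l hl =>
    hl.2 ▸ Finset.single_le_sum (fun b _ => hl.1 b) (Finset.mem_univ a)
  rw [Real.dist_eq, abs_le]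
  constructor <;> linarith [h1.1 a, h2.1 a, hle _ h1, hle _ h2]

theorem interior_refTri_nonempty (d : ℕ) : (interior (refTri d)).Nonempty := by
  have hopen : IsOpen {y : Space d | (∀ a, 0 < y a) ∧ ∑ a, y a < 1} := by
    refine IsOpen.and ?_ (isOpen_lt (by fun_prop) continuous_const)
    have : {y : Space d | ∀ a, 0 < y a} = ⋂ a, {y | 0 < y a} := by ext; simp
    rw [this]
    exact isOpen_iInter_of_finite fun a => isOpen_lt continuous_const (by fun_prop)
  refine ⟨WithLp.toLp 2 fun _ => ((d : ℝ) + 1)⁻¹, mem_interior.2 ⟨_, ?_, hopen, ?_, ?_⟩⟩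
  · exact fun y hy => ⟨fun a => (hy.1 a).le, hy.2.le⟩
  · intro a
    positivity
  · simp only [Finset.sum_const, Finset.card_univ, Fintype.card_fin, nsmul_eq_mul]
    rw [mul_inv_lt_iff₀ (by positivity)]
    linarith

theorem closure_interior_refTri (d : ℕ) : closure (interior (refTri d)) = refTri d := by
  rw [(convex_refTri d).closure_interior_eq_closure_of_nonempty_interior
    (interior_refTri_nonempty d), (isClosed_refTri d).closure_eq]

theorem volume_refTri_diff_interior (d : ℕ) : volume (refTri d \ interior (refTri d)) = 0 := by
  have := (convex_refTri d).addHaar_frontier volume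
  rwa [(isClosed_refTri d).frontier_eq] at this

theorem bary_pos_of_mem_interior {d : ℕ} (hd : 1 ≤ d) {y : Space d} (hy : y ∈ interior (refTri d))
    (a : Fin (d + 1)) : 0 < bary y a := by
  -- moving from `y` in the direction of decrease of a coordinate stays in the simplex
  obtain ⟨v, hv⟩ : ∃ v : Space d, ∀ s : ℝ, bary (y + s • v) a = bary y a - s := by
    refine Fin.cases ?_ (fun a => ?_) a
    · refine ⟨EuclideanSpace.single ⟨0, hd⟩ 1, fun s => ?_⟩
      simp [bary, Finset.sum_add_distrib, sub_sub]
    · refine ⟨-EuclideanSpace.single a 1, fun s => ?_⟩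
      simp [bary, sub_eq_add_neg]
  have hc : Tendsto (fun s : ℝ => y + s • v) (𝓝 0) (𝓝 y) := by
    have : Continuous fun s : ℝ => y + s • v := by fun_prop
    simpa using this.tendsto 0
  have h1 : ∀ᶠ s : ℝ in 𝓝 0, y + s • v ∈ refTri d :=
    hc (mem_interior_iff_mem_nhds.1 hy)
  obtain ⟨ε, hε, h2⟩ := Metric.eventually_nhds_iff.1 h1
  have h3 := (bary_mem (h2 (y := ε / 2) (by simp [abs_of_pos hε, hε]))).1 a
  rw [hv] at h3
  linarith

/-! ### Lagrange interpolation of nodal values -/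

/-- The polynomial of degree `k` on `ℝ^d` with nodal values `a` on the reference simplex. -/
def interp {d : ℕ} (k : ℕ) {V : Type*} [NormedAddCommGroup V] [NormedSpace ℝ V]
    (a : nodeIdx d k → V) (y : Space d) : V := ∑ β, lagr k β.1 (bary y) • a β

/-- The derivative of `interp k a`. -/
def dinterp {d : ℕ} (k : ℕ) {V : Type*} [NormedAddCommGroup V] [NormedSpace ℝ V]
    (a : nodeIdx d k → V) (y : Space d) : Space d →L[ℝ] V :=
  ∑ β : nodeIdx d k, (fderiv ℝ (fun y : Space d => lagr k β.1 (bary y)) y).smulRight (a β)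

section Interp

variable {d k : ℕ} {V : Type*} [NormedAddCommGroup V] [NormedSpace ℝ V]

theorem contDiff_bary (d : ℕ) : ContDiff ℝ ⊤ (bary (d := d)) := by
  refine contDiff_pi.2 fun a => ?_
  refine Fin.cases ?_ (fun a => ?_) a
  · simp only [bary, Fin.cons_zero]
    fun_prop
  · simp only [bary, Fin.cons_succ]
    fun_prop

theorem contDiff_shape (k : ℕ) (β : Fin (d + 1) → ℕ) :
    ContDiff ℝ ⊤ fun y : Space d => lagr k β (bary y) :=
  (contDiff_lagr k β).comp (contDiff_bary d)

theorem continuous_fderiv_shape (k : ℕ) (β : Fin (d + 1) → ℕ) :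
    Continuous fun y : Space d => fderiv ℝ (fun y : Space d => lagr k β (bary y)) y :=
  (contDiff_shape k β).continuous_fderiv (by simp)

theorem hasStrictFDerivAt_interp (a : nodeIdx d k → V) (y : Space d) :
    HasStrictFDerivAt (interp k a) (dinterp k a y) y := by
  refine HasStrictFDerivAt.fun_sum fun β _ => ?_
  have := ((contDiff_shape k β.1).contDiffAt (x := y)).hasStrictFDerivAt (by simp)
  exact this.smul_const (a β)

theorem continuousOn_interp {I : Set ℝ} {a : ℝ → nodeIdx d k → V}
    (ha : ∀ β, ContinuousOn (fun t => a t β) I) :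
    ContinuousOn (fun q : ℝ × Space d => interp k (a q.1) q.2) (I ×ˢ univ) := by
  refine continuousOn_finsetSum _ fun β _ => ContinuousOn.smul ?_ ?_
  · exact ((contDiff_shape k β.1).continuous.comp continuous_snd).continuousOn
  · exact (ha β).comp continuousOn_fst fun q hq => hq.1

theorem continuousOn_dinterp {I : Set ℝ} {a : ℝ → nodeIdx d k → V}
    (ha : ∀ β, ContinuousOn (fun t => a t β) I) :
    ContinuousOn (fun q : ℝ × Space d => dinterp k (a q.1) q.2) (I ×ˢ univ) := by
  refine continuousOn_finsetSum _ fun β _ => ?_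
  have h1 : ContinuousOn (fun q : ℝ × Space d =>
      fderiv ℝ (fun y : Space d => lagr k β.1 (bary y)) q.2) (I ×ˢ univ) :=
    ((continuous_fderiv_shape k β.1).comp continuous_snd).continuousOn
  have h2 : ContinuousOn (fun q : ℝ × Space d => a q.1 β) (I ×ˢ univ) :=
    (ha β).comp continuousOn_fst fun q hq => hq.1
  exact ((ContinuousLinearMap.smulRightL ℝ (Space d) V).continuous₂.comp_continuousOn
    (h1.prodMk h2))

theorem hasDerivWithinAt_dinterp {I : Set ℝ} {a : ℝ → nodeIdx d k → V} {a' : nodeIdx d k → V}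
    {t : ℝ} (ha : ∀ β, HasDerivWithinAt (fun t => a t β) (a' β) I t) (y : Space d) :
    HasDerivWithinAt (fun t => dinterp k (a t) y) (dinterp k a' y) I t := by
  refine HasDerivWithinAt.fun_sum fun β _ => ?_
  exact ((ContinuousLinearMap.smulRightL ℝ (Space d) V
    (fderiv ℝ (fun y : Space d => lagr k β.1 (bary y)) y)).hasFDerivAt.comp_hasDerivWithinAt t
    (ha β))

theorem interp_add (a b : nodeIdx d k → V) (y : Space d) :
    interp k (a + b) y = interp k a y + interp k b y := by
  simp [interp, Finset.sum_add_distrib]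

theorem dinterp_add (a b : nodeIdx d k → V) (y : Space d) :
    dinterp k (a + b) y = dinterp k a y + dinterp k b y := by
  ext v
  simp [dinterp, Finset.sum_add_distrib]

theorem interp_smul (r : ℝ) (a : nodeIdx d k → V) (y : Space d) :
    interp k (r • a) y = r • interp k a y := by
  simp [interp, Finset.smul_sum, smul_comm r]

theorem dinterp_smul (r : ℝ) (a : nodeIdx d k → V) (y : Space d) :
    dinterp k (r • a) y = r • dinterp k a y := by
  ext v
  simp [dinterp, Finset.smul_sum, smul_comm r]

/-- The interpolant of a constant is constant. -/
theorem dinterp_const (hk : 1 ≤ k) (b : V) (y : Space d) :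
    dinterp k (fun _ : nodeIdx d k => b) y = 0 := by
  have h1 : interp k (fun _ : nodeIdx d k => b) = fun _ : Space d => b := by
    funext y
    rw [interp, ← Finset.sum_smul, Finset.sum_coe_sort (nodeIdx d k) fun β => lagr k β (bary y),
      sum_lagr_eq_one hk (sum_bary y), one_smul]
  have h2 := (hasStrictFDerivAt_interp (fun _ : nodeIdx d k => b) y).hasFDerivAt
  rw [h1] at h2
  exact h2.unique (hasFDerivAt_const b y)

/-- Interpolation and its derivative are bounded operators on the nodal values, by compactness of
the simplex. -/
theorem exists_norm_interp_le (d k : ℕ) : ∃ C : ℝ, 0 ≤ C ∧ ∀ {V : Type} [NormedAddCommGroup V]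
    [NormedSpace ℝ V] (a : nodeIdx d k → V) (b : ℝ), (∀ β, ‖a β‖ ≤ b) → ∀ y ∈ refTri d,
      ‖interp k a y‖ ≤ C * b ∧ ‖dinterp k a y‖ ≤ C * b := by
  have h1 : ∀ β : nodeIdx d k, ∃ C : ℝ, 0 ≤ C ∧ ∀ y ∈ refTri d, ‖lagr k β.1 (bary y)‖ ≤ C ∧
      ‖fderiv ℝ (fun y : Space d => lagr k β.1 (bary y)) y‖ ≤ C := by
    intro β
    obtain ⟨C₁, hC₁⟩ := (isCompact_refTri d).exists_bound_of_continuousOn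
      (contDiff_shape k β.1).continuous.continuousOn
    obtain ⟨C₂, hC₂⟩ := (isCompact_refTri d).exists_bound_of_continuousOn
      (continuous_fderiv_shape k β.1).continuousOn
    exact ⟨max 0 (max C₁ C₂), le_max_left _ _, fun y hy =>
      ⟨(hC₁ y hy).trans ((le_max_left _ _).trans (le_max_right _ _)),
      (hC₂ y hy).trans ((le_max_right _ _).trans (le_max_right _ _))⟩⟩
  choose C hC0 hC using h1
  refine ⟨∑ β, C β, Finset.sum_nonneg fun β _ => hC0 β, fun {V} _ _ a b hb y hy => ⟨?_, ?_⟩⟩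
  · refine (norm_sum_le _ _).trans ?_
    rw [Finset.sum_mul]
    refine Finset.sum_le_sum fun β _ => ?_
    rw [norm_smul]
    exact mul_le_mul (hC β y hy).1 (hb β) (norm_nonneg _) (hC0 β)
  · refine (norm_sum_le _ _).trans ?_
    rw [Finset.sum_mul]
    refine Finset.sum_le_sum fun β _ => ?_
    rw [ContinuousLinearMap.norm_smulRight_apply]
    exact mul_le_mul (hC β y hy).2 (hb β) (norm_nonneg _) (hC0 β)

end Interp

/-! ### Expansion of distances and derivatives -/

theorem le_norm_fderiv_apply {E F : Type*} [NormedAddCommGroup E] [NormedSpace ℝ E]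
    [NormedAddCommGroup F] [NormedSpace ℝ F] {f : E → F} {f' : E →L[ℝ] F} {y : E}
    (hf : HasFDerivAt f f' y) {c : ℝ} (h : ∀ᶠ x in 𝓝 y, c * ‖x - y‖ ≤ ‖f x - f y‖) (v : E) :
    c * ‖v‖ ≤ ‖f' v‖ := by
  have hline : HasDerivAt (fun s : ℝ => y + s • v) v 0 := by
    simpa using ((hasDerivAt_id (0 : ℝ)).smul_const v).const_add y
  have h1 : HasDerivAt (fun s : ℝ => f (y + s • v)) (f' v) 0 := by
    have hf' : HasFDerivAt f f' (y + (0 : ℝ) • v) := by simpa using hf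
    exact hf'.comp_hasDerivAt 0 hline
  have h2 := h1.tendsto_slope.norm
  have hc : Tendsto (fun s : ℝ => y + s • v) (𝓝[≠] 0) (𝓝 y) := by
    have := hline.continuousAt.tendsto.mono_left (nhdsWithin_le_nhds (s := {0}ᶜ))
    simpa using this
  refine ge_of_tendsto h2 ?_
  filter_upwards [hc.eventually h, self_mem_nhdsWithin] with s hs hs0
  have hs0' : (0 : ℝ) < |s| := abs_pos.2 hs0
  rw [slope_def_module, norm_smul, sub_zero, norm_inv, Real.norm_eq_abs, zero_smul, add_zero,
    inv_mul_eq_div, le_div_iff₀ hs0']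
  rw [add_sub_cancel_left, norm_smul, Real.norm_eq_abs] at hs
  linarith

/-- The derivative of the determinant at the identity is the trace. -/
theorem hasDerivWithinAt_matrix_det {n : Type*} [Fintype n] [DecidableEq n] {I : Set ℝ} {t : ℝ}
    {A : ℝ → Matrix n n ℝ} {A' : Matrix n n ℝ}
    (hA : ∀ i j, HasDerivWithinAt (fun s => A s i j) (A' i j) I t) (h1 : A t = 1) :
    HasDerivWithinAt (fun s => (A s).det) A'.trace I t := by
  have h : HasDerivWithinAt (fun s => ∑ σ : Equiv.Perm n, ((Equiv.Perm.sign σ : ℤ) : ℝ) *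
      ∏ i, A s (σ i) i) (∑ σ : Equiv.Perm n, ((Equiv.Perm.sign σ : ℤ) : ℝ) *
      ∑ i, (∏ j ∈ Finset.univ.erase i, A t (σ j) j) • A' (σ i) i) I t :=
    HasDerivWithinAt.fun_sum fun σ _ =>
      (HasDerivWithinAt.fun_finsetProd fun i _ => hA (σ i) i).const_mul _
  simp only [Matrix.det_apply']
  convert h using 1
  rw [Finset.sum_eq_single 1]
  · simp [h1, Matrix.trace]
  · intro σ _ hσ
    rw [Finset.sum_eq_zero, mul_zero]
    intro i _
    -- a permutation other than the identity moves an index different from `i`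
    obtain ⟨j, hji, hj⟩ : ∃ j, j ≠ i ∧ σ j ≠ j := by
      by_cases hi : σ i = i
      · obtain ⟨j, hj⟩ : ∃ j, σ j ≠ j := by
          by_contra hcon
          push Not at hcon
          exact hσ (Equiv.ext hcon)
        exact ⟨j, fun h => hj (h ▸ hi), hj⟩
      · exact ⟨σ i, hi, fun h => hi (σ.injective h)⟩
    rw [Finset.prod_eq_zero (Finset.mem_erase.2 ⟨hji, Finset.mem_univ j⟩), zero_smul]
    rw [h1, Matrix.one_apply_ne hj]
  · simp

/-- Jacobi's formula along a differentiable curve of invertible maps, with an absolute value: after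
composition with the inverse `R` at time `t` the curve passes through the identity. -/
theorem hasDerivWithinAt_abs_det {d : ℕ} {A : ℝ → Space d →L[ℝ] Space d}
    {A' R : Space d →L[ℝ] Space d} {I : Set ℝ} {t : ℝ} (hA : HasDerivWithinAt A A' I t)
    (hR : (A t).comp R = ContinuousLinearMap.id ℝ _)
    (hR' : R.comp (A t) = ContinuousLinearMap.id ℝ _) :
    HasDerivWithinAt (fun s => |(A s).det|)
      (|(A t).det| * LinearMap.trace ℝ (Space d) (A'.comp R : Space d →L[ℝ] Space d)) I t := by
  let b := (EuclideanSpace.basisFun (Fin d) ℝ).toBasis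
  have hB : HasDerivWithinAt (fun s => (A s).comp R) (A'.comp R) I t := by
    simpa using hA.clm_comp (hasDerivWithinAt_const t I R)
  have hdet : HasDerivWithinAt (fun s => ((A s).comp R).det)
      (LinearMap.trace ℝ (Space d) (A'.comp R : Space d →L[ℝ] Space d)) I t := by
    have h1 := hasDerivWithinAt_matrix_det (I := I) (t := t)
      (A := fun s => LinearMap.toMatrix b b ((A s).comp R : Space d →L[ℝ] Space d))
      (A' := LinearMap.toMatrix b b (A'.comp R : Space d →L[ℝ] Space d)) (fun i j => by
        simp only [LinearMap.toMatrix_apply]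
        have h2 := hB.clm_apply (hasDerivWithinAt_const t I (b j))
        have h3 := (EuclideanSpace.proj (𝕜 := ℝ) i).hasFDerivAt.comp_hasDerivWithinAt t h2
        simpa [b, Function.comp_def] using h3)
      (by
        simp only [hR]
        exact LinearMap.toMatrix_one b)
    rw [LinearMap.trace_eq_matrix_trace ℝ b]
    simpa only [LinearMap.det_toMatrix] using h1
  have hmul : ∀ s, (A s).det = ((A s).comp R).det * (A t).det := by
    intro s
    have : A s = ((A s).comp R).comp (A t) := by
      rw [ContinuousLinearMap.comp_assoc, hR', ContinuousLinearMap.comp_id]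
    conv_lhs => rw [this]
    exact LinearMap.det_comp _ _
  have hone : ((A t).comp R).det = 1 := by
    rw [hR]
    exact LinearMap.det_id
  have habs : HasDerivWithinAt (fun s => |((A s).comp R).det|)
      (LinearMap.trace ℝ (Space d) (A'.comp R : Space d →L[ℝ] Space d)) I t := by
    have h2 : HasDerivAt (|·|) (1 : ℝ) (((A t).comp R).det) := by
      have := hasDerivAt_abs (x := ((A t).comp R).det) (by rw [hone]; exact one_ne_zero)
      rw [hone] at this ⊢
      simpa using this
    simpa [Function.comp_def] using h2.comp_hasDerivWithinAt t hdet
  have hfin := habs.mul_const |(A t).det|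
  have e : (fun s => |(A s).det|) = fun s => |((A s).comp R).det| * |(A t).det| := by
    funext s
    rw [← abs_mul, ← hmul]
  rw [e, mul_comm]
  exact hfin

/-! ### Calculus on the moving elements -/

namespace Mesh

/-- The reference map of `K(t)` in Cartesian coordinates of the reference simplex. -/
def par {d : ℕ} (M : Mesh d) (D : Geometry d) (k : ℕ) (t : ℝ) (K : M.Elt) : Space d → Space d :=
  interp k fun β => M.node D k t K β.1

/-- The derivative of `par`. -/
def dpar {d : ℕ} (M : Mesh d) (D : Geometry d) (k : ℕ) (t : ℝ) (K : M.Elt) (y : Space d) :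
    Space d →L[ℝ] Space d := dinterp k (fun β => M.node D k t K β.1) y

/-- The inverse of the derivative of `par`. -/
def dinv {d : ℕ} (M : Mesh d) (D : Geometry d) (k : ℕ) (t : ℝ) (K : M.Elt) (y : Space d) :
    Space d →L[ℝ] Space d := (M.dpar D k t K y).inverse

/-- The Jacobian of the reference map. -/
def jac {d : ℕ} (M : Mesh d) (D : Geometry d) (k : ℕ) (t : ℝ) (K : M.Elt) (y : Space d) : ℝ :=
  |(M.dpar D k t K y).det|

/-- The discrete velocity in reference coordinates. -/
def vel {d : ℕ} (M : Mesh d) (D : Geometry d) (k : ℕ) (t : ℝ) (K : M.Elt) : Space d → Space d :=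
  interp k fun β => D.w t (M.node D k t K β.1)

/-- The derivative of `vel`. -/
def dvel {d : ℕ} (M : Mesh d) (D : Geometry d) (k : ℕ) (t : ℝ) (K : M.Elt) (y : Space d) :
    Space d →L[ℝ] Space d := dinterp k (fun β => D.w t (M.node D k t K β.1)) y

/-- The divergence of the discrete velocity in reference coordinates. -/
def divVel {d : ℕ} (M : Mesh d) (D : Geometry d) (k : ℕ) (t : ℝ) (K : M.Elt) (y : Space d) : ℝ :=
  LinearMap.trace ℝ (Space d)
    ((M.dvel D k t K y).comp (M.dinv D k t K y) : Space d →L[ℝ] Space d)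

/-- The gradient of a finite element function in reference coordinates. -/
def grad {d : ℕ} (M : Mesh d) (D : Geometry d) (k : ℕ) (t : ℝ) (c : M.Coef k) (K : M.Elt)
    (y : Space d) : Space d :=
  (InnerProductSpace.toDual ℝ (Space d)).symm ((dinterp k (c K) y).comp (M.dinv D k t K y))

/-- The lift in reference coordinates. -/
def liftPar {d : ℕ} (M : Mesh d) (D : Geometry d) (k : ℕ) (t : ℝ) (K : M.Elt) (y : Space d) :
    Space d := M.lift D k t K (M.par D k t K y)

namespace Standing

variable {d k : ℕ} {M : Mesh d} {D : Geometry d} {T κ h : ℝ}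

theorem one_le_d (hM : M.Standing D k T κ h) : 1 ≤ d := by
  have := hM.two_le
  omega

theorem par_eq (M : Mesh d) (D : Geometry d) (t : ℝ) (K : M.Elt) (y : Space d) :
    M.par D k t K y = M.refMap D k t K (bary y) := by
  rw [Mesh.par, interp, Mesh.refMap, ← Finset.sum_coe_sort (nodeIdx d k)]

theorem par_image (M : Mesh d) (D : Geometry d) (t : ℝ) (K : M.Elt) :
    M.par D k t K '' refTri d = M.elt D k t K := by
  rw [Mesh.elt, ← bary_image, image_image]
  simp only [par_eq]

theorem par_mem_elt {t : ℝ} {K : M.Elt} {y : Space d} (hy : y ∈ refTri d) :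
    M.par D k t K y ∈ M.elt D k t K := by
  rw [← par_image]
  exact mem_image_of_mem _ hy

theorem node_mem (hM : M.Standing D k T κ h) {t : ℝ} (ht : t ∈ Icc 0 T) (K : M.Elt)
    (β : nodeIdx d k) : M.node D k t K β.1 ∈ closure (D.Om K.1 t) :=
  hM.adm.flow_mem ht K.1 (hM.regular.node_mem K β.1 β.2)

theorem node_hasDerivWithinAt (hM : M.Standing D k T κ h) {t : ℝ} (ht : t ∈ Icc 0 T) (K : M.Elt)
    (β : nodeIdx d k) : HasDerivWithinAt (fun s => M.node D k s K β.1)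
      (D.w t (M.node D k t K β.1)) (Icc 0 T) t :=
  hM.adm.flow_deriv K.1 _ (hM.regular.node_mem K β.1 β.2) t ht

theorem node_continuousOn (hM : M.Standing D k T κ h) (K : M.Elt) (β : nodeIdx d k) :
    ContinuousOn (fun s => M.node D k s K β.1) (Icc 0 T) :=
  fun _ ht => (hM.node_hasDerivWithinAt ht K β).continuousWithinAt

theorem velocity_node_continuousOn (hM : M.Standing D k T κ h) (K : M.Elt) (β : nodeIdx d k) :
    ContinuousOn (fun s => D.w s (M.node D k s K β.1)) (Icc 0 T) :=
  ContinuousOn.comp (g := fun q : ℝ × Space d => D.w q.1 q.2) hM.adm.velocity_continuous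
    (continuousOn_id.prodMk (hM.node_continuousOn K β))
    fun _ ht => ⟨ht, hM.adm.closure_om_subset ht K.1 (hM.node_mem ht K β)⟩

theorem le_dist_par (hM : M.Standing D k T κ h) {t : ℝ} (ht : t ∈ Icc 0 T) (K : M.Elt)
    {y y' : Space d} (hy : y ∈ refTri d) (hy' : y' ∈ refTri d) :
    dist y y' ≤ d * κ / h * dist (M.par D k t K y) (M.par D k t K y') := by
  rw [par_eq, par_eq]
  have h1 := hM.regular.lower t ht K _ (bary_mem hy) _ (bary_mem hy')
  have h2 := dist_le_dist_bary hM.one_le_d y y'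
  have h3 : dist (bary y) (bary y') ≤
      κ / h * dist (M.refMap D k t K (bary y)) (M.refMap D k t K (bary y')) := by
    rw [div_mul_eq_mul_div, le_div_iff₀ hM.h_pos, mul_comm]
    exact h1
  calc dist y y' ≤ d * (κ / h * dist (M.refMap D k t K (bary y)) (M.refMap D k t K (bary y'))) :=
        h2.trans (by gcongr)
    _ = _ := by ring

theorem par_injOn (hM : M.Standing D k T κ h) {t : ℝ} (ht : t ∈ Icc 0 T) (K : M.Elt) :
    InjOn (M.par D k t K) (refTri d) := by
  intro y hy y' hy' hyy
  have := hM.le_dist_par ht K hy hy'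
  rw [hyy, dist_self, mul_zero] at this
  exact dist_le_zero.1 this

theorem hasStrictFDerivAt_par (M : Mesh d) (D : Geometry d) (t : ℝ) (K : M.Elt) (y : Space d) :
    HasStrictFDerivAt (M.par D k t K) (M.dpar D k t K y) y := hasStrictFDerivAt_interp _ _

theorem continuous_dpar (M : Mesh d) (D : Geometry d) (t : ℝ) (K : M.Elt) :
    Continuous (M.dpar D k t K) :=
  continuous_finsetSum _ fun β _ =>
    ((ContinuousLinearMap.smulRightL ℝ (Space d) (Space d)).continuous₂.comp
      ((continuous_fderiv_shape k β.1).prodMk continuous_const))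

theorem norm_le_dpar (hM : M.Standing D k T κ h) {t : ℝ} (ht : t ∈ Icc 0 T) (K : M.Elt)
    {y : Space d} (hy : y ∈ refTri d) (v : Space d) :
    ‖v‖ ≤ d * κ / h * ‖M.dpar D k t K y v‖ := by
  have hclosed : IsClosed {y | ‖v‖ ≤ d * κ / h * ‖M.dpar D k t K y v‖} :=
    isClosed_le continuous_const (continuous_const.mul
      ((continuous_dpar M D t K).clm_apply continuous_const).norm)
  have hdpos : (0 : ℝ) < d := by exact_mod_cast hM.one_le_d
  have hpos : 0 < d * κ / h := div_pos (mul_pos hdpos hM.κ_pos) hM.h_pos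
  rw [← closure_interior_refTri] at hy
  refine closure_minimal (fun y hy => ?_) hclosed hy
  have h1 := le_norm_fderiv_apply (hasStrictFDerivAt_par M D t K y).hasFDerivAt
    (c := (d * κ / h)⁻¹) (by
      filter_upwards [isOpen_interior.mem_nhds hy] with x hx
      have := hM.le_dist_par ht K (interior_subset hx) (interior_subset hy)
      rw [dist_eq_norm, dist_eq_norm] at this
      rwa [inv_mul_le_iff₀ hpos]) v
  rwa [inv_mul_le_iff₀ hpos] at h1

theorem exists_equiv_dpar (hM : M.Standing D k T κ h) {t : ℝ} (ht : t ∈ Icc 0 T) (K : M.Elt)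
    {y : Space d} (hy : y ∈ refTri d) :
    ∃ e : Space d ≃L[ℝ] Space d, (e : Space d →L[ℝ] Space d) = M.dpar D k t K y := by
  have hinj : Function.Injective (M.dpar D k t K y : Space d →ₗ[ℝ] Space d) := by
    rw [← LinearMap.ker_eq_bot, LinearMap.ker_eq_bot']
    intro v hv
    have := hM.norm_le_dpar ht K hy v
    rw [show M.dpar D k t K y v = 0 from hv, norm_zero, mul_zero] at this
    exact norm_le_zero_iff.1 this
  refine ⟨(LinearEquiv.ofInjectiveEndo _ hinj).toContinuousLinearEquiv, ?_⟩
  ext v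
  rfl

theorem dinv_eq {t : ℝ} {K : M.Elt} {y : Space d} {e : Space d ≃L[ℝ] Space d}
    (he : (e : Space d →L[ℝ] Space d) = M.dpar D k t K y) : M.dinv D k t K y = e.symm := by
  rw [Mesh.dinv, ← he, ContinuousLinearMap.inverse_equiv]

theorem dpar_comp_dinv (hM : M.Standing D k T κ h) {t : ℝ} (ht : t ∈ Icc 0 T) (K : M.Elt)
    {y : Space d} (hy : y ∈ refTri d) :
    (M.dpar D k t K y).comp (M.dinv D k t K y) = ContinuousLinearMap.id ℝ _ := by
  obtain ⟨e, he⟩ := hM.exists_equiv_dpar ht K hy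
  rw [dinv_eq he, ← he]
  ext v
  simp

theorem dinv_comp_dpar (hM : M.Standing D k T κ h) {t : ℝ} (ht : t ∈ Icc 0 T) (K : M.Elt)
    {y : Space d} (hy : y ∈ refTri d) :
    (M.dinv D k t K y).comp (M.dpar D k t K y) = ContinuousLinearMap.id ℝ _ := by
  obtain ⟨e, he⟩ := hM.exists_equiv_dpar ht K hy
  rw [dinv_eq he, ← he]
  ext v
  simp

theorem norm_dinv_le (hM : M.Standing D k T κ h) {t : ℝ} (ht : t ∈ Icc 0 T) (K : M.Elt)
    {y : Space d} (hy : y ∈ refTri d) : ‖M.dinv D k t K y‖ ≤ d * κ / h := by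
  have hpos : 0 ≤ d * κ / h := div_nonneg (mul_nonneg (by positivity) hM.κ_pos.le) hM.h_pos.le
  refine ContinuousLinearMap.opNorm_le_bound _ hpos fun v => ?_
  have h1 := hM.norm_le_dpar ht K hy (M.dinv D k t K y v)
  have h2 := DFunLike.congr_fun (hM.dpar_comp_dinv ht K hy) v
  simp only [ContinuousLinearMap.comp_apply, ContinuousLinearMap.id_apply] at h2
  rwa [h2] at h1

theorem jac_pos (hM : M.Standing D k T κ h) {t : ℝ} (ht : t ∈ Icc 0 T) (K : M.Elt)
    {y : Space d} (hy : y ∈ refTri d) : 0 < M.jac D k t K y := by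
  refine abs_pos.2 ?_
  obtain ⟨e, he⟩ := hM.exists_equiv_dpar ht K hy
  rw [← he]
  exact e.toLinearEquiv.isUnit_det'.ne_zero

theorem continuousOn_par (hM : M.Standing D k T κ h) (K : M.Elt) :
    ContinuousOn (fun q : ℝ × Space d => M.par D k q.1 K q.2) (Icc 0 T ×ˢ univ) :=
  continuousOn_interp (a := fun t β => M.node D k t K β.1) fun β => hM.node_continuousOn K β

theorem continuousOn_dpar (hM : M.Standing D k T κ h) (K : M.Elt) :
    ContinuousOn (fun q : ℝ × Space d => M.dpar D k q.1 K q.2) (Icc 0 T ×ˢ univ) :=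
  continuousOn_dinterp (a := fun t β => M.node D k t K β.1) fun β => hM.node_continuousOn K β

theorem continuousOn_vel (hM : M.Standing D k T κ h) (K : M.Elt) :
    ContinuousOn (fun q : ℝ × Space d => M.vel D k q.1 K q.2) (Icc 0 T ×ˢ univ) :=
  continuousOn_interp (a := fun t β => D.w t (M.node D k t K β.1))
    fun β => hM.velocity_node_continuousOn K β

theorem continuousOn_dvel (hM : M.Standing D k T κ h) (K : M.Elt) :
    ContinuousOn (fun q : ℝ × Space d => M.dvel D k q.1 K q.2) (Icc 0 T ×ˢ univ) :=
  continuousOn_dinterp (a := fun t β => D.w t (M.node D k t K β.1))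
    fun β => hM.velocity_node_continuousOn K β

theorem continuousOn_jac (hM : M.Standing D k T κ h) (K : M.Elt) :
    ContinuousOn (fun q : ℝ × Space d => M.jac D k q.1 K q.2) (Icc 0 T ×ˢ refTri d) :=
  ((ContinuousLinearMap.continuous_det.comp_continuousOn (hM.continuousOn_dpar K)).abs).mono
    (prod_mono_right (subset_univ _))

theorem continuousOn_dinv (hM : M.Standing D k T κ h) (K : M.Elt) :
    ContinuousOn (fun q : ℝ × Space d => M.dinv D k q.1 K q.2) (Icc 0 T ×ˢ refTri d) := by
  rintro ⟨t, y⟩ ⟨ht, hy⟩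
  obtain ⟨e, he⟩ := hM.exists_equiv_dpar ht K hy
  have h1 : ContinuousAt ContinuousLinearMap.inverse (M.dpar D k t K y) := by
    rw [← he]
    exact (contDiffAt_map_inverse (𝕜 := ℝ) (n := 0) e).continuousAt
  have h2 : ContinuousWithinAt (fun q : ℝ × Space d => M.dpar D k q.1 K q.2)
      (Icc 0 T ×ˢ refTri d) (t, y) :=
    ((hM.continuousOn_dpar K).mono (prod_mono_right (subset_univ _))) _ ⟨ht, hy⟩
  exact ContinuousAt.comp_continuousWithinAt (f := fun q : ℝ × Space d => M.dpar D k q.1 K q.2)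
    (x := (t, y)) h1 h2

theorem continuousOn_divVel (hM : M.Standing D k T κ h) (K : M.Elt) :
    ContinuousOn (fun q : ℝ × Space d => M.divVel D k q.1 K q.2) (Icc 0 T ×ˢ refTri d) := by
  have h1 : Continuous fun A : Space d →L[ℝ] Space d =>
      LinearMap.trace ℝ (Space d) (A : Space d →ₗ[ℝ] Space d) :=
    LinearMap.continuous_of_finiteDimensional
      ((LinearMap.trace ℝ (Space d)).comp (ContinuousLinearMap.coeLM ℝ))
  exact h1.comp_continuousOn (((hM.continuousOn_dvel K).mono
    (prod_mono_right (subset_univ _))).clm_comp (hM.continuousOn_dinv K))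

theorem continuousOn_grad (hM : M.Standing D k T κ h) (c : M.Coef k) (K : M.Elt) :
    ContinuousOn (fun q : ℝ × Space d => M.grad D k q.1 c K q.2) (Icc 0 T ×ˢ refTri d) := by
  have h1 : ContinuousOn (fun q : ℝ × Space d => dinterp k (c K) q.2) (Icc 0 T ×ˢ refTri d) :=
    (continuousOn_dinterp (I := Icc 0 T) (a := fun _ => c K)
      fun _ => continuousOn_const).mono (prod_mono_right (subset_univ _))
  exact (InnerProductSpace.toDual ℝ (Space d)).symm.continuous.comp_continuousOn
    (h1.clm_comp (hM.continuousOn_dinv K))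

theorem continuousOn_interp_const (a : nodeIdx d k → ℝ) (s : Set (ℝ × Space d)) :
    ContinuousOn (fun q : ℝ × Space d => interp k a q.2) s :=
  (continuousOn_interp (I := univ) (a := fun _ => a)
      fun _ => continuousOn_const).mono (by simp)

/-- The Jacobian changes at the rate of the divergence of the discrete velocity. -/
theorem hasDerivWithinAt_jac (hM : M.Standing D k T κ h) {t : ℝ} (ht : t ∈ Icc 0 T) (K : M.Elt)
    {y : Space d} (hy : y ∈ refTri d) :
    HasDerivWithinAt (fun s => M.jac D k s K y) (M.jac D k t K y * M.divVel D k t K y)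
      (Icc 0 T) t :=
  hasDerivWithinAt_abs_det (hasDerivWithinAt_dinterp
    (a := fun t β => M.node D k t K β.1) (fun β => hM.node_hasDerivWithinAt ht K β) y)
    (hM.dpar_comp_dinv ht K hy) (hM.dinv_comp_dpar ht K hy)

/-! ### Transformation to the reference simplex -/

theorem lintegral_elt (hM : M.Standing D k T κ h) {t : ℝ} (ht : t ∈ Icc 0 T) (K : M.Elt)
    (f : Space d → ℝ≥0∞) : ∫⁻ x in M.elt D k t K, f x =
      ∫⁻ y in interior (refTri d), ENNReal.ofReal (M.jac D k t K y) * f (M.par D k t K y) := by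
  rw [← par_image, lintegral_image_eq_lintegral_abs_det_fderiv_mul volume
    (isClosed_refTri d).measurableSet
    (fun y _ => (hasStrictFDerivAt_par M D t K y).hasFDerivAt.hasFDerivWithinAt)
    (hM.par_injOn ht K)]
  refine setLIntegral_congr ((LE.le.eventuallyLE interior_subset).antisymm ?_).symm
  exact ae_le_set.2 (volume_refTri_diff_interior d)

theorem setIntegral_elt (hM : M.Standing D k T κ h) {t : ℝ} (ht : t ∈ Icc 0 T) (K : M.Elt)
    (f : Space d → ℝ) : ∫ x in M.elt D k t K, f x =
      ∫ y in interior (refTri d), M.jac D k t K y * f (M.par D k t K y) := by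
  rw [← par_image, integral_image_eq_integral_abs_det_fderiv_smul volume
    (isClosed_refTri d).measurableSet
    (fun y _ => (hasStrictFDerivAt_par M D t K y).hasFDerivAt.hasFDerivWithinAt)
    (hM.par_injOn ht K)]
  refine setIntegral_congr_set ((LE.le.eventuallyLE interior_subset).antisymm ?_).symm
  exact ae_le_set.2 (volume_refTri_diff_interior d)

theorem par_mem_nhds (hM : M.Standing D k T κ h) {t : ℝ} (ht : t ∈ Icc 0 T) (K : M.Elt)
    {y : Space d} (hy : y ∈ interior (refTri d)) {s : Set (Space d)} (hs : s ∈ 𝓝 y) :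
    M.par D k t K '' s ∈ 𝓝 (M.par D k t K y) := by
  obtain ⟨e, he⟩ := hM.exists_equiv_dpar ht K (interior_subset hy)
  have h1 := hasStrictFDerivAt_par (k := k) M D t K y
  rw [← he] at h1
  rw [← h1.map_nhds_eq_of_equiv]
  exact image_mem_map hs

theorem isOpen_par_image (hM : M.Standing D k T κ h) {t : ℝ} (ht : t ∈ Icc 0 T) (K : M.Elt) :
    IsOpen (M.par D k t K '' interior (refTri d)) := by
  rw [isOpen_iff_mem_nhds]
  rintro _ ⟨y, hy, rfl⟩
  exact hM.par_mem_nhds ht K hy (isOpen_interior.mem_nhds hy)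

/-- The derivative of a function on an element given in reference coordinates. -/
theorem hasFDerivAt_of_par (hM : M.Standing D k T κ h) {t : ℝ} (ht : t ∈ Icc 0 T) (K : M.Elt)
    {y : Space d} (hy : y ∈ interior (refTri d)) {V : Type*} [NormedAddCommGroup V]
    [NormedSpace ℝ V] {F G : Space d → V} {G' : Space d →L[ℝ] V}
    (hF : ∀ y ∈ refTri d, F (M.par D k t K y) = G y) (hG : HasFDerivAt G G' y) :
    HasFDerivAt F (G'.comp (M.dinv D k t K y)) (M.par D k t K y) := by
  obtain ⟨e, he⟩ := hM.exists_equiv_dpar ht K (interior_subset hy)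
  have h1 := hasStrictFDerivAt_par (k := k) M D t K y
  rw [dinv_eq he]
  rw [← he] at h1
  set g := HasStrictFDerivAt.localInverse _ _ _ h1 with hg
  have h2 : HasFDerivAt g (e.symm : Space d →L[ℝ] Space d) (M.par D k t K y) :=
    h1.to_localInverse.hasFDerivAt
  have h3 : g (M.par D k t K y) = y := h1.localInverse_apply_image
  have hG' : HasFDerivAt G G' (g (M.par D k t K y)) := by rwa [h3]
  refine (hG'.comp _ h2).congr_of_eventuallyEq ?_
  have h4 : ∀ᶠ x in 𝓝 (M.par D k t K y), g x ∈ refTri d := by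
    refine h2.continuousAt.eventually ?_
    rw [h3]
    exact mem_interior_iff_mem_nhds.1 hy
  filter_upwards [h4, h1.eventually_right_inverse] with x hx hx'
  rw [Function.comp_apply, ← hF _ hx, hx']

theorem fn_par (hM : M.Standing D k T κ h) {t : ℝ} (ht : t ∈ Icc 0 T) (c : M.Coef k) (K : M.Elt)
    {y : Space d} (hy : y ∈ refTri d) :
    M.fn D k t c K (M.par D k t K y) = interp k (c K) y := by
  rw [par_eq, hM.fn_refMap ht c K (bary_mem hy), interp]
  simp only [smul_eq_mul, mul_comm]

theorem hasFDerivAt_fn (hM : M.Standing D k T κ h) {t : ℝ} (ht : t ∈ Icc 0 T) (c : M.Coef k)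
    (K : M.Elt) {y : Space d} (hy : y ∈ interior (refTri d)) :
    HasFDerivAt (M.fn D k t c K) ((dinterp k (c K) y).comp (M.dinv D k t K y))
      (M.par D k t K y) :=
  hM.hasFDerivAt_of_par ht K hy (fun _ hy => hM.fn_par ht c K hy)
    (hasStrictFDerivAt_interp (c K) y).hasFDerivAt

theorem gradient_fn (hM : M.Standing D k T κ h) {t : ℝ} (ht : t ∈ Icc 0 T) (c : M.Coef k)
    (K : M.Elt) {y : Space d} (hy : y ∈ interior (refTri d)) :
    gradient (M.fn D k t c K) (M.par D k t K y) = M.grad D k t c K y := by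
  rw [gradient, (hM.hasFDerivAt_fn ht c K hy).fderiv, Mesh.grad]

theorem velocity_par (hM : M.Standing D k T κ h) {t : ℝ} (ht : t ∈ Icc 0 T)
    (K : M.Elt) {y : Space d} (hy : y ∈ refTri d) :
    M.velocity D k t K (M.par D k t K y) = M.vel D k t K y := by
  rw [par_eq, Mesh.velocity, hM.refInv_refMap ht K (bary_mem hy), Mesh.vel, interp,
    ← Finset.sum_coe_sort (nodeIdx d k)]

theorem divVelocity_par (hM : M.Standing D k T κ h) {t : ℝ} (ht : t ∈ Icc 0 T)
    (K : M.Elt) {y : Space d} (hy : y ∈ interior (refTri d)) :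
    M.divVelocity D k t K (M.par D k t K y) = M.divVel D k t K y := by
  have h1 := hM.hasFDerivAt_of_par ht K hy (fun _ hy => hM.velocity_par ht K hy)
    (hasStrictFDerivAt_interp (fun β : nodeIdx d k => D.w t (M.node D k t K β.1)) y).hasFDerivAt
  rw [Mesh.divVelocity, h1.fderiv]
  rfl

end Standing

end Mesh

/-! ### Nearest points and the lift -/

theorem isNearest_nearest {d : ℕ} {Γ : Set (Space d)} {x : Space d} (h : ∃ y, IsNearest Γ x y) :
    IsNearest Γ x (nearest Γ x) := by
  rw [nearest, dif_pos h]
  exact h.choose_spec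

/-- Where nearest points are unique, the projection is continuous in space and time: limits of
nearest points are nearest points, and the interface moves in a compact set. -/
theorem Geometry.IsAdmissible.continuousOn_nearest {d k : ℕ} {D : Geometry d} {T : ℝ}
    (hD : D.IsAdmissible k T) :
    ContinuousOn (fun q : ℝ × Space d => nearest (D.Γ q.1) q.2)
      {q | q.1 ∈ Icc 0 T ∧ ∃! y, IsNearest (D.Γ q.1) q.2 y} := by
  rintro ⟨t, p⟩ ⟨ht, hu⟩
  simp only at ht hu
  set N : Set (ℝ × Space d) := {q | q.1 ∈ Icc 0 T ∧ ∃! y, IsNearest (D.Γ q.1) q.2 y} with hN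
  have h0 : (0 : ℝ) ∈ Icc 0 T := ⟨le_rfl, ht.1.trans ht.2⟩
  have hnear : ∀ q ∈ N, IsNearest (D.Γ q.1) q.2 (nearest (D.Γ q.1) q.2) :=
    fun q hq => isNearest_nearest hq.2.exists
  have hpn : IsNearest (D.Γ t) p (nearest (D.Γ t) p) := hnear (t, p) ⟨ht, hu⟩
  -- all nearest points lie in the closed space-time interface
  let S : Set (ℝ × Space d) := (fun q : ℝ × Space d => (q.1, D.Φ 0 q.1 q.2)) '' (Icc 0 T ×ˢ D.Γ 0)
  have hflow : ContinuousOn (fun q : ℝ × Space d => D.Φ 0 q.1 q.2) (Icc 0 T ×ˢ D.Γ 0) :=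
    (hD.flow_continuousOn 0).mono (prod_mono_right (hD.interface_subset_inner h0))
  have hS : IsCompact S := (isCompact_Icc.prod (hD.interface_compact 0 h0)).image_of_continuousOn
    (continuousOn_fst.prodMk hflow)
  have hSmem : ∀ s z, (s, z) ∈ S ↔ s ∈ Icc 0 T ∧ z ∈ D.Γ s := by
    intro s z
    constructor
    · rintro ⟨⟨s', x⟩, ⟨hs, hx⟩, he⟩
      simp only [Prod.mk.injEq] at he
      obtain ⟨rfl, rfl⟩ := he
      exact ⟨hs, by rw [← hD.flow_interface 0 s' hs]; exact mem_image_of_mem _ hx⟩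
    · rintro ⟨hs, hz⟩
      rw [← hD.flow_interface 0 s hs] at hz
      obtain ⟨x, hx, rfl⟩ := hz
      exact ⟨(s, x), ⟨hs, hx⟩, rfl⟩
  have htend : Tendsto (fun q : ℝ × Space d => (q.1, nearest (D.Γ q.1) q.2)) (𝓝[N] (t, p))
      (𝓝 (t, nearest (D.Γ t) p)) := by
    -- in a compact set it suffices that every cluster point is the nearest point
    refine hS.tendsto_nhds_of_unique_mapClusterPt ?_ ?_
    · filter_upwards [self_mem_nhdsWithin] with q hq
      exact (hSmem _ _).2 ⟨hq.1, (hnear q hq).1⟩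
    · rintro ⟨s, z⟩ hsz hcl
      obtain ⟨hs, hz⟩ := (hSmem s z).1 hsz
      have h1 : Tendsto (fun q : ℝ × Space d => q.1) (𝓝[N] (t, p)) (𝓝 t) :=
        (continuous_fst.tendsto (t, p)).mono_left nhdsWithin_le_nhds
      have h2 : Tendsto (fun q : ℝ × Space d => q.2) (𝓝[N] (t, p)) (𝓝 p) :=
        (continuous_snd.tendsto (t, p)).mono_left nhdsWithin_le_nhds
      have hst : s = t := by
        have := hcl.tendsto_comp (continuous_fst.tendsto (s, z))
        have h3 : ClusterPt s (𝓝 t) := ClusterPt.mono this h1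
        exact eq_of_nhds_neBot h3
      subst hst
      have hzcl : MapClusterPt z (𝓝[N] (s, p)) fun q => nearest (D.Γ q.1) q.2 :=
        hcl.tendsto_comp (continuous_snd.tendsto (s, z))
      -- compare with the trajectory of the nearest point
      obtain ⟨x, hx, hxe⟩ : nearest (D.Γ s) p ∈ D.Φ 0 s '' D.Γ 0 := by
        rw [hD.flow_interface 0 s hs]; exact hpn.1
      have hle : dist p z ≤ dist p (nearest (D.Γ s) p) := by
        have h3 : ∀ᶠ q in 𝓝[N] (s, p), dist q.2 (nearest (D.Γ q.1) q.2) ≤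
            dist q.2 (D.Φ 0 q.1 x) := by
          filter_upwards [self_mem_nhdsWithin] with q hq
          rw [(hnear q hq).2]
          refine Metric.infDist_le_dist_of_mem ?_
          rw [← hD.flow_interface 0 q.1 hq.1]
          exact mem_image_of_mem _ hx
        have h4 : Tendsto (fun q : ℝ × Space d => dist q.2 (D.Φ 0 q.1 x)) (𝓝[N] (s, p))
            (𝓝 (dist p (nearest (D.Γ s) p))) := by
          rw [← hxe]
          refine h2.dist ?_
          have h5 := hD.flow_continuousOn_time 0 (hD.interface_subset_inner h0 hx) s hs
          exact h5.tendsto.comp (tendsto_nhdsWithin_iff.2 ⟨h1, by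
            filter_upwards [self_mem_nhdsWithin] with q hq using hq.1⟩)
        refine le_of_forall_pos_le_add fun ε hε => ?_
        have h6 : ∃ᶠ q in 𝓝[N] (s, p), dist (nearest (D.Γ q.1) q.2) z < ε / 3 :=
          hzcl.frequently (Metric.ball_mem_nhds z (by positivity))
        obtain ⟨q, hq6, hq3, hq4, hq2⟩ := (h6.and_eventually (h3.and
          ((h4.eventually (gt_mem_nhds (lt_add_of_pos_right _ (by positivity : 0 < ε / 3)))).and
          (h2.eventually (Metric.ball_mem_nhds p (by positivity : 0 < ε / 3)))))).exists
        have := dist_triangle4 p q.2 (nearest (D.Γ q.1) q.2) z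
        rw [dist_comm] at hq2
        linarith
      have hzn : IsNearest (D.Γ s) p z :=
        ⟨hz, le_antisymm (hle.trans hpn.2.le) (Metric.infDist_le_dist_of_mem hz)⟩
      rw [hu.unique hzn hpn]
  exact (continuous_snd.tendsto _).comp htend

theorem muTilde_nonneg {d : ℕ} (S : Finset (Fin (d + 1))) {l : Fin (d + 1) → ℝ}
    (hl : l ∈ refSimplex d) : 0 ≤ muTilde S l := Finset.sum_nonneg fun a _ => hl.1 a

theorem yTilde_mem {d : ℕ} {S : Finset (Fin (d + 1))} {l : Fin (d + 1) → ℝ}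
    (hl : l ∈ refSimplex d) (hμ : muTilde S l ≠ 0) : yTilde S l ∈ refSimplex d := by
  refine ⟨fun a => ?_, ?_⟩
  · simp only [yTilde]
    split_ifs
    · exact div_nonneg (hl.1 a) (muTilde_nonneg S hl)
    · exact le_rfl
  · simp only [yTilde]
    rw [Finset.sum_ite_mem, Finset.univ_inter, ← Finset.sum_div]
    exact div_self hμ

theorem continuous_muTilde {d : ℕ} (S : Finset (Fin (d + 1))) : Continuous (muTilde S) := by
  unfold muTilde
  fun_prop

namespace Mesh.Standing

variable {d k : ℕ} {M : Mesh d} {D : Geometry d} {T κ h : ℝ}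

theorem continuousOn_refMap (hM : M.Standing D k T κ h) (K : M.Elt) :
    ContinuousOn (fun q : ℝ × (Fin (d + 1) → ℝ) => M.refMap D k q.1 K q.2)
      (Icc 0 T ×ˢ univ) := by
  refine continuousOn_finsetSum _ fun β hβ => ?_
  have h1 : ContinuousOn (fun q : ℝ × (Fin (d + 1) → ℝ) => lagr k β q.2) (Icc 0 T ×ˢ univ) :=
    ((contDiff_lagr k β).continuous.comp continuous_snd).continuousOn
  have h2 : ContinuousOn (fun q : ℝ × (Fin (d + 1) → ℝ) => M.node D k q.1 K β) (Icc 0 T ×ˢ univ) :=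
    (hM.node_continuousOn K ⟨β, hβ⟩).comp continuousOn_fst fun q hq => hq.1
  exact h1.smul h2

theorem liftPar_eq (hM : M.Standing D k T κ h) {t : ℝ} (ht : t ∈ Icc 0 T) (K : M.Elt) {y : Space d}
    (hy : y ∈ refTri d) : M.liftPar D k t K y =
      projCorrect (D.Γ t) k (M.ifaceVerts D K) (M.refMap D k t K) (bary y) := by
  rw [Mesh.liftPar, Mesh.lift, par_eq, hM.refInv_refMap ht K (bary_mem hy)]

/-- The lift is continuous in space and time on each element. -/
theorem continuousOn_liftPar (hM : M.Standing D k T κ h) (K : M.Elt) :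
    ContinuousOn (fun q : ℝ × Space d => M.liftPar D k q.1 K q.2) (Icc 0 T ×ˢ refTri d) := by
  set S := M.ifaceVerts D K with hS
  have hpar : ContinuousOn (fun q : ℝ × Space d => M.par D k q.1 K q.2) (Icc 0 T ×ˢ refTri d) :=
    (hM.continuousOn_par K).mono (prod_mono_right (subset_univ _))
  by_cases hcard : 2 ≤ S.card
  swap
  · refine hpar.congr fun q hq => ?_
    rw [hM.liftPar_eq hq.1 K hq.2, projCorrect, if_neg fun h => hcard h.1]
    exact (par_eq M D q.1 K q.2).symm
  -- the correction is continuous where `μ̃ ≠ 0` and is small where `μ̃` is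
  set Y : ℝ × Space d → Space d := fun q => M.refMap D k q.1 K (yTilde S (bary q.2)) with hY
  have hval : ∀ q ∈ Icc 0 T ×ˢ refTri d, muTilde S (bary q.2) ≠ 0 →
      M.liftPar D k q.1 K q.2 = M.par D k q.1 K q.2 +
        muTilde S (bary q.2) ^ (k + 2) • (nearest (D.Γ q.1) (Y q) - Y q) := by
    intro q hq hμ
    rw [hM.liftPar_eq hq.1 K hq.2, projCorrect, if_pos ⟨hcard, hμ⟩, par_eq]
  have hval0 : ∀ q ∈ Icc 0 T ×ˢ refTri d, muTilde S (bary q.2) = 0 →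
      M.liftPar D k q.1 K q.2 = M.par D k q.1 K q.2 := by
    intro q hq hμ
    rw [hM.liftPar_eq hq.1 K hq.2, projCorrect, if_neg fun h => h.2 hμ, par_eq]
  have hbary : Continuous (bary (d := d)) := (contDiff_bary d).continuous
  have hμc : Continuous fun q : ℝ × Space d => muTilde S (bary q.2) :=
    (continuous_muTilde S).comp (hbary.comp continuous_snd)
  rintro ⟨t, y⟩ hq
  by_cases hμ : muTilde S (bary y) = 0
  · -- a bound for the distance of the corrected points
    obtain ⟨R₁, hR₁⟩ := (isCompact_Icc.prod (isCompact_stdSimplex ℝ (Fin (d + 1)))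
      ).exists_bound_of_continuousOn
      ((hM.continuousOn_refMap K).mono (prod_mono_right (subset_univ _)))
    obtain ⟨R₂, hR₂⟩ := hM.adm.isCompact_closure.isBounded.exists_norm_le
    have hbd : ∀ q ∈ Icc 0 T ×ˢ refTri d, ‖M.liftPar D k q.1 K q.2 - M.par D k q.1 K q.2‖ ≤
        muTilde S (bary q.2) ^ (k + 2) * (R₂ + R₁) := by
      intro q hq
      by_cases hμq : muTilde S (bary q.2) = 0
      · rw [hval0 q hq hμq, sub_self, norm_zero, hμq, zero_pow (by omega), zero_mul]
      · have hl := bary_mem hq.2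
        have hn := isNearest_nearest (hM.regular.nearest_evolving q.1 hq.1 K hcard _ hl hμq).exists
        rw [hval q hq hμq, add_sub_cancel_left, norm_smul, norm_pow, Real.norm_eq_abs,
          abs_of_nonneg (muTilde_nonneg S hl)]
        refine mul_le_mul_of_nonneg_left ((norm_sub_le _ _).trans (add_le_add ?_ ?_))
          (pow_nonneg (muTilde_nonneg S hl) _)
        · exact hR₂ _ (subset_closure (hM.adm.interface_subset q.1 hq.1 hn.1))
        · exact hR₁ (q.1, yTilde S (bary q.2)) ⟨hq.1, yTilde_mem hl hμq⟩
    have h1 : Tendsto (fun q : ℝ × Space d => M.liftPar D k q.1 K q.2 - M.par D k q.1 K q.2)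
        (𝓝[Icc 0 T ×ˢ refTri d] (t, y)) (𝓝 0) := by
      refine squeeze_zero_norm' (a := fun q => muTilde S (bary q.2) ^ (k + 2) * (R₂ + R₁)) ?_ ?_
      · filter_upwards [self_mem_nhdsWithin] with q hq using hbd q hq
      · have : Continuous fun q : ℝ × Space d => muTilde S (bary q.2) ^ (k + 2) * (R₂ + R₁) :=
          (hμc.pow _).mul continuous_const
        have h2 := this.tendsto (t, y)
        simp only [hμ] at h2
        rw [zero_pow (by omega), zero_mul] at h2
        exact h2.mono_left nhdsWithin_le_nhds
    have h3 := h1.add (hpar (t, y) hq).tendsto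
    rw [zero_add] at h3
    rw [ContinuousWithinAt, hval0 (t, y) hq hμ]
    simpa using h3
  · have hev : ∀ᶠ q in 𝓝[Icc 0 T ×ˢ refTri d] (t, y),
        q ∈ Icc 0 T ×ˢ refTri d ∧ muTilde S (bary q.2) ≠ 0 :=
      Filter.Eventually.and self_mem_nhdsWithin
        (nhdsWithin_le_nhds (hμc.continuousAt.eventually_ne hμ))
    set V : Set (ℝ × Space d) := {q | q ∈ Icc 0 T ×ˢ refTri d ∧ muTilde S (bary q.2) ≠ 0} with hV
    have hyt : ContinuousOn (fun q : ℝ × Space d => yTilde S (bary q.2)) V := by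
      refine continuousOn_pi.2 fun a => ?_
      simp only [yTilde]
      split_ifs
      · have h1 : Continuous fun q : ℝ × Space d => bary q.2 a :=
          (continuous_apply a).comp (hbary.comp continuous_snd)
        exact h1.continuousOn.div hμc.continuousOn fun q hq => hq.2
      · exact continuousOn_const
    have hYc : ContinuousOn Y V :=
      ContinuousOn.comp (g := fun q : ℝ × (Fin (d + 1) → ℝ) => M.refMap D k q.1 K q.2)
        (f := fun q : ℝ × Space d => (q.1, yTilde S (bary q.2))) (t := Icc 0 T ×ˢ univ)
        (hM.continuousOn_refMap K) (continuousOn_fst.prodMk hyt)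
        fun q hq => ⟨hq.1.1, mem_univ _⟩
    have hnc : ContinuousOn (fun q => nearest (D.Γ q.1) (Y q)) V :=
      ContinuousOn.comp (g := fun q : ℝ × Space d => nearest (D.Γ q.1) q.2)
        (f := fun q : ℝ × Space d => (q.1, Y q))
        (t := {q | q.1 ∈ Icc 0 T ∧ ∃! y, IsNearest (D.Γ q.1) q.2 y})
        hM.adm.continuousOn_nearest (continuousOn_fst.prodMk hYc)
        fun q hq =>
        ⟨hq.1.1, hM.regular.nearest_evolving q.1 hq.1.1 K hcard _ (bary_mem hq.1.2) hq.2⟩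
    have hVc : ContinuousOn (fun q : ℝ × Space d => M.liftPar D k q.1 K q.2) V := by
      refine ContinuousOn.congr ?_ fun q hq => hval q hq.1 hq.2
      have h1 : ContinuousOn (fun q => nearest (D.Γ q.1) (Y q) - Y q) V := hnc.sub hYc
      have h2 : ContinuousOn (fun q : ℝ × Space d => muTilde S (bary q.2) ^ (k + 2)) V :=
        (hμc.pow _).continuousOn
      have h3 : ContinuousOn (fun q : ℝ × Space d => M.par D k q.1 K q.2) V :=
        hpar.mono fun q hq => hq.1
      exact h3.add (h2.smul h1)
    exact (hVc (t, y) ⟨hq, hμ⟩).mono_of_mem_nhdsWithin hev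

theorem lift_mem (hM : M.Standing D k T κ h) {t : ℝ} (ht : t ∈ Icc 0 T) (K : M.Elt)
    {x : Space d} (hx : x ∈ M.elt D k t K) : M.lift D k t K x ∈ closure (D.Om K.1 t) := by
  rw [← hM.regular.lift_onto t ht K.1]
  exact mem_iUnion.2 ⟨K.2, mem_image_of_mem _ hx⟩

theorem liftPar_mem (hM : M.Standing D k T κ h) {t : ℝ} (ht : t ∈ Icc 0 T) (K : M.Elt)
    {y : Space d} (hy : y ∈ refTri d) : M.liftPar D k t K y ∈ closure (D.Om K.1 t) :=
  hM.lift_mem ht K (par_mem_elt hy)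

end Mesh.Standing

/-! ### Functionals along a continuous family of functions -/

theorem normSqHHalf_congr {d : ℕ} {Γ : Set (Space d)} (hΓ : MeasurableSet Γ)
    [SFinite (surf Γ)] {v w : Space d → ℝ} (h : EqOn v w Γ) :
    normSqHHalf Γ v = normSqHHalf Γ w := by
  have h1 : ∀ᵐ x ∂surf Γ, x ∈ Γ := ae_restrict_mem hΓ
  have h2 : ∀ᵐ q ∂(surf Γ).prod (surf Γ), gagliardo v q = gagliardo w q := by
    have h3 : ∀ᵐ q ∂(surf Γ).prod (surf Γ), q.1 ∈ Γ := Measure.quasiMeasurePreserving_fst.ae h1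
    have h4 : ∀ᵐ q ∂(surf Γ).prod (surf Γ), q.2 ∈ Γ := Measure.quasiMeasurePreserving_snd.ae h1
    filter_upwards [h3, h4] with q hq hq'
    rw [gagliardo, gagliardo, h hq, h hq']
  rw [normSqHHalf, normSqHHalf, eLpNorm_congr_ae h2,
    eLpNorm_congr_ae (h1.mono fun x hx => h hx)]

theorem enorm_dualPair_sub_sq_le {d : ℕ} {Γ : Set (Space d)} {g : HHalf Γ →ₗ[ℝ] ℝ}
    (hg : dualNorm Γ g < ⊤) {v w : Space d → ℝ} (hv : v ∈ HHalf Γ) (hw : w ∈ HHalf Γ) :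
    ‖dualPair g v - dualPair g w‖ₑ ^ 2 ≤ dualNorm Γ g ^ 2 * normSqHHalf Γ (v - w) := by
  have hvw : v - w ∈ HHalf Γ := Submodule.sub_mem _ hv hw
  have : dualPair g v - dualPair g w = dualPair g (v - w) := by
    rw [dualPair, dif_pos hv, dualPair, dif_pos hw, dualPair, dif_pos hvw, ← map_sub]
    rfl
  rw [this]
  exact enorm_dualPair_sq_le hg hvw

theorem dualPair_congr {d : ℕ} {Γ : Set (Space d)} (hΓ : MeasurableSet Γ) [SFinite (surf Γ)]
    {g : HHalf Γ →ₗ[ℝ] ℝ} (hg : dualNorm Γ g < ⊤) {v w : Space d → ℝ} (hv : v ∈ HHalf Γ)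
    (hw : w ∈ HHalf Γ) (h : EqOn v w Γ) : dualPair g v = dualPair g w := by
  have h1 := enorm_dualPair_sub_sq_le hg hv hw
  have h2 : normSqHHalf Γ (v - w) = 0 := by
    rw [normSqHHalf_congr hΓ (w := (0 : ℝ) • v) fun x hx => by simp [h hx], normSqHHalf_smul]
    simp
  rw [h2, mul_zero, nonpos_iff_eq_zero, pow_eq_zero_iff two_ne_zero, enorm_eq_zero] at h1
  exact sub_eq_zero.1 h1

/-- The kernel `|x - y|²⁻ᵈ`, which dominates the Gagliardo quotient of a Lipschitz function. -/
def gagliardoKernel {d : ℕ} (q : Space d × Space d) : ℝ≥0∞ :=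
  ‖q.1 - q.2‖ₑ ^ 2 * (‖q.1 - q.2‖ₑ ^ d)⁻¹

theorem measurable_gagliardoKernel {d : ℕ} : Measurable (gagliardoKernel (d := d)) := by
  unfold gagliardoKernel
  fun_prop

theorem enorm_gagliardo_sq_le {d : ℕ} {Γ : Set (Space d)} {w : Space d → ℝ} {L : ℝ≥0}
    (hw : LipschitzOnWith L w Γ) {q : Space d × Space d} (hx : q.1 ∈ Γ) (hy : q.2 ∈ Γ) :
    ‖gagliardo w q‖ₑ ^ 2 ≤ (L : ℝ≥0∞) ^ 2 * gagliardoKernel q := by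
  obtain ⟨x, y⟩ := q
  rw [enorm_gagliardo_sq, gagliardoKernel]
  simp only
  rw [← mul_assoc, ← mul_pow]
  gcongr
  have := hw hx hy
  rwa [edist_eq_enorm_sub, edist_eq_enorm_sub] at this

theorem enorm_sq_le_of_abs_le {r : ℝ} {L : ℝ≥0} (h : |r| ≤ L) : ‖r‖ₑ ^ 2 ≤ (L : ℝ≥0∞) ^ 2 := by
  gcongr
  rw [← ofReal_norm, ← ENNReal.ofReal_coe_nnreal]
  exact ENNReal.ofReal_le_ofReal h

theorem aemeasurable_gagliardo {d : ℕ} {Γ : Set (Space d)} (hΓ : MeasurableSet Γ)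
    {w : Space d → ℝ} (hw : ContinuousOn w Γ) :
    AEMeasurable (gagliardo w) ((surf Γ).prod (surf Γ)) := by
  have h1 : AEMeasurable w (surf Γ) := (hw.aestronglyMeasurable hΓ).aemeasurable
  refine AEMeasurable.div ?_ (by fun_prop)
  exact (h1.comp_fst).sub (h1.comp_snd)

theorem ae_mem_prod_surf {d : ℕ} {Γ : Set (Space d)} (hΓ : MeasurableSet Γ) :
    ∀ᵐ q ∂(surf Γ).prod (surf Γ), q.1 ∈ Γ ∧ q.2 ∈ Γ :=
  (Measure.quasiMeasurePreserving_fst.ae (ae_restrict_mem hΓ)).and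
    (Measure.quasiMeasurePreserving_snd.ae (ae_restrict_mem hΓ))

section
variable {d : ℕ} {Γ : Set (Space d)} (hΓ : MeasurableSet Γ) [IsFiniteMeasure (surf Γ)]
  (hR : ∫⁻ q, gagliardoKernel q ∂(surf Γ).prod (surf Γ) < ⊤)
include hΓ

include hR

/-- Bounded Lipschitz functions that converge to zero pointwise do so in `H^{1/2}`. -/
theorem tendsto_normSqHHalf_of_lipschitz {u : ℕ → Space d → ℝ} {L : ℝ≥0}
    (hb : ∀ n, ∀ x ∈ Γ, |u n x| ≤ L) (hL : ∀ n, LipschitzOnWith L (u n) Γ)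
    (hpt : ∀ x ∈ Γ, Tendsto (fun n => u n x) atTop (𝓝 0)) :
    Tendsto (fun n => normSqHHalf Γ (u n)) atTop (𝓝 0) := by
  have hsq : Tendsto (fun r : ℝ => ‖r‖ₑ ^ 2) (𝓝 0) (𝓝 0) := by
    have : Continuous fun r : ℝ => ‖r‖ₑ ^ 2 := (ENNReal.continuous_pow 2).comp continuous_enorm
    simpa using this.tendsto 0
  -- dominated convergence in both parts of the norm
  have t1 : Tendsto (fun n => ∫⁻ x, ‖u n x‖ₑ ^ 2 ∂surf Γ) atTop (𝓝 (∫⁻ _, 0 ∂surf Γ)) := by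
    refine tendsto_lintegral_of_dominated_convergence' (fun _ => (L : ℝ≥0∞) ^ 2)
      (fun n => ((hL n).continuousOn.aestronglyMeasurable hΓ).aemeasurable.enorm.pow_const 2)
      (fun n => ?_) ?_ ?_
    · filter_upwards [ae_restrict_mem hΓ] with x hx using enorm_sq_le_of_abs_le (hb n x hx)
    · rw [lintegral_const]
      exact ENNReal.mul_ne_top (by finiteness) (measure_ne_top _ _)
    · filter_upwards [ae_restrict_mem hΓ] with x hx using hsq.comp (hpt x hx)
  have t2 : Tendsto (fun n => ∫⁻ q, ‖gagliardo (u n) q‖ₑ ^ 2 ∂(surf Γ).prod (surf Γ)) atTop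
      (𝓝 (∫⁻ _, 0 ∂(surf Γ).prod (surf Γ))) := by
    refine tendsto_lintegral_of_dominated_convergence'
      (fun q => (L : ℝ≥0∞) ^ 2 * gagliardoKernel q)
      (fun n => (aemeasurable_gagliardo hΓ (hL n).continuousOn).enorm.pow_const 2)
      (fun n => ?_) ?_ ?_
    · filter_upwards [ae_mem_prod_surf hΓ] with q hq using
        enorm_gagliardo_sq_le (hL n) hq.1 hq.2
    · rw [lintegral_const_mul _ measurable_gagliardoKernel]
      exact ENNReal.mul_ne_top (by finiteness) hR.ne
    · filter_upwards [ae_mem_prod_surf hΓ] with q hq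
      have h3 := ((hpt q.1 hq.1).sub (hpt q.2 hq.2)).div_const (‖q.1 - q.2‖ ^ ((d : ℝ) / 2))
      rw [sub_zero, zero_div] at h3
      exact hsq.comp h3
  have t3 := t1.add t2
  simp only [lintegral_zero, add_zero] at t3
  simpa only [normSqHHalf, eLpNorm_two_sq] using t3

theorem mem_HHalf_of_lipschitz {w : Space d → ℝ} {L : ℝ≥0} (hb : ∀ x ∈ Γ, |w x| ≤ L)
    (hL : LipschitzOnWith L w Γ) : w ∈ HHalf Γ := by
  rw [mem_HHalf_iff (hL.continuousOn.aestronglyMeasurable hΓ), normSqHHalf, eLpNorm_two_sq,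
    eLpNorm_two_sq]
  refine ENNReal.add_lt_top.2 ⟨?_, ?_⟩
  · refine (lintegral_mono_ae (g := fun _ => (L : ℝ≥0∞) ^ 2) ?_).trans_lt ?_
    · filter_upwards [ae_restrict_mem hΓ] with x hx using enorm_sq_le_of_abs_le (hb x hx)
    · rw [lintegral_const]
      exact ENNReal.mul_lt_top (by finiteness) (measure_lt_top _ _)
  · refine (lintegral_mono_ae (g := fun q => (L : ℝ≥0∞) ^ 2 * gagliardoKernel q) ?_).trans_lt ?_
    · filter_upwards [ae_mem_prod_surf hΓ] with q hq using
        enorm_gagliardo_sq_le hL hq.1 hq.2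
    · rw [lintegral_const_mul _ measurable_gagliardoKernel]
      exact ENNReal.mul_lt_top (by finiteness) hR

end

namespace Geometry.IsAdmissible

variable {d k : ℕ} {D : Geometry d} {T : ℝ}

theorem interfacePush_flow (hD : D.IsAdmissible k T) {t : ℝ} (ht : t ∈ Icc 0 T) (w : Space d → ℝ)
    {x : Space d} (hx : x ∈ D.Γ 0) : interfacePush D t w (D.Φ 0 t x) = w x := by
  have h0 : (0 : ℝ) ∈ Icc 0 T := ⟨le_rfl, ht.1.trans ht.2⟩
  rw [interfacePush, ((hD.flow_injOn ht 0).mono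
    (hD.interface_subset_inner h0)).leftInvOn_invFunOn hx]

theorem interfacePush_continuousOn (hD : D.IsAdmissible k T) {t : ℝ} (ht : t ∈ Icc 0 T)
    {w : Space d → ℝ} (hw : ContinuousOn w (D.Γ 0)) :
    ContinuousOn (interfacePush D t w) (D.Γ t) := by
  have h0 : (0 : ℝ) ∈ Icc 0 T := ⟨le_rfl, ht.1.trans ht.2⟩
  have hsub := hD.interface_subset_inner h0
  obtain ⟨K, -, hK⟩ := hD.flow_lipschitzOnWith
  have h1 : ContinuousOn (fun z => w (D.flowInv 0 t z)) (D.Γ t) := by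
    refine hw.comp ((hK 0 t ht).2.continuousOn.mono (hD.interface_subset_inner ht)) fun z hz => ?_
    rw [← hD.flow_interface 0 t ht] at hz
    obtain ⟨x, hx, rfl⟩ := hz
    rwa [hD.flowInv_flow ht 0 (hsub hx)]
  refine h1.congr fun z hz => ?_
  rw [← hD.flow_interface 0 t ht] at hz
  obtain ⟨x, hx, rfl⟩ := hz
  simp only [hD.interfacePush_flow ht w hx, hD.flowInv_flow ht 0 (hsub hx)]

theorem lintegral_gagliardoKernel_lt_top (hd : 2 ≤ d) (hD : D.IsAdmissible k T) {t : ℝ}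
    (ht : t ∈ Icc 0 T) :
    ∫⁻ q, gagliardoKernel q ∂(surf (D.Γ t)).prod (surf (D.Γ t)) < ⊤ := by
  have hfin := hD.isFiniteMeasure_surf hd ht
  rw [lintegral_prod _ measurable_gagliardoKernel.aemeasurable]
  exact hD.lintegral_interface_kernel_lt_top hd ht

theorem exists_normSqHHalf_interfacePush_le (hd : 2 ≤ d) (hD : D.IsAdmissible k T) :
    ∃ C : ℝ≥0, ∀ t ∈ Icc 0 T, ∀ w, ContinuousOn w (D.Γ 0) →
      normSqHHalf (D.Γ t) (interfacePush D t w) ≤ C * normSqHHalf (D.Γ 0) w := by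
  obtain ⟨C, hC⟩ := hD.exists_normSqHHalf_flow_le hd
  refine ⟨C, fun t ht w hw => ?_⟩
  have h0 : (0 : ℝ) ∈ Icc 0 T := ⟨le_rfl, ht.1.trans ht.2⟩
  have hfin := hD.isFiniteMeasure_surf hd h0
  refine (hC t ht _ (hD.interfacePush_continuousOn ht hw)).trans ?_
  rw [normSqHHalf_congr (hD.interface_compact 0 h0).isClosed.measurableSet
    fun x hx => hD.interfacePush_flow ht w hx]

/-- The pairing with a fixed functional is continuous under pointwise convergence of bounded
Lipschitz functions. -/
theorem tendsto_dualPair_interfacePush (hd : 2 ≤ d) (hD : D.IsAdmissible k T) {t : ℝ}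
    (ht : t ∈ Icc 0 T) {g : HHalf (D.Γ t) →ₗ[ℝ] ℝ} (hg : dualNorm (D.Γ t) g < ⊤)
    {u : ℕ → Space d → ℝ} {w : Space d → ℝ} {L : ℝ≥0}
    (hub : ∀ n, ∀ x ∈ D.Γ 0, |u n x| ≤ L) (huL : ∀ n, LipschitzOnWith L (u n) (D.Γ 0))
    (hwb : ∀ x ∈ D.Γ 0, |w x| ≤ L) (hwL : LipschitzOnWith L w (D.Γ 0))
    (hpt : ∀ x ∈ D.Γ 0, Tendsto (fun n => u n x) atTop (𝓝 (w x))) :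
    Tendsto (fun n => dualPair g (interfacePush D t (u n))) atTop
      (𝓝 (dualPair g (interfacePush D t w))) := by
  have h0 : (0 : ℝ) ∈ Icc 0 T := ⟨le_rfl, ht.1.trans ht.2⟩
  have hfin := hD.isFiniteMeasure_surf hd h0
  have hfin' := hD.isFiniteMeasure_surf hd ht
  have hΓm : MeasurableSet (D.Γ 0) := (hD.interface_compact 0 h0).isClosed.measurableSet
  have hR := hD.lintegral_gagliardoKernel_lt_top hd h0
  obtain ⟨C, hC⟩ := hD.exists_normSqHHalf_interfacePush_le hd
  have hmem : ∀ v : Space d → ℝ, (∀ x ∈ D.Γ 0, |v x| ≤ L) → LipschitzOnWith L v (D.Γ 0) →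
      interfacePush D t v ∈ HHalf (D.Γ t) := by
    intro v hvb hvL
    rw [mem_HHalf_iff ((hD.interfacePush_continuousOn ht hvL.continuousOn).aestronglyMeasurable
      (hD.interface_compact t ht).isClosed.measurableSet)]
    exact (hC t ht _ hvL.continuousOn).trans_lt (ENNReal.mul_lt_top ENNReal.coe_lt_top
      (normSqHHalf_lt_top_of_mem (mem_HHalf_of_lipschitz hΓm hR hvb hvL)))
  -- convergence in `H^{1/2}` at time `0`, hence after transport to time `t`
  have hconv : Tendsto (fun n => normSqHHalf (D.Γ 0) (u n - w)) atTop (𝓝 0) := by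
    refine tendsto_normSqHHalf_of_lipschitz hΓm hR (L := L + L) (fun n x hx => ?_)
      (fun n => (huL n).sub hwL) fun x hx => ?_
    · push_cast
      exact (abs_sub _ _).trans (add_le_add (hub n x hx) (hwb x hx))
    · simpa using (hpt x hx).sub_const (w x)
  rw [tendsto_iff_edist_tendsto_0]
  have hle : ∀ n, edist (dualPair g (interfacePush D t (u n)))
      (dualPair g (interfacePush D t w)) ^ 2 ≤
      dualNorm (D.Γ t) g ^ 2 * C * normSqHHalf (D.Γ 0) (u n - w) := by
    intro n
    rw [edist_eq_enorm_sub, mul_assoc]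
    refine (enorm_dualPair_sub_sq_le hg (hmem _ (hub n) (huL n)) (hmem _ hwb hwL)).trans ?_
    exact mul_le_mul' le_rfl (hC t ht (u n - w) ((huL n).continuousOn.sub hwL.continuousOn))
  have h1 : Tendsto (fun n => dualNorm (D.Γ t) g ^ 2 * C * normSqHHalf (D.Γ 0) (u n - w))
      atTop (𝓝 0) := by
    have h4 := ENNReal.Tendsto.const_mul (a := dualNorm (D.Γ t) g ^ 2 * C) hconv
      (Or.inr (ENNReal.mul_ne_top (ENNReal.pow_ne_top hg.ne) ENNReal.coe_ne_top))
    rwa [mul_zero] at h4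
  have h5 := tendsto_of_tendsto_of_tendsto_of_le_of_le tendsto_const_nhds h1
    (fun _ => zero_le) hle
  have h6 := ((ENNReal.continuous_rpow_const (y := 1 / 2)).tendsto 0).comp h5
  rw [ENNReal.zero_rpow_of_pos (by norm_num)] at h6
  refine h6.congr fun n => ?_
  rw [Function.comp_apply, ← ENNReal.rpow_natCast, ← ENNReal.rpow_mul]
  norm_num

/-- The pairing of a measurable family of functionals with a continuous, uniformly Lipschitz family
of functions is measurable: it is the limit of the pairings with step functions in time. -/
theorem aemeasurable_dualPair (hd : 2 ≤ d) (hD : D.IsAdmissible k T) (hT : 0 < T)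
    {G : (t : ℝ) → HHalf (D.Γ t) →ₗ[ℝ] ℝ} (hG : MemL2VΓdual D T G) {v : ℝ → Space d → ℝ} {L : ℝ≥0}
    (hb : ∀ t ∈ Icc 0 T, ∀ x ∈ D.Γ 0, |v t x| ≤ L)
    (hL : ∀ t ∈ Icc 0 T, LipschitzOnWith L (v t) (D.Γ 0))
    (hc : ∀ x ∈ D.Γ 0, ContinuousOn (fun t => v t x) (Icc 0 T)) :
    AEMeasurable (fun t => dualPair (G t) (interfacePush D t (v t)))
      (volume.restrict (Icc 0 T)) := by
  have h0 : (0 : ℝ) ∈ Icc 0 T := ⟨le_rfl, hT.le⟩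
  have hfin := hD.isFiniteMeasure_surf hd h0
  have hΓm : MeasurableSet (D.Γ 0) := (hD.interface_compact 0 h0).isClosed.measurableSet
  have hvH : ∀ t ∈ Icc 0 T, v t ∈ HHalf (D.Γ 0) := fun t ht =>
    mem_HHalf_of_lipschitz hΓm (hD.lintegral_gagliardoKernel_lt_top hd h0) (hb t ht) (hL t ht)
  -- the step functions
  let σ : ℕ → ℝ → ℝ := fun n t => (⌊(n + 1 : ℝ) * t⌋₊ : ℝ) / (n + 1)
  have hσ : ∀ n, ∀ t ∈ Icc 0 T, σ n t ∈ Icc 0 T ∧ t - 1 / (n + 1) ≤ σ n t ∧ σ n t ≤ t := by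
    intro n t ht
    have hn : (0 : ℝ) < n + 1 := by positivity
    have h1 : σ n t ≤ t := by
      simp only [σ]
      rw [div_le_iff₀ hn, mul_comm t]
      exact Nat.floor_le (mul_nonneg hn.le ht.1)
    have h2 : t - 1 / (n + 1) ≤ σ n t := by
      simp only [σ]
      rw [le_div_iff₀ hn, sub_mul, one_div, inv_mul_cancel₀ hn.ne', mul_comm t]
      linarith [Nat.lt_floor_add_one ((n + 1 : ℝ) * t)]
    exact ⟨⟨by simp only [σ]; positivity, h1.trans ht.2⟩, h2, h1⟩
  have hσt : ∀ t ∈ Icc 0 T, Tendsto (fun n => σ n t) atTop (𝓝 t) := by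
    intro t ht
    refine tendsto_of_tendsto_of_tendsto_of_le_of_le (g := fun n : ℕ => t - 1 / ((n : ℝ) + 1)) ?_
      tendsto_const_nhds (fun n => (hσ n t ht).2.1) fun n => (hσ n t ht).2.2
    simpa using tendsto_one_div_add_atTop_nhds_zero_nat.const_sub t
  refine aemeasurable_of_tendsto_metrizable_ae atTop
    (f := fun n t => dualPair (G t) (interfacePush D t (v (σ n t)))) (fun n => ?_) ?_
  · -- finitely many functions occur
    have hmeasj : ∀ j : ℕ, AEMeasurable (fun t => if (j : ℝ) / (n + 1) ∈ Icc 0 T then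
        dualPair (G t) (interfacePush D t (v ((j : ℝ) / (n + 1)))) else 0)
        (volume.restrict (Icc 0 T)) := by
      intro j
      split_ifs with hj
      · exact hG.measurable _ (hvH _ hj)
      · exact aemeasurable_const
    set N : ℕ := ⌊(n + 1 : ℝ) * T⌋₊ + 1 with hN
    have hsum : AEMeasurable (fun t => ∑ j ∈ Finset.range N,
        {t : ℝ | ⌊(n + 1 : ℝ) * t⌋₊ = j}.indicator (fun t => if (j : ℝ) / (n + 1) ∈ Icc 0 T then
        dualPair (G t) (interfacePush D t (v ((j : ℝ) / (n + 1)))) else 0) t)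
        (volume.restrict (Icc 0 T)) := by
      refine Finset.aemeasurable_fun_sum _ fun j _ => (hmeasj j).indicator ?_
      exact (measurableSet_singleton j).preimage (f := fun t : ℝ => ⌊(n + 1 : ℝ) * t⌋₊)
        (Nat.measurable_floor.comp (measurable_const_mul _))
    refine hsum.congr ?_
    filter_upwards [ae_restrict_mem measurableSet_Icc] with t ht
    rw [Finset.sum_eq_single ⌊(n + 1 : ℝ) * t⌋₊]
    · rw [indicator_of_mem (by rfl), if_pos (hσ n t ht).1]
    · intro j _ hj
      exact indicator_of_notMem (fun h => hj h.symm) _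
    · intro hj
      refine absurd (Finset.mem_range.2 ?_) hj
      rw [hN, Nat.lt_succ_iff]
      exact Nat.floor_le_floor (mul_le_mul_of_nonneg_left ht.2 (by positivity))
  · filter_upwards [ae_restrict_mem measurableSet_Icc] with t ht
    refine hD.tendsto_dualPair_interfacePush hd ht (hG.bounded t ht)
      (fun n => hb _ (hσ n t ht).1) (fun n => hL _ (hσ n t ht).1) (hb t ht) (hL t ht)
      fun x hx => ?_
    exact (hc x hx t ht).tendsto.comp
      (tendsto_nhdsWithin_iff.2 ⟨hσt t ht, Eventually.of_forall fun n => (hσ n t ht).1⟩)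

end Geometry.IsAdmissible

/-! ### Traces of lifted finite element functions -/

/-- A function which is given continuously in terms of compactly many parameters is continuous. -/
theorem continuousOn_of_compact_parametrization {ι X Y Z : Type*} [Finite ι] [TopologicalSpace X]
    [T2Space X] [TopologicalSpace Y] [TopologicalSpace Z] [T2Space Z] {s : Set X} {g : X → Y}
    {Q : ι → Set Z} {a : ι → Z → X} {b : ι → Z → Y} (hQ : ∀ i, IsCompact (Q i))
    (ha : ∀ i, ContinuousOn (a i) (Q i)) (hb : ∀ i, ContinuousOn (b i) (Q i))
    (hg : ∀ i, ∀ q ∈ Q i, g (a i q) = b i q) (hs : ∀ x ∈ s, ∃ i, ∃ q ∈ Q i, a i q = x) :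
    ContinuousOn g s := by
  refine continuousOn_iff_isClosed.2 fun A hA => ⟨⋃ i, a i '' (Q i ∩ b i ⁻¹' A), ?_, ?_⟩
  · refine isClosed_iUnion_of_finite fun i => IsCompact.isClosed ?_
    exact ((hQ i).of_isClosed_subset ((hb i).preimage_isClosed_of_isClosed (hQ i).isClosed hA)
      inter_subset_left).image_of_continuousOn ((ha i).mono inter_subset_left)
  · ext x
    refine and_congr_left fun hx => ⟨fun hxA => ?_, fun hx' => ?_⟩
    · obtain ⟨i, q, hq, rfl⟩ := hs x hx
      rw [mem_preimage, hg i q hq] at hxA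
      exact mem_iUnion.2 ⟨i, q, ⟨hq, hxA⟩, rfl⟩
    · obtain ⟨i, q, ⟨hq, hqA⟩, rfl⟩ := mem_iUnion.1 hx'
      rw [mem_preimage, hg i q hq]
      exact hqA

theorem exists_lipschitz_interp {d k : ℕ} (a : nodeIdx d k → ℝ) :
    ∃ B : ℝ≥0, LipschitzOnWith B (interp k a) (refTri d) ∧ ∀ y ∈ refTri d, |interp k a y| ≤ B := by
  obtain ⟨C, hC, h⟩ := exists_norm_interp_le d k
  have hb : ∀ β, ‖a β‖ ≤ ∑ β, ‖a β‖ := fun β =>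
    Finset.single_le_sum (f := fun β => ‖a β‖) (fun _ _ => norm_nonneg _) (Finset.mem_univ β)
  have hB : 0 ≤ C * ∑ β, ‖a β‖ := mul_nonneg hC (Finset.sum_nonneg fun _ _ => norm_nonneg _)
  refine ⟨⟨_, hB⟩, ?_, fun y hy => (h a _ hb y hy).1⟩
  exact (convex_refTri d).lipschitzOnWith_of_nnnorm_hasFDerivWithin_le
    (fun y _ => (hasStrictFDerivAt_interp a y).hasFDerivAt.hasFDerivWithinAt)
    fun y hy => (h a _ hb y hy).2

namespace Mesh.Standing

variable {d k : ℕ} {M : Mesh d} {D : Geometry d} {T κ h : ℝ}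

/-- An interior point of an element lies in no other element: by conformity its positive coordinates
belong to vertices of the other element too, and elements with the same vertices coincide. -/
theorem elt_eq_of_interior (hM : M.Standing D k T κ h) {t : ℝ} (ht : t ∈ Icc 0 T) {K K' : M.Elt}
    {y : Space d} (hy : y ∈ interior (refTri d)) (hx : M.par D k t K y ∈ M.elt D k t K') :
    K' = K := by
  obtain ⟨l', hl', he⟩ := hx
  have h1 := hM.regular.conforming t ht K K' _ (bary_mem (interior_subset hy)) l' hl'
    ((par_eq M D t K y).symm.trans he.symm)
  have hsub : range (M.vert K) ⊆ range (M.vert K') := by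
    rintro _ ⟨a, rfl⟩
    by_contra hn
    have h2 : label (M.vert K) (bary y) (M.vert K a) = label (M.vert K') l' (M.vert K a) := h1 _
    rw [label_apply (hM.vert_injective K), label_of_notMem l' hn] at h2
    exact (bary_pos_of_mem_interior hM.one_le_d hy a).ne' h2
  refine (hM.fitted.distinct K K' (eq_of_subset_of_ncard_le hsub ?_ (finite_range _))).symm
  rw [← image_univ, ← image_univ, ncard_image_of_injective _ (hM.vert_injective K),
    ncard_image_of_injective _ (hM.vert_injective K')]

theorem liftFun_lift (hM : M.Standing D k T κ h) {t : ℝ} (ht : t ∈ Icc 0 T) {c : M.Coef k}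
    (hc : c ∈ M.nodal D k) {i : Fin 2} (j : Fin (M.n i)) {x : Space d}
    (hx : x ∈ M.elt D k t ⟨i, j⟩) :
    M.liftFun D k t i (M.fn D k t c) (M.lift D k t ⟨i, j⟩ x) = M.fn D k t c ⟨i, j⟩ x := by
  have hex : ∃ q : Fin (M.n i) × Space d, q.2 ∈ M.elt D k t ⟨i, q.1⟩ ∧
      M.lift D k t ⟨i, q.1⟩ q.2 = M.lift D k t ⟨i, j⟩ x := ⟨(j, x), hx, rfl⟩
  rw [Mesh.liftFun, dif_pos hex]
  obtain ⟨h1, h2⟩ := hex.choose_spec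
  have h3 := hM.regular.lift_injective t ht i _ _ _ h1 x hx h2
  rw [hM.fn_eq_of_mem ht hc h1 (K' := ⟨i, j⟩) (by rwa [h3]), h3]

theorem liftFun_liftPar (hM : M.Standing D k T κ h) {t : ℝ} (ht : t ∈ Icc 0 T) {c : M.Coef k}
    (hc : c ∈ M.nodal D k) {i : Fin 2} (j : Fin (M.n i)) {y : Space d} (hy : y ∈ refTri d) :
    M.liftFun D k t i (M.fn D k t c) (M.liftPar D k t ⟨i, j⟩ y) = interp k (c ⟨i, j⟩) y := by
  rw [Mesh.liftPar, hM.liftFun_lift ht hc j (par_mem_elt hy), hM.fn_par ht c _ hy]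

theorem le_dist_liftPar (hM : M.Standing D k T κ h) {t : ℝ} (ht : t ∈ Icc 0 T) (K : M.Elt)
    {y y' : Space d} (hy : y ∈ refTri d) (hy' : y' ∈ refTri d) :
    dist y y' ≤ d * κ / h * κ * dist (M.liftPar D k t K y) (M.liftPar D k t K y') := by
  refine (hM.le_dist_par ht K hy hy').trans ?_
  rw [mul_assoc]
  refine mul_le_mul_of_nonneg_left (hM.regular.lift_lower t ht K _ (par_mem_elt hy) _
    (par_mem_elt hy')) ?_
  exact div_nonneg (mul_nonneg (by positivity) hM.κ_pos.le) hM.h_pos.le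

theorem exists_liftPar_eq (hM : M.Standing D k T κ h) {t : ℝ} (ht : t ∈ Icc 0 T) {i : Fin 2}
    {z : Space d} (hz : z ∈ closure (D.Om i t)) :
    ∃ j : Fin (M.n i), ∃ y ∈ refTri d, M.liftPar D k t ⟨i, j⟩ y = z := by
  rw [← hM.regular.lift_onto t ht i] at hz
  obtain ⟨j, x, hx, rfl⟩ := mem_iUnion.1 hz
  rw [← par_image] at hx
  obtain ⟨y, hy, rfl⟩ := hx
  exact ⟨j, y, hy, rfl⟩

theorem lipschitzOnWith_fn (hM : M.Standing D k T κ h) {t : ℝ} (ht : t ∈ Icc 0 T) (c : M.Coef k)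
    (K : M.Elt) : ∃ B : ℝ≥0, LipschitzOnWith B (M.fn D k t c K) (M.elt D k t K) := by
  obtain ⟨B, hB, -⟩ := exists_lipschitz_interp (c K)
  refine ⟨B * (d * κ / h).toNNReal, ?_⟩
  rw [← par_image]
  refine LipschitzOnWith.of_dist_le_mul ?_
  rintro _ ⟨y, hy, rfl⟩ _ ⟨y', hy', rfl⟩
  rw [hM.fn_par ht c K hy, hM.fn_par ht c K hy']
  refine (hB.dist_le_mul y hy y' hy').trans ?_
  rw [NNReal.coe_mul, mul_assoc]
  refine mul_le_mul_of_nonneg_left ((hM.le_dist_par ht K hy hy').trans ?_) B.2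
  exact mul_le_mul_of_nonneg_right (Real.le_coe_toNNReal _) dist_nonneg

theorem isCompact_elt (M : Mesh d) (D : Geometry d) (t : ℝ) (K : M.Elt) :
    IsCompact (M.elt D k t K) := by
  rw [← par_image]
  exact (isCompact_refTri d).image_of_continuousOn fun y _ =>
    (hasStrictFDerivAt_par M D t K y).hasFDerivAt.continuousAt.continuousWithinAt

theorem volume_elt_diff (M : Mesh d) (D : Geometry d) (t : ℝ) (K : M.Elt) :
    volume (M.elt D k t K \ M.par D k t K '' interior (refTri d)) = 0 := by
  have h1 : M.elt D k t K \ M.par D k t K '' interior (refTri d) ⊆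
      M.par D k t K '' (refTri d \ interior (refTri d)) := by
    rw [← par_image]
    rintro _ ⟨⟨y, hy, rfl⟩, hn⟩
    exact mem_image_of_mem _ ⟨hy, fun h => hn (mem_image_of_mem _ h)⟩
  refine measure_mono_null h1 (addHaar_image_eq_zero_of_differentiableOn_of_addHaar_eq_zero volume
    (fun y _ =>
      (hasStrictFDerivAt_par M D t K y).hasFDerivAt.differentiableAt.differentiableWithinAt)
    (volume_refTri_diff_interior d))

theorem lift_lipschitzOnWith (hM : M.Standing D k T κ h) {t : ℝ} (ht : t ∈ Icc 0 T) (K : M.Elt) :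
    LipschitzOnWith κ.toNNReal (M.lift D k t K) (M.elt D k t K) ∧ ∀ x ∈ M.elt D k t K,
      ∀ x' ∈ M.elt D k t K,
        edist x x' ≤ κ.toNNReal * edist (M.lift D k t K x) (M.lift D k t K x') := by
  refine ⟨LipschitzOnWith.of_dist_le_mul fun x hx x' hx' => ?_, fun x hx x' hx' => ?_⟩
  · rw [Real.coe_toNNReal _ hM.κ_pos.le]
    exact hM.regular.lift_upper t ht K x hx x' hx'
  · rw [edist_dist, edist_dist, ← ENNReal.ofReal_coe_nnreal, Real.coe_toNNReal _ hM.κ_pos.le,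
      ← ENNReal.ofReal_mul hM.κ_pos.le]
    exact ENNReal.ofReal_le_ofReal (hM.regular.lift_lower t ht K x hx x' hx')

theorem enorm_gradient (f : Space d → ℝ) (x : Space d) : ‖gradient f x‖ₑ = ‖fderiv ℝ f x‖ₑ := by
  rw [gradient, ← ofReal_norm, ← ofReal_norm, LinearIsometryEquiv.norm_map]

end Mesh.Standing

/-- The trace on the interface of a lifted finite element function is controlled by the broken
`H¹` norm, with a constant that does not depend on the mesh. -/
theorem Geometry.IsAdmissible.exists_normSqHHalf_liftFun_le {d k : ℕ} {D : Geometry d} {T : ℝ}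
    (hd : 2 ≤ d) (hD : D.IsAdmissible k T) (κ : ℝ) :
    ∃ C : ℝ≥0, ∀ (M : Mesh d) (h : ℝ), M.Standing D k T κ h → ∀ t ∈ Icc 0 T, ∀ c ∈ M.nodal D k,
      ContinuousOn (M.liftFun D k t 0 (M.fn D k t c)) (closure (D.Om 0 t)) ∧
      normSqHHalf (D.Γ t) (M.liftFun D k t 0 (M.fn D k t c)) ≤
        C * M.normSqV D k t (M.fn D k t c) := by
  obtain ⟨C, hC⟩ := hD.exists_trace hd
  set L : ℝ≥0 := κ.toNNReal with hL
  refine ⟨C * (L ^ d + L ^ d * L ^ 2), fun M h hM t ht c hc => ?_⟩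
  obtain ⟨hu, hu2, g, hgm, hg, hg2⟩ := exists_upperGradient_of_pieces
    (X := closure (D.Om 0 t)) (P := fun j : Fin (M.n 0) => M.elt D k t ⟨0, j⟩)
    (O := fun j => M.par D k t ⟨0, j⟩ '' interior (refTri d))
    (φ := fun j => M.lift D k t ⟨0, j⟩) (ζ := fun j => M.fn D k t c ⟨0, j⟩)
    (u := M.liftFun D k t 0 (M.fn D k t c)) (L := L)
    (fun j => Mesh.Standing.isCompact_elt M D t _)
    (fun j => by
      rw [← Mesh.Standing.par_image]
      exact image_mono interior_subset)
    (fun j => hM.isOpen_par_image ht _) (fun j => Mesh.Standing.volume_elt_diff M D t _)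
    (fun j => (hM.lift_lipschitzOnWith ht _).1) (fun j => (hM.lift_lipschitzOnWith ht _).2)
    (hM.regular.lift_onto t ht 0)
    (by
      rintro j _ ⟨y, hy, rfl⟩ j' x' hx' he
      have h1 := hM.regular.lift_injective t ht 0 j' j x' hx' _
        (Mesh.Standing.par_mem_elt (interior_subset hy)) he
      have h2 := hM.elt_eq_of_interior ht hy (h1 ▸ hx')
      simpa using h2)
    (fun j => hM.lipschitzOnWith_fn ht c _)
    (by
      rintro j _ ⟨y, hy, rfl⟩
      exact (hM.hasFDerivAt_fn ht c _ hy).differentiableAt)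
    (fun j x hx => hM.liftFun_lift ht hc j hx)
  refine ⟨hu, (hC t ht _ g hu hgm hg).trans ?_⟩
  -- the trace only involves the elements of the inner submesh
  have hsum : ∀ F : M.Elt → ℝ≥0∞, ∑ j : Fin (M.n 0), F ⟨0, j⟩ ≤ ∑ K, F K := fun F => by
    rw [Fintype.sum_sigma, Fin.sum_univ_two]
    exact le_self_add
  rw [lintegral_add_right _ (hgm.pow_const 2), ENNReal.coe_mul, mul_assoc, ENNReal.coe_add, add_mul]
  gcongr
  · refine hu2.trans ?_
    rw [ENNReal.coe_pow]
    gcongr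
    refine (hsum fun K => ∫⁻ x in M.elt D k t K, ‖M.fn D k t c K x‖ₑ ^ 2).trans ?_
    exact Finset.sum_le_sum fun K _ => lintegral_mono fun x => le_self_add
  · refine hg2.trans ?_
    rw [ENNReal.coe_mul, ENNReal.coe_pow, ENNReal.coe_pow, mul_assoc]
    gcongr
    refine (hsum fun K => ∫⁻ x in M.elt D k t K, ‖fderiv ℝ (M.fn D k t c K) x‖ₑ ^ 2).trans ?_
    refine Finset.sum_le_sum fun K _ => lintegral_mono fun x => ?_
    simp only [Mesh.Standing.enorm_gradient]
    exact le_add_self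

theorem Geometry.IsAdmissible.exists_enorm_dualPair_sq_le {d k : ℕ} {D : Geometry d} {T : ℝ}
    (hd : 2 ≤ d) (hD : D.IsAdmissible k T) (κ : ℝ) :
    ∃ C : ℝ≥0, ∀ (M : Mesh d) (h : ℝ), M.Standing D k T κ h → ∀ t ∈ Icc 0 T, ∀ c ∈ M.nodal D k,
      ∀ g : HHalf (D.Γ t) →ₗ[ℝ] ℝ, dualNorm (D.Γ t) g < ⊤ →
      ‖dualPair g (M.liftFun D k t 0 (M.fn D k t c))‖ₑ ^ 2 ≤
        dualNorm (D.Γ t) g ^ 2 * (C * M.normSqV D k t (M.fn D k t c)) := by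
  obtain ⟨C, hC⟩ := hD.exists_normSqHHalf_liftFun_le hd κ
  refine ⟨C, fun M h hM t ht c hc g hg => ?_⟩
  by_cases hv : M.liftFun D k t 0 (M.fn D k t c) ∈ HHalf (D.Γ t)
  · exact (enorm_dualPair_sq_le hg hv).trans (mul_le_mul' le_rfl (hC M h hM t ht c hc).2)
  · rw [dualPair, dif_neg hv]
    simp

namespace Mesh.Standing

variable {d k : ℕ} {M : Mesh d} {D : Geometry d} {T κ h : ℝ}

/-- On a fixed mesh, the lifted functions with fixed coefficients, pulled back to the initial
interface, are bounded and Lipschitz uniformly in time. -/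
theorem exists_lipschitz_liftFun_flow (hM : M.Standing D k T κ h) {c : M.Coef k}
    (hc : c ∈ M.nodal D k) :
    ∃ L : ℝ≥0, ∀ t ∈ Icc 0 T,
      (∀ x ∈ D.Γ 0, |M.liftFun D k t 0 (M.fn D k t c) (D.Φ 0 t x)| ≤ L) ∧
      LipschitzOnWith L (fun x => M.liftFun D k t 0 (M.fn D k t c) (D.Φ 0 t x)) (D.Γ 0) := by
  have h0 := hM.zero_mem
  obtain ⟨C, hC⟩ := hM.adm.exists_interface_lipschitz hM.two_le h0
  obtain ⟨F, -, hF⟩ := hM.adm.flow_lipschitzOnWith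
  choose B hB hBb using fun K : M.Elt => exists_lipschitz_interp (c K)
  set b : ℝ≥0 := ∑ K, B K with hb
  have hBb' : ∀ K, B K ≤ b := fun K => Finset.single_le_sum (fun _ _ => zero_le) (Finset.mem_univ K)
  set m : ℝ≥0 := (d * κ / h * κ).toNNReal with hm
  have hm' : (m : ℝ) = d * κ / h * κ := Real.coe_toNNReal _
    (mul_nonneg (div_nonneg (mul_nonneg (by positivity) hM.κ_pos.le) hM.h_pos.le) hM.κ_pos.le)
  -- bound of the function plus its Lipschitz constant along curves: `b` for the interpolant, `m`
  -- for the inverse of the lifted parametrisation, `F` for the flow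
  set L : ℝ≥0 := b + b * m * F with hL
  refine ⟨L + C * L, fun t ht => ?_⟩
  set u : Space d → ℝ := fun x => M.liftFun D k t 0 (M.fn D k t c) (D.Φ 0 t x) with hu
  have hbound : ∀ x ∈ closure (D.Om 0 0), |u x| ≤ L := by
    intro x hx
    obtain ⟨j, y, hy, hyz⟩ := hM.exists_liftPar_eq ht (hM.adm.flow_mem ht 0 hx)
    simp only [hu]
    rw [← hyz, hM.liftFun_liftPar ht hc j hy]
    refine (hBb _ y hy).trans (NNReal.coe_le_coe.2 ((hBb' _).trans ?_))
    exact le_self_add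
  have hgrad : IsUpperGradientOn u (fun _ => (L : ℝ≥0∞)) (closure (D.Om 0 0)) := by
    intro p P hp hpm
    have hflow : ContinuousOn (fun s => D.Φ 0 t (p s)) (Icc 0 1) :=
      ((hF 0 t ht).1.comp hp hpm).continuousOn
    have hcomp : ∀ j : Fin (M.n 0), IsCompact (M.liftPar D k t ⟨0, j⟩ '' refTri d) := fun j =>
      (isCompact_refTri d).image_of_continuousOn
        ((hM.continuousOn_liftPar ⟨0, j⟩).comp (f := fun y => (t, y)) (by fun_prop)
          fun y hy => ⟨ht, hy⟩)
    -- a curve in the closed initial domain is cut into the closed sets of times at which its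
    -- image under the flow is in a given lifted element
    have key := dist_le_of_finite_closed_cover (f := fun s => u (p s)) (M := b * m * F * P)
      (C := fun j : Fin (M.n 0) => Icc (0 : ℝ) 1 ∩
        (fun s => D.Φ 0 t (p s)) ⁻¹' (M.liftPar D k t ⟨0, j⟩ '' refTri d))
      (fun j => hflow.preimage_isClosed_of_isClosed isClosed_Icc (hcomp j).isClosed) ?_
      Finset.univ 0 1 zero_le_one ?_
    · rw [lintegral_const, Measure.restrict_apply_univ, Real.volume_Ioc, ← ofReal_norm]
      simp only [sub_zero, ENNReal.ofReal_one, mul_one] at key ⊢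
      rw [← ENNReal.coe_mul, ← ENNReal.ofReal_coe_nnreal]
      refine ENNReal.ofReal_le_ofReal (key.trans ?_)
      have : b * m * F * P ≤ P * L := by
        rw [mul_comm P]
        gcongr
        exact le_add_self
      exact_mod_cast this
    · rintro j s ⟨hs, y, hy, hys⟩ s' ⟨hs', y', hy', hys'⟩
      simp only [hu] at *
      rw [← hys, ← hys', hM.liftFun_liftPar ht hc j hy, hM.liftFun_liftPar ht hc j hy']
      have e1 := (hB ⟨0, j⟩).dist_le_mul y hy y' hy'
      have e2 := hM.le_dist_liftPar ht ⟨0, j⟩ hy hy'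
      rw [hys, hys', ← hm'] at e2
      have e3 := (hF 0 t ht).1.dist_le_mul _ (hpm hs) _ (hpm hs')
      have e4 := hp.dist_le_mul s hs s' hs'
      rw [Real.dist_eq] at e1 e4
      calc _ ≤ (B ⟨0, j⟩ : ℝ) * dist y y' := e1
        _ ≤ b * (m * (F * (P * |s - s'|))) := by
          gcongr
          · exact_mod_cast hBb' _
          · exact e2.trans (by gcongr; exact e3.trans (by gcongr))
        _ = _ := by ring
    · intro s hs
      obtain ⟨j, y, hy, hyz⟩ := hM.exists_liftPar_eq ht (hM.adm.flow_mem ht 0 (hpm hs))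
      exact mem_iUnion₂.2 ⟨j, Finset.mem_univ _, hs, y, hy, hyz⟩
  have hsub := hM.adm.interface_subset_inner h0
  refine ⟨fun x hx => (hbound x (hsub hx)).trans (NNReal.coe_le_coe.2 le_self_add), ?_⟩
  exact (hC u L (fun x hx => hbound x (hsub hx)) hgrad).weaken le_add_self

theorem continuousOn_liftFun (hM : M.Standing D k T κ h) {c : M.Coef k}
    (hc : c ∈ M.nodal D k) (i : Fin 2) :
    ContinuousOn (fun q : ℝ × Space d => M.liftFun D k q.1 i (M.fn D k q.1 c) q.2)
      (D.cyl T i) := by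
  refine continuousOn_of_compact_parametrization (ι := Fin (M.n i)) (Z := ℝ × Space d)
    (Q := fun _ => Icc (0 : ℝ) T ×ˢ refTri d)
    (a := fun j q => (q.1, M.liftPar D k q.1 ⟨i, j⟩ q.2)) (b := fun j q => interp k (c ⟨i, j⟩) q.2)
    (fun _ => isCompact_Icc.prod (isCompact_refTri d))
    (fun j => continuousOn_fst.prodMk (hM.continuousOn_liftPar ⟨i, j⟩))
    (fun j => continuousOn_interp_const _ _) (fun j q hq => hM.liftFun_liftPar hq.1 hc j hq.2) ?_
  rintro ⟨t, z⟩ ⟨ht, hz⟩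
  obtain ⟨j, y, hy, hyz⟩ := hM.exists_liftPar_eq ht hz
  exact ⟨j, (t, y), ⟨ht, hy⟩, Prod.ext rfl hyz⟩

theorem liftFun_mem_HHalf (hM : M.Standing D k T κ h) {t : ℝ} (ht : t ∈ Icc 0 T) {c : M.Coef k}
    (hc : c ∈ M.nodal D k) : M.liftFun D k t 0 (M.fn D k t c) ∈ HHalf (D.Γ t) := by
  have h0 := hM.zero_mem
  obtain ⟨C, hC⟩ := hM.adm.exists_normSqHHalf_liftFun_le hM.two_le κ
  obtain ⟨C', hC'⟩ := hM.adm.exists_normSqHHalf_flow_le hM.two_le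
  obtain ⟨L, hL⟩ := hM.exists_lipschitz_liftFun_flow hc
  have hfin := hM.adm.isFiniteMeasure_surf hM.two_le h0
  have hfin' := hM.adm.isFiniteMeasure_surf hM.two_le ht
  have hcont := (hC M h hM t ht c hc).1.mono (hM.adm.interface_subset_inner ht)
  rw [mem_HHalf_iff (hcont.aestronglyMeasurable
    (hM.adm.interface_compact t ht).isClosed.measurableSet)]
  refine (hC' t ht _ hcont).trans_lt (ENNReal.mul_lt_top ENNReal.coe_lt_top ?_)
  exact normSqHHalf_lt_top_of_mem (mem_HHalf_of_lipschitz
    (hM.adm.interface_compact 0 h0).isClosed.measurableSet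
    (hM.adm.lintegral_gagliardoKernel_lt_top hM.two_le h0) (hL t ht).1 (hL t ht).2)

/-- Pulled back to the initial interface, the lifted functions form a continuous family, so that
`aemeasurable_dualPair` applies. -/
theorem aemeasurable_dualPair_liftFun (hM : M.Standing D k T κ h) {c : M.Coef k}
    (hc : c ∈ M.nodal D k) {G : (t : ℝ) → HHalf (D.Γ t) →ₗ[ℝ] ℝ} (hG : MemL2VΓdual D T G) :
    AEMeasurable (fun t => dualPair (G t) (M.liftFun D k t 0 (M.fn D k t c)))
      (volume.restrict (Icc 0 T)) := by
  have h0 := hM.zero_mem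
  have hsub := hM.adm.interface_subset_inner h0
  obtain ⟨L, hL⟩ := hM.exists_lipschitz_liftFun_flow hc
  refine (hM.adm.aemeasurable_dualPair hM.two_le hM.T_pos hG
    (v := fun t x => M.liftFun D k t 0 (M.fn D k t c) (D.Φ 0 t x)) (L := L)
    (fun t ht => (hL t ht).1) (fun t ht => (hL t ht).2)
    fun x hx => (hM.continuousOn_liftFun hc 0).comp (f := fun t => (t, D.Φ 0 t x))
      (continuousOn_id.prodMk (hM.adm.flow_continuousOn_time 0 (hsub hx)))
      fun t ht => ⟨ht, hM.adm.flow_mem ht 0 (hsub hx)⟩).congr ?_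
  filter_upwards [ae_restrict_mem measurableSet_Icc] with t ht
  have hfin := hM.adm.isFiniteMeasure_surf hM.two_le ht
  have hmeas := (hM.adm.interface_compact t ht).isClosed.measurableSet
  have heq : EqOn (interfacePush D t fun x => M.liftFun D k t 0 (M.fn D k t c) (D.Φ 0 t x))
      (M.liftFun D k t 0 (M.fn D k t c)) (D.Γ t) := by
    intro z hz
    rw [← hM.adm.flow_interface 0 t ht] at hz
    obtain ⟨x, hx, rfl⟩ := hz
    rw [hM.adm.interfacePush_flow ht _ hx]
  have hmem := hM.liftFun_mem_HHalf ht hc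
  refine dualPair_congr hmeas (hG.bounded t ht) ?_ hmem heq
  rw [mem_HHalf_iff ((hM.adm.interfacePush_continuousOn ht
    (hL t ht).2.continuousOn).aestronglyMeasurable hmeas), normSqHHalf_congr hmeas heq]
  exact normSqHHalf_lt_top_of_mem hmem

end Mesh.Standing

/-! ### Lipschitz changes of variables -/

section ChangeOfVariables

variable {d : ℕ} {S : Set (Space d)} {φ : Space d → Space d} {K : ℝ≥0}

theorem volume_image_eq_zero {A : Set (Space d)} (hA : MeasurableSet A) (hφ : LipschitzOnWith K φ A)
    (h0 : volume A = 0) : volume (φ '' A) = 0 := by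
  have h1 := volume_setLIntegral_image_le hA hφ fun _ => 1
  rw [setLIntegral_one, setLIntegral_one, h0, mul_zero] at h1
  exact le_antisymm h1 zero_le

/-- By Rademacher's theorem, an injective Lipschitz map on an open set is differentiable outside a
null set, which is mapped to a null set. -/
theorem exists_differentiable_part (hS : IsOpen S) (hφ : LipschitzOnWith K φ S) :
    ∃ A ⊆ S, MeasurableSet A ∧ (∀ x ∈ A, DifferentiableAt ℝ φ x) ∧ A =ᵐ[volume] S ∧
      φ '' A =ᵐ[volume] φ '' S := by
  set A : Set (Space d) := S ∩ {x | DifferentiableAt ℝ φ x} with hA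
  have hAm : MeasurableSet A := hS.measurableSet.inter (measurableSet_of_differentiableAt ℝ φ)
  have hnull : volume (S \ A) = 0 := by
    have h1 := hφ.ae_differentiableWithinAt_of_mem (μ := volume)
    refine measure_mono_null (fun x hx => ?_) h1
    simp only [mem_compl_iff, mem_ofPred_eq]
    intro h2
    exact hx.2 ⟨hx.1, (h2 hx.1).differentiableAt (hS.mem_nhds hx.1)⟩
  refine ⟨A, inter_subset_left, hAm, fun x hx => hx.2, ?_, ?_⟩
  · exact (LE.le.eventuallyLE inter_subset_left).antisymm (ae_le_set.2 hnull)
  · refine (LE.le.eventuallyLE (image_mono inter_subset_left)).antisymm (ae_le_set.2 ?_)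
    refine measure_mono_null (t := φ '' (S \ A)) ?_ (volume_image_eq_zero
      (hS.measurableSet.diff hAm) (hφ.mono sdiff_subset) hnull)
    rintro _ ⟨⟨y, hy, rfl⟩, hn⟩
    exact mem_image_of_mem _ ⟨hy, fun h => hn (mem_image_of_mem _ h)⟩

theorem setIntegral_image_of_lipschitz (hS : IsOpen S) (hφ : LipschitzOnWith K φ S)
    (hinj : InjOn φ S) (g : Space d → ℝ) :
    ∫ z in φ '' S, g z = ∫ x in S, |(fderiv ℝ φ x).det| * g (φ x) := by
  obtain ⟨A, hAS, hAm, hdiff, h1, h2⟩ := exists_differentiable_part hS hφ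
  rw [← setIntegral_congr_set h1, ← setIntegral_congr_set h2,
    integral_image_eq_integral_abs_det_fderiv_smul volume hAm
      (fun x hx => (hdiff x hx).hasFDerivAt.hasFDerivWithinAt) (hinj.mono hAS)]
  rfl

theorem setLIntegral_image_of_lipschitz (hS : IsOpen S) (hφ : LipschitzOnWith K φ S)
    (hinj : InjOn φ S) (g : Space d → ℝ≥0∞) :
    ∫⁻ z in φ '' S, g z = ∫⁻ x in S, ENNReal.ofReal |(fderiv ℝ φ x).det| * g (φ x) := by
  obtain ⟨A, hAS, hAm, hdiff, h1, h2⟩ := exists_differentiable_part hS hφ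
  rw [← setLIntegral_congr h1, ← setLIntegral_congr h2,
    lintegral_image_eq_lintegral_abs_det_fderiv_mul volume hAm
      (fun x hx => (hdiff x hx).hasFDerivAt.hasFDerivWithinAt) (hinj.mono hAS)]

end ChangeOfVariables

/-- The spatial derivative of a map that is continuous in space and time is measurable. -/
theorem exists_measurable_det_fderiv {d : ℕ} {T : ℝ} {S : Set (Space d)} (hS : IsOpen S)
    {φ : ℝ → Space d → Space d}
    (hφ : ContinuousOn (fun q : ℝ × Space d => φ q.1 q.2) (Icc 0 T ×ˢ closure S)) :
    ∃ J : ℝ × Space d → ℝ, Measurable J ∧ ∀ t ∈ Icc 0 T, ∀ x ∈ S,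
      J (t, x) = |(fderiv ℝ (φ t) x).det| := by
  obtain ⟨g, hg⟩ := ContinuousMap.exists_restrict_eq (Y := Space d)
    (isClosed_Icc.prod (isClosed_closure (s := S)))
    ⟨_, continuousOn_iff_continuous_domRestrict.1 hφ⟩
  refine ⟨fun q => |(fderiv ℝ (fun x => g (q.1, x)) q.2).det|, ?_, fun t ht x hx => ?_⟩
  · have h1 := measurable_fderiv_with_param ℝ (f := fun (t : ℝ) (x : Space d) => g (t, x))
      (by simpa [Function.uncurry_def] using g.continuous)
    exact (continuous_abs.comp ContinuousLinearMap.continuous_det).measurable.comp h1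
  · have h1 : (fun x => g (t, x)) =ᶠ[𝓝 x] φ t := by
      filter_upwards [hS.mem_nhds hx] with z hz
      have := DFunLike.congr_fun hg ⟨(t, z), ht, subset_closure hz⟩
      simpa using this
    simp only
    rw [h1.fderiv_eq]

namespace Geometry.IsAdmissible

variable {d k : ℕ} {D : Geometry d} {T : ℝ}

/-- A set of finite `(d - 1)`-dimensional measure is a null set. -/
theorem volume_interface (hd : 2 ≤ d) (hD : D.IsAdmissible k T) {t : ℝ} (ht : t ∈ Icc 0 T) :
    volume (D.Γ t) = 0 := by
  have hfin := hD.isFiniteMeasure_surf hd ht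
  have h1 : (Measure.euclideanHausdorffMeasure (d - 1) : Measure (Space d)) (D.Γ t) ≠ ⊤ := by
    have := measure_ne_top (surf (D.Γ t)) univ
    rwa [surf, Measure.restrict_apply_univ] at this
  have hlt : ((d - 1 : ℕ) : ℝ) < (d : ℕ) := by
    exact_mod_cast Nat.sub_lt (by omega) one_pos
  rw [← EuclideanSpace.euclideanHausdorffMeasure_eq_volume]
  rcases Measure.hausdorffMeasure_zero_or_top hlt (D.Γ t) with h | h
  · rw [Measure.euclideanHausdorffMeasure_def, Measure.smul_apply, h, smul_zero]
  · rw [Measure.euclideanHausdorffMeasure_def, Measure.smul_apply, h] at h1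
    refine absurd ?_ h1
    rw [ENNReal.smul_def, smul_eq_mul, ENNReal.mul_top]
    exact_mod_cast Measure.addHaarScalarFactor_volume_hausdorffMeasure_ne_zero (d - 1)

/-- The boundary of the polyhedral domain lies in finitely many boundaries of convex sets. -/
theorem volume_frontier_domain (hD : D.IsAdmissible k T) : volume (frontier D.Ω) = 0 := by
  obtain ⟨P, hP⟩ := hD.polyhedral
  have h1 : frontier D.Ω ⊆ ⋃ s ∈ P, frontier (convexHull ℝ (s : Set (Space d))) := by
    intro x hx
    have hxc : x ∈ ⋃ s ∈ P, convexHull ℝ (s : Set (Space d)) := hP ▸ hx.1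
    obtain ⟨s, hs, hxs⟩ := mem_iUnion₂.1 hxc
    refine mem_iUnion₂.2 ⟨s, hs, subset_closure hxs, fun hi => hx.2 ?_⟩
    rw [hD.isOpen.interior_eq, ← hD.regular]
    refine interior_mono ?_ hi
    rw [hP]
    exact subset_biUnion_of_mem
      (u := fun s : Finset (Space d) => convexHull ℝ (s : Set (Space d))) hs
  refine measure_mono_null h1 ((measure_biUnion_null_iff P.countable_toSet).2 fun s _ => ?_)
  exact (convex_convexHull ℝ _).addHaar_frontier volume

theorem om_ae_eq_closure (hd : 2 ≤ d) (hD : D.IsAdmissible k T) {t : ℝ} (ht : t ∈ Icc 0 T)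
    (i : Fin 2) : (D.Om i t : Set (Space d)) =ᵐ[volume] closure (D.Om i t) := by
  refine (LE.le.eventuallyLE subset_closure).antisymm (ae_le_set.2 ?_)
  refine measure_mono_null (t := D.Γ t ∪ frontier D.Ω) ?_
    (measure_union_null (hD.volume_interface hd ht) hD.volume_frontier_domain)
  rintro x ⟨hx, hn⟩
  fin_cases i
  · left
    rw [← hD.inner_frontier t ht]
    exact ⟨hx, fun h => hn (interior_subset h)⟩
  · by_cases hΩ : x ∈ D.Ω
    · left
      refine hD.mem_interface_of_mem_closure ht ?_ hx
      by_contra h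
      refine hn ?_
      change x ∈ D.Om 1 t
      rw [hD.outer_eq t ht]
      exact ⟨hΩ, h⟩
    · right
      exact ⟨hD.closure_om_subset ht 1 hx, fun h => hΩ (interior_subset h)⟩

/-! ### The volume load -/

/-- Square integrability on the pulled-back cylinder gives square integrability at almost every
time. -/
theorem ae_memLp (hD : D.IsAdmissible k T) {f : ℝ → Fin 2 → Space d → ℝ} (hf : MemL2H D T f) :
    ∀ᵐ t ∂volume.restrict (Icc 0 T), ∀ i, MemLp (f t i) 2 (volume.restrict (D.Om i t)) := by
  rw [ae_all_iff]
  intro i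
  obtain ⟨K, -, hK⟩ := hD.flow_lipschitzOnWith
  have h1 := hf i
  rw [Measure.volume_eq_prod, ← Measure.prod_restrict] at h1
  have h2 := h1.integrable_sq.prod_right_ae
  filter_upwards [h2, h1.aestronglyMeasurable.prodMk_left, ae_restrict_mem measurableSet_Icc]
    with t ht hm htI
  have h0 : (0 : ℝ) ∈ Icc 0 T := ⟨le_rfl, htI.1.trans htI.2⟩
  have hS := hD.om_isOpen h0 i
  have hO := hD.om_isOpen htI i
  -- the inverse flow, extended to a measurable map, does not charge null sets
  obtain ⟨g, hgm, hg⟩ := exists_measurable_eqOn ((hK i t htI).2.continuousOn.mono subset_closure)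
    hO.measurableSet
  have hgmem : ∀ z ∈ D.Om i t, g z ∈ D.Om i 0 ∧ D.Φ i t (g z) = z := by
    intro z hz
    have hz' := hz
    rw [← hD.flow_interior i t htI] at hz'
    obtain ⟨x, hx, rfl⟩ := hz'
    rw [hg hz, hD.flowInv_flow htI i (subset_closure hx)]
    exact ⟨hx, rfl⟩
  have hq : Measure.QuasiMeasurePreserving g (volume.restrict (D.Om i t))
      (volume.restrict (D.Om i 0)) := by
    refine ⟨hgm, Measure.AbsolutelyContinuous.mk fun s hs hs0 => ?_⟩
    rw [Measure.restrict_apply hs] at hs0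
    rw [Measure.map_apply hgm hs, Measure.restrict_apply (hgm hs)]
    refine measure_mono_null (t := D.Φ i t '' (s ∩ D.Om i 0)) ?_ (volume_image_eq_zero
      (hs.inter hS.measurableSet) ((hK i t htI).1.mono
        (inter_subset_right.trans subset_closure)) hs0)
    rintro z ⟨hz, hz'⟩
    exact ⟨g z, ⟨hz, (hgmem z hz').1⟩, (hgmem z hz').2⟩
  have hmeas : AEStronglyMeasurable (f t i) (volume.restrict (D.Om i t)) := by
    refine (hm.comp_quasiMeasurePreserving hq).congr ?_
    filter_upwards [ae_restrict_mem hO.measurableSet] with z hz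
    simp only [Function.comp_apply, (hgmem z hz).2]
  refine ⟨hmeas, ?_⟩
  have h3 : eLpNorm (f t i) 2 (volume.restrict (D.Om i t)) ^ 2 < ⊤ := by
    rw [eLpNorm_two_sq, ← hD.flow_interior i t htI]
    refine (volume_setLIntegral_image_le hS.measurableSet
      ((hK i t htI).1.mono subset_closure) _).trans_lt ?_
    refine ENNReal.mul_lt_top (by finiteness) ?_
    have h4 := ht.2
    simpa [HasFiniteIntegral, enorm_pow] using h4
  exact (ENNReal.pow_lt_top_iff.1 h3).resolve_right two_ne_zero

/-- The change of variables by the flow, with a Jacobian that is measurable in space and time. -/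
theorem exists_measurable_jacobian (hD : D.IsAdmissible k T) (i : Fin 2) :
    ∃ J : ℝ × Space d → ℝ, Measurable J ∧ ∀ t ∈ Icc 0 T,
      (∀ g : Space d → ℝ, ∫ z in D.Om i t, g z = ∫ x in D.Om i 0, J (t, x) * g (D.Φ i t x)) ∧
      ∀ g : Space d → ℝ≥0∞, ∫⁻ z in D.Om i t, g z =
        ∫⁻ x in D.Om i 0, ENNReal.ofReal (J (t, x)) * g (D.Φ i t x) := by
  by_cases hT : 0 ≤ T
  swap
  · exact ⟨0, measurable_zero, fun t ht => absurd (ht.1.trans ht.2) hT⟩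
  have h0 : (0 : ℝ) ∈ Icc 0 T := ⟨le_rfl, hT⟩
  have hS := hD.om_isOpen h0 i
  obtain ⟨K, -, hK⟩ := hD.flow_lipschitzOnWith
  obtain ⟨J, hJ, hJeq⟩ := exists_measurable_det_fderiv hS (hD.flow_continuousOn i)
  refine ⟨J, hJ, fun t ht => ⟨fun g => ?_, fun g => ?_⟩⟩
  · rw [← hD.flow_interior i t ht, setIntegral_image_of_lipschitz hS
      ((hK i t ht).1.mono subset_closure) ((hD.flow_injOn ht i).mono subset_closure)]
    exact setIntegral_congr_fun hS.measurableSet fun x hx => by simp only [hJeq t ht x hx]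
  · rw [← hD.flow_interior i t ht, setLIntegral_image_of_lipschitz hS
      ((hK i t ht).1.mono subset_closure) ((hD.flow_injOn ht i).mono subset_closure)]
    exact setLIntegral_congr_fun hS.measurableSet fun x hx => by simp only [hJeq t ht x hx]

theorem aemeasurable_normSq (hD : D.IsAdmissible k T) {f : ℝ → Fin 2 → Space d → ℝ}
    (hf : MemL2H D T f) : AEMeasurable (fun t => ∑ i, ∫⁻ x in D.Om i t, ‖f t i x‖ₑ ^ 2)
      (volume.restrict (Icc 0 T)) := by
  refine Finset.aemeasurable_fun_sum _ fun i _ => ?_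
  obtain ⟨J, hJ, hJeq⟩ := hD.exists_measurable_jacobian i
  have h1 := (hf i).aestronglyMeasurable.aemeasurable
  rw [Measure.volume_eq_prod, ← Measure.prod_restrict] at h1
  have h2 : AEMeasurable (fun q : ℝ × Space d => ENNReal.ofReal (J q) *
      ‖f q.1 i (D.Φ i q.1 q.2)‖ₑ ^ 2) ((volume.restrict (Icc 0 T)).prod
        (volume.restrict (D.Om i 0))) :=
    hJ.ennreal_ofReal.aemeasurable.mul (h1.enorm.pow_const 2)
  refine h2.lintegral_prod_right'.congr ?_
  filter_upwards [ae_restrict_mem measurableSet_Icc] with t ht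
  exact ((hJeq t ht).2 fun x => ‖f t i x‖ₑ ^ 2).symm

theorem normSqL2H_lt_top (hD : D.IsAdmissible k T) {f : ℝ → Fin 2 → Space d → ℝ}
    (hf : MemL2H D T f) : normSqL2H D T f < ⊤ := by
  obtain ⟨K, -, hK⟩ := hD.flow_lipschitzOnWith
  have h1 : ∀ i, ∫⁻ t in Icc 0 T, ∫⁻ x in D.Om i 0, ‖f t i (D.Φ i t x)‖ₑ ^ 2 < ⊤ := by
    intro i
    have h2 := (hf i).aestronglyMeasurable.aemeasurable
    have h3 : eLpNorm (fun q : ℝ × Space d => f q.1 i (D.Φ i q.1 q.2)) 2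
        (volume.restrict (Icc 0 T ×ˢ D.Om i 0)) ^ 2 < ⊤ := ENNReal.pow_lt_top (hf i).2
    rw [eLpNorm_two_sq] at h3
    rw [Measure.volume_eq_prod, ← Measure.prod_restrict] at h2 h3
    rwa [lintegral_prod _ (h2.enorm.pow_const 2)] at h3
  have h4 : normSqL2H D T f ≤ ∫⁻ t in Icc 0 T, ∑ i,
      (K : ℝ≥0∞) ^ d * ∫⁻ x in D.Om i 0, ‖f t i (D.Φ i t x)‖ₑ ^ 2 := by
    refine setLIntegral_mono' measurableSet_Icc fun t ht => Finset.sum_le_sum fun i _ => ?_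
    have h0 : (0 : ℝ) ∈ Icc 0 T := ⟨le_rfl, ht.1.trans ht.2⟩
    rw [← hD.flow_interior i t ht]
    exact volume_setLIntegral_image_le (hD.om_isOpen h0 i).measurableSet
      ((hK i t ht).1.mono subset_closure) _
  refine h4.trans_lt ?_
  rw [lintegral_finsetSum' _ fun i _ => ?_]
  · refine ENNReal.sum_lt_top.2 fun i _ => ?_
    rw [lintegral_const_mul' _ _ (by finiteness)]
    exact ENNReal.mul_lt_top (by finiteness) (h1 i)
  · have h2 := (hf i).aestronglyMeasurable.aemeasurable
    rw [Measure.volume_eq_prod, ← Measure.prod_restrict] at h2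
    exact ((h2.enorm.pow_const 2).lintegral_prod_right').const_mul _

end Geometry.IsAdmissible

namespace Mesh

/-- The volume part of the load functional. -/
def volLoad {d : ℕ} (M : Mesh d) (D : Geometry d) (k : ℕ) (f : ℝ → Fin 2 → Space d → ℝ) (t : ℝ)
    (ζ : M.Fun) : ℝ :=
  ∑ K : M.Elt, ∫ x in M.elt D k t K,
    f t K.1 (M.lift D k t K x) * |(fderiv ℝ (M.lift D k t K) x).det| * ζ K x

namespace Standing

variable {d k : ℕ} {M : Mesh d} {D : Geometry d} {T κ h : ℝ}

theorem continuousOn_liftFun_closure (hM : M.Standing D k T κ h) {t : ℝ} (ht : t ∈ Icc 0 T)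
    {c : M.Coef k} (hc : c ∈ M.nodal D k) (i : Fin 2) :
    ContinuousOn (M.liftFun D k t i (M.fn D k t c)) (closure (D.Om i t)) :=
  (hM.continuousOn_liftFun hc i).comp (f := fun z => (t, z)) (by fun_prop) fun _ hz => ⟨ht, hz⟩

theorem memLp_liftFun (hM : M.Standing D k T κ h) {t : ℝ} (ht : t ∈ Icc 0 T)
    {c : M.Coef k} (hc : c ∈ M.nodal D k) (i : Fin 2) :
    MemLp (M.liftFun D k t i (M.fn D k t c)) 2 (volume.restrict (D.Om i t)) := by
  have hcomp := hM.adm.isCompact_closure_om ht i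
  have hcont := hM.continuousOn_liftFun_closure ht hc i
  have hfin : IsFiniteMeasure (volume.restrict (closure (D.Om i t))) :=
    ⟨by rw [Measure.restrict_apply_univ]; exact hcomp.measure_lt_top⟩
  obtain ⟨B, hB⟩ := hcomp.exists_bound_of_continuousOn hcont
  refine (MemLp.of_bound (hcont.aestronglyMeasurable isClosed_closure.measurableSet) B
    ?_).mono_measure (Measure.restrict_mono subset_closure le_rfl)
  filter_upwards [ae_restrict_mem isClosed_closure.measurableSet] with z hz using hB z hz

/-- The images of the open elements under the lift partition `Ωᵢ(t)` up to a null set. -/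
theorem iUnion_lift_ae_eq (hM : M.Standing D k T κ h) {t : ℝ} (ht : t ∈ Icc 0 T) (i : Fin 2) :
    (⋃ j : Fin (M.n i), M.lift D k t ⟨i, j⟩ '' (M.par D k t ⟨i, j⟩ '' interior (refTri d)) :
      Set (Space d)) =ᵐ[volume] D.Om i t := by
  refine EventuallyEq.trans ?_ (hM.adm.om_ae_eq_closure hM.two_le ht i).symm
  have hsub : ∀ K, M.par D k t K '' interior (refTri d) ⊆ M.elt D k t K := fun K => by
    rw [← par_image]
    exact image_mono interior_subset
  rw [← hM.regular.lift_onto t ht i]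
  refine (LE.le.eventuallyLE (iUnion_mono fun j => image_mono (hsub _))).antisymm (ae_le_set.2 ?_)
  refine measure_mono_null (t := ⋃ j : Fin (M.n i), M.lift D k t ⟨i, j⟩ ''
    (M.elt D k t ⟨i, j⟩ \ M.par D k t ⟨i, j⟩ '' interior (refTri d))) ?_
    (measure_iUnion_null fun j => ?_)
  · rintro z ⟨hz, hn⟩
    obtain ⟨j, x, hx, rfl⟩ := mem_iUnion.1 hz
    exact mem_iUnion.2 ⟨j, x, ⟨hx, fun h => hn (mem_iUnion.2 ⟨j, mem_image_of_mem _ h⟩)⟩, rfl⟩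
  · exact volume_image_eq_zero ((isCompact_elt M D t _).isClosed.measurableSet.diff
      (hM.isOpen_par_image ht _).measurableSet)
      ((hM.lift_lipschitzOnWith ht _).1.mono sdiff_subset) (volume_elt_diff M D t _)

/-- By the change of variables `z = Λ(x)`, the volume load is `∑ᵢ ∫ fᵢ ζ^l` over the exact
subdomains. -/
theorem volLoad_eq (hM : M.Standing D k T κ h) {t : ℝ} (ht : t ∈ Icc 0 T)
    {f : ℝ → Fin 2 → Space d → ℝ} (hf : ∀ i, MemLp (f t i) 2 (volume.restrict (D.Om i t)))
    {c : M.Coef k} (hc : c ∈ M.nodal D k) :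
    M.volLoad D k f t (M.fn D k t c) =
      ∑ i, ∫ z in D.Om i t, f t i z * M.liftFun D k t i (M.fn D k t c) z := by
  rw [Mesh.volLoad, Fintype.sum_sigma]
  refine Finset.sum_congr rfl fun i _ => ?_
  have hsub : ∀ K, M.par D k t K '' interior (refTri d) ⊆ M.elt D k t K := fun K => by
    rw [← par_image]
    exact image_mono interior_subset
  have hinj : ∀ j, InjOn (M.lift D k t ⟨i, j⟩) (M.elt D k t ⟨i, j⟩) := fun j x hx x' hx' he =>
    hM.regular.lift_injective t ht i j j x hx x' hx' he
  have hae := hM.iUnion_lift_ae_eq ht i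
  have hint : IntegrableOn (fun z => f t i z * M.liftFun D k t i (M.fn D k t c) z)
      (⋃ j : Fin (M.n i), M.lift D k t ⟨i, j⟩ '' (M.par D k t ⟨i, j⟩ '' interior (refTri d))) := by
    rw [integrableOn_congr_set_ae hae]
    exact (hf i).integrable_mul (hM.memLp_liftFun ht hc i)
  rw [← setIntegral_congr_set hae, integral_iUnion_fintype]
  · refine Finset.sum_congr rfl fun j _ => ?_
    rw [setIntegral_image_of_lipschitz (hM.isOpen_par_image ht _)
      ((hM.lift_lipschitzOnWith ht _).1.mono (hsub _)) ((hinj j).mono (hsub _)),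
      ← setIntegral_congr_set ((LE.le.eventuallyLE (hsub _)).antisymm
        (ae_le_set.2 (volume_elt_diff M D t _)))]
    refine setIntegral_congr_fun (hM.isOpen_par_image ht _).measurableSet fun x hx => ?_
    simp only
    rw [hM.liftFun_lift ht hc j (hsub _ hx)]
    ring
  · exact fun j => (hM.isOpen_par_image ht _).measurableSet.image_of_continuousOn_injOn
      ((hM.lift_lipschitzOnWith ht _).1.continuousOn.mono (hsub _)) ((hinj j).mono (hsub _))
  · intro j j' hjj
    refine disjoint_left.2 ?_
    rintro _ ⟨_, ⟨y, hy, rfl⟩, rfl⟩ ⟨_, ⟨y', hy', rfl⟩, he⟩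
    have h1 := hM.regular.lift_injective t ht i j' j _ (par_mem_elt (interior_subset hy')) _
      (par_mem_elt (interior_subset hy)) he
    have h2 := hM.elt_eq_of_interior ht hy (K' := ⟨i, j'⟩)
      (h1 ▸ par_mem_elt (interior_subset hy'))
    exact hjj (by simpa using h2.symm)
  · exact fun j => hint.mono_set (subset_iUnion (fun j : Fin (M.n i) =>
      M.lift D k t ⟨i, j⟩ '' (M.par D k t ⟨i, j⟩ '' interior (refTri d))) j)

/-- The volume load is bounded by the `L²` norms: Cauchy–Schwarz on the exact subdomains, where
`f` is given, and the Lipschitz bound for the lift to return to the elements. -/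
theorem volLoad_bound (hM : M.Standing D k T κ h) {t : ℝ} (ht : t ∈ Icc 0 T)
    {f : ℝ → Fin 2 → Space d → ℝ} (hf : ∀ i, MemLp (f t i) 2 (volume.restrict (D.Om i t)))
    {c : M.Coef k} (hc : c ∈ M.nodal D k) :
    ‖M.volLoad D k f t (M.fn D k t c)‖ₑ ^ 2 ≤ 2 * ((∑ i, ∫⁻ z in D.Om i t, ‖f t i z‖ₑ ^ 2) *
      (κ.toNNReal ^ d * M.normSqH D k t (M.fn D k t c))) := by
  set a : Fin 2 → ℝ≥0∞ := fun i => ∫⁻ z in D.Om i t, ‖f t i z‖ₑ ^ 2 with ha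
  set b : Fin 2 → ℝ≥0∞ := fun i =>
    ∫⁻ z in D.Om i t, ‖M.liftFun D k t i (M.fn D k t c) z‖ₑ ^ 2 with hb
  have h1 : ∀ i, ‖∫ z in D.Om i t, f t i z * M.liftFun D k t i (M.fn D k t c) z‖ₑ ^ 2 ≤
      a i * b i := by
    intro i
    refine le_trans ?_ (lintegral_mul_sq_le (hf i).aestronglyMeasurable.aemeasurable.enorm
      (hM.memLp_liftFun ht hc i).aestronglyMeasurable.aemeasurable.enorm)
    gcongr
    refine (enorm_integral_le_lintegral_enorm _).trans (le_of_eq ?_)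
    simp only [enorm_mul]
  have h2 : ∑ i, b i ≤ κ.toNNReal ^ d * M.normSqH D k t (M.fn D k t c) := by
    rw [Mesh.normSqH, Fintype.sum_sigma, Finset.mul_sum]
    refine Finset.sum_le_sum fun i _ => ?_
    rw [Finset.mul_sum]
    calc b i ≤ ∫⁻ z in ⋃ j : Fin (M.n i), M.lift D k t ⟨i, j⟩ '' M.elt D k t ⟨i, j⟩,
          ‖M.liftFun D k t i (M.fn D k t c) z‖ₑ ^ 2 := by
          rw [hM.regular.lift_onto t ht i]
          exact lintegral_mono_set subset_closure
      _ ≤ ∑ j : Fin (M.n i), ∫⁻ z in M.lift D k t ⟨i, j⟩ '' M.elt D k t ⟨i, j⟩,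
          ‖M.liftFun D k t i (M.fn D k t c) z‖ₑ ^ 2 := by
          refine (lintegral_iUnion_le _ _).trans_eq ?_
          rw [tsum_fintype]
      _ ≤ _ := by
          refine Finset.sum_le_sum fun j _ => ?_
          have hm := (isCompact_elt (k := k) M D t ⟨i, j⟩).isClosed.measurableSet
          refine (volume_setLIntegral_image_le hm (hM.lift_lipschitzOnWith ht _).1 _).trans_eq ?_
          congr 1
          exact setLIntegral_congr_fun hm fun x hx => by simp only [hM.liftFun_lift ht hc j hx]
  rw [hM.volLoad_eq ht hf hc, Fin.sum_univ_two]
  refine (pow_le_pow_left' (enorm_add_le _ _) 2).trans ((add_sq_le_two_mul _ _).trans ?_)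
  gcongr
  refine (add_le_add (h1 0) (h1 1)).trans ?_
  refine le_trans ?_ (mul_le_mul' le_rfl h2)
  rw [Fin.sum_univ_two, Fin.sum_univ_two, add_mul, mul_add, mul_add]
  exact add_le_add le_self_add le_add_self

/-- In coordinates of the initial domain the volume load is an integral over a fixed set, so that
Fubini's theorem gives measurability in time. -/
theorem aemeasurable_volLoad (hM : M.Standing D k T κ h) {f : ℝ → Fin 2 → Space d → ℝ}
    (hf : MemL2H D T f) {c : M.Coef k} (hc : c ∈ M.nodal D k) :
    AEMeasurable (fun t => M.volLoad D k f t (M.fn D k t c)) (volume.restrict (Icc 0 T)) := by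
  have h0 := hM.zero_mem
  have h1 : ∀ i, AEStronglyMeasurable (fun t => ∫ z in D.Om i t,
      f t i z * M.liftFun D k t i (M.fn D k t c) z) (volume.restrict (Icc 0 T)) := by
    intro i
    obtain ⟨J, hJ, hJeq⟩ := hM.adm.exists_measurable_jacobian i
    have h2 := (hf i).aestronglyMeasurable
    have h3 : ContinuousOn (fun q : ℝ × Space d =>
        M.liftFun D k q.1 i (M.fn D k q.1 c) (D.Φ i q.1 q.2)) (Icc 0 T ×ˢ D.Om i 0) :=
      (hM.continuousOn_liftFun hc i).comp (f := fun q : ℝ × Space d => (q.1, D.Φ i q.1 q.2))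
        (continuousOn_fst.prodMk ((hM.adm.flow_continuousOn i).mono
          (prod_mono le_rfl subset_closure)))
        fun q hq => ⟨hq.1, hM.adm.flow_mem hq.1 i (subset_closure hq.2)⟩
    have h4 := h3.aestronglyMeasurable (μ := volume)
      (measurableSet_Icc.prod (hM.adm.om_isOpen h0 i).measurableSet)
    have h5 := hJ.aestronglyMeasurable.mul (h2.mul h4)
    rw [Measure.volume_eq_prod, ← Measure.prod_restrict] at h5
    refine h5.integral_prod_right'.congr ?_
    filter_upwards [ae_restrict_mem measurableSet_Icc] with t ht
    exact ((hJeq t ht).1 fun z => f t i z * M.liftFun D k t i (M.fn D k t c) z).symm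
  refine (Finset.aemeasurable_fun_sum Finset.univ fun i _ => (h1 i).aemeasurable).congr ?_
  filter_upwards [hM.adm.ae_memLp hf, ae_restrict_mem measurableSet_Icc] with t hft ht
  exact (hM.volLoad_eq ht hft hc).symm

end Standing

end Mesh

/-! ### The bilinear forms in reference coordinates -/

section Param

variable {d : ℕ} {T : ℝ} {g g' : ℝ × Space d → ℝ}

theorem integrableOn_refTri (hg : ContinuousOn g (Icc 0 T ×ˢ refTri d)) {t : ℝ}
    (ht : t ∈ Icc 0 T) : IntegrableOn (fun y => g (t, y)) (interior (refTri d)) := by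
  have h1 : ContinuousOn (fun y => g (t, y)) (refTri d) :=
    hg.comp (f := fun y => (t, y)) (by fun_prop) fun y hy => ⟨ht, hy⟩
  exact (h1.integrableOn_compact (isCompact_refTri d)).mono_set interior_subset

theorem exists_bound_refTri (hg : ContinuousOn g (Icc 0 T ×ˢ refTri d)) :
    ∃ B, ∀ t ∈ Icc 0 T, ∀ y ∈ refTri d, ‖g (t, y)‖ ≤ B := by
  obtain ⟨B, hB⟩ := (isCompact_Icc.prod (isCompact_refTri d)).exists_bound_of_continuousOn hg
  exact ⟨B, fun t ht y hy => hB (t, y) ⟨ht, hy⟩⟩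

theorem isFiniteMeasure_refTri (d : ℕ) :
    IsFiniteMeasure (volume.restrict (interior (refTri d))) :=
  ⟨by
    rw [Measure.restrict_apply_univ]
    exact (measure_mono interior_subset).trans_lt (isCompact_refTri d).measure_lt_top⟩

theorem continuousOn_integral_refTri (hg : ContinuousOn g (Icc 0 T ×ˢ refTri d)) :
    ContinuousOn (fun t => ∫ y in interior (refTri d), g (t, y)) (Icc 0 T) := by
  have := isFiniteMeasure_refTri d
  obtain ⟨B, hB⟩ := exists_bound_refTri hg
  refine continuousOn_of_dominated (bound := fun _ => B)
    (fun t ht => (integrableOn_refTri hg ht).aestronglyMeasurable) (fun t ht => ?_)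
    (integrable_const B) ?_
  · filter_upwards [ae_restrict_mem isOpen_interior.measurableSet] with y hy
    exact hB t ht y (interior_subset hy)
  · filter_upwards [ae_restrict_mem isOpen_interior.measurableSet] with y hy
    exact hg.comp (f := fun t => (t, y)) (by fun_prop) fun t ht => ⟨ht, interior_subset hy⟩

theorem hasDerivAt_integral_refTri (hg : ContinuousOn g (Icc 0 T ×ˢ refTri d))
    (hg' : ContinuousOn g' (Icc 0 T ×ˢ refTri d))
    (hd : ∀ t ∈ Icc 0 T, ∀ y ∈ refTri d,
      HasDerivWithinAt (fun s => g (s, y)) (g' (t, y)) (Icc 0 T) t) {t : ℝ} (ht : t ∈ Ioo 0 T) :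
    HasDerivAt (fun t => ∫ y in interior (refTri d), g (t, y))
      (∫ y in interior (refTri d), g' (t, y)) t := by
  have := isFiniteMeasure_refTri d
  obtain ⟨B, hB⟩ := exists_bound_refTri hg'
  have hI := Ioo_mem_nhds ht.1 ht.2
  refine (hasDerivAt_integral_of_dominated_loc_of_deriv_le (bound := fun _ => B)
    (F := fun t y => g (t, y)) (F' := fun t y => g' (t, y)) hI
    (by
      filter_upwards [hI] with s hs
      exact (integrableOn_refTri hg (Ioo_subset_Icc_self hs)).aestronglyMeasurable)
    (integrableOn_refTri hg (Ioo_subset_Icc_self ht))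
    (integrableOn_refTri hg' (Ioo_subset_Icc_self ht)).aestronglyMeasurable ?_
    (integrable_const B) ?_).2
  · filter_upwards [ae_restrict_mem isOpen_interior.measurableSet] with y hy s hs
    exact hB s (Ioo_subset_Icc_self hs) y (interior_subset hy)
  · filter_upwards [ae_restrict_mem isOpen_interior.measurableSet] with y hy s hs
    exact (hd s (Ioo_subset_Icc_self hs) y (interior_subset hy)).hasDerivAt
      (Icc_mem_nhds hs.1 hs.2)

/-- Together with differentiability in the interior this makes the integral absolutely
continuous. -/
theorem exists_lipschitz_integral_refTri (hg : ContinuousOn g (Icc 0 T ×ˢ refTri d))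
    (hg' : ContinuousOn g' (Icc 0 T ×ˢ refTri d))
    (hd : ∀ t ∈ Icc 0 T, ∀ y ∈ refTri d,
      HasDerivWithinAt (fun s => g (s, y)) (g' (t, y)) (Icc 0 T) t) :
    ∃ L : ℝ≥0, LipschitzOnWith L (fun t => ∫ y in interior (refTri d), g (t, y)) (Icc 0 T) := by
  have := isFiniteMeasure_refTri d
  obtain ⟨B, hB⟩ := exists_bound_refTri hg'
  refine ⟨(B * volume.real (interior (refTri d))).toNNReal, LipschitzOnWith.of_dist_le_mul
    fun t ht s hs => ?_⟩
  rw [dist_eq_norm, ← integral_sub (integrableOn_refTri hg ht) (integrableOn_refTri hg hs)]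
  refine (norm_setIntegral_le_of_norm_le_const (C := B * dist t s)
    ((measure_mono interior_subset).trans_lt (isCompact_refTri d).measure_lt_top)
    fun y hy => ?_).trans ?_
  · have := (convex_Icc (0 : ℝ) T).norm_image_sub_le_of_norm_hasDerivWithin_le
      (f := fun s => g (s, y)) (fun r hr => hd r hr y (interior_subset hy))
      (fun r hr => hB r hr y (interior_subset hy)) hs ht
    rwa [← dist_eq_norm t s] at this
  · rw [mul_right_comm]
    exact mul_le_mul_of_nonneg_right (Real.le_coe_toNNReal _) dist_nonneg

end Param

namespace Mesh

variable {d : ℕ} (M : Mesh d) (D : Geometry d) (k : ℕ)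

/-- The mass form in reference coordinates. -/
def massInt (t : ℝ) (K : M.Elt) (a b : M.Coef k) (y : Space d) : ℝ :=
  M.jac D k t K y * (interp k (a K) y * interp k (b K) y)

/-- The integrand of `λ^h` in reference coordinates. -/
def lamInt (t : ℝ) (K : M.Elt) (a b : M.Coef k) (y : Space d) : ℝ :=
  M.jac D k t K y * M.divVel D k t K y * (interp k (a K) y * interp k (b K) y)

/-- The integrand of `a^h + λ^h` in reference coordinates; the terms with `∇ · w^h` cancel. -/
def stiffInt (cf : Coeffs d) (t : ℝ) (K : M.Elt) (a b : M.Coef k) (y : Space d) : ℝ :=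
  M.jac D k t K y *
    (cf.A K.1 t (M.liftPar D k t K y) * inner ℝ (M.grad D k t a K y) (M.grad D k t b K y)
      + inner ℝ (cf.B t (M.liftPar D k t K y) - M.vel D k t K y) (M.grad D k t a K y)
        * interp k (b K) y
      + cf.C t (M.liftPar D k t K y) * interp k (a K) y * interp k (b K) y)

/-- The integrand of the squared broken `H¹` norm in reference coordinates. -/
def h1Int (t : ℝ) (K : M.Elt) (a : M.Coef k) (y : Space d) : ℝ :=
  M.jac D k t K y * (interp k (a K) y ^ 2 + ‖M.grad D k t a K y‖ ^ 2)

/-- The mass form `m^h(t; ·, ·)` on coefficients. -/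
def mass (t : ℝ) (a b : M.Coef k) : ℝ :=
  ∑ K : M.Elt, ∫ y in interior (refTri d), M.massInt D k t K a b y

/-- The form `λ^h(t; ·, ·)` on coefficients. -/
def lam (t : ℝ) (a b : M.Coef k) : ℝ :=
  ∑ K : M.Elt, ∫ y in interior (refTri d), M.lamInt D k t K a b y

/-- The form `a^h(t; ·, ·) + λ^h(t; ·, ·)` on coefficients. -/
def stiff (cf : Coeffs d) (t : ℝ) (a b : M.Coef k) : ℝ :=
  ∑ K : M.Elt, ∫ y in interior (refTri d), M.stiffInt D k cf t K a b y

/-- The squared broken `H¹` norm on coefficients. -/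
def h1 (t : ℝ) (a : M.Coef k) : ℝ :=
  ∑ K : M.Elt, ∫ y in interior (refTri d), M.h1Int D k t K a y

variable {M D k}

theorem grad_add (t : ℝ) (K : M.Elt) (a b : M.Coef k) (y : Space d) :
    M.grad D k t (a + b) K y = M.grad D k t a K y + M.grad D k t b K y := by
  rw [grad, grad, grad, ← map_add, Pi.add_apply, dinterp_add]
  rfl

theorem grad_smul (t : ℝ) (K : M.Elt) (r : ℝ) (a : M.Coef k) (y : Space d) :
    M.grad D k t (r • a) K y = r • M.grad D k t a K y := by
  rw [grad, grad, ← LinearIsometryEquiv.map_smul, Pi.smul_apply, dinterp_smul]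
  rfl

namespace Standing

variable {T κ h γ : ℝ} {cf : Coeffs d}

section Cont

theorem continuousOn_massInt (hM : M.Standing D k T κ h) (K : M.Elt) (a b : M.Coef k) :
    ContinuousOn (fun q : ℝ × Space d => M.massInt D k q.1 K a b q.2) (Icc 0 T ×ˢ refTri d) :=
  (hM.continuousOn_jac K).mul ((continuousOn_interp_const _ _).mul (continuousOn_interp_const _ _))

theorem continuousOn_lamInt (hM : M.Standing D k T κ h) (K : M.Elt) (a b : M.Coef k) :
    ContinuousOn (fun q : ℝ × Space d => M.lamInt D k q.1 K a b q.2) (Icc 0 T ×ˢ refTri d) :=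
  ((hM.continuousOn_jac K).mul (hM.continuousOn_divVel K)).mul
    ((continuousOn_interp_const _ _).mul (continuousOn_interp_const _ _))

theorem continuousOn_A (hM : M.Standing D k T κ h) (hcf : cf.IsAdmissible D T γ) (K : M.Elt) :
    ContinuousOn (fun q : ℝ × Space d => cf.A K.1 q.1 (M.liftPar D k q.1 K q.2))
      (Icc 0 T ×ˢ refTri d) :=
  (hcf.A_continuous K.1).comp (f := fun q : ℝ × Space d => (q.1, M.liftPar D k q.1 K q.2))
    (continuousOn_fst.prodMk (hM.continuousOn_liftPar K))
    fun _ hq => ⟨hq.1, hM.liftPar_mem hq.1 K hq.2⟩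

theorem liftPar_mem_closure (hM : M.Standing D k T κ h) {t : ℝ} (ht : t ∈ Icc 0 T) (K : M.Elt)
    {y : Space d} (hy : y ∈ refTri d) : M.liftPar D k t K y ∈ closure D.Ω :=
  hM.adm.closure_om_subset ht K.1 (hM.liftPar_mem ht K hy)

theorem continuousOn_B (hM : M.Standing D k T κ h) (hcf : cf.IsAdmissible D T γ) (K : M.Elt) :
    ContinuousOn (fun q : ℝ × Space d => cf.B q.1 (M.liftPar D k q.1 K q.2))
      (Icc 0 T ×ˢ refTri d) :=
  hcf.B_continuous.comp (f := fun q : ℝ × Space d => (q.1, M.liftPar D k q.1 K q.2))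
    (continuousOn_fst.prodMk (hM.continuousOn_liftPar K))
    fun _ hq => ⟨hq.1, hM.liftPar_mem_closure hq.1 K hq.2⟩

theorem continuousOn_C (hM : M.Standing D k T κ h) (hcf : cf.IsAdmissible D T γ) (K : M.Elt) :
    ContinuousOn (fun q : ℝ × Space d => cf.C q.1 (M.liftPar D k q.1 K q.2))
      (Icc 0 T ×ˢ refTri d) :=
  hcf.C_continuous.comp (f := fun q : ℝ × Space d => (q.1, M.liftPar D k q.1 K q.2))
    (continuousOn_fst.prodMk (hM.continuousOn_liftPar K))
    fun _ hq => ⟨hq.1, hM.liftPar_mem_closure hq.1 K hq.2⟩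

theorem continuousOn_stiffInt (hM : M.Standing D k T κ h) (hcf : cf.IsAdmissible D T γ)
    (K : M.Elt) (a b : M.Coef k) :
    ContinuousOn (fun q : ℝ × Space d => M.stiffInt D k cf q.1 K a b q.2)
      (Icc 0 T ×ˢ refTri d) := by
  have ha := hM.continuousOn_grad a K
  have hb := hM.continuousOn_grad b K
  have hv := (hM.continuousOn_vel K).mono (prod_mono (le_refl (Icc 0 T)) (subset_univ (refTri d)))
  exact (hM.continuousOn_jac K).mul ((((hM.continuousOn_A hcf K).mul (ha.inner hb)).add
    ((((hM.continuousOn_B hcf K).sub hv).inner ha).mul (continuousOn_interp_const _ _))).add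
    (((hM.continuousOn_C hcf K).mul (continuousOn_interp_const _ _)).mul
      (continuousOn_interp_const _ _)))

theorem continuousOn_h1Int (hM : M.Standing D k T κ h) (K : M.Elt) (a : M.Coef k) :
    ContinuousOn (fun q : ℝ × Space d => M.h1Int D k q.1 K a q.2) (Icc 0 T ×ˢ refTri d) :=
  (hM.continuousOn_jac K).mul (((continuousOn_interp_const _ _).pow 2).add
    ((hM.continuousOn_grad a K).norm.pow 2))

end Cont

theorem continuousOn_mass (hM : M.Standing D k T κ h) (a b : M.Coef k) :
    ContinuousOn (fun t => M.mass D k t a b) (Icc 0 T) :=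
  continuousOn_finsetSum _ fun K _ => continuousOn_integral_refTri (hM.continuousOn_massInt K a b)

theorem continuousOn_stiff (hM : M.Standing D k T κ h) (hcf : cf.IsAdmissible D T γ)
    (a b : M.Coef k) : ContinuousOn (fun t => M.stiff D k cf t a b) (Icc 0 T) :=
  continuousOn_finsetSum _ fun K _ =>
    continuousOn_integral_refTri (hM.continuousOn_stiffInt hcf K a b)

theorem hasDerivWithinAt_massInt (hM : M.Standing D k T κ h) (K : M.Elt) (a b : M.Coef k) :
    ∀ t ∈ Icc 0 T, ∀ y ∈ refTri d, HasDerivWithinAt (fun s => M.massInt D k s K a b y)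
      (M.lamInt D k t K a b y) (Icc 0 T) t := fun _ ht _ hy =>
  (hM.hasDerivWithinAt_jac ht K hy).mul_const _

/-- The transport formula: `d/dt m^h(t; ·, ·) = λ^h(t; ·, ·)` for fixed coefficients. -/
theorem hasDerivAt_mass (hM : M.Standing D k T κ h) (a b : M.Coef k) {t : ℝ} (ht : t ∈ Ioo 0 T) :
    HasDerivAt (fun t => M.mass D k t a b) (M.lam D k t a b) t :=
  HasDerivAt.fun_sum fun K _ => hasDerivAt_integral_refTri (hM.continuousOn_massInt K a b)
    (hM.continuousOn_lamInt K a b) (hM.hasDerivWithinAt_massInt K a b) ht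

theorem absolutelyContinuous_mass (hM : M.Standing D k T κ h) (a b : M.Coef k) :
    AbsolutelyContinuousOnInterval (fun t => M.mass D k t a b) 0 T := by
  choose L hL using fun K => exists_lipschitz_integral_refTri (hM.continuousOn_massInt K a b)
    (hM.continuousOn_lamInt K a b) (hM.hasDerivWithinAt_massInt K a b)
  refine LipschitzOnWith.absolutelyContinuousOnInterval (K := ∑ K, L K) ?_
  rw [uIcc_of_le hM.T_pos.le]
  refine LipschitzOnWith.of_dist_le_mul fun t ht s hs => ?_
  rw [dist_eq_norm, mass, mass, ← Finset.sum_sub_distrib, NNReal.coe_sum, Finset.sum_mul]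
  refine (norm_sum_le _ _).trans (Finset.sum_le_sum fun K _ => ?_)
  rw [← dist_eq_norm]
  exact (hL K).dist_le_mul t ht s hs

/-! Integrals of sums and multiples. -/

theorem sum_integral_add {F G : M.Elt → Space d → ℝ}
    (hF : ∀ K, IntegrableOn (F K) (interior (refTri d)))
    (hG : ∀ K, IntegrableOn (G K) (interior (refTri d))) :
    ∑ K, ∫ y in interior (refTri d), (F K y + G K y) =
      (∑ K, ∫ y in interior (refTri d), F K y) + ∑ K, ∫ y in interior (refTri d), G K y := by
  rw [← Finset.sum_add_distrib]
  exact Finset.sum_congr rfl fun K _ => integral_add (hF K) (hG K)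

theorem sum_integral_congr {F G : M.Elt → Space d → ℝ} (h : ∀ K y, F K y = G K y) :
    ∑ K, ∫ y in interior (refTri d), F K y = ∑ K, ∫ y in interior (refTri d), G K y :=
  Finset.sum_congr rfl fun K _ => integral_congr_ae (Eventually.of_forall (h K))

theorem sum_integral_smul (r : ℝ) (F : M.Elt → Space d → ℝ) :
    ∑ K, ∫ y in interior (refTri d), r * F K y =
      r * ∑ K, ∫ y in interior (refTri d), F K y := by
  rw [Finset.mul_sum]
  exact Finset.sum_congr rfl fun K _ => integral_const_mul _ _

theorem mass_add_left (hM : M.Standing D k T κ h) {t : ℝ} (ht : t ∈ Icc 0 T) (a a' b : M.Coef k) :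
    M.mass D k t (a + a') b = M.mass D k t a b + M.mass D k t a' b := by
  rw [mass, mass, mass, ← sum_integral_add
    (F := fun K => M.massInt D k t K a b) (G := fun K => M.massInt D k t K a' b)
    (fun K => integrableOn_refTri (hM.continuousOn_massInt K a b) ht)
    (fun K => integrableOn_refTri (hM.continuousOn_massInt K a' b) ht)]
  refine sum_integral_congr fun K y => ?_
  simp only [massInt, Pi.add_apply, interp_add]
  ring

theorem mass_smul_left (t : ℝ) (r : ℝ) (a b : M.Coef k) :
    M.mass D k t (r • a) b = r * M.mass D k t a b := by
  rw [mass, mass, ← sum_integral_smul]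
  refine sum_integral_congr fun K y => ?_
  simp only [massInt, Pi.smul_apply, interp_smul, smul_eq_mul]
  ring

theorem mass_comm (t : ℝ) (a b : M.Coef k) : M.mass D k t a b = M.mass D k t b a := by
  refine sum_integral_congr fun K y => ?_
  simp only [massInt]
  ring

theorem stiff_add_left (hM : M.Standing D k T κ h) (hcf : cf.IsAdmissible D T γ) {t : ℝ}
    (ht : t ∈ Icc 0 T) (a a' b : M.Coef k) :
    M.stiff D k cf t (a + a') b = M.stiff D k cf t a b + M.stiff D k cf t a' b := by
  rw [stiff, stiff, stiff, ← sum_integral_add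
    (F := fun K => M.stiffInt D k cf t K a b) (G := fun K => M.stiffInt D k cf t K a' b)
    (fun K => integrableOn_refTri (hM.continuousOn_stiffInt hcf K a b) ht)
    (fun K => integrableOn_refTri (hM.continuousOn_stiffInt hcf K a' b) ht)]
  refine sum_integral_congr fun K y => ?_
  simp only [stiffInt, Pi.add_apply, interp_add, grad_add, inner_add_left, inner_add_right]
  ring

theorem stiff_smul_left (t : ℝ) (r : ℝ) (a b : M.Coef k) :
    M.stiff D k cf t (r • a) b = r * M.stiff D k cf t a b := by
  rw [stiff, stiff, ← sum_integral_smul]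
  refine sum_integral_congr fun K y => ?_
  simp only [stiffInt, Pi.smul_apply, interp_smul, grad_smul, inner_smul_left, inner_smul_right,
    smul_eq_mul, conj_trivial]
  ring

theorem stiff_add_right (hM : M.Standing D k T κ h) (hcf : cf.IsAdmissible D T γ) {t : ℝ}
    (ht : t ∈ Icc 0 T) (a b b' : M.Coef k) :
    M.stiff D k cf t a (b + b') = M.stiff D k cf t a b + M.stiff D k cf t a b' := by
  rw [stiff, stiff, stiff, ← sum_integral_add
    (F := fun K => M.stiffInt D k cf t K a b) (G := fun K => M.stiffInt D k cf t K a b')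
    (fun K => integrableOn_refTri (hM.continuousOn_stiffInt hcf K a b) ht)
    (fun K => integrableOn_refTri (hM.continuousOn_stiffInt hcf K a b') ht)]
  refine sum_integral_congr fun K y => ?_
  simp only [stiffInt, Pi.add_apply, interp_add, grad_add, inner_add_right]
  ring

theorem stiff_smul_right (t : ℝ) (r : ℝ) (a b : M.Coef k) :
    M.stiff D k cf t a (r • b) = r * M.stiff D k cf t a b := by
  rw [stiff, stiff, ← sum_integral_smul]
  refine sum_integral_congr fun K y => ?_
  simp only [stiffInt, Pi.smul_apply, interp_smul, grad_smul, inner_smul_right, smul_eq_mul]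
  ring

/-! The forms of the scheme. -/

theorem mForm_fn (hM : M.Standing D k T κ h) {t : ℝ} (ht : t ∈ Icc 0 T) (a b : M.Coef k) :
    M.mForm D k t (M.fn D k t a) (M.fn D k t b) = M.mass D k t a b := by
  refine Finset.sum_congr rfl fun K _ => ?_
  rw [hM.setIntegral_elt ht K]
  refine setIntegral_congr_fun isOpen_interior.measurableSet fun y hy => ?_
  rw [hM.fn_par ht _ K (interior_subset hy), hM.fn_par ht _ K (interior_subset hy), massInt]

theorem aForm_add_lamForm_fn (hM : M.Standing D k T κ h) (hcf : cf.IsAdmissible D T γ) {t : ℝ}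
    (ht : t ∈ Icc 0 T) (a b : M.Coef k) :
    M.aForm D cf k t (M.fn D k t a) (M.fn D k t b) +
      M.lamForm D k t (M.fn D k t a) (M.fn D k t b) = M.stiff D k cf t a b := by
  have h1 : M.lamForm D k t (M.fn D k t a) (M.fn D k t b) = M.lam D k t a b := by
    refine Finset.sum_congr rfl fun K _ => ?_
    rw [hM.setIntegral_elt ht K]
    refine setIntegral_congr_fun isOpen_interior.measurableSet fun y hy => ?_
    rw [hM.fn_par ht _ K (interior_subset hy), hM.fn_par ht _ K (interior_subset hy),
      hM.divVelocity_par ht K hy, lamInt]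
    ring
  have h2 : M.aForm D cf k t (M.fn D k t a) (M.fn D k t b) = ∑ K : M.Elt,
      ∫ y in interior (refTri d), (M.stiffInt D k cf t K a b y - M.lamInt D k t K a b y) := by
    refine Finset.sum_congr rfl fun K _ => ?_
    rw [hM.setIntegral_elt ht K]
    refine setIntegral_congr_fun isOpen_interior.measurableSet fun y hy => ?_
    rw [hM.fn_par ht _ K (interior_subset hy), hM.fn_par ht _ K (interior_subset hy),
      hM.divVelocity_par ht K hy, hM.gradient_fn ht _ K hy, hM.gradient_fn ht _ K hy,
      hM.velocity_par ht K (interior_subset hy), lamInt, stiffInt, liftPar]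
    ring
  rw [h1, h2, lam, ← sum_integral_add (F := fun K y => M.stiffInt D k cf t K a b y -
    M.lamInt D k t K a b y) (G := fun K => M.lamInt D k t K a b)]
  · simp only [sub_add_cancel]
    rfl
  · exact fun K => (integrableOn_refTri (hM.continuousOn_stiffInt hcf K a b) ht).sub
      (integrableOn_refTri (hM.continuousOn_lamInt K a b) ht)
  · exact fun K => integrableOn_refTri (hM.continuousOn_lamInt K a b) ht

theorem normSqH_fn (hM : M.Standing D k T κ h) {t : ℝ} (ht : t ∈ Icc 0 T) (a : M.Coef k) :
    M.normSqH D k t (M.fn D k t a) = ENNReal.ofReal (M.mass D k t a a) := by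
  have h0 : ∀ (K : M.Elt), ∀ y ∈ interior (refTri d), 0 ≤ M.massInt D k t K a a y :=
    fun K y _ => mul_nonneg (abs_nonneg _) (mul_self_nonneg _)
  rw [mass, ENNReal.ofReal_sum_of_nonneg fun K _ =>
    setIntegral_nonneg isOpen_interior.measurableSet (h0 K)]
  refine Finset.sum_congr rfl fun K _ => ?_
  rw [hM.lintegral_elt ht K, ofReal_integral_eq_lintegral_ofReal
    (integrableOn_refTri (hM.continuousOn_massInt K a a) ht)
    ((ae_restrict_mem isOpen_interior.measurableSet).mono (h0 K))]
  refine setLIntegral_congr_fun isOpen_interior.measurableSet fun y hy => ?_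
  rw [hM.fn_par ht _ K (interior_subset hy), massInt,
    ENNReal.ofReal_mul (hM.jac_pos ht K (interior_subset hy)).le,
    ← pow_two, ← sq_abs, ENNReal.ofReal_pow (abs_nonneg _), ← Real.norm_eq_abs, ofReal_norm]

theorem normSqV_fn (hM : M.Standing D k T κ h) {t : ℝ} (ht : t ∈ Icc 0 T) (a : M.Coef k) :
    M.normSqV D k t (M.fn D k t a) = ENNReal.ofReal (M.h1 D k t a) := by
  have h0 : ∀ (K : M.Elt), ∀ y ∈ interior (refTri d), 0 ≤ M.h1Int D k t K a y :=
    fun K y _ => mul_nonneg (abs_nonneg _) (by positivity)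
  rw [h1, ENNReal.ofReal_sum_of_nonneg fun K _ =>
    setIntegral_nonneg isOpen_interior.measurableSet (h0 K)]
  refine Finset.sum_congr rfl fun K _ => ?_
  rw [hM.lintegral_elt ht K, ofReal_integral_eq_lintegral_ofReal
    (integrableOn_refTri (hM.continuousOn_h1Int K a) ht)
    ((ae_restrict_mem isOpen_interior.measurableSet).mono (h0 K))]
  refine setLIntegral_congr_fun isOpen_interior.measurableSet fun y hy => ?_
  rw [hM.fn_par ht _ K (interior_subset hy), hM.gradient_fn ht _ K hy, h1Int,
    ENNReal.ofReal_mul (hM.jac_pos ht K (interior_subset hy)).le,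
    ENNReal.ofReal_add (sq_nonneg _) (sq_nonneg _),
    ← sq_abs (interp k (a K) y), ENNReal.ofReal_pow (abs_nonneg _), ← Real.norm_eq_abs, ofReal_norm,
    ENNReal.ofReal_pow (norm_nonneg _), ofReal_norm]

end Standing

end Mesh

/-! ### Bounds that do not depend on the mesh -/

theorem abs_trace_le {d : ℕ} (A : Space d →L[ℝ] Space d) :
    |LinearMap.trace ℝ (Space d) (A : Space d →ₗ[ℝ] Space d)| ≤ d * ‖A‖ := by
  rw [LinearMap.trace_eq_sum_inner _ (EuclideanSpace.basisFun (Fin d) ℝ)]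
  refine (Finset.abs_sum_le_sum_abs _ _).trans ?_
  have h1 : ∀ i ∈ Finset.univ, |inner ℝ (EuclideanSpace.basisFun (Fin d) ℝ i)
      ((A : Space d →ₗ[ℝ] Space d) (EuclideanSpace.basisFun (Fin d) ℝ i))| ≤ ‖A‖ := by
    intro i _
    refine (abs_real_inner_le_norm _ _).trans ?_
    have h2 := A.le_opNorm (EuclideanSpace.basisFun (Fin d) ℝ i)
    rw [OrthonormalBasis.norm_eq_one, mul_one] at h2
    rw [OrthonormalBasis.norm_eq_one, one_mul]
    exact h2
  refine (Finset.sum_le_card_nsmul _ _ _ h1).trans_eq ?_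
  rw [Finset.card_univ, Fintype.card_fin, nsmul_eq_mul]

theorem dist_le_one_of_mem_refSimplex {d : ℕ} {l l' : Fin (d + 1) → ℝ} (hl : l ∈ refSimplex d)
    (hl' : l' ∈ refSimplex d) : dist l l' ≤ 1 := by
  refine (dist_pi_le_iff zero_le_one).2 fun a => ?_
  have h1 : ∀ m ∈ refSimplex d, 0 ≤ m a ∧ m a ≤ 1 := fun m hm =>
    ⟨hm.1 a, hm.2 ▸ Finset.single_le_sum (fun b _ => hm.1 b) (Finset.mem_univ a)⟩
  rw [Real.dist_eq, abs_le]
  constructor <;> linarith [h1 l hl, h1 l' hl']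

namespace Mesh.Standing

variable {d k : ℕ} {M : Mesh d} {D : Geometry d} {T κ h γ : ℝ} {cf : Coeffs d}

/-- The discrete velocity has a bounded gradient: constants are interpolated exactly, and over one
element the velocity varies by a multiple of the mesh size. -/
theorem norm_dvel_le (hM : M.Standing D k T κ h) {C : ℝ} {L : ℝ≥0}
    (hC : ∀ (a : nodeIdx d k → Space d) (b : ℝ), (∀ β, ‖a β‖ ≤ b) → ∀ y ∈ refTri d,
      ‖interp k a y‖ ≤ C * b ∧ ‖dinterp k a y‖ ≤ C * b)
    (hL : ∀ i, ∀ t ∈ Icc 0 T, LipschitzOnWith L (D.w t) (closure (D.Om i t))) {t : ℝ}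
    (ht : t ∈ Icc 0 T) (K : M.Elt) {y : Space d} (hy : y ∈ refTri d) :
    ‖M.dvel D k t K y‖ ≤ C * (L * (κ * h)) := by
  have hβ0 : Pi.single (0 : Fin (d + 1)) k ∈ nodeIdx d k := by
    rw [mem_nodeIdx, Finset.sum_pi_single', if_pos (Finset.mem_univ _)]
  -- subtract the velocity at one vertex
  set b : Space d := D.w t (M.node D k t K (Pi.single 0 k)) with hb
  have h1 : M.dvel D k t K y =
      dinterp k (fun β : nodeIdx d k => D.w t (M.node D k t K β.1) - b) y := by
    have h2 := dinterp_add (k := k) (fun β : nodeIdx d k => D.w t (M.node D k t K β.1) - b)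
      (fun _ => b) y
    rw [dinterp_const hM.one_le, add_zero] at h2
    rw [← h2, Mesh.dvel]
    congr 1
    funext β
    simp
  rw [h1]
  refine (hC _ _ (fun β => ?_) y hy).2
  rw [← dist_eq_norm]
  refine ((hL K.1 t ht).dist_le_mul _ (hM.node_mem ht K β) _
    (hM.node_mem ht K ⟨_, hβ0⟩)).trans ?_
  refine mul_le_mul_of_nonneg_left ?_ L.2
  rw [← hM.refMap_refNode t K β.2, ← hM.refMap_refNode t K hβ0]
  refine (hM.regular.upper t ht K _ (refNode_mem hM.one_le β.2) _
    (refNode_mem hM.one_le hβ0)).trans ?_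
  exact mul_le_of_le_one_right (mul_nonneg hM.κ_pos.le hM.h_pos.le)
    (dist_le_one_of_mem_refSimplex (refNode_mem hM.one_le β.2) (refNode_mem hM.one_le hβ0))

theorem lower_A (hM : M.Standing D k T κ h) (hcf : cf.IsAdmissible D T γ) {t : ℝ}
    (ht : t ∈ Icc 0 T) (K : M.Elt) {y : Space d} (hy : y ∈ refTri d) :
    γ ≤ cf.A K.1 t (M.liftPar D k t K y) := by
  have h1 : ContinuousOn (cf.A K.1 t) (closure (D.Om K.1 t)) :=
    (hcf.A_continuous K.1).comp (f := fun z => (t, z)) (by fun_prop) fun z hz => ⟨ht, hz⟩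
  have h2 : MapsTo (cf.A K.1 t) (closure (D.Om K.1 t)) (closure (Ici γ)) :=
    MapsTo.closure_of_continuousOn (fun z hz => hcf.A_lower K.1 t ht z hz) h1
  rw [closure_Ici] at h2
  exact h2 (hM.liftPar_mem ht K hy)

end Mesh.Standing

/-- The discrete velocity, its divergence and the lower order coefficients are bounded uniformly
over all regular meshes. -/
theorem Geometry.IsAdmissible.exists_uniform_bound {d k : ℕ} {D : Geometry d} {T γ : ℝ}
    (hD : D.IsAdmissible k T) {cf : Coeffs d} (hcf : cf.IsAdmissible D T γ) (κ : ℝ) :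
    ∃ W : ℝ, 0 ≤ W ∧ ∀ (M : Mesh d) (h : ℝ), M.Standing D k T κ h → ∀ t ∈ Icc 0 T,
      ∀ K : M.Elt, ∀ y ∈ refTri d,
      ‖cf.B t (M.liftPar D k t K y) - M.vel D k t K y‖ ≤ W ∧ |M.divVel D k t K y| ≤ W ∧
      |cf.C t (M.liftPar D k t K y)| ≤ W := by
  have hcomp : IsCompact (Icc (0 : ℝ) T ×ˢ closure D.Ω) := isCompact_Icc.prod hD.isCompact_closure
  obtain ⟨b₁, hb₁⟩ := hcomp.exists_bound_of_continuousOn hcf.B_continuous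
  obtain ⟨b₂, hb₂⟩ := hcomp.exists_bound_of_continuousOn hD.velocity_continuous
  obtain ⟨b₃, hb₃⟩ := hcomp.exists_bound_of_continuousOn hcf.C_continuous
  obtain ⟨C, hC0, hC⟩ := exists_norm_interp_le d k
  obtain ⟨L, hL⟩ := hD.exists_velocity_lipschitz
  -- the last term bounds the divergence: the velocity gradient on the reference simplex is at
  -- most `C L κ h`, the inverse of the Jacobian matrix at most `d κ / h`, and the powers of `h`
  -- cancel
  refine ⟨|b₁| + C * |b₂| + |b₃| + d * (C * (L * |κ|) * (d * |κ|)), by positivity,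
    fun M h hM t ht K y hy => ?_⟩
  have hκ := hM.κ_pos
  rw [abs_of_pos hκ]
  set R : ℝ := d * (C * (L * κ) * (d * κ)) with hR
  have hR0 : 0 ≤ R := by positivity
  have hz := hM.liftPar_mem_closure ht K hy
  have e0 : 0 ≤ C * |b₂| := by positivity
  refine ⟨?_, ?_, ?_⟩
  · have e1 := (hb₁ (t, M.liftPar D k t K y) ⟨ht, hz⟩).trans (le_abs_self b₁)
    have e2 : ‖M.vel D k t K y‖ ≤ C * |b₂| := (hC (V := Space d) _ _ (fun β =>
      (hb₂ (t, M.node D k t K β.1) ⟨ht, hD.closure_om_subset ht K.1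
        (hM.node_mem ht K β)⟩).trans (le_abs_self b₂)) y hy).1
    have e3 := norm_sub_le (cf.B t (M.liftPar D k t K y)) (M.vel D k t K y)
    simp only at e1
    linarith [abs_nonneg b₃]
  · have e1 := hM.norm_dvel_le (hC (V := Space d)) hL ht K hy
    have e2 := hM.norm_dinv_le ht K hy
    have e3 : |M.divVel D k t K y| ≤ R := by
      refine (abs_trace_le _).trans ?_
      refine mul_le_mul_of_nonneg_left ?_ (Nat.cast_nonneg d)
      refine (ContinuousLinearMap.opNorm_comp_le _ _).trans ?_
      refine (mul_le_mul e1 e2 (norm_nonneg _) ?_).trans_eq ?_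
      · have := hM.h_pos
        positivity
      · have := hM.h_pos.ne'
        field_simp
    linarith [abs_nonneg b₃, abs_nonneg b₁]
  · have e1 := (hb₃ (t, M.liftPar D k t K y) ⟨ht, hz⟩).trans (le_abs_self b₃)
    rw [Real.norm_eq_abs] at e1
    linarith [abs_nonneg b₃, abs_nonneg b₁]

namespace Mesh.Standing

variable {d k : ℕ} {M : Mesh d} {D : Geometry d} {T κ h γ : ℝ} {cf : Coeffs d}

theorem sum_integral_mono {F G : M.Elt → Space d → ℝ}
    (hF : ∀ K, IntegrableOn (F K) (interior (refTri d)))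
    (hG : ∀ K, IntegrableOn (G K) (interior (refTri d)))
    (hFG : ∀ K, ∀ y ∈ interior (refTri d), F K y ≤ G K y) :
    ∑ K, ∫ y in interior (refTri d), F K y ≤ ∑ K, ∫ y in interior (refTri d), G K y :=
  Finset.sum_le_sum fun K _ => setIntegral_mono_on (hF K) (hG K) isOpen_interior.measurableSet
    (hFG K)

theorem mass_nonneg (t : ℝ) (a : M.Coef k) : 0 ≤ M.mass D k t a a :=
  Finset.sum_nonneg fun _ _ => setIntegral_nonneg isOpen_interior.measurableSet fun _ _ =>
    mul_nonneg (abs_nonneg _) (mul_self_nonneg _)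

theorem h1_nonneg (t : ℝ) (a : M.Coef k) : 0 ≤ M.h1 D k t a :=
  Finset.sum_nonneg fun _ _ => setIntegral_nonneg isOpen_interior.measurableSet fun _ _ =>
    mul_nonneg (abs_nonneg _) (by positivity)

theorem mass_le_h1 (hM : M.Standing D k T κ h) {t : ℝ} (ht : t ∈ Icc 0 T) (a : M.Coef k) :
    M.mass D k t a a ≤ M.h1 D k t a :=
  sum_integral_mono (fun K => integrableOn_refTri (hM.continuousOn_massInt K a a) ht)
    (fun K => integrableOn_refTri (hM.continuousOn_h1Int K a) ht) fun K y _ => by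
      rw [massInt, h1Int]
      refine mul_le_mul_of_nonneg_left ?_ (abs_nonneg _)
      nlinarith [sq_nonneg ‖M.grad D k t a K y‖]

/-- The Gårding inequality, in the form in which it enters the energy estimate. -/
theorem garding (hM : M.Standing D k T κ h) (hcf : cf.IsAdmissible D T γ) {W : ℝ}
    {t : ℝ} (ht : t ∈ Icc 0 T)
    (hW : ∀ (K : M.Elt), ∀ y ∈ refTri d,
      ‖cf.B t (M.liftPar D k t K y) - M.vel D k t K y‖ ≤ W ∧ |M.divVel D k t K y| ≤ W ∧
      |cf.C t (M.liftPar D k t K y)| ≤ W) (a : M.Coef k) :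
    γ * M.h1 D k t a + M.lam D k t a a ≤
      2 * M.stiff D k cf t a a + (γ + 4 * W ^ 2 / γ + 3 * W) * M.mass D k t a a := by
  have hγ := hcf.γ_pos
  have i1 := fun K => integrableOn_refTri (hM.continuousOn_h1Int K a) ht
  have i2 := fun K => integrableOn_refTri (hM.continuousOn_lamInt K a a) ht
  have i3 := fun K => integrableOn_refTri (hM.continuousOn_stiffInt hcf K a a) ht
  have i4 := fun K => integrableOn_refTri (hM.continuousOn_massInt K a a) ht
  rw [h1, lam, stiff, mass, ← sum_integral_smul, ← sum_integral_smul, ← sum_integral_smul,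
    ← sum_integral_add (F := fun K y => γ * M.h1Int D k t K a y)
      (G := fun K => M.lamInt D k t K a a) (fun K => (i1 K).const_mul γ) i2,
    ← sum_integral_add (F := fun K y => 2 * M.stiffInt D k cf t K a a y)
      (G := fun K y => (γ + 4 * W ^ 2 / γ + 3 * W) * M.massInt D k t K a a y)
      (fun K => (i3 K).const_mul 2) (fun K => (i4 K).const_mul _)]
  refine sum_integral_mono (fun K => ((i1 K).const_mul γ).add (i2 K))
    (fun K => ((i3 K).const_mul 2).add ((i4 K).const_mul _)) fun K y hy' => ?_
  have hy := interior_subset hy'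
  obtain ⟨hB, hdiv, hCb⟩ := hW K y hy
  have hA := hM.lower_A hcf ht K hy
  have hJ : 0 ≤ M.jac D k t K y := abs_nonneg _
  simp only [h1Int, lamInt, stiffInt, massInt]
  set g := M.grad D k t a K y with hg
  set r := interp k (a K) y with hr
  set J := M.jac D k t K y with hJd
  set b := cf.B t (M.liftPar D k t K y) - M.vel D k t K y with hb
  set A := cf.A K.1 t (M.liftPar D k t K y) with hAd
  set Cc := cf.C t (M.liftPar D k t K y) with hCc
  set v := M.divVel D k t K y with hv
  rw [real_inner_self_eq_norm_sq]
  have hbg : |inner ℝ b g * r| ≤ W * ‖g‖ * |r| := by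
    rw [abs_mul]
    refine mul_le_mul_of_nonneg_right ((abs_real_inner_le_norm _ _).trans ?_) (abs_nonneg r)
    exact mul_le_mul_of_nonneg_right hB (norm_nonneg g)
  -- Young's inequality absorbs the convection term in the diffusion
  have hyoung : 4 * (W * ‖g‖ * |r|) ≤ γ * ‖g‖ ^ 2 + 4 * W ^ 2 / γ * r ^ 2 := by
    have h1 : 4 * W ^ 2 / γ * r ^ 2 = (2 * W * |r|) ^ 2 / γ := by
      rw [mul_pow, sq_abs]
      ring
    have h2 : 0 ≤ (γ * ‖g‖ - 2 * W * |r|) ^ 2 / γ := by positivity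
    have h3 : (γ * ‖g‖ - 2 * W * |r|) ^ 2 / γ =
        γ * ‖g‖ ^ 2 - 4 * (W * ‖g‖ * |r|) + (2 * W * |r|) ^ 2 / γ := by
      field_simp
      ring
    linarith
  have hr2 : 0 ≤ r ^ 2 := sq_nonneg r
  have hg2 : 0 ≤ ‖g‖ ^ 2 := sq_nonneg _
  have e1 := abs_le.1 hbg
  have e2 : -(W * r ^ 2) ≤ Cc * r ^ 2 := by nlinarith [abs_le.1 hCb]
  have e3 : v * r ^ 2 ≤ W * r ^ 2 := by nlinarith [abs_le.1 hdiv]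
  have e4 : γ * ‖g‖ ^ 2 ≤ A * ‖g‖ ^ 2 := by nlinarith
  have key : γ * (r ^ 2 + ‖g‖ ^ 2) + v * r ^ 2 ≤ 2 * (A * ‖g‖ ^ 2 + inner ℝ b g * r + Cc * r ^ 2) +
      (γ + 4 * W ^ 2 / γ + 3 * W) * r ^ 2 := by
    linarith
  have := mul_le_mul_of_nonneg_left key hJ
  linarith

theorem interp_refNode (hk : 1 ≤ k) (a : nodeIdx d k → ℝ) (β : nodeIdx d k) {y : Space d}
    (hy : bary y = refNode k β.1) : interp k a y = a β := by
  rw [interp, Finset.sum_eq_single β]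
  · rw [hy, lagr_refNode hk β.2 β.2, if_pos rfl, one_smul]
  · intro β' _ hne
    rw [hy, lagr_refNode hk β'.2 β.2, if_neg (fun h => hne (Subtype.ext h.symm)), zero_smul]
  · exact fun h => absurd (Finset.mem_univ β) h

/-- The mass form is definite. -/
theorem eq_zero_of_mass_eq_zero (hM : M.Standing D k T κ h) {t : ℝ} (ht : t ∈ Icc 0 T)
    {a : M.Coef k} (ha : M.mass D k t a a = 0) : a = 0 := by
  funext K β
  have h0 : ∀ K, 0 ≤ ∫ y in interior (refTri d), M.massInt D k t K a a y := fun K =>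
    setIntegral_nonneg isOpen_interior.measurableSet fun _ _ =>
      mul_nonneg (abs_nonneg _) (mul_self_nonneg _)
  have h1 := (Finset.sum_eq_zero_iff_of_nonneg fun K _ => h0 K).1 ha K (Finset.mem_univ K)
  rw [integral_eq_zero_iff_of_nonneg_ae (f := fun y => M.massInt D k t K a a y)
    (Eventually.of_forall fun _ => mul_nonneg (abs_nonneg _) (mul_self_nonneg _))
    (integrableOn_refTri (hM.continuousOn_massInt K a a) ht)] at h1
  have hcont : ContinuousOn (fun y => M.massInt D k t K a a y) (refTri d) :=
    (hM.continuousOn_massInt K a a).comp (f := fun y => (t, y)) (by fun_prop)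
      fun y hy => ⟨ht, hy⟩
  -- a nonnegative continuous integrand with integral zero vanishes, first in the interior, then
  -- on the closed simplex, which contains the nodes
  have h2 : EqOn (fun y => M.massInt D k t K a a y) (fun _ => 0) (interior (refTri d)) :=
    Measure.eqOn_open_of_ae_eq h1 isOpen_interior (hcont.mono interior_subset) continuousOn_const
  have h3 : EqOn (fun y => M.massInt D k t K a a y) (fun _ => 0) (refTri d) :=
    h2.of_subset_closure hcont continuousOn_const interior_subset
      (closure_interior_refTri d).ge
  obtain ⟨y, hy, hyβ⟩ : refNode k β.1 ∈ bary '' refTri d := by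
    rw [bary_image]
    exact refNode_mem hM.one_le β.2
  have h4 := h3 hy
  simp only [massInt, interp_refNode hM.one_le _ β hyβ] at h4
  rcases mul_eq_zero.1 h4 with h5 | h5
  · exact absurd h5 (hM.jac_pos ht K hy).ne'
  · exact mul_self_eq_zero.1 h5

end Mesh.Standing

/-! ### Linear evolution equations with integrable right-hand side -/

theorem _root_.AbsolutelyContinuousOnInterval.congr_uIcc {X : Type*} [PseudoMetricSpace X]
    {f g : ℝ → X} {a b : ℝ} (hf : AbsolutelyContinuousOnInterval f a b)
    (h : EqOn f g (uIcc a b)) : AbsolutelyContinuousOnInterval g a b := by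
  rw [absolutelyContinuousOnInterval_iff] at hf ⊢
  intro ε hε
  obtain ⟨δ, hδ, H⟩ := hf ε hε
  refine ⟨δ, hδ, fun E hE hEδ => ?_⟩
  convert! H E hE hEδ using 3 with i hi
  · exact (h (hE.1 i hi).1).symm
  · exact (h (hE.1 i hi).2).symm

theorem _root_.AbsolutelyContinuousOnInterval.fun_sum {ι F : Type*} [SeminormedAddCommGroup F]
    {f : ι → ℝ → F} {a b : ℝ} {s : Finset ι}
    (hf : ∀ i ∈ s, AbsolutelyContinuousOnInterval (f i) a b) :
    AbsolutelyContinuousOnInterval (fun t => ∑ i ∈ s, f i t) a b := by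
  classical
  induction s using Finset.induction_on with
  | empty =>
    simp only [Finset.sum_empty]
    exact (LipschitzWith.const (0 : F)).lipschitzOnWith.absolutelyContinuousOnInterval
  | insert i s hi ih =>
    simp only [Finset.sum_insert hi]
    exact (hf i (Finset.mem_insert_self i s)).add
      (ih fun j hj => hf j (Finset.mem_insert_of_mem hj))

section LinearODE

variable {E : Type*} [NormedAddCommGroup E] [NormedSpace ℝ E] [CompleteSpace E] {T : ℝ}

theorem integral_exp_mul_le {L t : ℝ} (hL : 0 < L) :
    ∫ s in (0 : ℝ)..t, Real.exp (L * s) ≤ Real.exp (L * t) / L := by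
  have h1 : ∀ s ∈ uIcc 0 t, HasDerivAt (fun s => Real.exp (L * s) / L) (Real.exp (L * s)) s := by
    intro s _
    have h2 := (((hasDerivAt_id s).const_mul L).exp).div_const L
    simp only [id, mul_one] at h2
    rwa [mul_div_assoc, div_self hL.ne', mul_one] at h2
  rw [intervalIntegral.integral_eq_sub_of_hasDerivAt h1
    (Continuous.intervalIntegrable (by fun_prop) _ _)]
  have : 0 < Real.exp (L * 0) / L := by positivity
  linarith

/-- A linear equation with continuous coefficients and integrable right-hand side has a solution.
In terms of `z = e^{-Lt} u` the integral equation is a fixed point problem for a contraction, if `L`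
exceeds the bound of the coefficients. -/
theorem exists_linear_integral_equation (hT : 0 ≤ T) {A : ℝ → E →L[ℝ] E}
    (hA : ContinuousOn A (Icc 0 T)) {g : ℝ → E} (hg : IntervalIntegrable g volume 0 T) (u₀ : E) :
    ∃ u : ℝ → E, ContinuousOn u (Icc 0 T) ∧
      IntervalIntegrable (fun s => A s (u s) + g s) volume 0 T ∧
      ∀ t ∈ Icc 0 T, u t = u₀ + ∫ s in (0 : ℝ)..t, (A s (u s) + g s) := by
  obtain ⟨B, hB⟩ := isCompact_Icc.exists_bound_of_continuousOn hA
  set L : ℝ := |B| + 1 with hL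
  have hL0 : 0 < L := by positivity
  have hAB : ∀ s ∈ Icc 0 T, ‖A s‖ ≤ |B| := fun s hs => (hB s hs).trans (le_abs_self B)
  -- `ext z` is the function `u` that corresponds to `z`
  let ext : C(Icc (0 : ℝ) T, E) → ℝ → E := fun z s => Real.exp (L * s) • IccExtend hT z s
  have hext : ∀ z, Continuous (ext z) := fun z => by
    refine Continuous.smul (by fun_prop) ?_
    exact z.continuous.Icc_extend'
  have hAz : ∀ z, ContinuousOn (fun s => A s (ext z s)) (Icc 0 T) := fun z =>
    hA.clm_apply (hext z).continuousOn
  have hint : ∀ z, IntervalIntegrable (fun s => A s (ext z s)) volume 0 T := fun z =>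
    ContinuousOn.intervalIntegrable (by rw [uIcc_of_le hT]; exact hAz z)
  have hint' : ∀ z, IntervalIntegrable (fun s => A s (ext z s) + g s) volume 0 T := fun z =>
    (hint z).add hg
  have hprim : ∀ z, ContinuousOn (fun t => ∫ s in (0 : ℝ)..t, (A s (ext z s) + g s)) (Icc 0 T) := by
    intro z
    have := intervalIntegral.continuousOn_primitive_interval' (hint' z) left_mem_uIcc
    rwa [uIcc_of_le hT] at this
  let F : C(Icc (0 : ℝ) T, E) → C(Icc (0 : ℝ) T, E) := fun z =>
    ⟨fun t => Real.exp (-(L * t)) • (u₀ + ∫ s in (0 : ℝ)..t, (A s (ext z s) + g s)), by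
      refine Continuous.smul (by fun_prop) (continuous_const.add ?_)
      exact continuousOn_iff_continuous_domRestrict.1 (hprim z)⟩
  have hF : ContractingWith (|B| / L).toNNReal F := by
    have hlt : |B| / L < 1 := by
      rw [div_lt_one hL0, hL]
      linarith
    refine ⟨by simpa using hlt, LipschitzWith.of_dist_le_mul fun z z' => ?_⟩
    rw [Real.coe_toNNReal _ (by positivity)]
    refine (ContinuousMap.dist_le (by positivity)).2 fun t => ?_
    have hsub : ∀ z, IntervalIntegrable (fun s => A s (ext z s)) volume 0 t := fun z =>
      (hint z).mono_set (by
        rw [uIcc_of_le hT, uIcc_of_le t.2.1]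
        exact Icc_subset_Icc_right t.2.2)
    have hsub' : IntervalIntegrable g volume 0 t := hg.mono_set (by
        rw [uIcc_of_le hT, uIcc_of_le t.2.1]
        exact Icc_subset_Icc_right t.2.2)
    have h1 : F z t - F z' t = Real.exp (-(L * t)) •
        ∫ s in (0 : ℝ)..t, (A s (ext z s) - A s (ext z' s)) := by
      simp only [F, ContinuousMap.coe_mk]
      rw [← smul_sub, add_sub_add_left_eq_sub, ← intervalIntegral.integral_sub
        ((hsub z).add hsub') ((hsub z').add hsub')]
      simp only [add_sub_add_right_eq_sub]
    rw [dist_eq_norm, h1, norm_smul, Real.norm_of_nonneg (Real.exp_pos _).le]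
    have h2 : ‖∫ s in (0 : ℝ)..t, (A s (ext z s) - A s (ext z' s))‖ ≤
        ∫ s in (0 : ℝ)..t, Real.exp (L * s) * (|B| * dist z z') := by
      refine intervalIntegral.norm_integral_le_of_norm_le t.2.1 (ae_of_all _ fun s hs => ?_)
        (Continuous.intervalIntegrable (by fun_prop) _ _)
      have hs' : s ∈ Icc 0 T := ⟨hs.1.le, hs.2.trans t.2.2⟩
      rw [← map_sub]
      refine ((A s).le_opNorm _).trans ?_
      have h3 : ‖ext z s - ext z' s‖ ≤ Real.exp (L * s) * dist z z' := by
        simp only [ext]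
        rw [← smul_sub, norm_smul, Real.norm_of_nonneg (Real.exp_pos _).le, ← dist_eq_norm]
        exact mul_le_mul_of_nonneg_left (ContinuousMap.dist_apply_le_dist _) (Real.exp_pos _).le
      calc ‖A s‖ * ‖ext z s - ext z' s‖ ≤ |B| * (Real.exp (L * s) * dist z z') :=
            mul_le_mul (hAB s hs') h3 (norm_nonneg _) (abs_nonneg _)
        _ = _ := by ring
    rw [intervalIntegral.integral_mul_const] at h2
    have h4 := integral_exp_mul_le (L := L) (t := t) hL0
    calc _ ≤ Real.exp (-(L * t)) * (Real.exp (L * t) / L * (|B| * dist z z')) := by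
          gcongr
          exact h2.trans (by gcongr)
      _ = |B| / L * dist z z' := by
          rw [Real.exp_neg]
          field_simp
  obtain ⟨z, hz⟩ : ∃ z, F z = z := ⟨hF.fixedPoint, hF.fixedPoint_isFixedPt⟩
  refine ⟨ext z, (hext z).continuousOn, hint' z, fun t ht => ?_⟩
  have h1 := DFunLike.congr_fun hz ⟨t, ht⟩
  simp only [F, ContinuousMap.coe_mk] at h1
  have h2 : ext z t = Real.exp (L * t) • z ⟨t, ht⟩ := by
    simp only [ext, IccExtend_of_mem hT z ht]
  rw [h2, ← h1, smul_smul, ← Real.exp_add, add_neg_cancel, Real.exp_zero, one_smul]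

end LinearODE

/-- Gronwall's inequality in the form of an energy estimate. -/
theorem energy_estimate {T α δ : ℝ} (hα : 0 ≤ α) (hδ : 0 ≤ δ) {y V φ : ℝ → ℝ}
    (hy : AbsolutelyContinuousOnInterval y 0 T) (hy0 : ∀ t ∈ Icc 0 T, 0 ≤ y t)
    (hV : ContinuousOn V (Icc 0 T)) (hV0 : ∀ t ∈ Icc 0 T, 0 ≤ V t)
    (hφ : IntervalIntegrable φ volume 0 T) (hφ0 : ∀ t ∈ Icc 0 T, 0 ≤ φ t)
    (h : ∀ᵐ t ∂volume.restrict (Icc 0 T), deriv y t + δ * V t ≤ α * y t + φ t) :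
    ∀ t ∈ Icc 0 T, y t + δ * ∫ s in (0 : ℝ)..t, V s ≤
      Real.exp (α * T) * (y 0 + ∫ s in (0 : ℝ)..T, φ s) := by
  intro t ht
  have hT : 0 ≤ T := ht.1.trans ht.2
  have hsub : uIcc 0 t ⊆ uIcc 0 T := by
    rw [uIcc_of_le hT, uIcc_of_le ht.1]
    exact Icc_subset_Icc_right ht.2
  have hexp : AbsolutelyContinuousOnInterval (fun s => Real.exp (-(α * s))) 0 T :=
    ContDiffOn.absolutelyContinuousOnInterval (by fun_prop)
  have hz : AbsolutelyContinuousOnInterval (fun s => Real.exp (-(α * s)) * y s) 0 t :=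
    (hexp.mul hy).mono hsub
  have hVi : IntervalIntegrable V volume 0 t :=
    (ContinuousOn.intervalIntegrable (by rwa [uIcc_of_le hT])).mono_set hsub
  have hφi := hφ.mono_set hsub
  -- integrate the derivative of `e^{-αs} y`, which is at most `φ - δ e^{-αT} V`
  have h1 : ∫ s in (0 : ℝ)..t, deriv (fun s => Real.exp (-(α * s)) * y s) s ≤
      ∫ s in (0 : ℝ)..t, (φ s - δ * Real.exp (-(α * T)) * V s) := by
    refine intervalIntegral.integral_mono_ae_restrict ht.1 hz.intervalIntegrable_deriv
      (hφi.sub (hVi.const_mul _)) ?_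
    have h2 : ∀ᵐ s ∂volume.restrict (Icc 0 t), deriv y s + δ * V s ≤ α * y s + φ s :=
      ae_restrict_of_ae_restrict_of_subset (Icc_subset_Icc_right ht.2) h
    filter_upwards [h2, ae_restrict_mem measurableSet_Icc,
      ae_restrict_of_ae hy.ae_differentiableAt] with s hs hst hd
    have hsT : s ∈ Icc 0 T := ⟨hst.1, hst.2.trans ht.2⟩
    have hd' := (hd (by rwa [uIcc_of_le hT])).hasDerivAt
    have he : HasDerivAt (fun s => Real.exp (-(α * s))) (Real.exp (-(α * s)) * (-α)) s := by
      have := ((hasDerivAt_id s).const_mul α).neg.exp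
      simpa using this
    rw [(he.fun_mul hd').deriv]
    have e1 : Real.exp (-(α * s)) ≤ 1 := Real.exp_le_one_iff.2 (by
      have := mul_nonneg hα hst.1
      linarith)
    have e2 : Real.exp (-(α * T)) ≤ Real.exp (-(α * s)) := Real.exp_le_exp.2 (by
      have := mul_le_mul_of_nonneg_left hsT.2 hα
      linarith)
    have e3 := mul_le_mul_of_nonneg_left hs (Real.exp_pos (-(α * s))).le
    have e4 := mul_le_mul_of_nonneg_right e1 (hφ0 s hsT)
    have e5 := mul_le_mul_of_nonneg_right e2 (mul_nonneg hδ (hV0 s hsT))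
    linarith
  rw [hz.integral_deriv_eq_sub, intervalIntegral.integral_sub hφi (hVi.const_mul _),
    intervalIntegral.integral_const_mul] at h1
  have hφT : ∫ s in (0 : ℝ)..t, φ s ≤ ∫ s in (0 : ℝ)..T, φ s := by
    refine intervalIntegral.integral_mono_interval le_rfl ht.1 ht.2 ?_ hφ
    filter_upwards [ae_restrict_mem measurableSet_Ioc] with s hs using hφ0 s ⟨hs.1.le, hs.2⟩
  have hE : Real.exp (α * T) * Real.exp (-(α * T)) = 1 := by
    rw [← Real.exp_add, add_neg_cancel, Real.exp_zero]
  have h3 : y t ≤ Real.exp (α * T) * (Real.exp (-(α * t)) * y t) := by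
    rw [← mul_assoc, ← Real.exp_add]
    refine le_mul_of_one_le_left (hy0 t ht) (Real.one_le_exp ?_)
    have := mul_le_mul_of_nonneg_left ht.2 hα
    linarith
  have h0 : Real.exp (-(α * 0)) * y 0 = y 0 := by simp
  have h4 := mul_le_mul_of_nonneg_left (h1.trans (sub_le_sub_right hφT _))
    (Real.exp_pos (α * T)).le
  rw [h0, mul_sub, mul_sub] at h4
  have h5 : Real.exp (α * T) * (δ * Real.exp (-(α * T)) * ∫ s in (0 : ℝ)..t, V s) =
      δ * ∫ s in (0 : ℝ)..t, V s := by
    linear_combination (δ * ∫ s in (0 : ℝ)..t, V s) * hE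
  rw [h5] at h4
  linarith

/-! ### Linear evolution systems with a variable mass matrix -/

section MatrixEvolution

variable {ι : Type*} [Fintype ι] {T : ℝ} {A L S : ℝ → Matrix ι ι ℝ}

open Matrix

theorem continuousOn_matrix_inv [DecidableEq ι] {s : Set ℝ} (hA : ContinuousOn A s)
    (hdet : ∀ t ∈ s, (A t).det ≠ 0) : ContinuousOn (fun t => (A t)⁻¹) s := by
  have h1 : ContinuousOn (fun t => (A t).det) s :=
    (Continuous.matrix_det continuous_id).comp_continuousOn hA
  have h2 : ContinuousOn (fun t => (A t).adjugate) s :=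
    (Continuous.matrix_adjugate continuous_id).comp_continuousOn hA
  simp only [Matrix.inv_def, Ring.inverse_eq_inv']
  exact (h1.inv₀ hdet).smul h2

/-- The system `A x' + S x = l` with invertible `A` and integrable `l` has an absolutely continuous
solution with given initial value: multiplied by `A⁻¹` it is a linear equation as in
`exists_linear_integral_equation`, with `A⁻¹ l` still integrable. -/
theorem exists_matrix_evolution [DecidableEq ι] (hT : 0 ≤ T)
    (hA : ∀ i j, ContinuousOn (fun t => A t i j) (Icc 0 T))
    (hS : ∀ i j, ContinuousOn (fun t => S t i j) (Icc 0 T))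
    (hpos : ∀ t ∈ Icc 0 T, ∀ x : ι → ℝ, x ⬝ᵥ A t *ᵥ x = 0 → x = 0) {l : ℝ → ι → ℝ}
    (hl : ∀ i, IntervalIntegrable (fun t => l t i) volume 0 T) (x₀ : ι → ℝ) :
    ∃ x : ℝ → ι → ℝ, x 0 = x₀ ∧ (∀ i, AbsolutelyContinuousOnInterval (fun t => x t i) 0 T) ∧
      ∀ᵐ t ∂volume.restrict (Icc 0 T), ∃ x' : ι → ℝ,
        (∀ i, HasDerivAt (fun s => x s i) (x' i) t) ∧ A t *ᵥ x' + S t *ᵥ x t = l t := by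
  have hA' : ContinuousOn A (Icc 0 T) :=
    continuousOn_pi.2 fun i => continuousOn_pi.2 fun j => hA i j
  have hS' : ContinuousOn S (Icc 0 T) :=
    continuousOn_pi.2 fun i => continuousOn_pi.2 fun j => hS i j
  have hdet : ∀ t ∈ Icc 0 T, (A t).det ≠ 0 := by
    intro t ht h0
    obtain ⟨v, hv, hv0⟩ := Matrix.exists_mulVec_eq_zero_iff.2 h0
    exact hv (hpos t ht v (by rw [hv0, dotProduct_zero]))
  have hinv := continuousOn_matrix_inv hA' hdet
  have hinv' : ∀ i j, ContinuousOn (fun t => (A t)⁻¹ i j) (Icc 0 T) := fun i j =>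
    continuousOn_pi.1 (continuousOn_pi.1 hinv i) j
  let Ψ : Matrix ι ι ℝ →ₗ[ℝ] ((ι → ℝ) →L[ℝ] (ι → ℝ)) :=
    (LinearMap.toContinuousLinearMap (𝕜 := ℝ) (E := ι → ℝ) (F' := ι → ℝ)).toLinearMap ∘ₗ
      (Matrix.toLin' (R := ℝ) (m := ι) (n := ι)).toLinearMap
  have hΨ : ∀ B v, Ψ B v = B *ᵥ v := fun B v => rfl
  have hΨc : Continuous Ψ := Ψ.continuous_of_finiteDimensional
  have hg : ∀ i, IntervalIntegrable (fun t => ((A t)⁻¹ *ᵥ l t) i) volume 0 T := by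
    intro i
    simp only [Matrix.mulVec, dotProduct]
    refine IntervalIntegrable.sum (Finset.univ) (f := fun j t => (A t)⁻¹ i j * l t j)
      (fun j _ => (hl j).continuousOn_mul ?_) |>.congr ?_
    · rw [uIcc_of_le hT]
      exact hinv' i j
    · exact fun t _ => by simp only [Finset.sum_apply]
  have hg' : IntervalIntegrable (fun t => (A t)⁻¹ *ᵥ l t) volume 0 T :=
    ⟨Integrable.of_eval fun i => (hg i).1, Integrable.of_eval fun i => (hg i).2⟩
  obtain ⟨x, hx, hint, heq⟩ := exists_linear_integral_equation hT
    (A := fun t => -Ψ ((A t)⁻¹ * S t)) (hΨc.comp_continuousOn (hinv.mul hS')).neg hg' x₀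
  set F : ℝ → ι → ℝ := fun s => (-Ψ ((A s)⁻¹ * S s)) (x s) + (A s)⁻¹ *ᵥ l s with hF
  have hFi : ∀ i, IntervalIntegrable (fun s => F s i) volume 0 T := fun i =>
    ⟨hint.1.eval i, hint.2.eval i⟩
  have hxi : ∀ i, ∀ t ∈ Icc 0 T, x t i = x₀ i + ∫ s in (0 : ℝ)..t, F s i := by
    intro i t ht
    have hsub : uIcc 0 t ⊆ uIcc 0 T := by
      rw [uIcc_of_le hT, uIcc_of_le ht.1]
      exact Icc_subset_Icc_right ht.2
    rw [heq t ht, Pi.add_apply, intervalIntegral.integral_of_le ht.1,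
      intervalIntegral.integral_of_le ht.1, eval_integral]
    exact fun j => ((hFi j).mono_set hsub).1
  refine ⟨x, ?_, fun i => ?_, ?_⟩
  · rw [heq 0 ⟨le_rfl, hT⟩, intervalIntegral.integral_same, add_zero]
  · have h1 := (LipschitzWith.const (x₀ i)).lipschitzOnWith.absolutelyContinuousOnInterval.add
      ((hFi i).absolutelyContinuousOnInterval_intervalIntegral (c := 0) left_mem_uIcc)
    refine h1.congr_uIcc fun t ht => ?_
    rw [uIcc_of_le hT] at ht
    exact (hxi i t ht).symm
  · rw [← restrict_Ioo_eq_restrict_Icc]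
    have h1 : ∀ᵐ t, ∀ i, t ∈ uIcc 0 T → ∀ c ∈ uIcc 0 T,
        HasDerivAt (fun x => ∫ s in c..x, F s i) (F t i) t :=
      ae_all_iff.2 fun i => (hFi i).ae_hasDerivAt_integral
    filter_upwards [ae_restrict_of_ae h1, ae_restrict_mem measurableSet_Ioo] with t ht htT
    have htI := Ioo_subset_Icc_self htT
    refine ⟨F t, fun i => ?_, ?_⟩
    · have h2 := (ht i (by rwa [uIcc_of_le hT]) 0 left_mem_uIcc).const_add (x₀ i)
      refine h2.congr_of_eventuallyEq ?_
      filter_upwards [Ioo_mem_nhds htT.1 htT.2] with s hs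
      exact hxi i s (Ioo_subset_Icc_self hs)
    · have hu : IsUnit (A t).det := isUnit_iff_ne_zero.2 (hdet t htI)
      simp only [hF, _root_.neg_apply, hΨ, Matrix.mulVec_add, Matrix.mulVec_neg,
        Matrix.mulVec_mulVec]
      rw [← mul_assoc, Matrix.mul_nonsing_inv _ hu, one_mul, Matrix.one_mulVec]
      abel

/-- The energy identity `(xᵀ A x)' = 2 xᵀ A x' + xᵀ A' x` for a symmetric matrix `A`. -/
theorem hasDerivAt_quadratic {t : ℝ} (hsymm : (A t)ᵀ = A t)
    (hA : ∀ i j, HasDerivAt (fun s => A s i j) (L t i j) t) {x : ℝ → ι → ℝ} {x' : ι → ℝ}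
    (hx : ∀ i, HasDerivAt (fun s => x s i) (x' i) t) :
    HasDerivAt (fun s => x s ⬝ᵥ A s *ᵥ x s)
      (2 * (x t ⬝ᵥ A t *ᵥ x') + x t ⬝ᵥ L t *ᵥ x t) t := by
  have h1 : HasDerivAt (fun s => x s ⬝ᵥ A s *ᵥ x s)
      (∑ i, (x' i * ∑ j, A t i j * x t j +
        x t i * ∑ j, (L t i j * x t j + A t i j * x' j))) t := by
    simp only [dotProduct, Matrix.mulVec]
    exact HasDerivAt.fun_sum fun i _ => (hx i).fun_mul
      (HasDerivAt.fun_sum fun j _ => (hA i j).fun_mul (hx j))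
  convert! h1 using 1
  have h2 : x' ⬝ᵥ A t *ᵥ x t = x t ⬝ᵥ A t *ᵥ x' := by
    rw [Matrix.dotProduct_mulVec, ← Matrix.mulVec_transpose, hsymm, dotProduct_comm]
  have h3 : ∑ i, (x' i * ∑ j, A t i j * x t j +
        x t i * ∑ j, (L t i j * x t j + A t i j * x' j)) =
      x' ⬝ᵥ A t *ᵥ x t + (x t ⬝ᵥ L t *ᵥ x t + x t ⬝ᵥ A t *ᵥ x') := by
    simp only [dotProduct, Matrix.mulVec, Finset.sum_add_distrib, mul_add]
  rw [h3, h2]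
  ring

/-- The energy estimate for an evolution system with a Gårding inequality. -/
theorem matrix_energy_estimate {α γ : ℝ} (hα : 0 ≤ α) (hγ : 0 ≤ γ)
    (hA : ∀ i j, AbsolutelyContinuousOnInterval (fun t => A t i j) 0 T)
    (hL : ∀ t ∈ Ioo 0 T, ∀ i j, HasDerivAt (fun s => A s i j) (L t i j) t)
    (hsymm : ∀ t ∈ Icc 0 T, (A t)ᵀ = A t)
    (hnonneg : ∀ t ∈ Icc 0 T, ∀ x : ι → ℝ, 0 ≤ x ⬝ᵥ A t *ᵥ x)
    {V : ℝ → (ι → ℝ) → ℝ}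
    (hG : ∀ t ∈ Ioo 0 T, ∀ x : ι → ℝ, γ * V t x + x ⬝ᵥ L t *ᵥ x ≤
      2 * (x ⬝ᵥ S t *ᵥ x) + α * (x ⬝ᵥ A t *ᵥ x))
    {x : ℝ → ι → ℝ} (hx : ∀ i, AbsolutelyContinuousOnInterval (fun t => x t i) 0 T)
    (hV : ContinuousOn (fun t => V t (x t)) (Icc 0 T)) (hV0 : ∀ t ∈ Icc 0 T, 0 ≤ V t (x t))
    {l : ℝ → ι → ℝ}
    (heq : ∀ᵐ t ∂volume.restrict (Icc 0 T), ∀ x' : ι → ℝ,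
      (∀ i, HasDerivAt (fun s => x s i) (x' i) t) → A t *ᵥ x' + S t *ᵥ x t = l t)
    {φ : ℝ → ℝ} (hφ : IntervalIntegrable φ volume 0 T) (hφ0 : ∀ t ∈ Icc 0 T, 0 ≤ φ t)
    (hl : ∀ᵐ t ∂volume.restrict (Icc 0 T), 2 * (x t ⬝ᵥ l t) ≤ γ / 2 * V t (x t) + φ t) :
    ∀ t ∈ Icc 0 T, x t ⬝ᵥ A t *ᵥ x t + γ / 2 * ∫ s in (0 : ℝ)..t, V s (x s) ≤
      Real.exp (α * T) * (x 0 ⬝ᵥ A 0 *ᵥ x 0 + ∫ s in (0 : ℝ)..T, φ s) := by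
  rcases lt_or_ge T 0 with hT | hT
  · intro t ht
    exact absurd (ht.1.trans ht.2) hT.not_ge
  have hy : AbsolutelyContinuousOnInterval (fun t => x t ⬝ᵥ A t *ᵥ x t) 0 T := by
    simp only [dotProduct, Matrix.mulVec]
    exact AbsolutelyContinuousOnInterval.fun_sum fun i _ => (hx i).mul
      (AbsolutelyContinuousOnInterval.fun_sum fun j _ => (hA i j).mul (hx j))
  refine energy_estimate hα (by positivity) hy (fun t ht => hnonneg t ht _) hV hV0 hφ hφ0 ?_
  have hd : ∀ᵐ t, ∀ i, t ∈ uIcc 0 T → DifferentiableAt ℝ (fun t => x t i) t :=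
    ae_all_iff.2 fun i => (hx i).ae_differentiableAt
  rw [← restrict_Ioo_eq_restrict_Icc] at heq hl ⊢
  filter_upwards [heq, hl, ae_restrict_of_ae hd, ae_restrict_mem measurableSet_Ioo]
    with t h1 h2 h3 ht
  have htI := Ioo_subset_Icc_self ht
  have hx' : ∀ i, HasDerivAt (fun s => x s i) (deriv (fun s => x s i) t) t := fun i =>
    (h3 i (by rwa [uIcc_of_le hT])).hasDerivAt
  rw [(hasDerivAt_quadratic (hsymm t htI) (hL t ht) hx').deriv]
  have h4 := congrArg (fun z => x t ⬝ᵥ z) (h1 _ hx')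
  simp only [dotProduct_add] at h4
  have h5 := hG t ht (x t)
  linarith

end MatrixEvolution

/-! ### The scheme as a linear evolution system -/

open Matrix

namespace Mesh

variable {d : ℕ} {M : Mesh d} {D : Geometry d} {k : ℕ} {T κ h γ : ℝ} {cf : Coeffs d}
  {ι : Type*} [Fintype ι]

/-- The coefficients with coordinates `x` in the basis `b` of the space of admissible nodal
values. -/
def vec (b : Module.Basis ι ℝ (M.nodal D k)) (x : ι → ℝ) : M.Coef k :=
  ∑ i, x i • (b i : M.Coef k)

/-- The mass matrix. -/
def massMat (b : Module.Basis ι ℝ (M.nodal D k)) (t : ℝ) : Matrix ι ι ℝ :=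
  Matrix.of fun i j => M.mass D k t (b i) (b j)

/-- The matrix of `λ^h`, which is the time derivative of the mass matrix. -/
def lamMat (b : Module.Basis ι ℝ (M.nodal D k)) (t : ℝ) : Matrix ι ι ℝ :=
  Matrix.of fun i j => M.lam D k t (b i) (b j)

/-- The matrix of `a^h + λ^h`; rows belong to test functions. -/
def stiffMat (cf : Coeffs d) (b : Module.Basis ι ℝ (M.nodal D k)) (t : ℝ) : Matrix ι ι ℝ :=
  Matrix.of fun i j => M.stiff D k cf t (b j) (b i)

/-- The load vector. -/
def loadVec (f : ℝ → Fin 2 → Space d → ℝ) (G : (t : ℝ) → HHalf (D.Γ t) →ₗ[ℝ] ℝ)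
    (b : Module.Basis ι ℝ (M.nodal D k)) (t : ℝ) (i : ι) : ℝ :=
  M.load D k f G t (M.fn D k t (b i))

variable {b : Module.Basis ι ℝ (M.nodal D k)}

theorem vec_eq (x : ι → ℝ) : vec b x = ((b.equivFun.symm x : M.nodal D k) : M.Coef k) := by
  rw [Module.Basis.equivFun_symm_apply]
  simp only [vec, Submodule.coe_sum, Submodule.coe_smul]

theorem vec_mem (x : ι → ℝ) : vec b x ∈ M.nodal D k := by
  rw [vec_eq]
  exact SetLike.coe_mem _

theorem exists_vec_eq {c : M.Coef k} (hc : c ∈ M.nodal D k) : ∃ x, vec b x = c :=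
  ⟨b.equivFun ⟨c, hc⟩, by rw [vec_eq, LinearEquiv.symm_apply_apply]⟩

theorem vec_eq_zero {x : ι → ℝ} (hx : vec b x = 0) : x = 0 := by
  rw [vec_eq, ZeroMemClass.coe_eq_zero, LinearEquiv.map_eq_zero_iff] at hx
  exact hx

theorem vec_apply (x : ι → ℝ) (K : M.Elt) (β : nodeIdx d k) :
    vec b x K β = ∑ i, x i * (b i : M.Coef k) K β := by
  simp only [vec, Finset.sum_apply, Pi.smul_apply, smul_eq_mul]

theorem vec_single [DecidableEq ι] (i : ι) : vec b (Pi.single i 1) = b i := by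
  rw [vec_eq, b.equivFun_symm_apply, Finset.sum_eq_single i]
  · simp
  · intro j _ hj
    simp [hj]
  · simp

theorem vec_sub (x y : ι → ℝ) : vec b (x - y) = vec b x - vec b y := by
  simp only [vec_eq, map_sub, Submodule.coe_sub]

theorem bilinear_vec {B : M.Coef k → M.Coef k → ℝ}
    (h1 : ∀ a a' c, B (a + a') c = B a c + B a' c) (h2 : ∀ (r : ℝ) a c, B (r • a) c = r * B a c)
    (h3 : ∀ a c c', B a (c + c') = B a c + B a c') (h4 : ∀ (r : ℝ) a c, B a (r • c) = r * B a c)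
    (x y : ι → ℝ) :
    B (vec b x) (vec b y) = ∑ i, x i * ∑ j, B (b i) (b j) * y j := by
  let B' : M.Coef k →ₗ[ℝ] M.Coef k →ₗ[ℝ] ℝ := LinearMap.mk₂ ℝ B h1 h2 h3 h4
  have hB : ∀ a c, B a c = B' a c := fun _ _ => rfl
  simp only [hB, vec, map_sum, LinearMap.sum_apply, map_smul, LinearMap.smul_apply, smul_eq_mul,
    Finset.mul_sum]
  rw [Finset.sum_comm]
  refine Finset.sum_congr rfl fun i _ => Finset.sum_congr rfl fun j _ => ?_
  ring

namespace Standing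

theorem mass_vec (hM : M.Standing D k T κ h) {t : ℝ} (ht : t ∈ Icc 0 T) (x y : ι → ℝ) :
    M.mass D k t (vec b x) (vec b y) = x ⬝ᵥ massMat b t *ᵥ y := by
  refine bilinear_vec (hM.mass_add_left ht) (mass_smul_left t) (fun a c c' => ?_)
    (fun r a c => ?_) x y
  · simp only [mass_comm t a, hM.mass_add_left ht]
  · simp only [mass_comm t a, mass_smul_left]

theorem stiff_vec (hM : M.Standing D k T κ h) (hcf : cf.IsAdmissible D T γ) {t : ℝ}
    (ht : t ∈ Icc 0 T) (x y : ι → ℝ) :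
    M.stiff D k cf t (vec b y) (vec b x) = x ⬝ᵥ stiffMat cf b t *ᵥ y :=
  bilinear_vec (B := fun a c => M.stiff D k cf t c a)
    (fun a a' c => hM.stiff_add_right hcf ht c a a') (fun r a c => stiff_smul_right t r c a)
    (fun a c c' => hM.stiff_add_left hcf ht c c' a) (fun r a c => stiff_smul_left t r c a) x y

theorem lam_vec (hM : M.Standing D k T κ h) {t : ℝ} (ht : t ∈ Ioo 0 T) (x y : ι → ℝ) :
    M.lam D k t (vec b x) (vec b y) = x ⬝ᵥ lamMat b t *ᵥ y := by
  have h1 := hM.hasDerivAt_mass (vec b x) (vec b y) ht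
  have h2 : HasDerivAt (fun s => x ⬝ᵥ massMat b s *ᵥ y) (x ⬝ᵥ lamMat b t *ᵥ y) t := by
    simp only [dotProduct, Matrix.mulVec]
    exact HasDerivAt.fun_sum fun i _ => (HasDerivAt.fun_sum fun j _ =>
      (hM.hasDerivAt_mass _ _ ht).mul_const _).const_mul _
  refine (h1.congr_of_eventuallyEq ?_).unique h2
  filter_upwards [Ioo_mem_nhds ht.1 ht.2] with s hs
  exact (hM.mass_vec (Ioo_subset_Icc_self hs) x y).symm

theorem transpose_massMat {ι : Type*} (b : Module.Basis ι ℝ (M.nodal D k)) (t : ℝ) :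
    (massMat b t)ᵀ = massMat b t :=
  Matrix.ext fun i j => mass_comm t (b j : M.Coef k) (b i)

theorem continuousOn_h1_comp (hM : M.Standing D k T κ h) {u : ℝ → M.Coef k}
    (hu : ∀ K β, ContinuousOn (fun t => u t K β) (Icc 0 T)) :
    ContinuousOn (fun t => M.h1 D k t (u t)) (Icc 0 T) := by
  refine continuousOn_finsetSum _ fun K _ =>
    continuousOn_integral_refTri (g := fun q => M.h1Int D k q.1 K (u q.1) q.2) ?_
  have h1 : ContinuousOn (fun q : ℝ × Space d => interp k (u q.1 K) q.2)
      (Icc 0 T ×ˢ refTri d) :=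
    (continuousOn_interp (I := Icc 0 T) (a := fun t => u t K)
      fun β => hu K β).mono (prod_mono_right (subset_univ _))
  have h2 : ContinuousOn (fun q : ℝ × Space d => dinterp k (u q.1 K) q.2)
      (Icc 0 T ×ˢ refTri d) :=
    (continuousOn_dinterp (I := Icc 0 T) (a := fun t => u t K)
      fun β => hu K β).mono (prod_mono_right (subset_univ _))
  have h3 : ContinuousOn (fun q : ℝ × Space d => M.grad D k q.1 (u q.1) K q.2)
      (Icc 0 T ×ˢ refTri d) :=
    (InnerProductSpace.toDual ℝ (Space d)).symm.continuous.comp_continuousOn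
      (h2.clm_comp (hM.continuousOn_dinv K))
  exact (hM.continuousOn_jac K).mul ((h1.pow 2).add (h3.norm.pow 2))

theorem continuousOn_vec {x : ℝ → ι → ℝ} (hx : ∀ i, ContinuousOn (fun t => x t i) (Icc 0 T))
    (K : M.Elt) (β : nodeIdx d k) : ContinuousOn (fun t => vec b (x t) K β) (Icc 0 T) := by
  simp only [vec_apply]
  exact continuousOn_finsetSum _ fun i _ => (hx i).mul continuousOn_const

theorem pull_fn (hM : M.Standing D k T κ h) {t : ℝ} (ht : t ∈ Icc 0 T) (c : M.Coef k) :
    M.pull D k t (M.fn D k t c) = M.fn D k 0 c := by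
  funext K x
  by_cases hx : x ∈ M.elt D k 0 K
  · rw [Mesh.pull, indicator_of_mem hx, hM.fn_refMap ht c K (refInv_mem hx), Mesh.fn,
      indicator_of_mem hx]
  · rw [Mesh.pull, indicator_of_notMem hx, Mesh.fn, indicator_of_notMem hx]

theorem push_fn (hM : M.Standing D k T κ h) {t : ℝ} (c : M.Coef k) :
    M.push D k t (M.fn D k 0 c) = M.fn D k t c := by
  funext K x
  by_cases hx : x ∈ M.elt D k t K
  · rw [Mesh.push, indicator_of_mem hx, hM.fn_refMap hM.zero_mem c K (refInv_mem hx), Mesh.fn,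
      indicator_of_mem hx]
  · rw [Mesh.push, indicator_of_notMem hx, Mesh.fn, indicator_of_notMem hx]

theorem fn_vec (t : ℝ) (x : ι → ℝ) (K : M.Elt) (z : Space d) :
    M.fn D k t (vec b x) K z = ∑ i, x i * M.fn D k t (b i) K z := by
  by_cases hz : z ∈ M.elt D k t K
  · simp only [Mesh.fn, indicator_of_mem hz, vec_apply, Finset.sum_mul, Finset.mul_sum]
    rw [Finset.sum_comm]
    simp only [mul_assoc]
  · simp only [Mesh.fn, indicator_of_notMem hz, mul_zero, Finset.sum_const_zero]

/-- The material derivative acts on the coefficients, since the basis functions are transported by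
the discrete flow. -/
theorem matDeriv_vec (hM : M.Standing D k T κ h) {t : ℝ} (ht : t ∈ Ioo 0 T) {U : ℝ → M.Fun}
    {x : ℝ → ι → ℝ} (hU : ∀ s ∈ Icc 0 T, U s = M.fn D k s (vec b (x s))) {x' : ι → ℝ}
    (hx : ∀ i, HasDerivAt (fun s => x s i) (x' i) t) :
    M.matDeriv D k U t = M.fn D k t (vec b x') := by
  have h1 : (fun K z => deriv (fun s => M.pull D k s (U s) K z) t) = M.fn D k 0 (vec b x') := by
    funext K z
    refine HasDerivAt.deriv ?_
    have h2 : HasDerivAt (fun s => M.fn D k 0 (vec b (x s)) K z) (M.fn D k 0 (vec b x') K z) t := by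
      simp only [fn_vec]
      exact HasDerivAt.fun_sum fun i _ => (hx i).mul_const _
    refine h2.congr_of_eventuallyEq ?_
    filter_upwards [Ioo_mem_nhds ht.1 ht.2] with s hs
    have hsI := Ioo_subset_Icc_self hs
    rw [hU s hsI, hM.pull_fn hsI]
  rw [Mesh.matDeriv, h1, hM.push_fn]

/-- The scheme, tested with a basis, is a linear system for the coordinates. -/
theorem equation_iff (hM : M.Standing D k T κ h) (hcf : cf.IsAdmissible D T γ) {t : ℝ}
    (ht : t ∈ Ioo 0 T) {U : ℝ → M.Fun} {x : ℝ → ι → ℝ}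
    (hU : ∀ s ∈ Icc 0 T, U s = M.fn D k s (vec b (x s))) {x' : ι → ℝ}
    (hx : ∀ i, HasDerivAt (fun s => x s i) (x' i) t) (z : ι → ℝ) :
    M.mForm D k t (M.matDeriv D k U t) (M.fn D k t (vec b z))
      + M.aForm D cf k t (U t) (M.fn D k t (vec b z))
      + M.lamForm D k t (U t) (M.fn D k t (vec b z)) =
    z ⬝ᵥ (massMat b t *ᵥ x' + stiffMat cf b t *ᵥ x t) := by
  have htI := Ioo_subset_Icc_self ht
  rw [hM.matDeriv_vec ht hU hx, hU t htI, hM.mForm_fn htI, add_assoc,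
    hM.aForm_add_lamForm_fn hcf htI, mass_comm, hM.mass_vec htI, hM.stiff_vec hcf htI,
    dotProduct_add]

/-- The coordinates of a solution. They are absolutely continuous, being linear combinations of the
nodal values of the pulled back solution. -/
theorem exists_coordinates (hM : M.Standing D k T κ h) (hcf : cf.IsAdmissible D T γ)
    {f : ℝ → Fin 2 → Space d → ℝ} {G : (t : ℝ) → HHalf (D.Γ t) →ₗ[ℝ] ℝ} {U₀ : M.Fun}
    {U : ℝ → M.Fun} (hU : M.IsSolution D cf k T f G U₀ U) :
    ∃ x : ℝ → ι → ℝ, (∀ t ∈ Icc 0 T, U t = M.fn D k t (vec b (x t))) ∧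
      (∀ i, AbsolutelyContinuousOnInterval (fun t => x t i) 0 T) ∧
      ∀ᵐ t ∂volume.restrict (Icc 0 T), ∀ x' : ι → ℝ,
        (∀ i, HasDerivAt (fun s => x s i) (x' i) t) →
        massMat b t *ᵥ x' + stiffMat cf b t *ᵥ x t = loadVec f G b t := by
  classical
  -- the coordinate functionals, extended to all nodal values so that they apply at times outside
  -- of `[0, T]` too
  choose Λ hΛ using fun i => LinearMap.exists_extend (b.coord i)
  let u : ℝ → M.Coef k := fun t K β => M.pull D k t (U t) K (M.node D k 0 K β.1)
  have hu : ∀ t ∈ Icc 0 T, U t = M.fn D k t (vec b fun i => Λ i (u t)) := by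
    intro t ht
    obtain ⟨c, hc, hcU⟩ := (hM.memS_iff ht (U t)).1 (hU.mem t ht)
    have h1 : u t = c := by
      funext K β
      simp only [u]
      rw [hcU, hM.pull_fn ht, hM.fn_node hM.zero_mem]
    have h2 : (fun i => Λ i (u t)) = b.equivFun ⟨c, hc⟩ := by
      funext i
      rw [h1]
      exact LinearMap.congr_fun (hΛ i) ⟨c, hc⟩
    rw [hcU, h2, vec_eq, LinearEquiv.symm_apply_apply]
  refine ⟨fun t i => Λ i (u t), hu, fun i => ?_, ?_⟩
  · have h1 : ∀ t, Λ i (u t) =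
        ∑ K, ∑ β, Λ i (Pi.single K (Pi.single β 1)) * u t K β := by
      intro t
      have h2 : u t = ∑ K, ∑ β, u t K β • (Pi.single K (Pi.single β 1) : M.Coef k) := by
        funext K β
        simp only [Finset.sum_apply, Pi.smul_apply, smul_eq_mul]
        rw [Finset.sum_eq_single K, Finset.sum_eq_single β]
        · simp
        · intro β' _ hβ
          simp [hβ.symm]
        · simp
        · intro K' _ hK
          simp [hK.symm]
        · simp
      conv_lhs => rw [h2]
      simp only [map_sum, map_smul, smul_eq_mul]
      exact Finset.sum_congr rfl fun K _ => Finset.sum_congr rfl fun β _ => mul_comm _ _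
    simp only [h1]
    exact AbsolutelyContinuousOnInterval.fun_sum fun K _ =>
      AbsolutelyContinuousOnInterval.fun_sum fun β _ => (hU.absCont K _).const_mul _
  · have h1 := hU.equation
    rw [← restrict_Ioo_eq_restrict_Icc] at h1 ⊢
    filter_upwards [h1, ae_restrict_mem measurableSet_Ioo] with t h1 ht x' hx'
    funext i
    have h2 := h1 (M.fn D k t (vec b (Pi.single i 1)))
      ((hM.memS_iff (Ioo_subset_Icc_self ht) _).2 ⟨_, vec_mem _, rfl⟩)
    rw [hM.equation_iff hcf ht hu hx', single_dotProduct, one_mul, vec_single] at h2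
    exact h2

/-- A solution of the linear system for the coordinates gives a solution of the scheme. -/
theorem isSolution_of_coordinates (hM : M.Standing D k T κ h) (hcf : cf.IsAdmissible D T γ)
    {f : ℝ → Fin 2 → Space d → ℝ} {G : (t : ℝ) → HHalf (D.Γ t) →ₗ[ℝ] ℝ}
    (hlin : ∀ᵐ t ∂volume.restrict (Icc 0 T), ∀ z,
      M.load D k f G t (M.fn D k t (vec b z)) = z ⬝ᵥ loadVec f G b t)
    {x : ℝ → ι → ℝ} (hx : ∀ i, AbsolutelyContinuousOnInterval (fun t => x t i) 0 T)
    (heq : ∀ᵐ t ∂volume.restrict (Icc 0 T), ∃ x' : ι → ℝ,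
      (∀ i, HasDerivAt (fun s => x s i) (x' i) t) ∧
        massMat b t *ᵥ x' + stiffMat cf b t *ᵥ x t = loadVec f G b t) :
    M.IsSolution D cf k T f G (M.fn D k 0 (vec b (x 0))) fun t => M.fn D k t (vec b (x t)) where
  mem t ht := (hM.memS_iff ht _).2 ⟨_, vec_mem _, rfl⟩
  absCont K z := by
    have h1 : AbsolutelyContinuousOnInterval (fun t => M.fn D k 0 (vec b (x t)) K z) 0 T := by
      simp only [fn_vec]
      refine AbsolutelyContinuousOnInterval.fun_sum fun i _ => ?_
      simpa only [mul_comm] using (hx i).const_mul (M.fn D k 0 (b i) K z)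
    refine h1.congr_uIcc fun t ht => ?_
    rw [uIcc_of_le hM.T_pos.le] at ht
    simp only
    rw [hM.pull_fn ht]
  initial := rfl
  equation := by
    rw [← restrict_Ioo_eq_restrict_Icc] at heq hlin ⊢
    filter_upwards [heq, hlin, ae_restrict_mem measurableSet_Ioo] with t h1 h2 ht ζ hζ
    obtain ⟨x', hx', h3⟩ := h1
    obtain ⟨c, hc, rfl⟩ := (hM.memS_iff (Ioo_subset_Icc_self ht) _).1 hζ
    obtain ⟨z, rfl⟩ := exists_vec_eq (b := b) hc
    rw [hM.equation_iff hcf ht (fun s _ => rfl) hx', h3, h2]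

end Standing

end Mesh

/-! ### The load functional -/

open Matrix

namespace Mesh

variable {d : ℕ} {M : Mesh d} {D : Geometry d} {k : ℕ} {T κ h γ : ℝ} {cf : Coeffs d}
  {ι : Type*} [Fintype ι] {b : Module.Basis ι ℝ (M.nodal D k)}
  {f : ℝ → Fin 2 → Space d → ℝ} {G : (t : ℝ) → HHalf (D.Γ t) →ₗ[ℝ] ℝ}

theorem liftFun_vec (t : ℝ) (i : Fin 2) (z : ι → ℝ) (p : Space d) :
    M.liftFun D k t i (M.fn D k t (vec b z)) p =
      ∑ j, z j * M.liftFun D k t i (M.fn D k t (b j)) p := by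
  unfold Mesh.liftFun
  split_ifs with hp
  · exact Standing.fn_vec t z _ _
  · simp

namespace Standing

theorem normSqH_le_normSqV (hM : M.Standing D k T κ h) {t : ℝ} (ht : t ∈ Icc 0 T)
    (c : M.Coef k) : M.normSqH D k t (M.fn D k t c) ≤ M.normSqV D k t (M.fn D k t c) := by
  rw [hM.normSqH_fn ht, hM.normSqV_fn ht]
  exact ENNReal.ofReal_le_ofReal (hM.mass_le_h1 ht c)

/-- The load functional is linear in the test function. For the volume part this needs `f t` to be
square integrable, which holds for almost every `t`. -/
theorem load_vec (hM : M.Standing D k T κ h) {t : ℝ} (ht : t ∈ Icc 0 T)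
    (hf : ∀ i, MemLp (f t i) 2 (volume.restrict (D.Om i t))) (z : ι → ℝ) :
    M.load D k f G t (M.fn D k t (vec b z)) = z ⬝ᵥ loadVec f G b t := by
  have hload : ∀ ζ, M.load D k f G t ζ =
      M.volLoad D k f t ζ + dualPair (G t) (M.liftFun D k t 0 ζ) := fun _ => rfl
  have h1 : M.volLoad D k f t (M.fn D k t (vec b z)) =
      ∑ j, z j * M.volLoad D k f t (M.fn D k t (b j)) := by
    rw [hM.volLoad_eq ht hf (vec_mem z)]
    simp only [hM.volLoad_eq ht hf (SetLike.coe_mem (b _)), Finset.mul_sum]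
    rw [Finset.sum_comm]
    refine Finset.sum_congr rfl fun i _ => ?_
    simp only [← integral_const_mul]
    rw [← integral_finsetSum _ fun j _ => ?_]
    · refine integral_congr_ae (ae_of_all _ fun p => ?_)
      simp only [liftFun_vec, Finset.mul_sum]
      exact Finset.sum_congr rfl fun j _ => by ring
    · exact ((hf i).integrable_mul (hM.memLp_liftFun ht (SetLike.coe_mem (b j)) i)).const_mul _
  have h2 : dualPair (G t) (M.liftFun D k t 0 (M.fn D k t (vec b z))) =
      ∑ j, z j * dualPair (G t) (M.liftFun D k t 0 (M.fn D k t (b j))) := by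
    have hmem := fun c (hc : c ∈ M.nodal D k) => hM.liftFun_mem_HHalf ht hc
    have h3 : (⟨_, hmem _ (vec_mem (b := b) z)⟩ : HHalf (D.Γ t)) =
        ∑ j, z j • ⟨_, hmem _ (SetLike.coe_mem (b j))⟩ := by
      refine Subtype.ext (funext fun p => ?_)
      rw [Submodule.coe_sum, Finset.sum_apply]
      exact liftFun_vec t 0 z p
    rw [dualPair, dif_pos (hmem _ (vec_mem z)), h3, map_sum]
    refine Finset.sum_congr rfl fun j _ => ?_
    rw [map_smul, smul_eq_mul, dualPair, dif_pos (hmem _ (SetLike.coe_mem (b j)))]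
  simp only [loadVec, dotProduct, hload, h1, h2, mul_add, Finset.sum_add_distrib]

theorem aemeasurable_load (hM : M.Standing D k T κ h) (hf : MemL2H D T f)
    (hG : MemL2VΓdual D T G) {c : M.Coef k} (hc : c ∈ M.nodal D k) :
    AEMeasurable (fun t => M.load D k f G t (M.fn D k t c)) (volume.restrict (Icc 0 T)) :=
  (hM.aemeasurable_volLoad hf hc).add (hM.aemeasurable_dualPair_liftFun hc hG)

end Standing

end Mesh

/-- The squared norm of the data at time `t`. -/
def dataSq {d : ℕ} (D : Geometry d) (f : ℝ → Fin 2 → Space d → ℝ)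
    (G : (t : ℝ) → HHalf (D.Γ t) →ₗ[ℝ] ℝ) (t : ℝ) : ℝ≥0∞ :=
  (∑ i, ∫⁻ x in D.Om i t, ‖f t i x‖ₑ ^ 2) + dualNorm (D.Γ t) (G t) ^ 2

namespace Geometry.IsAdmissible

variable {d k : ℕ} {D : Geometry d} {T : ℝ} {f : ℝ → Fin 2 → Space d → ℝ}
  {G : (t : ℝ) → HHalf (D.Γ t) →ₗ[ℝ] ℝ}

theorem lintegral_dataSq (hD : D.IsAdmissible k T) (hf : MemL2H D T f) :
    ∫⁻ t in Icc 0 T, dataSq D f G t = normSqL2H D T f + normSqL2VΓdual D T G :=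
  lintegral_add_left' (hD.aemeasurable_normSq hf) _

/-- The load is bounded in the dual of the broken `H¹` norm, uniformly over all regular meshes: the
volume part by a change of variables, the interface part by the trace theorem. -/
theorem exists_enorm_load_sq_le (hd : 2 ≤ d) (hD : D.IsAdmissible k T) (κ : ℝ) :
    ∃ C : ℝ≥0, ∀ (M : Mesh d) (h : ℝ), M.Standing D k T κ h →
      ∀ (f : ℝ → Fin 2 → Space d → ℝ) (G : (t : ℝ) → HHalf (D.Γ t) →ₗ[ℝ] ℝ), ∀ t ∈ Icc 0 T,
      (∀ i, MemLp (f t i) 2 (volume.restrict (D.Om i t))) → dualNorm (D.Γ t) (G t) < ⊤ →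
      ∀ c ∈ M.nodal D k, ‖M.load D k f G t (M.fn D k t c)‖ₑ ^ 2 ≤
        C * dataSq D f G t * M.normSqV D k t (M.fn D k t c) := by
  obtain ⟨C, hC⟩ := hD.exists_enorm_dualPair_sq_le hd κ
  refine ⟨2 * (2 * κ.toNNReal ^ d + C), fun M h hM f G t ht hf hG c hc => ?_⟩
  have h1 := hM.volLoad_bound ht hf hc
  have h2 := hC M h hM t ht c hc (G t) hG
  have h3 := hM.normSqH_le_normSqV ht c
  refine (pow_le_pow_left' (enorm_add_le _ _) 2).trans ((add_sq_le_two_mul _ _).trans ?_)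
  simp only [dataSq]
  set A := ∑ i, ∫⁻ x in D.Om i t, ‖f t i x‖ₑ ^ 2
  set N := dualNorm (D.Γ t) (G t) ^ 2
  set V := M.normSqV D k t (M.fn D k t c)
  push_cast
  calc _ ≤ 2 * (2 * (A * ((κ.toNNReal : ℝ≥0∞) ^ d * V)) + N * (C * V)) := by
        gcongr
        exact h1.trans (by gcongr)
    _ = 2 * ((2 * (κ.toNNReal : ℝ≥0∞) ^ d) * A + C * N) * V := by ring
    _ ≤ 2 * ((2 * (κ.toNNReal : ℝ≥0∞) ^ d + C) * A +
          (2 * (κ.toNNReal : ℝ≥0∞) ^ d + C) * N) * V := by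
        gcongr
        · exact le_self_add
        · exact le_add_self
    _ = _ := by ring

end Geometry.IsAdmissible

namespace Mesh.Standing

variable {d : ℕ} {M : Mesh d} {D : Geometry d} {k : ℕ} {T κ h : ℝ}
  {ι : Type*} [Fintype ι] {b : Module.Basis ι ℝ (M.nodal D k)}
  {f : ℝ → Fin 2 → Space d → ℝ} {G : (t : ℝ) → HHalf (D.Γ t) →ₗ[ℝ] ℝ}

theorem lintegral_dataSq_lt_top (hM : M.Standing D k T κ h) (hf : MemL2H D T f)
    (hG : MemL2VΓdual D T G) : ∫⁻ t in Icc 0 T, dataSq D f G t < ⊤ := by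
  rw [hM.adm.lintegral_dataSq hf]
  exact ENNReal.add_lt_top.2 ⟨hM.adm.normSqL2H_lt_top hf, hG.integrable⟩

theorem intervalIntegrable_load (hM : M.Standing D k T κ h) (hf : MemL2H D T f)
    (hG : MemL2VΓdual D T G) {c : M.Coef k} (hc : c ∈ M.nodal D k) :
    IntervalIntegrable (fun t => M.load D k f G t (M.fn D k t c)) volume 0 T := by
  rw [intervalIntegrable_iff_integrableOn_Icc_of_le hM.T_pos.le]
  refine ⟨(hM.aemeasurable_load hf hG hc).aestronglyMeasurable, ?_⟩
  obtain ⟨C, hC⟩ := hM.adm.exists_enorm_load_sq_le hM.two_le κ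
  obtain ⟨B, hB⟩ := isCompact_Icc.exists_bound_of_continuousOn
    (hM.continuousOn_h1_comp (u := fun _ => c) fun _ _ => continuousOn_const)
  have h1 : ∀ᵐ t ∂volume.restrict (Icc 0 T), ‖M.load D k f G t (M.fn D k t c)‖ₑ ≤
      1 + C * ENNReal.ofReal B * dataSq D f G t := by
    filter_upwards [hM.adm.ae_memLp hf, ae_restrict_mem measurableSet_Icc] with t h1 ht
    have h2 := hC M h hM f G t ht h1 (hG.bounded t ht) c hc
    rw [hM.normSqV_fn ht, mul_right_comm] at h2
    have h3 : M.h1 D k t c ≤ B := (le_abs_self _).trans (hB t ht)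
    have h4 : ∀ a : ℝ≥0∞, a ≤ 1 + a ^ 2 := fun a => by
      rcases le_total a 1 with ha | ha
      · exact ha.trans le_self_add
      · exact (le_self_pow₀ ha two_ne_zero).trans le_add_self
    refine (h4 _).trans (add_le_add le_rfl (h2.trans ?_))
    gcongr
  refine (lintegral_mono_ae h1).trans_lt ?_
  rw [lintegral_add_left measurable_const, lintegral_const_mul' _ _
    (ENNReal.mul_ne_top ENNReal.coe_ne_top ENNReal.ofReal_ne_top)]
  refine ENNReal.add_lt_top.2 ⟨?_, ENNReal.mul_lt_top (ENNReal.mul_lt_top ENNReal.coe_lt_top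
    ENNReal.ofReal_lt_top) (hM.lintegral_dataSq_lt_top hf hG)⟩
  simp

end Mesh.Standing

/-! ### Well-posedness and stability -/

open Matrix

namespace Mesh.Standing

variable {d : ℕ} {M : Mesh d} {D : Geometry d} {k : ℕ} {T κ h γ : ℝ} {cf : Coeffs d}
  {ι : Type*} [Fintype ι] {b : Module.Basis ι ℝ (M.nodal D k)}
  {f : ℝ → Fin 2 → Space d → ℝ} {G : (t : ℝ) → HHalf (D.Γ t) →ₗ[ℝ] ℝ}

/-- The energy estimate for the coordinates, with a load that is absorbed up to a function `φ`. -/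
theorem coordinates_energy (hM : M.Standing D k T κ h) (hcf : cf.IsAdmissible D T γ) {W : ℝ}
    (hW0 : 0 ≤ W)
    (hW : ∀ t ∈ Icc 0 T, ∀ (K : M.Elt), ∀ y ∈ refTri d,
      ‖cf.B t (M.liftPar D k t K y) - M.vel D k t K y‖ ≤ W ∧ |M.divVel D k t K y| ≤ W ∧
        |cf.C t (M.liftPar D k t K y)| ≤ W)
    {x : ℝ → ι → ℝ} (hx : ∀ i, AbsolutelyContinuousOnInterval (fun t => x t i) 0 T)
    {l : ℝ → ι → ℝ}
    (heq : ∀ᵐ t ∂volume.restrict (Icc 0 T), ∀ x' : ι → ℝ,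
      (∀ i, HasDerivAt (fun s => x s i) (x' i) t) →
        massMat b t *ᵥ x' + stiffMat cf b t *ᵥ x t = l t)
    {φ : ℝ → ℝ} (hφ : IntervalIntegrable φ volume 0 T) (hφ0 : ∀ t ∈ Icc 0 T, 0 ≤ φ t)
    (hl : ∀ᵐ t ∂volume.restrict (Icc 0 T),
      2 * (x t ⬝ᵥ l t) ≤ γ / 2 * M.h1 D k t (vec b (x t)) + φ t) :
    ∀ t ∈ Icc 0 T, M.mass D k t (vec b (x t)) (vec b (x t)) +
        γ / 2 * ∫ s in (0 : ℝ)..t, M.h1 D k s (vec b (x s)) ≤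
      Real.exp ((γ + 4 * W ^ 2 / γ + 3 * W) * T) *
        (M.mass D k 0 (vec b (x 0)) (vec b (x 0)) + ∫ s in (0 : ℝ)..T, φ s) := by
  have hγ := hcf.γ_pos
  intro t ht
  have hxc : ∀ i, ContinuousOn (fun t => x t i) (Icc 0 T) := fun i => by
    have := (hx i).continuousOn
    rwa [uIcc_of_le hM.T_pos.le] at this
  have := matrix_energy_estimate (A := massMat b) (L := lamMat b) (S := stiffMat cf b)
    (α := γ + 4 * W ^ 2 / γ + 3 * W) (γ := γ) (V := fun t x => M.h1 D k t (vec b x)) (l := l)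
    (by positivity) hγ.le (fun i j => hM.absolutelyContinuous_mass _ _)
    (fun t ht i j => hM.hasDerivAt_mass _ _ ht) (fun t _ => transpose_massMat b t)
    (fun t ht x => by
      rw [← hM.mass_vec ht]
      exact mass_nonneg t _)
    (fun t ht x => by
      have htI := Ioo_subset_Icc_self ht
      rw [← hM.mass_vec htI, ← hM.stiff_vec hcf htI, ← hM.lam_vec ht]
      exact hM.garding hcf htI (hW t htI) _)
    hx (hM.continuousOn_h1_comp (continuousOn_vec hxc)) (fun t _ => h1_nonneg t _) heq hφ hφ0 hl
    t ht
  rwa [← hM.mass_vec ht, ← hM.mass_vec hM.zero_mem] at this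

/-- Two solutions of the scheme with the same data coincide: their difference solves the homogeneous
system. -/
theorem eq_of_isSolution (hM : M.Standing D k T κ h) (hcf : cf.IsAdmissible D T γ) {U₀ : M.Fun}
    {U V : ℝ → M.Fun} (hU : M.IsSolution D cf k T f G U₀ U)
    (hV : M.IsSolution D cf k T f G U₀ V) {t : ℝ} (ht : t ∈ Icc 0 T) : V t = U t := by
  let b := Module.finBasis ℝ (M.nodal D k)
  obtain ⟨W, hW0, hW⟩ := hM.adm.exists_uniform_bound hcf κ
  obtain ⟨x, hxU, hx, hxeq⟩ := hM.exists_coordinates (b := b) hcf hU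
  obtain ⟨y, hyV, hy, hyeq⟩ := hM.exists_coordinates (b := b) hcf hV
  have h0 : vec b (x 0) = vec b (y 0) := by
    have h1 : M.fn D k 0 (vec b (x 0)) = M.fn D k 0 (vec b (y 0)) := by
      rw [← hxU 0 hM.zero_mem, ← hyV 0 hM.zero_mem, hU.initial, hV.initial]
    funext K β
    rw [← hM.fn_node hM.zero_mem (vec b (x 0)), h1, hM.fn_node hM.zero_mem]
  have heq : ∀ᵐ t ∂volume.restrict (Icc 0 T), ∀ z' : Fin _ → ℝ,
      (∀ i, HasDerivAt (fun s => (x s - y s) i) (z' i) t) →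
        massMat b t *ᵥ z' + stiffMat cf b t *ᵥ (x t - y t) = 0 := by
    have hd : ∀ᵐ t, ∀ i, t ∈ uIcc 0 T → DifferentiableAt ℝ (fun t => y t i) t :=
      ae_all_iff.2 fun i => (hy i).ae_differentiableAt
    filter_upwards [hxeq, hyeq, ae_restrict_of_ae hd, ae_restrict_mem measurableSet_Icc]
      with t h1 h2 h3 ht z' hz
    have hy' : ∀ i, HasDerivAt (fun s => y s i) (deriv (fun s => y s i) t) t := fun i =>
      (h3 i (by rwa [uIcc_of_le hM.T_pos.le])).hasDerivAt
    have h4 := h2 _ hy'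
    have h5 := h1 (z' + fun i => deriv (fun s => y s i) t) fun i => by
      have := (hz i).add (hy' i)
      simpa only [Pi.add_def, Pi.sub_apply, sub_add_cancel] using this
    rw [Matrix.mulVec_add] at h5
    rw [Matrix.mulVec_sub]
    linear_combination (exp := 1) h5 - h4
  have hz : ∀ i, AbsolutelyContinuousOnInterval (fun t => (x t - y t) i) 0 T := fun i =>
    (hx i).sub (hy i)
  have hγ := hcf.γ_pos
  have key := hM.coordinates_energy hcf hW0 (hW M h hM) (b := b) (x := fun t => x t - y t)
    (l := fun _ => 0) (φ := fun _ => 0) hz heq (by simp) (fun _ _ => le_rfl)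
    (ae_of_all _ fun t => by
      have := h1_nonneg (M := M) (D := D) (k := k) t (vec b (x t - y t))
      simp only [dotProduct_zero, mul_zero, add_zero]
      positivity) t ht
  have hzero : M.mass D k 0 (0 : M.Coef k) 0 = 0 := by
    have := mass_smul_left (M := M) (D := D) (k := k) 0 0 0 0
    rwa [zero_smul, zero_mul] at this
  rw [vec_sub (x 0), h0, sub_self, hzero, intervalIntegral.integral_zero, add_zero,
    mul_zero] at key
  have hint : 0 ≤ ∫ s in (0 : ℝ)..t, M.h1 D k s (vec b (x s - y s)) :=
    intervalIntegral.integral_nonneg ht.1 fun s _ => h1_nonneg s _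
  have h1 := mass_nonneg (M := M) (D := D) (k := k) t (vec b (x t - y t))
  have h2 : M.mass D k t (vec b (x t - y t)) (vec b (x t - y t)) = 0 := by
    have := mul_nonneg (half_pos hγ).le hint
    linarith
  rw [hxU t ht, hyV t ht, ← sub_eq_zero.1 ((vec_sub (b := b) (x t) (y t)).symm.trans
    (hM.eq_zero_of_mass_eq_zero ht h2))]

/-- Existence: the mass matrix is definite and the load vector integrable. -/
theorem exists_isSolution (hM : M.Standing D k T κ h) (hcf : cf.IsAdmissible D T γ)
    (hf : MemL2H D T f) (hG : MemL2VΓdual D T G) {U₀ : M.Fun} (hU₀ : M.MemS D k 0 U₀) :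
    ∃ U : ℝ → M.Fun, M.IsSolution D cf k T f G U₀ U := by
  let b := Module.finBasis ℝ (M.nodal D k)
  obtain ⟨c, hc, rfl⟩ := (hM.memS_iff hM.zero_mem U₀).1 hU₀
  obtain ⟨x₀, rfl⟩ := exists_vec_eq (b := b) hc
  obtain ⟨x, rfl, hx, heq⟩ := exists_matrix_evolution hM.T_pos.le (A := massMat b)
    (S := stiffMat cf b) (l := loadVec f G b) (fun i j => hM.continuousOn_mass _ _)
    (fun i j => hM.continuousOn_stiff hcf _ _) (fun t ht x hx => by
      rw [← hM.mass_vec ht] at hx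
      exact vec_eq_zero (hM.eq_zero_of_mass_eq_zero ht hx))
    (fun i => hM.intervalIntegrable_load hf hG (SetLike.coe_mem (b i))) x₀
  refine ⟨_, hM.isSolution_of_coordinates hcf ?_ hx heq⟩
  filter_upwards [hM.adm.ae_memLp hf, ae_restrict_mem measurableSet_Icc] with t h1 ht z
  exact hM.load_vec ht h1 z

/-- The stability estimate. By Young's inequality the load is absorbed in the `H¹` norm up to the
function `φ = 2 l² / (γ V)`, where `l` is the load, tested with the solution, and `V` is the squared
broken `H¹` norm of the solution. Unlike the dual norm of `G` this function is measurable. -/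
theorem stability (hM : M.Standing D k T κ h) (hcf : cf.IsAdmissible D T γ) {W : ℝ}
    (hW0 : 0 ≤ W)
    (hW : ∀ t ∈ Icc 0 T, ∀ (K : M.Elt), ∀ y ∈ refTri d,
      ‖cf.B t (M.liftPar D k t K y) - M.vel D k t K y‖ ≤ W ∧ |M.divVel D k t K y| ≤ W ∧
        |cf.C t (M.liftPar D k t K y)| ≤ W)
    (hf : MemL2H D T f) (hG : MemL2VΓdual D T G) {C : ℝ≥0}
    (hC : ∀ t ∈ Icc 0 T, (∀ i, MemLp (f t i) 2 (volume.restrict (D.Om i t))) →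
      ∀ c ∈ M.nodal D k, ‖M.load D k f G t (M.fn D k t c)‖ₑ ^ 2 ≤
        C * dataSq D f G t * M.normSqV D k t (M.fn D k t c))
    {U₀ : M.Fun} {U : ℝ → M.Fun} (hU : M.IsSolution D cf k T f G U₀ U) :
    (⨆ t ∈ Icc 0 T, M.normSqH D k t (U t)) + ∫⁻ t in Icc 0 T, M.normSqV D k t (U t) ≤
      ENNReal.ofReal ((1 + 2 / γ) * Real.exp ((γ + 4 * W ^ 2 / γ + 3 * W) * T)) *
        (M.normSqH D k 0 U₀ + ENNReal.ofReal (2 / γ) * C *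
          (normSqL2H D T f + normSqL2VΓdual D T G)) := by
  have hγ := hcf.γ_pos
  have hT := hM.T_pos.le
  let b := Module.finBasis ℝ (M.nodal D k)
  obtain ⟨x, hxU, hx, hxeq⟩ := hM.exists_coordinates (b := b) hcf hU
  have hxc : ∀ i, ContinuousOn (fun t => x t i) (Icc 0 T) := fun i => by
    have := (hx i).continuousOn
    rwa [uIcc_of_le hT] at this
  set V : ℝ → ℝ := fun t => M.h1 D k t (vec b (x t)) with hVdef
  have hV : ContinuousOn V (Icc 0 T) := hM.continuousOn_h1_comp (continuousOn_vec hxc)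
  have hV0 : ∀ t, 0 ≤ V t := fun t => h1_nonneg t _
  set l : ℝ → ℝ := fun t => x t ⬝ᵥ loadVec f G b t with hldef
  have hlmeas : AEMeasurable l (volume.restrict (Icc 0 T)) := by
    simp only [hldef, dotProduct]
    exact Finset.aemeasurable_fun_sum _ fun i _ => ((hxc i).aemeasurable measurableSet_Icc).mul
      (hM.aemeasurable_load hf hG (SetLike.coe_mem (b i)))
  -- Where `V` vanishes the load vanishes as well, so that the value `0` of `l² / 0` is right.
  have hlV : ∀ᵐ t ∂volume.restrict (Icc 0 T),
      ENNReal.ofReal (l t ^ 2) ≤ C * dataSq D f G t * ENNReal.ofReal (V t) := by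
    filter_upwards [hM.adm.ae_memLp hf, ae_restrict_mem measurableSet_Icc] with t h1 ht
    have h2 := hC t ht h1 _ (vec_mem (b := b) (x t))
    rw [hM.load_vec ht h1, hM.normSqV_fn ht] at h2
    rwa [← sq_abs, ENNReal.ofReal_pow (abs_nonneg _), ← Real.enorm_eq_ofReal_abs]
  have hfin : ∀ᵐ t ∂volume.restrict (Icc 0 T), V t = 0 → l t = 0 := by
    filter_upwards [hlV] with t h1 h2
    rw [h2, ENNReal.ofReal_zero, mul_zero, nonpos_iff_eq_zero, ENNReal.ofReal_eq_zero] at h1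
    exact pow_eq_zero_iff two_ne_zero |>.1 (le_antisymm h1 (sq_nonneg _))
  set φ : ℝ → ℝ := fun t => 2 / γ * (l t ^ 2 / V t) with hφdef
  have hφ0 : ∀ t, 0 ≤ φ t := fun t => by
    have := hV0 t
    positivity
  have hφmeas : AEMeasurable φ (volume.restrict (Icc 0 T)) :=
    ((hlmeas.pow_const 2).div (hV.aemeasurable measurableSet_Icc)).const_mul _
  have hφle : ∫⁻ t in Icc 0 T, ENNReal.ofReal (φ t) ≤ ENNReal.ofReal (2 / γ) * C *
      (normSqL2H D T f + normSqL2VΓdual D T G) := by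
    rw [← hM.adm.lintegral_dataSq hf, ← lintegral_const_mul' _ _
      (ENNReal.mul_ne_top ENNReal.ofReal_ne_top ENNReal.coe_ne_top)]
    refine lintegral_mono_ae ?_
    filter_upwards [hlV, hfin] with t h1 h2
    rw [hφdef, ENNReal.ofReal_mul (by positivity), mul_assoc]
    gcongr
    rcases (hV0 t).eq_or_lt with h3 | h3
    · rw [← h3, div_zero, ENNReal.ofReal_zero]
      exact zero_le
    · rw [ENNReal.ofReal_div_of_pos h3]
      exact ENNReal.div_le_of_le_mul h1
  have hφint : IntegrableOn φ (Icc 0 T) := by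
    refine ⟨hφmeas.aestronglyMeasurable, ?_⟩
    rw [hasFiniteIntegral_iff_ofReal (ae_of_all _ hφ0)]
    refine hφle.trans_lt (ENNReal.mul_lt_top (ENNReal.mul_lt_top ENNReal.ofReal_lt_top
      ENNReal.coe_lt_top) ?_)
    exact ENNReal.add_lt_top.2 ⟨hM.adm.normSqL2H_lt_top hf, hG.integrable⟩
  have hl : ∀ᵐ t ∂volume.restrict (Icc 0 T),
      2 * (x t ⬝ᵥ loadVec f G b t) ≤ γ / 2 * V t + φ t := by
    filter_upwards [hfin] with t h1
    change 2 * l t ≤ γ / 2 * V t + 2 / γ * (l t ^ 2 / V t)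
    rcases (hV0 t).eq_or_lt with h3 | h3
    · rw [h1 h3.symm, ← h3]
      simp
    · have h4 : γ / 2 * V t + 2 / γ * (l t ^ 2 / V t) - 2 * l t =
          (γ * V t - 2 * l t) ^ 2 / (2 * γ * V t) := by
        field_simp
        ring
      have h5 : 0 ≤ (γ * V t - 2 * l t) ^ 2 / (2 * γ * V t) := by positivity
      linarith
  have key := hM.coordinates_energy hcf hW0 hW hx hxeq
    ((intervalIntegrable_iff_integrableOn_Icc_of_le hT).2 hφint) (fun t _ => hφ0 t) hl
  set E := Real.exp ((γ + 4 * W ^ 2 / γ + 3 * W) * T)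
  set m₀ := M.mass D k 0 (vec b (x 0)) (vec b (x 0)) with hm₀
  have hΦ : ENNReal.ofReal (∫ s in (0 : ℝ)..T, φ s) = ∫⁻ t in Icc 0 T, ENNReal.ofReal (φ t) := by
    rw [intervalIntegral.integral_of_le hT, ← integral_Icc_eq_integral_Ioc,
      ofReal_integral_eq_lintegral_ofReal hφint (ae_of_all _ hφ0)]
  have hm₀' : M.normSqH D k 0 U₀ = ENNReal.ofReal m₀ := by
    rw [← hU.initial, hxU 0 hM.zero_mem, hM.normSqH_fn hM.zero_mem]
  have hΦ0 : 0 ≤ ∫ s in (0 : ℝ)..T, φ s := intervalIntegral.integral_nonneg hT fun t _ => hφ0 t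
  set R := m₀ + ∫ s in (0 : ℝ)..T, φ s with hR
  have hR' : ENNReal.ofReal R ≤ M.normSqH D k 0 U₀ + ENNReal.ofReal (2 / γ) * C *
      (normSqL2H D T f + normSqL2VΓdual D T G) := by
    rw [hR, ENNReal.ofReal_add (mass_nonneg _ _) hΦ0, hm₀', hΦ]
    gcongr
  have hVint : ∀ t ∈ Icc 0 T, 0 ≤ ∫ s in (0 : ℝ)..t, V s := fun t ht =>
    intervalIntegral.integral_nonneg ht.1 fun s _ => hV0 s
  have h1 : (⨆ t ∈ Icc 0 T, M.normSqH D k t (U t)) ≤ ENNReal.ofReal (E * R) := by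
    refine iSup₂_le fun t ht => ?_
    rw [hxU t ht, hM.normSqH_fn ht]
    refine ENNReal.ofReal_le_ofReal ?_
    have := key t ht
    have := mul_nonneg (half_pos hγ).le (hVint t ht)
    linarith
  have h2 : ∫⁻ t in Icc 0 T, M.normSqV D k t (U t) ≤ ENNReal.ofReal (2 / γ * (E * R)) := by
    have h3 : ∫⁻ t in Icc 0 T, M.normSqV D k t (U t) = ENNReal.ofReal (∫ t in Icc 0 T, V t) := by
      rw [ofReal_integral_eq_lintegral_ofReal (hV.integrableOn_Icc) (ae_of_all _ hV0)]
      refine setLIntegral_congr_fun measurableSet_Icc fun t ht => ?_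
      rw [hxU t ht, hM.normSqV_fn ht]
    rw [h3, integral_Icc_eq_integral_Ioc, ← intervalIntegral.integral_of_le hT]
    refine ENNReal.ofReal_le_ofReal ?_
    have h4 := key T ⟨hT, le_rfl⟩
    have h5 := mass_nonneg (M := M) (D := D) (k := k) T (vec b (x T))
    have h6 : γ / 2 * ∫ s in (0 : ℝ)..T, V s ≤ E * R := by linarith
    calc ∫ s in (0 : ℝ)..T, V s = 2 / γ * (γ / 2 * ∫ s in (0 : ℝ)..T, V s) := by
          field_simp
      _ ≤ 2 / γ * (E * R) := by gcongr
  have hR0 : 0 ≤ R := add_nonneg (mass_nonneg _ _) hΦ0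
  have hE0 : 0 < E := Real.exp_pos _
  calc _ ≤ ENNReal.ofReal (E * R) + ENNReal.ofReal (2 / γ * (E * R)) := add_le_add h1 h2
    _ = ENNReal.ofReal ((1 + 2 / γ) * E) * ENNReal.ofReal R := by
        rw [← ENNReal.ofReal_add (by positivity) (by positivity),
          ← ENNReal.ofReal_mul (by positivity)]
        congr 1
        ring
    _ ≤ _ := by gcongr

end Mesh.Standing

theorem Mesh.IsRegular.mono {d k : ℕ} {M : Mesh d} {D : Geometry d} {T κ κ' h : ℝ}
    (hM : M.IsRegular D k T κ h) (hh : 0 < h) (hκ : κ ≤ κ') : M.IsRegular D k T κ' h where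
  straight_upper K l hl l' hl' := (hM.straight_upper K l hl l' hl').trans (by gcongr)
  straight_lower K l hl l' hl' := (hM.straight_lower K l hl l' hl').trans (by gcongr)
  upper t ht K l hl l' hl' := (hM.upper t ht K l hl l' hl').trans (by gcongr)
  lower t ht K l hl l' hl' := (hM.lower t ht K l hl l' hl').trans (by gcongr)
  node_mem := hM.node_mem
  conforming := hM.conforming
  nearest_initial := hM.nearest_initial
  nearest_evolving := hM.nearest_evolving
  lift_onto := hM.lift_onto
  lift_injective := hM.lift_injective
  lift_upper t ht K x hx y hy := (hM.lift_upper t ht K x hx y hy).trans (by gcongr)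
  lift_lower t ht K x hx y hy := (hM.lift_lower t ht K x hx y hy).trans (by gcongr)

end InterfaceFEM

end

theorem mainTheorem3 {d k : ℕ} (hd : d = 2 ∨ d = 3) (hk : 1 ≤ k) {T : ℝ} (hT : 0 < T)
    (D : InterfaceFEM.Geometry d) (hD : D.IsAdmissible k T)
    (c : InterfaceFEM.Coeffs d) {γ : ℝ} (hc : c.IsAdmissible D T γ) (κ : ℝ) :
    ∃ C : ℝ≥0, ∀ (M : InterfaceFEM.Mesh d) (h : ℝ), 0 < h → M.IsFitted D →
      M.IsRegular D k T κ h →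
      ∀ U₀ : M.Fun, M.MemS D k 0 U₀ →
      ∀ f : ℝ → Fin 2 → InterfaceFEM.Space d → ℝ, InterfaceFEM.MemL2H D T f →
      ∀ G : (t : ℝ) → InterfaceFEM.HHalf (D.Γ t) →ₗ[ℝ] ℝ, InterfaceFEM.MemL2VΓdual D T G →
      ∃ U : ℝ → M.Fun, M.IsSolution D c k T f G U₀ U ∧
        (∀ V : ℝ → M.Fun, M.IsSolution D c k T f G U₀ V → ∀ t ∈ Icc 0 T, V t = U t) ∧
        (⨆ t ∈ Icc 0 T, M.normSqH D k t (U t)) + ∫⁻ t in Icc 0 T, M.normSqV D k t (U t)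
          ≤ C * (M.normSqH D k 0 U₀ + InterfaceFEM.normSqL2H D T f
              + InterfaceFEM.normSqL2VΓdual D T G) := by
  have hd2 : 2 ≤ d := by omega
  obtain ⟨W, hW0, hW⟩ := hD.exists_uniform_bound hc (max κ 1)
  obtain ⟨C, hC⟩ := hD.exists_enorm_load_sq_le hd2 (max κ 1)
  set A : ℝ≥0 := ((1 + 2 / γ) * Real.exp ((γ + 4 * W ^ 2 / γ + 3 * W) * T)).toNNReal
  set B : ℝ≥0 := (2 / γ).toNNReal * C
  refine ⟨A * (1 + B), fun M h hh hfit hreg U₀ hU₀ f hf G hG => ?_⟩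
  -- a mesh that is regular for `κ` is regular for the larger constant `max κ 1`
  have hM : M.Standing D k T (max κ 1) h :=
    ⟨hd2, hk, hT, hh, le_max_right _ _, hD, hfit, hreg.mono hh (le_max_left _ _)⟩
  obtain ⟨U, hU⟩ := hM.exists_isSolution hc hf hG hU₀
  refine ⟨U, hU, fun V hV t ht => hM.eq_of_isSolution hc hU hV ht, ?_⟩
  have key := hM.stability hc hW0 (hW M h hM) hf hG
    (fun t ht h1 c hc => hC M h hM f G t ht h1 (hG.bounded t ht) c hc) hU
  set N₀ := M.normSqH D k 0 U₀
  set N := InterfaceFEM.normSqL2H D T f + InterfaceFEM.normSqL2VΓdual D T G with hN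
  calc _ ≤ (A : ℝ≥0∞) * (N₀ + B * N) := by
        rw [ENNReal.coe_mul]
        exact key
    _ ≤ A * ((1 + B) * N₀ + (1 + B) * N) := by
        refine mul_le_mul' le_rfl (add_le_add ?_ (mul_le_mul' le_add_self le_rfl))
        exact le_mul_of_one_le_left' le_self_add
    _ = _ := by
        rw [add_assoc N₀, ← hN]
        push_cast
        ring
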